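/- Let $z(w)=\dfrac{w^2-\frac13}{w(w^2-1)}$. An inverse mapping of $z(w)$ on a set $U\subset\mathbb C$ is a function $\psi$ with $\psi(z)\in\mathbb C\setminus\{0,1,-1\}$ and $z(\psi(z))=z$ for all $z\in U$. Let $\omega=e^{2\pi i/24}$ and $$z_1=3^{-1/4}\omega^{7},\quad z_2=3^{-1/4}\omega^{17},\quad z_3=3^{-1/4}\omega^{19},\quad z_4=3^{-1/4}\omega^{5}.$$ All curves below are simple, oriented, continuous up to their endpoints, and have a real-analytic parametrization with non-vanishing derivative away from the endpoints. The $+$side of an oriented curve is its left side, and $f_+$ denotes the boundary value of $f$ from the $+$side, taken along the normal. Whenever an integral is said to be real, its existence is included. Consider the following objects. 1. A curve $\Gamma_P$ from $z_1$ to $z_2$ in $\{\Re z<0\}$ and a curve $\Gamma_R$ from $z_3$ to $z_4$ in $\{\Re z>0\}$, with inverse mappings $\psi_P$, $\psi_Q$, $\psi_R$ of $z(w)$ that are defined and analytic on $\mathbb C\setminus\Gamma_P$, $\mathbb C\setminus(\Gamma_P\cup\Gamma_R\cup\{0\})$ and $\mathbb C\setminus\Gamma_R$, respectively, and satisfy $\psi_P(\infty)=-1$,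 $\psi_Q(\infty)=0$, $\psi_R(\infty)=1$, such that $\frac{3}{2\pi i}\int_{z_1}^z(\psi_Q-\psi_P)_+(s)\,ds\in\mathbb R$ for $z\in\Gamma_P$ and $\frac{3}{2\pi i}\int_{z_3}^z(\psi_Q-\psi_R)_+(s)\,ds\in\mathbb R$ for $z\in\Gamma_R$ (integrals along $\Gamma_P$ and $\Gamma_R$). 2. A curve $\Gamma_P^*$ from $z_2$ to $z_1$ that meets the positive real axis, and a curve $\Gamma_R^*$ from $z_4$ to $z_3$ that meets the negative real axis, both disjoint from $\Gamma_P\cup\Gamma_R\cup\{0\}$ apart from their endpoints, such that $\frac{3}{2\pi i}\int_{z_1}^z(\psi_Q-\psi_P)(s)\,ds$ is real for $z\in\Gamma_P^*$ and $\frac{3}{2\pi i}\int_{z_3}^z(\psi_Q-\psi_R)(s)\,ds$ is real for $z\in\Gamma_R^*$ (integrals along these curves); and a number $y^*>0$ such that $\pm iy^*\in\Gamma_P^*\cap\Gamma_R^*$. 3. Unbounded curves $\Gamma_{E,1}$ from $z_1$ to $\infty$ and $\Gamma_{E,2}$ from $\infty$ to $z_2$ in $\{\Re z<0\}$, disjoint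 from $\Gamma_P$ apart from $z_1$, $z_2$, along which the integral $\frac{3}{2\pi i}\int(\psi_Q-\psi_P)(s)\,ds$ from the finite endpoint of the curve is real; and unbounded curves $\Gamma_{E,3}$ from $z_3$ to $\infty$ and $\Gamma_{E,4}$ from $\infty$ to $z_4$ in $\{\Re z>0\}$, disjoint from $\Gamma_R$ apart from $z_3$, $z_4$, along which the integral $\frac{3}{2\pi i}\int(\psi_Q-\psi_R)(s)\,ds$ from the finite endpoint of the curve is real. Put $\Gamma_Q=[-iy^*,iy^*]\cup(\Gamma_P^*\cap\{\Re z<0\})\cup(\Gamma_R^*\cap\{\Re z>0\})$, with $[-iy^*,iy^*]$ oriented from $-iy^*$ to $iy^*$, and $\Gamma_E=\Gamma_{E,1}\cup\Gamma_{E,2}\cup\Gamma_{E,3}\cup\Gamma_{E,4}$. **Theorem.** Such objects exist. For any such objects the boundary values $(\psi_Q-\psi_P)_+$ on $\Gamma_P$ and $(\psi_Q-\psi_R)_+$ on $\Gamma_R$ exist away from the endpoints, and the following hold for the complex measures defined by the line elements $$d\mu_P=\tfrac{3}{2\pi i}(\psi_Q-\psi_P)_+\,ds\ \text{ on }\Gamma_P,\qquad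 d\mu_R=\tfrac{3}{2\pi i}(\psi_Q-\psi_R)_+\,ds\ \text{ on }\Gamma_R,$$ $$d\mu_Q=\begin{cases}\frac{3}{2\pi i}(\psi_Q-\psi_P)\,ds&\text{on }\Gamma_P^*\cap\{\Re z<0\},\\ \frac{3}{2\pi i}(\psi_Q-\psi_R)\,ds&\text{on }\Gamma_R^*\cap\{\Re z>0\},\\ \frac{3}{2\pi i}(\psi_R-\psi_P)\,ds&\text{on }[-iy^*,iy^*],\end{cases}\qquad d\mu_E=\begin{cases}\frac{3}{2\pi i}(\psi_Q-\psi_P)\,ds&\text{on }\Gamma_{E,1}\cup\Gamma_{E,2},\\ \frac{3}{2\pi i}(\psi_Q-\psi_R)\,ds&\text{on }\Gamma_{E,3}\cup\Gamma_{E,4}:\end{cases}$$ $\mu_P$ is a probability measure on $\Gamma_P$, $\mu_Q$ is a probability measure on $\Gamma_Q$, $\mu_R$ is a probability measure on $\Gamma_R$, and $\mu_E$ is a (locally finite) positive measure on $\Gamma_E$. -/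

import Mathlib

open Set Filter Topology MeasureTheory

namespace HermitePade

noncomputable section

/-- The rational function `z(w) = (w² - 1/3) / (w (w² - 1))`. -/
def zMap (w : ℂ) : ℂ := (w ^ 2 - 1 / 3) / (w * (w ^ 2 - 1))

/-- `ψ` is an inverse mapping of the rational function `zMap` on `U`: at every `z ∈ U` the value
`ψ z` is finite, is not one of the poles `0, 1, -1` of `zMap`, and is mapped to `z`. -/
def IsInverseBranchOn (ψ : ℂ → ℂ) (U : Set ℂ) : Prop :=
  ∀ z ∈ U, ψ z ≠ 0 ∧ ψ z ^ 2 ≠ 1 ∧ zMap (ψ z) = z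

/-- The inverse mappings are exactly the solutions of the cubic equation. -/
theorem inverse_iff_cubic (z w : ℂ) :
    (w ≠ 0 ∧ w ^ 2 ≠ 1 ∧ zMap w = z) ↔ z * w ^ 3 - w ^ 2 - z * w + 1 / 3 = 0 := by
  constructor
  · rintro ⟨h0, h1, h⟩
    have h2 : w ^ 2 - 1 ≠ 0 := sub_ne_zero.2 h1
    rw [zMap, div_eq_iff (mul_ne_zero h0 h2)] at h
    linear_combination -h
  · intro h
    have h0 : w ≠ 0 := by
      rintro rfl
      norm_num at h
    have h1 : w ^ 2 ≠ 1 := by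
      intro h1
      have h3 : z * w ^ 3 - w ^ 2 - z * w + 1 / 3 = (-2 / 3 : ℂ) := by
        linear_combination (z * w - 1) * h1
      rw [h3] at h
      norm_num at h
    have h2 : w ^ 2 - 1 ≠ 0 := sub_ne_zero.2 h1
    refine ⟨h0, h1, ?_⟩
    rw [zMap, div_eq_iff (mul_ne_zero h0 h2)]
    linear_combination -h

/-- The primitive 24th root of unity `e^{2πi/24}`. -/
def omega24 : ℂ := Complex.exp (2 * Real.pi * Complex.I / 24)

/-- The positive real number `3^{-1/4}`. -/
def branchRadius : ℝ := (3 : ℝ) ^ (-(1 / 4 : ℝ))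

/-- The four branch points of the inverse of `zMap`. -/
def z1 : ℂ := branchRadius * omega24 ^ 7
def z2 : ℂ := branchRadius * omega24 ^ 17
def z3 : ℂ := branchRadius * omega24 ^ 19
def z4 : ℂ := branchRadius * omega24 ^ 5

/-- `γ`, on the parameter interval `T`, is a simple oriented curve that is real analytic and
regular at all interior parameters. It is used with `T = [0,1]` (arcs), `T = [0,∞)` (curves that
start at `γ 0`) and `T = (-∞,0]` (curves that end at `γ 0`). -/
structure IsAnalyticCurve (γ : ℝ → ℂ) (T : Set ℝ) : Prop where
  continuousOn : ContinuousOn γ T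
  injOn : InjOn γ T
  analytic : AnalyticOnNhd ℝ γ (interior T)
  regular : ∀ t ∈ interior T, deriv γ t ≠ 0

/-- `L` is the boundary value of `f` at the point `γ t` from the `+`side of the oriented curve
`γ`, that is from the left: the limit along the left normal `i γ'(t)`. -/
def HasPlusValue (γ : ℝ → ℂ) (f : ℂ → ℂ) (t : ℝ) (L : ℂ) : Prop :=
  Tendsto (fun ε : ℝ => f (γ t + ε * (Complex.I * deriv γ t))) (𝓝[>] 0) (𝓝 L)

/-- The boundary value `f₊(γ t)` from the `+`side. -/
def plusValue (γ : ℝ → ℂ) (f : ℂ → ℂ) (t : ℝ) : ℂ :=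
  limUnder (𝓝[>] (0 : ℝ)) fun ε : ℝ => f (γ t + ε * (Complex.I * deriv γ t))

/-- The form `(3 / 2πi) h(s) ds` on the curve `s = γ t`, written in the parameter `t`;
`h t` is the value of the density at the point `γ t`. -/
def lineForm (γ : ℝ → ℂ) (h : ℝ → ℂ) (t : ℝ) : ℂ :=
  3 / (2 * Real.pi * Complex.I) * (h t * deriv γ t)

/-- For all `t ∈ T`, the integral `(3 / 2πi) ∫ h(s) ds`, taken along the curve `γ` from the point
`γ a` to the point `γ t`, exists and is real. -/
def RealAlong (γ : ℝ → ℂ) (T : Set ℝ) (a : ℝ) (h : ℝ → ℂ) : Prop :=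
  ∀ t ∈ T, IntervalIntegrable (lineForm γ h) volume a t ∧
    (∫ u in a..t, lineForm γ h u).im = 0

/-- The inverse mappings `ψ_P, ψ_Q, ψ_R`, parametrizations of the curves
`Γ_P, Γ_R, Γ_P^*, Γ_R^*, Γ_{E,1}, …, Γ_{E,4}`, and the number `y^*`. -/
structure Config where
  psiP : ℂ → ℂ
  psiQ : ℂ → ℂ
  psiR : ℂ → ℂ
  gP : ℝ → ℂ
  gR : ℝ → ℂ
  gPstar : ℝ → ℂ
  gRstar : ℝ → ℂ
  gE1 : ℝ → ℂ
  gE2 : ℝ → ℂ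
  gE3 : ℝ → ℂ
  gE4 : ℝ → ℂ
  ystar : ℝ

namespace Config

variable (C : Config)

def GammaP : Set ℂ := C.gP '' Icc 0 1
def GammaR : Set ℂ := C.gR '' Icc 0 1
def GammaPstar : Set ℂ := C.gPstar '' Icc 0 1
def GammaRstar : Set ℂ := C.gRstar '' Icc 0 1

/-- The upright segment from `-i y^*` to `i y^*`, parametrized by its imaginary part. -/
def segment (t : ℝ) : ℂ := t * Complex.I

def GammaQ : Set ℂ :=
  segment '' Icc (-C.ystar) C.ystar ∪ (C.GammaPstar ∩ {z | z.re < 0}) ∪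
    (C.GammaRstar ∩ {z | 0 < z.re})

def GammaE : Set ℂ :=
  C.gE1 '' Ici 0 ∪ C.gE2 '' Iic 0 ∪ C.gE3 '' Ici 0 ∪ C.gE4 '' Iic 0

/-- `ψ_Q - ψ_P`. -/
def QP (z : ℂ) : ℂ := C.psiQ z - C.psiP z

/-- `ψ_Q - ψ_R`. -/
def QR (z : ℂ) : ℂ := C.psiQ z - C.psiR z

/-- `ψ_R - ψ_P`. -/
def RP (z : ℂ) : ℂ := C.psiR z - C.psiP z

/-- The cuts `Γ_P`, `Γ_R` and the inverse mappings on the cut plane. The mapping `ψ_Q` has its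
pole at `0`, so analyticity is asked away from this point. -/
structure IsSheetStructure : Prop where
  curveP : IsAnalyticCurve C.gP (Icc 0 1)
  startP : C.gP 0 = z1
  endP : C.gP 1 = z2
  leftP : ∀ z ∈ C.GammaP, z.re < 0
  curveR : IsAnalyticCurve C.gR (Icc 0 1)
  startR : C.gR 0 = z3
  endR : C.gR 1 = z4
  rightR : ∀ z ∈ C.GammaR, 0 < z.re
  analyticP : AnalyticOnNhd ℂ C.psiP C.GammaPᶜ
  analyticQ : AnalyticOnNhd ℂ C.psiQ (C.GammaP ∪ C.GammaR ∪ {0})ᶜ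
  analyticR : AnalyticOnNhd ℂ C.psiR C.GammaRᶜ
  inverseP : IsInverseBranchOn C.psiP C.GammaPᶜ
  inverseQ : IsInverseBranchOn C.psiQ (C.GammaP ∪ C.GammaR ∪ {0})ᶜ
  inverseR : IsInverseBranchOn C.psiR C.GammaRᶜ
  inftyP : Tendsto C.psiP (Bornology.cobounded ℂ) (𝓝 (-1))
  inftyQ : Tendsto C.psiQ (Bornology.cobounded ℂ) (𝓝 0)
  inftyR : Tendsto C.psiR (Bornology.cobounded ℂ) (𝓝 1)
  realP : RealAlong C.gP (Icc 0 1) 0 (plusValue C.gP C.QP)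
  realR : RealAlong C.gR (Icc 0 1) 0 (plusValue C.gR C.QR)

/-- The curve `Γ_P^*`, oriented from `z₂` to `z₁`, and the curve `Γ_R^*`, oriented from `z₄` to
`z₃`; they meet at `± i y^*`. The integrals from `z₁` and from `z₃` start at the parameter `1`. -/
structure IsStarred : Prop where
  curveP : IsAnalyticCurve C.gPstar (Icc 0 1)
  startP : C.gPstar 0 = z2
  endP : C.gPstar 1 = z1
  avoidP : ∀ t ∈ Ioo (0 : ℝ) 1, C.gPstar t ∉ C.GammaP ∪ C.GammaR ∪ {0}
  crossP : ∃ x : ℝ, 0 < x ∧ (x : ℂ) ∈ C.GammaPstar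
  realP : RealAlong C.gPstar (Icc 0 1) 1 (fun t => C.QP (C.gPstar t))
  curveR : IsAnalyticCurve C.gRstar (Icc 0 1)
  startR : C.gRstar 0 = z4
  endR : C.gRstar 1 = z3
  avoidR : ∀ t ∈ Ioo (0 : ℝ) 1, C.gRstar t ∉ C.GammaP ∪ C.GammaR ∪ {0}
  crossR : ∃ x : ℝ, x < 0 ∧ (x : ℂ) ∈ C.GammaRstar
  realR : RealAlong C.gRstar (Icc 0 1) 1 (fun t => C.QR (C.gRstar t))
  ystar_pos : 0 < C.ystar
  meet_upper : (C.ystar : ℂ) * Complex.I ∈ C.GammaPstar ∩ C.GammaRstar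
  meet_lower : -((C.ystar : ℂ) * Complex.I) ∈ C.GammaPstar ∩ C.GammaRstar

/-- The unbounded curves: `Γ_{E,1}` from `z₁` to `∞`, `Γ_{E,2}` from `∞` to `z₂`, `Γ_{E,3}` from
`z₃` to `∞`, and `Γ_{E,4}` from `∞` to `z₄`. -/
structure IsUnbounded : Prop where
  curve1 : IsAnalyticCurve C.gE1 (Ici 0)
  start1 : C.gE1 0 = z1
  infty1 : Tendsto C.gE1 atTop (Bornology.cobounded ℂ)
  left1 : ∀ t ∈ Ici (0 : ℝ), (C.gE1 t).re < 0
  avoid1 : ∀ t ∈ Ioi (0 : ℝ), C.gE1 t ∉ C.GammaP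
  real1 : RealAlong C.gE1 (Ici 0) 0 (fun t => C.QP (C.gE1 t))
  curve2 : IsAnalyticCurve C.gE2 (Iic 0)
  end2 : C.gE2 0 = z2
  infty2 : Tendsto C.gE2 atBot (Bornology.cobounded ℂ)
  left2 : ∀ t ∈ Iic (0 : ℝ), (C.gE2 t).re < 0
  avoid2 : ∀ t ∈ Iio (0 : ℝ), C.gE2 t ∉ C.GammaP
  real2 : RealAlong C.gE2 (Iic 0) 0 (fun t => C.QP (C.gE2 t))
  curve3 : IsAnalyticCurve C.gE3 (Ici 0)
  start3 : C.gE3 0 = z3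
  infty3 : Tendsto C.gE3 atTop (Bornology.cobounded ℂ)
  right3 : ∀ t ∈ Ici (0 : ℝ), 0 < (C.gE3 t).re
  avoid3 : ∀ t ∈ Ioi (0 : ℝ), C.gE3 t ∉ C.GammaR
  real3 : RealAlong C.gE3 (Ici 0) 0 (fun t => C.QR (C.gE3 t))
  curve4 : IsAnalyticCurve C.gE4 (Iic 0)
  end4 : C.gE4 0 = z4
  infty4 : Tendsto C.gE4 atBot (Bornology.cobounded ℂ)
  right4 : ∀ t ∈ Iic (0 : ℝ), 0 < (C.gE4 t).re
  avoid4 : ∀ t ∈ Iio (0 : ℝ), C.gE4 t ∉ C.GammaR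
  real4 : RealAlong C.gE4 (Iic 0) 0 (fun t => C.QR (C.gE4 t))

/-- The defining properties of the inverse mappings and of all the curves. -/
structure IsAdmissible : Prop where
  sheets : C.IsSheetStructure
  starred : C.IsStarred
  unbounded : C.IsUnbounded

end Config

/-- An oriented piece of a curve, given by `curve` on the parameter set `dom`, with a density:
`density t` is the density with respect to `(3 / 2πi) ds` at the point `curve t`. -/
structure Piece where
  curve : ℝ → ℂ
  dom : Set ℝ
  density : ℝ → ℂ

/-- `μ` is the (locally finite) complex measure given by the line elements `(3 / 2πi) h(s) ds`
on the finitely many oriented pieces `p k`: for every bounded Borel set `B`, the line elements are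
integrable over the part of each piece in `B`, and `μ B` is finite and equals the sum of
their integrals. A complex measure is positive iff it is given by a measure `μ` in this sense. -/
def IsGivenBy (μ : Measure ℂ) {n : ℕ} (p : Fin n → Piece) : Prop :=
  ∀ B : Set ℂ, MeasurableSet B → Bornology.IsBounded B →
    (∀ k, IntegrableOn (lineForm (p k).curve (p k).density) ((p k).dom ∩ (p k).curve ⁻¹' B)) ∧
    μ B ≠ ⊤ ∧
    (((μ B).toReal : ℝ) : ℂ) =
      ∑ k, ∫ t in (p k).dom ∩ (p k).curve ⁻¹' B, lineForm (p k).curve (p k).density t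

namespace Config

variable (C : Config)

/-- `(3 / 2πi) (ψ_Q - ψ_P)₊ ds` on `Γ_P`. -/
def piecesP : Fin 1 → Piece := ![⟨C.gP, Ioo 0 1, plusValue C.gP C.QP⟩]

/-- `(3 / 2πi) (ψ_Q - ψ_R)₊ ds` on `Γ_R`. -/
def piecesR : Fin 1 → Piece := ![⟨C.gR, Ioo 0 1, plusValue C.gR C.QR⟩]

/-- `(3 / 2πi) (ψ_Q - ψ_P) ds` on `Γ_P^* ∩ {Re z < 0}`, `(3 / 2πi) (ψ_Q - ψ_R) ds` on
`Γ_R^* ∩ {Re z > 0}`, and `(3 / 2πi) (ψ_R - ψ_P) ds` on `[-i y^*, i y^*]`. -/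
def piecesQ : Fin 3 → Piece :=
  ![⟨C.gPstar, Ioo 0 1 ∩ {t | (C.gPstar t).re < 0}, fun t => C.QP (C.gPstar t)⟩,
    ⟨C.gRstar, Ioo 0 1 ∩ {t | 0 < (C.gRstar t).re}, fun t => C.QR (C.gRstar t)⟩,
    ⟨segment, Icc (-C.ystar) C.ystar, fun t => C.RP (segment t)⟩]

/-- `(3 / 2πi) (ψ_Q - ψ_P) ds` on `Γ_{E,1} ∪ Γ_{E,2}` and `(3 / 2πi) (ψ_Q - ψ_R) ds` on
`Γ_{E,3} ∪ Γ_{E,4}`. -/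
def piecesE : Fin 4 → Piece :=
  ![⟨C.gE1, Ioi 0, fun t => C.QP (C.gE1 t)⟩,
    ⟨C.gE2, Iio 0, fun t => C.QP (C.gE2 t)⟩,
    ⟨C.gE3, Ioi 0, fun t => C.QR (C.gE3 t)⟩,
    ⟨C.gE4, Iio 0, fun t => C.QR (C.gE4 t)⟩]

end Config

end

end HermitePade

/-! The integral `3 ∫ w dz` over the Riemann surface of the cubic is elementary: it is `2/(w²-1)`
minus the logarithms of `w`, `w-1` and `w+1`. Its real part `hFun` is single valued in `w`. An
integral of a difference of two sheets that starts at their common branch point is `2πi` times a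
real number along a curve exactly when `hFun` takes equal values on the two sheets there. All curves
of the theorem are therefore level curves of differences of `hFun`, and the task is to describe
these level sets completely.

In the closed left half plane without the origin the root of greatest real part (`maxRoot`) stays
away from the other two and is `ψ_R`. The other two, `ψ_Q` and `ψ_P`, are governed by `m = -1/(z ·
maxRoot)`: the square of their difference is `(m²+3)/3`. So they meet exactly for `m = ±i√3`, at
`z₁` and `z₂`, and have equal real parts exactly when `m` is imaginary with `|m| ≥ √3`. Explicit
equations show that `Re m` has at most one zero on each horizontal line above the real axis
(`curve_unique`).

The horizontal derivative of a difference of `hFun` is three times the real part of the difference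
of the sheets. If the sheets are ordered by real parts, the difference `mainH` is strictly
increasing along horizontal lines on the far side of the branch points, and each line carries
exactly one zero there. This graph `levelX` gives `Γ_P` between the branch heights and `Γ_{E,1}`,
`Γ_{E,2}` beyond them. To the right of the branch points the continued difference `boxH` has a zero
only at heights between `y^* = critHeight` and `Im z₁` in modulus; at `±iy^*` this curve crosses the
imaginary axis and goes on as a level curve of the reflected pair of sheets. That is `Γ_P^*`, the
graph of `starX`. The objects with index `R` are the images under `z ↦ -z`. This proves existence.

For arbitrary objects as in the theorem there is no other choice. An arc does not separate the half
plane (`isPreconnected_left_sdiff_arc`), so the identity theorem determines `ψ_R`, `ψ_Q + ψ_P` and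
`(ψ_Q - ψ_P)²` in the left half plane. A real integral forces `(ψ_Q - ψ_P)² γ'²` to be nonpositive
along the curve, hence `mainH = 0` there. Without the branch points the zero set of `mainH` lies in
five disjoint open sets (`level_component`), and the prescribed endpoints select the right one. So
`Γ_P` is `levelCut` and the sheets are `canonP` and `canonQ`.

Positivity: on a level curve the line element is real, with the sign of the real part of the
difference of the sheets times the vertical direction of travel. Masses: in each closed half plane,
upper or lower, the primitive has one continuous branch `heightPrim`, and the two branches differ on
the real axis by multiples of `πi` that count the poles `0, ±1` on either side. `Γ_P` crosses the
negative axis where `ψ_P < -1 < ψ_Q < 0`, which gives `2πi`. For `Γ_Q` the contributions at `±iy^*`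
cancel, and the values `±1/√3` of `ψ_R` and `ψ_P` at the origin give `2πi`. -/

namespace HermitePade

noncomputable section

/-! ### The cubic equation and its triples of roots -/

/-- `w` is a finite preimage of `z` under `zMap`. -/
def IsPreimage (z w : ℂ) : Prop := z * w ^ 3 - w ^ 2 - z * w + 1 / 3 = 0

/-- `a, b, c` are the three preimages of `z ≠ 0`, with multiplicity. -/
def IsTriple (z a b c : ℂ) : Prop :=
  z * (a + b + c) = 1 ∧ a * b + a * c + b * c = -1 ∧ 3 * z * (a * b * c) = -1

theorem IsTriple.ne_zero {z a b c : ℂ} (h : IsTriple z a b c) : z ≠ 0 := by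
  rintro rfl
  simpa using h.1

theorem IsTriple.factor {z a b c : ℂ} (h : IsTriple z a b c) (w : ℂ) :
    z * w ^ 3 - w ^ 2 - z * w + 1 / 3 = z * ((w - a) * (w - b) * (w - c)) := by
  obtain ⟨h1, h2, h3⟩ := h
  linear_combination w ^ 2 * h1 - z * w * h2 + 1 / 3 * h3

theorem IsTriple.isPreimage_iff {z a b c : ℂ} (h : IsTriple z a b c) (w : ℂ) :
    IsPreimage z w ↔ w = a ∨ w = b ∨ w = c := by
  rw [IsPreimage, h.factor]
  simp [h.ne_zero, sub_eq_zero, or_assoc]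

theorem IsTriple.swap12 {z a b c : ℂ} (h : IsTriple z a b c) : IsTriple z b a c :=
  ⟨by linear_combination h.1, by linear_combination h.2.1, by linear_combination h.2.2⟩

theorem IsTriple.swap23 {z a b c : ℂ} (h : IsTriple z a b c) : IsTriple z a c b :=
  ⟨by linear_combination h.1, by linear_combination h.2.1, by linear_combination h.2.2⟩

theorem IsTriple.rotate {z a b c : ℂ} (h : IsTriple z a b c) : IsTriple z b c a :=
  h.swap12.swap23

theorem IsTriple.conj {z a b c : ℂ} (h : IsTriple z a b c) :
    IsTriple (starRingEnd ℂ z) (starRingEnd ℂ a) (starRingEnd ℂ b) (starRingEnd ℂ c) := by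
  refine ⟨?_, ?_, ?_⟩
  · simpa using congrArg (starRingEnd ℂ) h.1
  · simpa using congrArg (starRingEnd ℂ) h.2.1
  · simpa [map_ofNat (starRingEnd ℂ) 3] using congrArg (starRingEnd ℂ) h.2.2

theorem IsPreimage.ne_zero {z w : ℂ} (h : IsPreimage z w) : w ≠ 0 :=
  ((inverse_iff_cubic z w).2 h).1

theorem IsPreimage.sq_ne_one {z w : ℂ} (h : IsPreimage z w) : w ^ 2 ≠ 1 :=
  ((inverse_iff_cubic z w).2 h).2.1

theorem IsPreimage.zMap_eq {z w : ℂ} (h : IsPreimage z w) : zMap w = z :=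
  ((inverse_iff_cubic z w).2 h).2.2

theorem IsPreimage.conj {z w : ℂ} (h : IsPreimage z w) :
    IsPreimage (starRingEnd ℂ z) (starRingEnd ℂ w) := by
  have := congrArg (starRingEnd ℂ) h
  simpa [IsPreimage, map_ofNat (starRingEnd ℂ) 3] using this

theorem IsPreimage.neg {z w : ℂ} (h : IsPreimage z w) : IsPreimage (-z) (-w) := by
  unfold IsPreimage at *
  linear_combination h

/-- The residues at `0`, `1` and `-1` all equal `1/3`. This form is behind the exchange of the half
planes and behind the equal weights of the three logarithms in the primitive. -/
theorem zMap_eq_of_ne {w : ℂ} (h0 : w ≠ 0) (h1 : w ^ 2 ≠ 1) :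
    zMap w = (1 / 3) * (w⁻¹ + (w - 1)⁻¹ + (w + 1)⁻¹) := by
  have h2 : w ^ 2 - 1 ≠ 0 := sub_ne_zero.2 h1
  have h3 : w - 1 ≠ 0 := fun h => h2 (by linear_combination (w + 1) * h)
  have h4 : w + 1 ≠ 0 := fun h => h2 (by linear_combination (w - 1) * h)
  rw [zMap]
  field_simp
  ring

theorem IsPreimage.sub_one_ne {z w : ℂ} (h : IsPreimage z w) : w - 1 ≠ 0 := fun h' =>
  h.sq_ne_one (by linear_combination (w + 1) * h')

theorem IsPreimage.add_one_ne {z w : ℂ} (h : IsPreimage z w) : w + 1 ≠ 0 := fun h' =>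
  h.sq_ne_one (by linear_combination (w - 1) * h')

/-- The map `zMap` interchanges the upper and the lower half plane. -/
theorem IsPreimage.exists_im {z w : ℂ} (h : IsPreimage z w) : ∃ k > 0, z.im = -k * w.im := by
  have n0 := Complex.normSq_pos.2 h.ne_zero
  have n1 := Complex.normSq_pos.2 h.sub_one_ne
  have n2 := Complex.normSq_pos.2 h.add_one_ne
  refine ⟨1 / 3 * ((Complex.normSq w)⁻¹ + (Complex.normSq (w - 1))⁻¹ +
    (Complex.normSq (w + 1))⁻¹), by positivity, ?_⟩
  rw [← h.zMap_eq, zMap_eq_of_ne h.ne_zero h.sq_ne_one]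
  have e : (1 / 3 : ℂ) = ((1 / 3 : ℝ) : ℂ) := by norm_num
  rw [e, Complex.im_ofReal_mul]
  simp
  ring

theorem exists_isPreimage {z : ℂ} : ∃ w, IsPreimage z w := by
  -- The leading coefficient is `z`; at the origin the equation degenerates to `w² = 1/3`.
  by_cases hz : z = 0
  · refine ⟨((√3)⁻¹ : ℝ), ?_⟩
    have h3 : ((√3 : ℝ) : ℂ) ^ 2 = 3 := by
      rw [← Complex.ofReal_pow, Real.sq_sqrt (by norm_num)]
      norm_num
    simp [IsPreimage, hz, h3]
  · have hd : (Polynomial.C z * Polynomial.X ^ 3 - Polynomial.X ^ 2 -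
        Polynomial.C z * Polynomial.X + Polynomial.C (1 / 3) : Polynomial ℂ).degree = 3 := by
      compute_degree!
    obtain ⟨w, hw⟩ := IsAlgClosed.exists_root _ (by rw [hd]; norm_num)
    refine ⟨w, ?_⟩
    simpa [Polynomial.IsRoot, IsPreimage] using hw

/-- The coordinate `-1 / (z r)` of the unordered pair of preimages different from `r`. -/
def pairCoord (z r : ℂ) : ℂ := -1 / (z * r)

theorem IsPreimage.pairCoord_mul {z r : ℂ} (hz : z ≠ 0) (h : IsPreimage z r) :
    pairCoord z r * (z * r) = -1 := by
  have := h.ne_zero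
  rw [pairCoord]
  field_simp

theorem IsPreimage.pairCoord_ne_zero {z r : ℂ} (hz : z ≠ 0) (h : IsPreimage z r) :
    pairCoord z r ≠ 0 := by
  intro h0
  have := h.pairCoord_mul hz
  rw [h0] at this
  norm_num at this

/-- Eliminating `z` from the cubic by means of `m z r = -1` leaves a relation between `r²` and `m`
alone. -/
theorem IsPreimage.sq_mul_pairCoord {z r : ℂ} (hz : z ≠ 0) (h : IsPreimage z r) :
    r ^ 2 * (1 + pairCoord z r) = 1 + pairCoord z r / 3 := by
  have hm := h.pairCoord_mul hz
  have hr := h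
  unfold IsPreimage at hr
  linear_combination (-pairCoord z r) * hr + (r ^ 2 - 1) * hm

/-- The other two roots have sum `-(1+m) r` and product `m/3`. The relation between `r²` and `m`
then turns their discriminant into `(m²+3)/3`, a polynomial in `m` only. -/
theorem IsPreimage.isTriple {z r s : ℂ} (hz : z ≠ 0) (h : IsPreimage z r)
    (hs : s ^ 2 = (pairCoord z r ^ 2 + 3) / 3) :
    IsTriple z r ((-(1 + pairCoord z r) * r + s) / 2) ((-(1 + pairCoord z r) * r - s) / 2) := by
  have hm := h.pairCoord_mul hz
  have h2 := h.sq_mul_pairCoord hz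
  set m := pairCoord z r
  refine ⟨?_, ?_, ?_⟩
  · linear_combination -hm
  · linear_combination (m - 3) / 4 * h2 - 1 / 4 * hs
  · linear_combination hm + 3 / 4 * z * r * ((1 + m) * h2 - hs)

theorem IsTriple.sub_sq {z a b c : ℂ} (h : IsTriple z a b c) :
    (b - c) ^ 2 = (pairCoord z a ^ 2 + 3) / 3 := by
  have ha : IsPreimage z a := (h.isPreimage_iff a).2 (Or.inl rfl)
  have hm := ha.pairCoord_mul h.ne_zero
  have h2 := ha.sq_mul_pairCoord h.ne_zero
  obtain ⟨e1, e2, e3⟩ := h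
  set m := pairCoord z a
  have hza : z * a ≠ 0 := by
    intro h0
    rw [h0] at hm
    norm_num at hm
  have hs : b + c = -(1 + m) * a := by
    apply mul_left_cancel₀ hza
    linear_combination a * e1 + a * hm
  have hp : b * c = m / 3 := by
    apply mul_left_cancel₀ hza
    linear_combination 1 / 3 * e3 - 1 / 3 * hm
  have : (b - c) ^ 2 = (b + c) ^ 2 - 4 * (b * c) := by ring
  rw [this, hs, hp]
  linear_combination (1 + m) * h2

theorem exists_isTriple {z : ℂ} (hz : z ≠ 0) : ∃ a b c, IsTriple z a b c := by
  obtain ⟨r, hr⟩ := exists_isPreimage (z := z)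
  obtain ⟨s, hs⟩ := IsAlgClosed.exists_pow_nat_eq ((pairCoord z r ^ 2 + 3) / 3) two_pos
  exact ⟨_, _, _, hr.isTriple hz hs⟩

/-- If the square of a number is real and at most `-3`, the number lies on the imaginary axis. -/
theorem eq_mul_I_of_sq {m : ℂ} {d : ℝ} (h : m ^ 2 = ((-3 - d : ℝ) : ℂ)) (hd : 0 ≤ d) :
    m.re = 0 ∧ m.im ^ 2 = 3 + d := by
  have h1 := congrArg Complex.re h
  have h2 := congrArg Complex.im h
  simp [pow_two] at h1 h2
  have h3 : m.re * m.im = 0 := by linarith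
  rcases mul_eq_zero.1 h3 with h4 | h4
  · refine ⟨h4, ?_⟩
    rw [h4] at h1
    nlinarith
  · rw [h4] at h1
    nlinarith [sq_nonneg m.re]

/-- For imaginary `m` the relations `(1+m) r² = 1 + m/3` and `m z r = -1` split into real equations.
They tie the signs of `Re z` and `Im z` to those of `Im r` and `Re r`. -/
theorem IsPreimage.re_im_of_pairCoord {z r : ℂ} (hz : z ≠ 0) (h : IsPreimage z r)
    (hm : (pairCoord z r).re = 0) :
    (pairCoord z r).im ≠ 0 ∧
      r.re * r.im * (3 * (1 + (pairCoord z r).im ^ 2)) = - (pairCoord z r).im ∧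
      z.re * ((pairCoord z r).im * Complex.normSq r) = r.im ∧
      z.im * ((pairCoord z r).im * Complex.normSq r) = r.re := by
  have h1 := h.pairCoord_mul hz
  have h2 := h.sq_mul_pairCoord hz
  have h0 := h.pairCoord_ne_zero hz
  set m := pairCoord z r
  have hm' : m.im ≠ 0 := fun h' => h0 (Complex.ext hm h')
  have h3 := congrArg Complex.re h1
  have h4 := congrArg Complex.im h1
  have h5 := congrArg Complex.re h2
  have h6 := congrArg Complex.im h2
  have e3 : (m / 3).re = m.re / 3 := by
    rw [show (3 : ℂ) = ((3 : ℝ) : ℂ) by norm_num, Complex.div_ofReal_re]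
  have e4 : (m / 3).im = m.im / 3 := by
    rw [show (3 : ℂ) = ((3 : ℝ) : ℂ) by norm_num, Complex.div_ofReal_im]
  simp [pow_two, hm, e3, e4] at h3 h4 h5 h6
  refine ⟨hm', ?_, ?_, ?_⟩
  · linear_combination 3/2 * h6 - 3/2 * m.im * h5
  · have h4' : z.re * r.re - z.im * r.im = 0 := by
      rcases h4 with h4 | h4
      · exact absurd h4 hm'
      · exact h4
    rw [Complex.normSq_apply]
    linear_combination m.im * r.re * h4' + r.im * h3
  · have h4' : z.re * r.re - z.im * r.im = 0 := by
      rcases h4 with h4 | h4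
      · exact absurd h4 hm'
      · exact h4
    rw [Complex.normSq_apply]
    linear_combination -m.im * r.im * h4' + r.re * h3

/-- In the closed left half plane, two preimages with the same real part lie in the left half
plane, and the third one in the right half plane. -/
theorem IsTriple.re_of_re_eq {z a b c : ℂ} (h : IsTriple z a b c) (hz : z.re ≤ 0)
    (hbc : b.re = c.re) : z.re < 0 ∧ b.re < 0 ∧ 0 < a.re ∧ (pairCoord z a).re = 0 ∧
      3 ≤ (pairCoord z a).im ^ 2 := by
  have ha : IsPreimage z a := (h.isPreimage_iff a).2 (Or.inl rfl)
  have hd := h.sub_sq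
  have e : (pairCoord z a) ^ 2 = ((-3 - 3 * (b.im - c.im) ^ 2 : ℝ) : ℂ) := by
    have : b - c = ((b.im - c.im : ℝ) : ℂ) * Complex.I := by
      apply Complex.ext <;> simp [hbc]
    rw [this, mul_pow, Complex.I_sq] at hd
    push_cast at hd ⊢
    linear_combination -3 * hd
  obtain ⟨hm, hm2⟩ := eq_mul_I_of_sq e (by positivity)
  obtain ⟨h0, h1, h2, h3⟩ := ha.re_im_of_pairCoord h.ne_zero hm
  have hs : (b + c).re = -(a.re - (pairCoord z a).im * a.im) := by
    have hza := ha.pairCoord_mul h.ne_zero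
    have : b + c = -(1 + pairCoord z a) * a := by
      apply mul_left_cancel₀ (mul_ne_zero h.ne_zero ha.ne_zero)
      linear_combination a * h.1 + a * hza
    rw [this]
    simp [hm]
    ring
  set t := (pairCoord z a).im
  have hn := Complex.normSq_pos.2 ha.ne_zero
  -- The product `t · Im a` has the sign of `Re z`, while `Re a · (t · Im a)` is negative. Hence `Re
  -- a > 0`, and `Re (b + c) = -(Re a - t · Im a)` is negative.
  have h5 : t * a.im = z.re * (t ^ 2 * Complex.normSq a) := by rw [← h2]; ring
  have ht : 0 < t ^ 2 := by positivity
  have h6 : t * a.im ≤ 0 := by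
    rw [h5]
    exact mul_nonpos_of_nonpos_of_nonneg hz (by positivity)
  have h7 : a.re * (t * a.im) * (3 * (1 + t ^ 2)) = - t ^ 2 := by linear_combination t * h1
  have h8 : a.re * (t * a.im) < 0 := by
    by_contra hcon
    push Not at hcon
    have : 0 ≤ a.re * (t * a.im) * (3 * (1 + t ^ 2)) := by positivity
    linarith
  have h9 : t * a.im < 0 := by
    rcases h6.lt_or_eq with h | h
    · exact h
    · rw [h] at h8; simp at h8
  have h10 : 0 < a.re := by
    by_contra hcon
    push Not at hcon
    have := mul_nonneg_of_nonpos_of_nonpos hcon h6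
    linarith
  refine ⟨?_, ?_, h10, hm, by rw [hm2]; nlinarith [sq_nonneg (b.im - c.im)]⟩
  · by_contra hcon
    have : z.re = 0 := le_antisymm hz (not_lt.1 hcon)
    rw [this] at h5
    simp at h5
    rcases h5 with h5 | h5
    · exact h0 h5
    · rw [h5] at h9; simp at h9
  · simp at hs
    linarith

/-! ### The root of greatest real part -/

theorem exists_maximal_preimage (z : ℂ) :
    ∃ r, IsPreimage z r ∧ ∀ w, IsPreimage z w → w.re ≤ r.re := by
  by_cases hz : z = 0
  · have hs : ((√3 : ℝ) : ℂ) ^ 2 = 3 := by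
      rw [← Complex.ofReal_pow, Real.sq_sqrt (by norm_num)]
      norm_num
    have hs0 : (0 : ℝ) < √3 := by positivity
    have hsc : ((√3 : ℝ) : ℂ) ≠ 0 := by exact_mod_cast hs0.ne'
    refine ⟨((√3)⁻¹ : ℝ), by simp [IsPreimage, hz, hs], fun w hw => ?_⟩
    have h1 : (w - (√3 : ℂ)⁻¹) * (w + (√3 : ℂ)⁻¹) = 0 := by
      unfold IsPreimage at hw
      have h3 : ((√3 : ℂ)⁻¹) ^ 2 = 1 / 3 := by rw [inv_pow, hs]; norm_num
      rw [hz] at hw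
      linear_combination -hw - h3
    have e : ((√3 : ℂ)⁻¹) = (((√3)⁻¹ : ℝ) : ℂ) := by push_cast; rfl
    rw [e] at h1
    rcases mul_eq_zero.1 h1 with h | h
    · rw [sub_eq_zero.1 h]
    · rw [eq_neg_of_add_eq_zero_left h, Complex.neg_re, Complex.ofReal_re]
      have : (0 : ℝ) < (√3)⁻¹ := by positivity
      linarith
  · obtain ⟨a, b, c, h⟩ := exists_isTriple hz
    obtain ⟨r, hr, hmax⟩ := Finset.exists_max_image {a, b, c} Complex.re ⟨a, by simp⟩
    refine ⟨r, (h.isPreimage_iff r).2 (by simpa using hr), fun w hw => hmax w ?_⟩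
    simpa using (h.isPreimage_iff w).1 hw

/-- A preimage of `z` of maximal real part. -/
def maxRoot (z : ℂ) : ℂ := (exists_maximal_preimage z).choose

theorem maxRoot_isPreimage (z : ℂ) : IsPreimage z (maxRoot z) :=
  (exists_maximal_preimage z).choose_spec.1

theorem re_le_maxRoot {z w : ℂ} (h : IsPreimage z w) : w.re ≤ (maxRoot z).re :=
  (exists_maximal_preimage z).choose_spec.2 w h

/-- In the closed left half plane, the preimage of maximal real part is unique and simple. -/
theorem IsTriple.re_lt_maxRoot {z p q : ℂ} (hz : z.re ≤ 0) (h : IsTriple z (maxRoot z) p q) :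
    p.re < (maxRoot z).re ∧ q.re < (maxRoot z).re := by
  have hp := re_le_maxRoot ((h.isPreimage_iff p).2 (by simp))
  have hq := re_le_maxRoot ((h.isPreimage_iff q).2 (by simp))
  constructor
  · refine lt_of_le_of_ne hp fun he => ?_
    obtain ⟨-, h1, h2, -⟩ := h.rotate.rotate.re_of_re_eq hz he.symm
    linarith
  · refine lt_of_le_of_ne hq fun he => ?_
    obtain ⟨-, h1, h2, -⟩ := h.swap12.re_of_re_eq hz he.symm
    linarith

/-- All roots lie in the open lower half plane, so with nonpositive real parts every term of `Im
(ab+ac+bc) = 0` is nonnegative and the roots are purely imaginary. For their imaginary parts, all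
negative, the product of the first two elementary symmetric functions would equal three times the
third; the expansion of that product has strictly negative additional terms. -/
theorem IsTriple.exists_re_pos_aux {z a b c : ℂ} (h : IsTriple z a b c) (hz : 0 < z.im)
    (ha : a.re ≤ 0) (hb : b.re ≤ 0) (hc : c.re ≤ 0) : False := by
  have key : ∀ {w}, IsPreimage z w → w.im < 0 := by
    intro w hw
    obtain ⟨k, hk, he⟩ := hw.exists_im
    by_contra hcon
    push Not at hcon
    nlinarith [mul_nonneg hk.le hcon]
  have ia := key ((h.isPreimage_iff a).2 (by simp))
  have ib := key ((h.isPreimage_iff b).2 (by simp))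
  have ic := key ((h.isPreimage_iff c).2 (by simp))
  have h2 := congrArg Complex.im h.2.1
  simp at h2
  have n1 := mul_nonneg_of_nonpos_of_nonpos ha ib.le
  have n2 := mul_nonneg_of_nonpos_of_nonpos ia.le hb
  have n3 := mul_nonneg_of_nonpos_of_nonpos ha ic.le
  have n4 := mul_nonneg_of_nonpos_of_nonpos ia.le hc
  have n5 := mul_nonneg_of_nonpos_of_nonpos hb ic.le
  have n6 := mul_nonneg_of_nonpos_of_nonpos ib.le hc
  have a0 : a.re = 0 := by
    have : a.re * b.im = 0 := by linarith
    rcases mul_eq_zero.1 this with h | h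
    · exact h
    · linarith
  have b0 : b.re = 0 := by
    have : a.im * b.re = 0 := by linarith
    rcases mul_eq_zero.1 this with h | h
    · linarith
    · exact h
  have c0 : c.re = 0 := by
    have : a.im * c.re = 0 := by linarith
    rcases mul_eq_zero.1 this with h | h
    · linarith
    · exact h
  have h3 := congrArg Complex.re h.2.1
  simp [a0, b0, c0] at h3
  have h4 : a + b + c = -3 * (a * b * c) := by
    apply mul_left_cancel₀ h.ne_zero
    linear_combination h.1 + h.2.2
  have h5 := congrArg Complex.im h4
  simp [a0, b0, c0] at h5
  have p1 := mul_pos_of_neg_of_neg ia ib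
  have p2 := mul_pos_of_neg_of_neg ia ic
  have p3 := mul_pos_of_neg_of_neg ib ic
  have h6 : a.im * b.im + a.im * c.im + b.im * c.im = 1 := by linarith
  have h7 : a.im * b.im * c.im < 0 := mul_neg_of_pos_of_neg p1 ic
  have h8 : (a.im + b.im + c.im) * (a.im * b.im + a.im * c.im + b.im * c.im) =
      3 * (a.im * b.im * c.im) := by rw [h6]; linarith
  have q1 := mul_neg_of_pos_of_neg p1 ia
  have q2 := mul_neg_of_pos_of_neg p1 ib
  have q3 := mul_neg_of_pos_of_neg p2 ia
  have q4 := mul_neg_of_pos_of_neg p2 ic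
  have q5 := mul_neg_of_pos_of_neg p3 ib
  have q6 := mul_neg_of_pos_of_neg p3 ic
  nlinarith

theorem conj_maxRoot {z : ℂ} (hz : z.re ≤ 0) (hz0 : z ≠ 0) :
    maxRoot (starRingEnd ℂ z) = starRingEnd ℂ (maxRoot z) := by
  obtain ⟨s, hs⟩ := IsAlgClosed.exists_pow_nat_eq ((pairCoord z (maxRoot z) ^ 2 + 3) / 3) two_pos
  have h := (maxRoot_isPreimage z).isTriple hz0 hs
  obtain ⟨h1, h2⟩ := h.re_lt_maxRoot hz
  have h3 := re_le_maxRoot (maxRoot_isPreimage z).conj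
  rw [Complex.conj_re] at h3
  rcases (h.conj.isPreimage_iff _).1 (maxRoot_isPreimage (starRingEnd ℂ z)) with h4 | h4 | h4
  · exact h4
  · rw [h4, Complex.conj_re] at h3; linarith
  · rw [h4, Complex.conj_re] at h3; linarith

theorem maxRoot_re_pos {z : ℂ} (hz : z.re ≤ 0) : 0 < (maxRoot z).re := by
  by_cases hz0 : z = 0
  · have hs : ((√3 : ℝ) : ℂ) ^ 2 = 3 := by
      rw [← Complex.ofReal_pow, Real.sq_sqrt (by norm_num)]
      norm_num
    have : IsPreimage z (((√3)⁻¹ : ℝ) : ℂ) := by simp [IsPreimage, hz0, hs]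
    have h := re_le_maxRoot this
    rw [Complex.ofReal_re] at h
    have : (0 : ℝ) < (√3)⁻¹ := by positivity
    linarith
  by_contra hcon
  push Not at hcon
  obtain ⟨s, hs⟩ := IsAlgClosed.exists_pow_nat_eq ((pairCoord z (maxRoot z) ^ 2 + 3) / 3) two_pos
  have h := (maxRoot_isPreimage z).isTriple hz0 hs
  obtain ⟨h1, h2⟩ := h.re_lt_maxRoot hz
  rcases lt_trichotomy z.im 0 with hi | hi | hi
  · refine h.conj.exists_re_pos_aux (by simpa using hi) ?_ ?_ ?_ <;>
      rw [Complex.conj_re] <;> linarith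
  -- For real `z` all roots are real, and `ab + ac + bc = -1` excludes that they are all
  -- nonpositive.
  · have key : ∀ {w}, IsPreimage z w → w.im = 0 := by
      intro w hw
      obtain ⟨k, hk, he⟩ := hw.exists_im
      rw [hi] at he
      rcases mul_eq_zero.1 he.symm with h | h
      · linarith
      · exact h
    have i1 := key (maxRoot_isPreimage z)
    have i2 := key ((h.isPreimage_iff _).2 (Or.inr (Or.inl rfl)))
    have i3 := key ((h.isPreimage_iff _).2 (Or.inr (Or.inr rfl)))
    have h3 := congrArg Complex.re h.2.1
    generalize (-(1 + pairCoord z (maxRoot z)) * maxRoot z + s) / 2 = p at *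
    generalize (-(1 + pairCoord z (maxRoot z)) * maxRoot z - s) / 2 = q at *
    simp only [Complex.add_re, Complex.mul_re, i1, i2, i3, Complex.neg_re, Complex.one_re] at h3
    nlinarith [mul_nonneg_of_nonpos_of_nonpos hcon (h1.le.trans hcon),
      mul_nonneg_of_nonpos_of_nonpos hcon (h2.le.trans hcon),
      mul_nonneg_of_nonpos_of_nonpos (h1.le.trans hcon) (h2.le.trans hcon)]
  · exact h.exists_re_pos_aux hi hcon (h1.le.trans hcon) (h2.le.trans hcon)

theorem maxRoot_zero : maxRoot 0 = ((√3)⁻¹ : ℝ) := by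
  have h := maxRoot_isPreimage 0
  have h0 := maxRoot_re_pos (z := 0) (by simp)
  have hs : ((√3 : ℝ) : ℂ) ^ 2 = 3 := by
    rw [← Complex.ofReal_pow, Real.sq_sqrt (by norm_num)]
    norm_num
  have h1 : (maxRoot 0 - (√3 : ℂ)⁻¹) * (maxRoot 0 + (√3 : ℂ)⁻¹) = 0 := by
    unfold IsPreimage at h
    have h3 : ((√3 : ℂ)⁻¹) ^ 2 = 1 / 3 := by rw [inv_pow, hs]; norm_num
    linear_combination -h - h3
  have e : ((√3 : ℂ)⁻¹) = (((√3)⁻¹ : ℝ) : ℂ) := by push_cast; rfl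
  rw [e] at h1
  rcases mul_eq_zero.1 h1 with h | h
  · exact sub_eq_zero.1 h
  · rw [eq_neg_of_add_eq_zero_left h, Complex.neg_re, Complex.ofReal_re] at h0
    have : (0 : ℝ) < (√3)⁻¹ := by positivity
    linarith

/-! ### The coordinate `m` of the two smaller roots -/

/-- The coordinate of the unordered pair of the two smaller preimages. -/
def pairM (z : ℂ) : ℂ := pairCoord z (maxRoot z)

theorem pairM_mul {z : ℂ} (hz : z ≠ 0) : pairM z * (z * maxRoot z) = -1 :=
  (maxRoot_isPreimage z).pairCoord_mul hz

theorem pairM_ne_zero {z : ℂ} (hz : z ≠ 0) : pairM z ≠ 0 :=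
  (maxRoot_isPreimage z).pairCoord_ne_zero hz

theorem conj_pairM {z : ℂ} (hz : z.re ≤ 0) (hz0 : z ≠ 0) :
    pairM (starRingEnd ℂ z) = starRingEnd ℂ (pairM z) := by
  simp [pairM, pairCoord, conj_maxRoot hz hz0]

theorem pairM_im_pos {z : ℂ} (hz : z.re ≤ 0) (hi : 0 < z.im) : 0 < (pairM z).im := by
  have hz0 : z ≠ 0 := by rintro rfl; simp at hi
  have hc := maxRoot_re_pos hz
  obtain ⟨k, hk, he⟩ := (maxRoot_isPreimage z).exists_im
  have hci : (maxRoot z).im < 0 := by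
    by_contra hcon
    push Not at hcon
    nlinarith [mul_nonneg hk.le hcon]
  have hn : 0 < Complex.normSq (z * maxRoot z) :=
    Complex.normSq_pos.2 (mul_ne_zero hz0 (maxRoot_isPreimage z).ne_zero)
  have : (pairM z).im = (z * maxRoot z).im / Complex.normSq (z * maxRoot z) := by
    simp [pairM, pairCoord, Complex.div_im]
    ring
  rw [this]
  apply div_pos _ hn
  rw [Complex.mul_im]
  have := mul_nonneg_of_nonpos_of_nonpos hz hci.le
  have := mul_pos hi hc
  linarith

theorem pairM_of_real {z : ℂ} (hz : z.re < 0) (hi : z.im = 0) :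
    0 < (pairM z).re ∧ (pairM z).im = 0 ∧ (maxRoot z).im = 0 := by
  have hz0 : z ≠ 0 := by rintro rfl; simp at hz
  have hc := maxRoot_re_pos hz.le
  obtain ⟨k, hk, he⟩ := (maxRoot_isPreimage z).exists_im
  have hci : (maxRoot z).im = 0 := by
    rw [hi] at he
    rcases mul_eq_zero.1 he.symm with h | h
    · linarith
    · exact h
  have hn : 0 < Complex.normSq (z * maxRoot z) :=
    Complex.normSq_pos.2 (mul_ne_zero hz0 (maxRoot_isPreimage z).ne_zero)
  have e1 : (pairM z).im = (z * maxRoot z).im / Complex.normSq (z * maxRoot z) := by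
    simp [pairM, pairCoord, Complex.div_im]
    ring
  have e2 : (pairM z).re = -(z * maxRoot z).re / Complex.normSq (z * maxRoot z) := by
    simp [pairM, pairCoord, Complex.div_re]
  refine ⟨?_, ?_, hci⟩
  · rw [e2]
    apply div_pos _ hn
    rw [Complex.mul_re, hi, hci]
    have := mul_pos_of_neg_of_neg hz (neg_neg_of_pos hc)
    linarith
  · rw [e1, Complex.mul_im, hi, hci]
    simp

/-- Far out to the left `Re m` is positive; together with the negative sign here this forces a zero
of `Re m` on each horizontal line above the real axis. -/
theorem pairM_re_neg_of_imaginary {z : ℂ} (hz : z.re = 0) (hi : 0 < z.im) :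
    (pairM z).re < 0 := by
  have hz0 : z ≠ 0 := by rintro rfl; simp at hi
  obtain ⟨k, hk, he⟩ := (maxRoot_isPreimage z).exists_im
  have hci : (maxRoot z).im < 0 := by
    by_contra hcon
    push Not at hcon
    nlinarith [mul_nonneg hk.le hcon]
  have hn : 0 < Complex.normSq (z * maxRoot z) :=
    Complex.normSq_pos.2 (mul_ne_zero hz0 (maxRoot_isPreimage z).ne_zero)
  have e2 : (pairM z).re = -(z * maxRoot z).re / Complex.normSq (z * maxRoot z) := by
    simp [pairM, pairCoord, Complex.div_re]
  rw [e2]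
  apply div_neg_of_neg_of_pos _ hn
  rw [Complex.mul_re, hz]
  have := mul_neg_of_pos_of_neg hi hci
  linarith

/-- The square of the difference of the two smaller preimages. -/
def pairD (z : ℂ) : ℂ := (pairM z ^ 2 + 3) / 3

theorem isTriple_of_sq {z s : ℂ} (hz : z ≠ 0) (hs : s ^ 2 = pairD z) :
    IsTriple z (maxRoot z) ((-(1 + pairM z) * maxRoot z + s) / 2)
      ((-(1 + pairM z) * maxRoot z - s) / 2) :=
  (maxRoot_isPreimage z).isTriple hz hs

/-! ### The branch points -/

theorem omega24_pow (n : ℕ) :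
    omega24 ^ n = Complex.exp (((n * (Real.pi / 12) : ℝ) : ℂ) * Complex.I) := by
  rw [omega24, ← Complex.exp_nat_mul]
  congr 1
  push_cast
  ring

theorem branchRadius_pos : 0 < branchRadius := Real.rpow_pos_of_pos (by norm_num) _

theorem branchRadius_pow_four : branchRadius ^ 4 = 1 / 3 := by
  rw [branchRadius, ← Real.rpow_natCast, ← Real.rpow_mul (by norm_num)]
  norm_num

theorem omega24_pow_twelve : omega24 ^ 12 = -1 := by
  rw [omega24_pow]
  have : (((12 : ℕ) * (Real.pi / 12) : ℝ) : ℂ) = (Real.pi : ℂ) := by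
    push_cast
    ring
  rw [this, Complex.exp_pi_mul_I]

theorem conj_omega24_mul : starRingEnd ℂ omega24 * omega24 = 1 := by
  have : ‖omega24‖ = 1 := by
    have h := omega24_pow 1
    rw [pow_one] at h
    rw [h, Complex.norm_exp_ofReal_mul_I]
  rw [mul_comm, Complex.mul_conj, Complex.normSq_eq_norm_sq, this]
  norm_num

theorem z3_eq : z3 = -z1 := by
  rw [z3, z1]
  linear_combination (branchRadius : ℂ) * omega24 ^ 7 * omega24_pow_twelve

theorem z4_eq : z4 = -z2 := by
  rw [z4, z2]
  linear_combination (branchRadius : ℂ) * omega24 ^ 5 * omega24_pow_twelve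

theorem z2_eq : z2 = starRingEnd ℂ z1 := by
  rw [z2, z1, map_mul, Complex.conj_ofReal, map_pow]
  have h := conj_omega24_mul
  have h2 : (starRingEnd ℂ omega24) ^ 7 * omega24 ^ 7 = 1 := by rw [← mul_pow, h, one_pow]
  linear_combination -(branchRadius : ℂ) * omega24 ^ 17 * h2 + (branchRadius : ℂ) *
    (starRingEnd ℂ omega24) ^ 7 * (omega24 ^ 12 - 1) * omega24_pow_twelve

theorem z1_re_neg : z1.re < 0 := by
  rw [z1, omega24_pow, Complex.re_ofReal_mul, Complex.exp_ofReal_mul_I_re]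
  apply mul_neg_of_pos_of_neg branchRadius_pos
  have := Real.pi_pos
  apply Real.cos_neg_of_pi_div_two_lt_of_lt <;> push_cast <;> linarith

theorem z1_im_pos : 0 < z1.im := by
  rw [z1, omega24_pow, Complex.im_ofReal_mul, Complex.exp_ofReal_mul_I_im]
  apply mul_pos branchRadius_pos
  have := Real.pi_pos
  apply Real.sin_pos_of_pos_of_lt_pi <;> push_cast <;> linarith

theorem z1_ne_zero : z1 ≠ 0 := by
  intro h
  have := z1_im_pos
  simp [h] at this

/-- This square and the signs of the two coordinates are what the estimates below use of the branch
point. -/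
theorem z1_sq : z1 ^ 2 = -(1 / 2) - (√3 / 6 : ℝ) * Complex.I := by
  have hb : branchRadius ^ 2 = √3 / 3 := by
    have h1 : (branchRadius ^ 2) ^ 2 = (√3 / 3) ^ 2 := by
      rw [div_pow, Real.sq_sqrt (by norm_num), ← pow_mul, branchRadius_pow_four]
      norm_num
    exact (pow_left_inj₀ (by positivity) (by positivity) two_ne_zero).1 h1
  have hs : √3 * √3 = 3 := Real.mul_self_sqrt (by norm_num)
  have e : omega24 ^ 14 = -(√3 / 2 : ℝ) - (1 / 2 : ℝ) * Complex.I := by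
    have : omega24 ^ 14 = - omega24 ^ 2 := by
      linear_combination omega24 ^ 2 * omega24_pow_twelve
    rw [this, omega24_pow]
    have h6 : ((2 : ℕ) * (Real.pi / 12) : ℝ) = Real.pi / 6 := by push_cast; ring
    rw [h6]
    apply Complex.ext
    · rw [Complex.neg_re, Complex.exp_ofReal_mul_I_re, Real.cos_pi_div_six]
      simp
    · rw [Complex.neg_im, Complex.exp_ofReal_mul_I_im, Real.sin_pi_div_six]
      simp
  rw [z1, mul_pow, ← pow_mul, e, ← Complex.ofReal_pow, hb]
  apply Complex.ext
  · rw [Complex.re_ofReal_mul]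
    simp
    linear_combination 1 / 6 * hs
  · rw [Complex.im_ofReal_mul]
    simp
    ring

theorem z1_re_sq_sub : z1.re ^ 2 - z1.im ^ 2 = -(1 / 2) := by
  have h := congrArg Complex.re z1_sq
  simp [pow_two] at h
  linarith

theorem z1_re_mul_im : z1.re * z1.im = -(√3 / 12) := by
  have h := congrArg Complex.im z1_sq
  simp [pow_two] at h
  linarith

/-- The number `u = (Re z₁)²` is the positive solution of `u² + u/2 = 1/48`; dropping `u²` gives the
bound. -/
theorem z1_re_sq_lt : 24 * z1.re ^ 2 < 1 := by
  have h1 := z1_re_sq_sub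
  have h2 := z1_re_mul_im
  have h3 : z1.re ^ 2 * z1.im ^ 2 = 1 / 48 := by
    rw [← mul_pow, h2, neg_sq, div_pow, Real.sq_sqrt (by norm_num)]
    norm_num
  have h4 : z1.im ^ 2 = z1.re ^ 2 + 1 / 2 := by linarith
  rw [h4] at h3
  nlinarith [sq_nonneg z1.re]

/-- With `m = i√3` the number `-1/(m z₁)` is a root whose two companions coincide. Coinciding
companions have equal real parts, which forces this root to be the one of greatest real part. -/
theorem pairM_z1 : pairM z1 = (√3 : ℝ) * Complex.I := by
  set m : ℂ := (√3 : ℝ) * Complex.I with hm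
  have hs : ((√3 : ℝ) : ℂ) ^ 2 = 3 := by
    rw [← Complex.ofReal_pow, Real.sq_sqrt (by norm_num)]
    norm_num
  have hm2 : m ^ 2 = -3 := by rw [hm, mul_pow, hs, Complex.I_sq]; norm_num
  have hm0 : m ≠ 0 := by
    intro h
    rw [h] at hm2
    norm_num at hm2
  have hz := z1_ne_zero
  have hz2 : z1 ^ 2 = -(1 / 2) - m / 6 := by
    rw [z1_sq, hm]
    push_cast
    ring
  set r : ℂ := -1 / (m * z1) with hr
  have hmr : m * (z1 * r) = -1 := by
    rw [hr]
    field_simp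
  have hr2 : r ^ 2 * (1 + m) = 1 + m / 3 := by
    apply mul_left_cancel₀ (mul_ne_zero (pow_ne_zero 2 hm0) (pow_ne_zero 2 hz))
    linear_combination (1 + m) * (m * z1 * r - 1) * hmr - (1 + m / 3) * z1 ^ 2 * hm2 +
      3 * (1 + m / 3) * hz2 - 1 / 6 * hm2
  have hpr : IsPreimage z1 r := by
    unfold IsPreimage
    apply mul_left_cancel₀ hm0
    linear_combination (r ^ 2 - 1) * hmr - hr2
  have hpc : pairCoord z1 r = m := by
    apply mul_right_cancel₀ (mul_ne_zero hz hpr.ne_zero)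
    rw [hpr.pairCoord_mul hz, hmr]
  have ht := hpr.isTriple (s := 0) hz (by rw [hpc, hm2]; norm_num)
  obtain ⟨-, h1, h2, -⟩ := ht.re_of_re_eq z1_re_neg.le (by simp)
  have h3 := re_le_maxRoot hpr
  have hmax : maxRoot z1 = r := by
    rcases (ht.isPreimage_iff _).1 (maxRoot_isPreimage z1) with h | h | h
    · exact h
    · rw [h] at h3; linarith
    · rw [h] at h3
      simp only [add_zero, sub_zero] at h1 h3
      linarith
  rw [pairM, hmax, hpc]

/-- Elimination of the root from `m z r = -1` and `(1+m) r² = 1 + m/3` leaves an equation between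
`z²` and `m`. -/
theorem pairM_sq_mul {z : ℂ} (hz : z ≠ 0) :
    pairM z ^ 2 * z ^ 2 * (3 + pairM z) = 3 * (1 + pairM z) := by
  have h1 := pairM_mul hz
  have h2 : maxRoot z ^ 2 * (1 + pairM z) = 1 + pairM z / 3 :=
    (maxRoot_isPreimage z).sq_mul_pairCoord hz
  linear_combination 3 * (1 + pairM z) * (pairM z * z * maxRoot z - 1) * h1 -
    3 * pairM z ^ 2 * z ^ 2 * h2

/-! ### The curve on which `m` is imaginary -/

/-- The equation of the curve on which `pairM` is imaginary. -/
theorem curve_eqs {z : ℂ} (hz : z ≠ 0) (hm : (pairM z).re = 0) :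
    (z.re ^ 2 - z.im ^ 2) * ((pairM z).im ^ 2 * (9 + (pairM z).im ^ 2)) =
        -3 * (3 + (pairM z).im ^ 2) ∧
      z.re * z.im * ((pairM z).im * (9 + (pairM z).im ^ 2)) = -3 := by
  have h := pairM_sq_mul hz
  have h0 := pairM_ne_zero hz
  set m := pairM z
  have hm0 : m.im ≠ 0 := fun h' => h0 (Complex.ext hm h')
  have h1 := congrArg Complex.re h
  have h2 := congrArg Complex.im h
  simp [pow_two, hm] at h1 h2
  constructor
  · linear_combination -3 * h1 - m.im * h2
  · apply mul_left_cancel₀ hm0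
    linear_combination 1 / 2 * m.im * h1 - 3 / 2 * h2

/-- On the curve, `y² - x²` and `(xy)²` are strictly decreasing functions of `t = Im m`. If `y` did
not decrease with `t`, then `x²` would increase, and `(xy)²` could not decrease. -/
theorem curve_height_lt {x y x' y' t t' : ℝ} (hy : 0 < y) (ht : 0 < t)
    (htt : t < t') (h1 : (x ^ 2 - y ^ 2) * (t ^ 2 * (9 + t ^ 2)) = -3 * (3 + t ^ 2))
    (h2 : x * y * (t * (9 + t ^ 2)) = -3)
    (h1' : (x' ^ 2 - y' ^ 2) * (t' ^ 2 * (9 + t' ^ 2)) = -3 * (3 + t' ^ 2))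
    (h2' : x' * y' * (t' * (9 + t' ^ 2)) = -3) : y' < y := by
  have ht' : 0 < t' := ht.trans htt
  have hsq : t ^ 2 < t' ^ 2 := by nlinarith
  by_contra hcon
  push Not at hcon
  set A := 3 * (3 + t ^ 2) / (t ^ 2 * (9 + t ^ 2)) with hA
  set A' := 3 * (3 + t' ^ 2) / (t' ^ 2 * (9 + t' ^ 2)) with hA'
  have e1 : x ^ 2 = y ^ 2 - A := by
    rw [hA]; field_simp; linear_combination h1
  have e1' : x' ^ 2 = y' ^ 2 - A' := by
    rw [hA']; field_simp; linear_combination h1'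
  have hAA : A' < A := by
    rw [hA, hA', div_lt_div_iff₀ (by positivity) (by positivity)]
    nlinarith [mul_pos (pow_pos ht 2) (pow_pos ht' 2), pow_pos ht 2, pow_pos ht' 2]
  have e2 : (x * y) ^ 2 = (3 / (t * (9 + t ^ 2))) ^ 2 := by
    have : x * y = -(3 / (t * (9 + t ^ 2))) := by field_simp; linear_combination h2
    rw [this, neg_sq]
  have e2' : (x' * y') ^ 2 = (3 / (t' * (9 + t' ^ 2))) ^ 2 := by
    have : x' * y' = -(3 / (t' * (9 + t' ^ 2))) := by field_simp; linear_combination h2'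
    rw [this, neg_sq]
  have hB : 3 / (t' * (9 + t' ^ 2)) < 3 / (t * (9 + t ^ 2)) := by
    apply div_lt_div_of_pos_left (by norm_num) (by positivity)
    nlinarith
  have hB2 : (3 / (t' * (9 + t' ^ 2))) ^ 2 < (3 / (t * (9 + t ^ 2))) ^ 2 :=
    pow_lt_pow_left₀ hB (by positivity) two_ne_zero
  rw [← e2, ← e2', mul_pow, mul_pow] at hB2
  have hyy : y ^ 2 ≤ y' ^ 2 := by nlinarith
  have hx : x ^ 2 ≤ x' ^ 2 := by rw [e1, e1']; linarith
  nlinarith [mul_le_mul hx hyy (sq_nonneg y) (sq_nonneg x')]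

/-- The height determines `Im m` by strict monotonicity, and then the product `xy` determines `x`.
-/
theorem curve_unique {z z' : ℂ} (hz : z.re ≤ 0) (hi : 0 < z.im) (hz' : z'.re ≤ 0)
    (hm : (pairM z).re = 0) (hm' : (pairM z').re = 0) (hii : z.im = z'.im) : z = z' := by
  have hi' : 0 < z'.im := hii ▸ hi
  have ne : z ≠ 0 := by rintro rfl; simp at hi
  have ne' : z' ≠ 0 := by rintro rfl; simp at hi'
  obtain ⟨h1, h2⟩ := curve_eqs ne hm
  obtain ⟨h1', h2'⟩ := curve_eqs ne' hm'
  have t := pairM_im_pos hz hi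
  have t' := pairM_im_pos hz' hi'
  rcases lt_trichotomy (pairM z).im (pairM z').im with h | h | h
  · have := curve_height_lt hi t h h1 h2 h1' h2'
    linarith
  · rw [← h, ← hii] at h2'
    refine Complex.ext ?_ hii
    have hne : z.im * ((pairM z).im * (9 + (pairM z).im ^ 2)) ≠ 0 := by positivity
    have h3 : z.re * (z.im * ((pairM z).im * (9 + (pairM z).im ^ 2))) =
        z'.re * (z.im * ((pairM z).im * (9 + (pairM z).im ^ 2))) := by linarith
    exact mul_right_cancel₀ hne h3
  · have := curve_height_lt hi' t' h h1' h2' h1 h2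
    linarith

/-- Below the branch point `Im m` exceeds `√3`. Eliminating `y` gives an equation for `x²` with a
left side increasing in `x²`; substituting the value `(Re z₁)²`, which solves it for `(Im m)² = 3`,
makes the left side too large. -/
theorem curve_below {z : ℂ} (hz : z.re ≤ 0) (hi : 0 < z.im) (hm : (pairM z).re = 0)
    (hlt : z.im < z1.im) : z1.re < z.re := by
  have ne : z ≠ 0 := by rintro rfl; simp at hi
  obtain ⟨h1, h2⟩ := curve_eqs ne hm
  have hm1 : (pairM z1).re = 0 := by simp [pairM_z1]
  obtain ⟨h1', h2'⟩ := curve_eqs z1_ne_zero hm1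
  have t := pairM_im_pos hz hi
  have hs : √3 ^ 2 = 3 := Real.sq_sqrt (by norm_num)
  have e1 : (pairM z1).im = √3 := by simp [pairM_z1]
  rw [e1] at h1' h2'
  have s0 : (0 : ℝ) < √3 := by positivity
  have ht : √3 < (pairM z).im := by
    rcases lt_trichotomy (pairM z).im √3 with h | h | h
    · have := curve_height_lt hi t h h1 h2 h1' h2'
      linarith
    · have := curve_unique hz hi z1_re_neg.le hm hm1
      exfalso
      rw [h] at h1 h2
      have a1 : z.re ^ 2 - z.im ^ 2 = z1.re ^ 2 - z1.im ^ 2 :=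
        mul_right_cancel₀ (b := √3 ^ 2 * (9 + √3 ^ 2)) (by positivity) (h1.trans h1'.symm)
      have a2 : z.re * z.im = z1.re * z1.im :=
        mul_right_cancel₀ (b := √3 * (9 + √3 ^ 2)) (by positivity) (h2.trans h2'.symm)
      have a3 : z.im ^ 2 < z1.im ^ 2 := by nlinarith
      have a4 : z.re ^ 2 < z1.re ^ 2 := by linarith
      have a5 : (z.re * z.im) ^ 2 < (z1.re * z1.im) ^ 2 := by
        rw [mul_pow, mul_pow]
        exact mul_lt_mul'' a4 a3 (sq_nonneg _) (sq_nonneg _)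
      rw [a2] at a5
      exact lt_irrefl _ a5
    · exact h
  set τ := (pairM z).im
  have hT : 3 < τ ^ 2 := by nlinarith
  have hu := z1_re_sq_lt
  have hu0 : 0 < z1.re ^ 2 := by nlinarith [z1_re_neg]
  have q1 : z1.re ^ 2 * z1.re ^ 2 = 1 / 48 - z1.re ^ 2 / 2 := by
    have h3 : z1.re ^ 2 * z1.im ^ 2 = 1 / 48 := by
      rw [← mul_pow, z1_re_mul_im, neg_sq, div_pow, Real.sq_sqrt (by norm_num)]
      norm_num
    have h4 := z1_re_sq_sub
    have h5 : z1.im ^ 2 = z1.re ^ 2 + 1 / 2 := by linarith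
    rw [h5] at h3
    linarith
  generalize hgen : z1.re ^ 2 = u at *
  have q2 : z.re ^ 2 * (z.re ^ 2 * (τ ^ 2 * (9 + τ ^ 2)) + 3 * (3 + τ ^ 2)) * (9 + τ ^ 2) = 9 := by
    have h3 : (z.re * z.im * (τ * (9 + τ ^ 2))) ^ 2 = 9 := by rw [h2]; norm_num
    linear_combination h3 + z.re ^ 2 * (9 + τ ^ 2) * h1
  have key : z.re ^ 2 < u := by
    by_contra hcon
    push Not at hcon
    have hT0 : 0 < τ ^ 2 := by positivity
    have b1 : u * (u * (τ ^ 2 * (9 + τ ^ 2)) + 3 * (3 + τ ^ 2)) * (9 + τ ^ 2) ≤ 9 := by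
      refine le_trans ?_ q2.le
      gcongr
    have b2 : (1 / 48 - u / 2) * (τ ^ 2 * (9 + τ ^ 2) ^ 2) + 3 * u * (3 + τ ^ 2) * (9 + τ ^ 2)
        ≤ 9 := by
      rw [← q1]
      linarith
    -- The left side of `b2` minus `9` is this product divided by `48`. The bound `24 u < 1` makes
    -- the second factor positive.
    have b3 : 0 < (τ ^ 2 - 3) * ((τ ^ 2) ^ 2 + 21 * τ ^ 2 + 144 -
        24 * u * (τ ^ 2 + 9) * (τ ^ 2 + 6)) := by
      apply mul_pos (by linarith)
      have : 24 * u * ((τ ^ 2 + 9) * (τ ^ 2 + 6)) < 1 * ((τ ^ 2 + 9) * (τ ^ 2 + 6)) := by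
        gcongr
      nlinarith
    nlinarith
  have hx1 := z1_re_neg
  rw [← hgen] at key
  nlinarith

/-! ### Continuity of the roots -/

theorem IsPreimage.norm_le {z w : ℂ} (hz : z ≠ 0) (h : IsPreimage z w) :
    ‖w‖ ≤ 1 + 2 / ‖z‖ := by
  have hn : 0 < ‖z‖ := norm_pos_iff.2 hz
  by_cases h1 : ‖w‖ ≤ 1
  · have : 0 ≤ 2 / ‖z‖ := by positivity
    linarith
  push Not at h1
  have e : z * w ^ 3 = w ^ 2 + z * w - 1 / 3 := by
    unfold IsPreimage at h
    linear_combination h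
  have h2 : ‖z‖ * ‖w‖ ^ 3 ≤ ‖w‖ ^ 2 + ‖z‖ * ‖w‖ + 1 / 3 := by
    rw [← norm_pow, ← norm_mul, e]
    refine (norm_sub_le _ _).trans ?_
    refine add_le_add ((norm_add_le _ _).trans ?_) (by norm_num)
    rw [norm_pow, norm_mul]
  have h3 : ‖z‖ * ‖w‖ ≤ ‖z‖ + 2 := by
    by_contra hcon
    push Not at hcon
    have : (‖z‖ + 2) * ‖w‖ ^ 2 < ‖z‖ * ‖w‖ * ‖w‖ ^ 2 := by gcongr
    nlinarith [mul_pos hn (sub_pos.2 h1), mul_pos (mul_pos hn (sub_pos.2 h1)) (sub_pos.2 h1)]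
  rw [← sub_le_iff_le_add', le_div_iff₀ hn]
  linarith

theorem lt_of_three_mul_lt {x y w ε : ℝ} (hε : 0 < ε) (h : x * y * w < ε ^ 3) :
    x < ε ∨ y < ε ∨ w < ε := by
  by_contra hcon
  push Not at hcon
  obtain ⟨h1, h2, h3⟩ := hcon
  have : ε ^ 3 ≤ x * y * w := by
    rw [show ε ^ 3 = ε * ε * ε by ring]
    exact mul_le_mul (mul_le_mul h1 h2 hε.le (hε.le.trans h1)) h3 hε.le
      (mul_nonneg (hε.le.trans h1) (hε.le.trans h2))
  linarith

/-- Inserting a root `w` for `z` into the cubic of `z₀` gives `z₀ (w-a)(w-b)(w-c) = (z₀-z)(w³-w)`,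
which is small since `w` is bounded; hence one factor is small. The argument does not need simple
roots. -/
theorem IsTriple.eventually_near {z₀ a b c : ℂ} (h : IsTriple z₀ a b c) {ε : ℝ} (hε : 0 < ε) :
    ∀ᶠ z in 𝓝 z₀, ∀ w, IsPreimage z w → ‖w - a‖ < ε ∨ ‖w - b‖ < ε ∨ ‖w - c‖ < ε := by
  have hz0 := h.ne_zero
  have hn : 0 < ‖z₀‖ := norm_pos_iff.2 hz0
  have hc : Tendsto (fun z : ℂ => ‖z - z₀‖ * ((1 + 2 / ‖z‖) ^ 3 + (1 + 2 / ‖z‖))) (𝓝 z₀)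
      (𝓝 (‖z₀ - z₀‖ * ((1 + 2 / ‖z₀‖) ^ 3 + (1 + 2 / ‖z₀‖)))) := by
    apply ContinuousAt.tendsto
    fun_prop (disch := simpa using hz0)
  rw [sub_self, norm_zero, zero_mul] at hc
  filter_upwards [hc.eventually (gt_mem_nhds (by positivity : 0 < ‖z₀‖ * ε ^ 3)),
    eventually_ne_nhds hz0] with z h1 h2 w hw
  have hb := hw.norm_le h2
  have e : z₀ * ((w - a) * (w - b) * (w - c)) = (z₀ - z) * (w ^ 3 - w) := by
    rw [← h.factor]
    unfold IsPreimage at hw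
    linear_combination hw
  apply lt_of_three_mul_lt hε
  have h3 : ‖z₀‖ * (‖w - a‖ * ‖w - b‖ * ‖w - c‖) ≤
      ‖z - z₀‖ * ((1 + 2 / ‖z‖) ^ 3 + (1 + 2 / ‖z‖)) := by
    rw [← norm_mul, ← norm_mul, ← norm_mul, e, norm_mul, norm_sub_rev z₀ z]
    gcongr
    refine (norm_sub_le _ _).trans ?_
    rw [norm_pow]
    gcongr
  exact lt_of_mul_lt_mul_left (h3.trans_lt h1) hn.le

/-- The same product with the roles exchanged: a fixed root of the cubic of `z₀` is inserted into
the cubic of `z`. -/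
theorem eventually_exists_near {z₀ w₀ : ℂ} (hz0 : z₀ ≠ 0) (h : IsPreimage z₀ w₀) {ε : ℝ}
    (hε : 0 < ε) : ∀ᶠ z in 𝓝 z₀, ∃ w, IsPreimage z w ∧ ‖w - w₀‖ < ε := by
  have hn : 0 < ‖z₀‖ := norm_pos_iff.2 hz0
  have hc : Tendsto (fun z : ℂ => ‖z - z₀‖ * ‖w₀ ^ 3 - w₀‖ - ‖z‖ * ε ^ 3) (𝓝 z₀)
      (𝓝 (‖z₀ - z₀‖ * ‖w₀ ^ 3 - w₀‖ - ‖z₀‖ * ε ^ 3)) := by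
    apply ContinuousAt.tendsto
    fun_prop
  have hneg : ‖z₀ - z₀‖ * ‖w₀ ^ 3 - w₀‖ - ‖z₀‖ * ε ^ 3 < 0 := by
    rw [sub_self, norm_zero, zero_mul, zero_sub, neg_neg_iff_pos]
    positivity
  filter_upwards [hc.eventually (gt_mem_nhds hneg), eventually_ne_nhds hz0] with z h1 h2
  obtain ⟨a, b, c, ht⟩ := exists_isTriple h2
  have e : z * ((w₀ - a) * (w₀ - b) * (w₀ - c)) = (z - z₀) * (w₀ ^ 3 - w₀) := by
    rw [← ht.factor]
    unfold IsPreimage at h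
    linear_combination h
  have e2 := congrArg norm e
  rw [norm_mul, norm_mul, norm_mul, norm_mul] at e2
  have h3 : ‖w₀ - a‖ * ‖w₀ - b‖ * ‖w₀ - c‖ < ε ^ 3 := by
    apply lt_of_mul_lt_mul_left _ (norm_nonneg z)
    rw [e2]
    linarith
  rcases lt_of_three_mul_lt hε h3 with h4 | h4 | h4
  · exact ⟨a, (ht.isPreimage_iff a).2 (by simp), by rwa [norm_sub_rev]⟩
  · exact ⟨b, (ht.isPreimage_iff b).2 (by simp), by rwa [norm_sub_rev]⟩
  · exact ⟨c, (ht.isPreimage_iff c).2 (by simp), by rwa [norm_sub_rev]⟩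

theorem abs_re_sub_lt {w a : ℂ} {ε : ℝ} (h : ‖w - a‖ < ε) : a.re - ε < w.re ∧ w.re < a.re + ε := by
  have := (Complex.abs_re_le_norm (w - a)).trans_lt h
  rw [abs_lt, Complex.sub_re] at this
  constructor <;> linarith [this.1, this.2]

theorem exists_isTriple_maxRoot {z : ℂ} (hz : z ≠ 0) : ∃ p q, IsTriple z (maxRoot z) p q := by
  obtain ⟨s, hs⟩ := IsAlgClosed.exists_pow_nat_eq (pairD z) two_pos
  exact ⟨_, _, isTriple_of_sq hz hs⟩

/-- There is a gap between the greatest real part and the other two. Nearby, a root close to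
`maxRoot z₀` therefore beats every root close to the other two. -/
theorem continuousAt_maxRoot {z₀ : ℂ} (hz : z₀.re ≤ 0) (hz0 : z₀ ≠ 0) :
    ContinuousAt maxRoot z₀ := by
  obtain ⟨p, q, h⟩ := exists_isTriple_maxRoot hz0
  obtain ⟨h1, h2⟩ := h.re_lt_maxRoot hz
  rw [Metric.continuousAt_iff']
  intro ε hε
  set δ := min ε (min (((maxRoot z₀).re - p.re) / 2) (((maxRoot z₀).re - q.re) / 2)) with hδ
  have hδ0 : 0 < δ := by
    apply lt_min hε (lt_min _ _) <;> linarith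
  have d1 : δ ≤ ε := min_le_left _ _
  have d2 : δ ≤ ((maxRoot z₀).re - p.re) / 2 := (min_le_right _ _).trans (min_le_left _ _)
  have d3 : δ ≤ ((maxRoot z₀).re - q.re) / 2 := (min_le_right _ _).trans (min_le_right _ _)
  filter_upwards [h.eventually_near hδ0,
    eventually_exists_near hz0 (maxRoot_isPreimage z₀) hδ0] with z h3 ⟨w, hw, hw2⟩
  have h4 := (abs_re_sub_lt hw2).1
  have h5 := re_le_maxRoot hw
  rw [dist_eq_norm]
  rcases h3 _ (maxRoot_isPreimage z) with h | h | h
  · exact h.trans_le d1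
  · have := (abs_re_sub_lt h).2
    linarith
  · have := (abs_re_sub_lt h).2
    linarith

theorem continuousAt_pairM {z₀ : ℂ} (hz : z₀.re ≤ 0) (hz0 : z₀ ≠ 0) :
    ContinuousAt pairM z₀ := by
  unfold pairM pairCoord
  have := continuousAt_maxRoot hz hz0
  have := (maxRoot_isPreimage z₀).ne_zero
  fun_prop (disch := positivity)

/-- For large `z` the product `(w-1) w (w+1) = (w²-1/3)/z` is small at every root, and some root is
close to `1`. With `δ ≤ 1/3` the discs about `1`, `0` and `-1` are separated by their real parts;
the constant `10` bounds `|w²-1/3|` for `|w| ≤ 3`. -/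
theorem tendsto_maxRoot_cobounded : Tendsto maxRoot (Bornology.cobounded ℂ) (𝓝 1) := by
  rw [Metric.tendsto_nhds]
  intro ε hε
  set δ := min ε (1 / 3) with hδ
  have hδ0 : 0 < δ := lt_min hε (by norm_num)
  have d1 : δ ≤ ε := min_le_left _ _
  have d2 : δ ≤ 1 / 3 := min_le_right _ _
  have hl : ∀ᶠ z : ℂ in Bornology.cobounded ℂ, 10 / δ ^ 3 + 1 < ‖z‖ :=
    tendsto_norm_cobounded_atTop.eventually (eventually_gt_atTop _)
  filter_upwards [hl] with z hz
  have hp : 0 < 10 / δ ^ 3 := by positivity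
  have hz1 : 1 < ‖z‖ := by linarith
  have hz0 : z ≠ 0 := by rintro rfl; simp at hz1; linarith
  have hzd : 10 < ‖z‖ * δ ^ 3 := by
    have : 10 / δ ^ 3 < ‖z‖ := by linarith
    rwa [div_lt_iff₀ (by positivity)] at this
  obtain ⟨a, b, c, ht⟩ := exists_isTriple hz0
  have near : ∃ w, IsPreimage z w ∧ ‖w - 1‖ < δ := by
    have e : z * ((1 - a) * (1 - b) * (1 - c)) = -2 / 3 := by
      rw [← ht.factor]
      ring
    have e2 := congrArg norm e
    rw [norm_mul, norm_mul, norm_mul] at e2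
    have h3 : ‖1 - a‖ * ‖1 - b‖ * ‖1 - c‖ < δ ^ 3 := by
      apply lt_of_mul_lt_mul_left _ (norm_nonneg z)
      rw [e2]
      norm_num
      linarith
    rcases lt_of_three_mul_lt hδ0 h3 with h4 | h4 | h4
    · exact ⟨a, (ht.isPreimage_iff a).2 (by simp), by rwa [norm_sub_rev]⟩
    · exact ⟨b, (ht.isPreimage_iff b).2 (by simp), by rwa [norm_sub_rev]⟩
    · exact ⟨c, (ht.isPreimage_iff c).2 (by simp), by rwa [norm_sub_rev]⟩
  obtain ⟨w, hw, hw1⟩ := near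
  have h4 := (abs_re_sub_lt hw1).1
  have h5 := re_le_maxRoot hw
  rw [Complex.one_re] at h4
  have hb : ‖maxRoot z‖ ≤ 3 := by
    refine ((maxRoot_isPreimage z).norm_le hz0).trans ?_
    have : 2 / ‖z‖ ≤ 2 := by rw [div_le_iff₀ (by linarith)]; linarith
    linarith
  have e : z * ((maxRoot z - 1) * (maxRoot z - 0) * (maxRoot z - (-1))) =
      maxRoot z ^ 2 - 1 / 3 := by
    have := maxRoot_isPreimage z
    unfold IsPreimage at this
    linear_combination this
  have e2 := congrArg norm e
  rw [norm_mul, norm_mul, norm_mul] at e2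
  have e3 : ‖maxRoot z ^ 2 - 1 / 3‖ ≤ 10 := by
    refine (norm_sub_le _ _).trans ?_
    rw [norm_pow]
    have : ‖maxRoot z‖ ^ 2 ≤ 3 ^ 2 := by gcongr
    norm_num
    linarith
  have h6 : ‖maxRoot z - 1‖ * ‖maxRoot z - 0‖ * ‖maxRoot z - (-1)‖ < δ ^ 3 := by
    apply lt_of_mul_lt_mul_left _ (norm_nonneg z)
    rw [e2]
    linarith
  rw [dist_eq_norm]
  rcases lt_of_three_mul_lt hδ0 h6 with h | h | h
  · exact h.trans_le d1
  · have := (abs_re_sub_lt h).2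
    simp at this
    linarith
  · have := (abs_re_sub_lt h).2
    simp at this
    linarith

/-! ### Derivatives of `zMap` and of its inverse branches -/

theorem hasStrictDerivAt_zMap {w : ℂ} (h0 : w ≠ 0) (h1 : w ^ 2 ≠ 1) :
    HasStrictDerivAt zMap (-(3 * w ^ 4 + 1) / (3 * w ^ 2 * (w ^ 2 - 1) ^ 2)) w := by
  have h2 : w ^ 2 - 1 ≠ 0 := sub_ne_zero.2 h1
  have hd : HasDerivAt zMap (-(3 * w ^ 4 + 1) / (3 * w ^ 2 * (w ^ 2 - 1) ^ 2)) w := by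
    have hi := hasDerivAt_id w
    have := (((hi.pow 2).sub_const (1 / 3)).div (hi.mul ((hi.pow 2).sub_const 1))
      (mul_ne_zero h0 h2))
    refine this.congr_deriv ?_
    simp
    field_simp
    ring
  have ha : AnalyticAt ℂ zMap w := by
    unfold zMap
    fun_prop (disch := exact mul_ne_zero h0 h2)
  rw [← hd.deriv]
  exact ha.hasStrictDerivAt

/-- The derivative of `zMap`. -/
def zMapDeriv (w : ℂ) : ℂ := -(3 * w ^ 4 + 1) / (3 * w ^ 2 * (w ^ 2 - 1) ^ 2)

/-- Both sides are, up to sign, the derivative of the cubic at its root `a`. Hence the derivative of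
`zMap` vanishes only at multiple roots. -/
theorem IsTriple.zMapDeriv_mul {z a b c : ℂ} (h : IsTriple z a b c) :
    zMapDeriv a * (a * (a ^ 2 - 1)) = -(z * ((a - b) * (a - c))) := by
  have ha : IsPreimage z a := (h.isPreimage_iff a).2 (by simp)
  have h0 := ha.ne_zero
  have h2 : a ^ 2 - 1 ≠ 0 := sub_ne_zero.2 ha.sq_ne_one
  have e : z * ((a - b) * (a - c)) = 3 * z * a ^ 2 - 2 * a - z := by
    obtain ⟨h1, h2, h3⟩ := h
    linear_combination -2 * a * h1 + z * h2
  rw [e, zMapDeriv]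
  have hz := ha.zMap_eq
  unfold zMap at hz
  rw [← hz]
  field_simp
  ring

theorem IsTriple.zMapDeriv_ne_zero {z a b c : ℂ} (h : IsTriple z a b c) (hb : a ≠ b)
    (hc : a ≠ c) : zMapDeriv a ≠ 0 := by
  intro h0
  have := h.zMapDeriv_mul
  rw [h0, zero_mul, zero_eq_neg] at this
  simp [h.ne_zero, sub_eq_zero, hb, hc] at this

theorem IsPreimage.hasStrictDerivAt {z w : ℂ} (h : IsPreimage z w) :
    HasStrictDerivAt zMap (zMapDeriv w) w := hasStrictDerivAt_zMap h.ne_zero h.sq_ne_one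

/-- A preimage that depends continuously on a parameter is differentiable if the point is. -/
theorem hasDerivAt_of_isPreimage {q γ : ℝ → ℂ} {γ' : ℂ} {t : ℝ} (hγ : HasDerivAt γ γ' t)
    (hq : ContinuousAt q t) (hr : ∀ᶠ u in 𝓝 t, IsPreimage (γ u) (q u))
    (hd : zMapDeriv (q t) ≠ 0) : HasDerivAt q ((zMapDeriv (q t))⁻¹ * γ') t := by
  have hs := hr.self_of_nhds.hasStrictDerivAt
  have h1 := hs.to_localInverse hd
  have h2 : zMap (q t) = γ t := hr.self_of_nhds.zMap_eq
  rw [h2] at h1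
  have h3 := HasDerivAt.comp_of_eq t h1.hasDerivAt hγ rfl
  have h4 := hq.eventually (hs.eventually_left_inverse hd)
  refine h3.congr_of_eventuallyEq ?_
  filter_upwards [h4, hr] with u hu hru
  rw [Function.comp_apply, ← hru.zMap_eq, hu]

theorem hasDerivAt_of_isPreimage_complex {ψ : ℂ → ℂ} {z : ℂ} (hq : ContinuousAt ψ z)
    (hr : ∀ᶠ u in 𝓝 z, IsPreimage u (ψ u)) (hd : zMapDeriv (ψ z) ≠ 0) :
    HasDerivAt ψ (zMapDeriv (ψ z))⁻¹ z :=
  HasDerivAt.of_local_left_inverse hq hr.self_of_nhds.hasStrictDerivAt.hasDerivAt hd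
    (hr.mono fun _ h => h.zMap_eq)

/-! ### Two square roots of the discriminant -/

theorem sqrt_sq (a : ℂ) : Complex.sqrt a ^ 2 = a := by
  rw [Complex.sqrt, ← Complex.cpow_nat_mul]
  norm_num

theorem sqrt_re_nonneg (a : ℂ) : 0 ≤ (Complex.sqrt a).re := by
  rw [Complex.sqrt, Complex.cpow_inv_two_re]
  positivity

theorem sqrt_re_pos {a : ℂ} (ha : a ∈ Complex.slitPlane) : 0 < (Complex.sqrt a).re := by
  refine lt_of_le_of_ne (sqrt_re_nonneg a) fun h => ?_
  have h1 := congrArg Complex.re (sqrt_sq a)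
  have h2 := congrArg Complex.im (sqrt_sq a)
  rw [pow_two, Complex.mul_re, ← h] at h1
  rw [pow_two, Complex.mul_im, ← h] at h2
  rcases Complex.mem_slitPlane_iff.1 ha with h3 | h3
  · nlinarith [mul_self_nonneg (Complex.sqrt a).im]
  · apply h3
    linarith

theorem continuousAt_sqrt_of_slit {a : ℂ} (ha : a ∈ Complex.slitPlane) :
    ContinuousAt Complex.sqrt a :=
  Complex.continuousAt_sqrt ((Complex.mem_slitPlane_iff.1 ha).imp le_of_lt id)

/-- The square root of `pairD` of nonnegative real part. -/
def mainSqrt (z : ℂ) : ℂ := Complex.sqrt (pairD z)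

/-- The square root of `pairD` that is regular at the zeros of `1 / pairM`. -/
def boxSqrt (z : ℂ) : ℂ := -pairM z * Complex.sqrt ((1 + 3 / pairM z ^ 2) / 3)

theorem mainSqrt_sq (z : ℂ) : mainSqrt z ^ 2 = pairD z := sqrt_sq _

theorem boxSqrt_sq {z : ℂ} (hz : z ≠ 0) : boxSqrt z ^ 2 = pairD z := by
  have := pairM_ne_zero hz
  rw [boxSqrt, mul_pow, sqrt_sq, pairD]
  field_simp

/-- The number `(m²+3)/3` is real and nonpositive only if `m` is imaginary with `|m| ≥ √3`; this is
the cut of `mainSqrt`. -/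
theorem pairD_mem_slitPlane {z : ℂ} (h : (pairM z).re ≠ 0 ∨ (pairM z).im ^ 2 < 3) :
    pairD z ∈ Complex.slitPlane := by
  rw [Complex.mem_slitPlane_iff]
  by_contra hcon
  push Not at hcon
  have e : pairD z = ((((pairM z).re ^ 2 - (pairM z).im ^ 2 + 3) / 3 : ℝ) : ℂ) +
      ((2 * (pairM z).re * (pairM z).im / 3 : ℝ) : ℂ) * Complex.I := by
    rw [pairD]
    conv_lhs => rw [← Complex.re_add_im (pairM z)]
    push_cast
    linear_combination ((pairM z).im : ℂ) ^ 2 / 3 * Complex.I_sq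
  rw [e] at hcon
  simp only [Complex.add_re, Complex.ofReal_re, Complex.mul_re, Complex.I_re, mul_zero,
    Complex.ofReal_im, Complex.I_im, mul_one, sub_self, add_zero, Complex.add_im, Complex.mul_im,
    zero_add] at hcon
  obtain ⟨h1, h2⟩ := hcon
  have h3 : (pairM z).re * (pairM z).im = 0 := by linarith
  rcases mul_eq_zero.1 h3 with h4 | h4
  · rw [h4] at h1
    rcases h with h | h
    · exact h h4
    · linarith
  · rw [h4] at h1
    nlinarith [sq_nonneg (pairM z).re]

theorem inv_sq_re_im {m : ℂ} :
    (m ^ 2)⁻¹.re = (m.re ^ 2 - m.im ^ 2) / Complex.normSq m ^ 2 ∧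
      (m ^ 2)⁻¹.im = -(2 * m.re * m.im) / Complex.normSq m ^ 2 := by
  constructor
  · rw [Complex.inv_re, map_pow]
    simp [pow_two]
  · rw [Complex.inv_im, map_pow]
    simp [pow_two]
    ring

theorem boxArg_re_im {m : ℂ} :
    ((1 + 3 / m ^ 2) / 3).re = 1 / 3 + (m.re ^ 2 - m.im ^ 2) / Complex.normSq m ^ 2 ∧
      ((1 + 3 / m ^ 2) / 3).im = -(2 * m.re * m.im) / Complex.normSq m ^ 2 := by
  have e : (1 + 3 / m ^ 2) / 3 = ((1 / 3 : ℝ) : ℂ) + (m ^ 2)⁻¹ := by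
    push_cast
    ring
  rw [e, Complex.add_re, Complex.add_im, Complex.ofReal_re, Complex.ofReal_im, inv_sq_re_im.1,
    inv_sq_re_im.2, zero_add]
  exact ⟨rfl, rfl⟩

/-- The number `1 + 3/m²` is real and nonpositive only if `m` is imaginary with `|m| ≤ √3`. So
`boxSqrt` is continuous across the part of the curve `Re m = 0` on which `mainSqrt` jumps. -/
theorem boxArg_mem_slitPlane {m : ℂ} (hm : m ≠ 0) (h : m.re ≠ 0 ∨ 3 < m.im ^ 2) :
    (1 + 3 / m ^ 2) / 3 ∈ Complex.slitPlane := by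
  rw [Complex.mem_slitPlane_iff, boxArg_re_im.1, boxArg_re_im.2]
  have hn := Complex.normSq_pos.2 hm
  by_contra hcon
  push Not at hcon
  obtain ⟨h1, h2⟩ := hcon
  rw [div_eq_zero_iff] at h2
  have h3 : m.re * m.im = 0 := by
    rcases h2 with h2 | h2
    · linarith
    · exact absurd h2 (by positivity)
  have e : Complex.normSq m = m.re ^ 2 + m.im ^ 2 := by rw [Complex.normSq_apply]; ring
  rcases mul_eq_zero.1 h3 with h4 | h4
  · rcases h with h | h
    · exact h h4
    · rw [e, h4] at h1
      have : 0 < m.im ^ 2 := by linarith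
      have hm2 : m.im ≠ 0 := by rintro h0; simp [h0] at this
      have e2 : (0 ^ 2 - m.im ^ 2) / (0 ^ 2 + m.im ^ 2) ^ 2 = -(1 / m.im ^ 2) := by
        field_simp
        ring
      rw [e2] at h1
      have : 1 / m.im ^ 2 < 1 / 3 := one_div_lt_one_div_of_lt (by norm_num) h
      linarith
  · rw [h4] at h1
    have : 0 ≤ (m.re ^ 2 - 0 ^ 2) / Complex.normSq m ^ 2 := by
      rw [zero_pow two_ne_zero, sub_zero]
      positivity
    linarith

/-- The sign of the real part is what matters: `boxSqrt` and `mainSqrt` agree on one side of the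
curve `Re m = 0` and are opposite on the other. -/
theorem boxSqrt_re {z : ℂ} (hz : z ≠ 0) (h : (pairM z).re ≠ 0 ∨ 3 < (pairM z).im ^ 2) :
    ∃ κ > 0, (boxSqrt z).re = -(pairM z).re * κ := by
  have hm := pairM_ne_zero hz
  have hsl := boxArg_mem_slitPlane hm h
  rw [boxSqrt]
  set m := pairM z
  set u := Complex.sqrt ((1 + 3 / m ^ 2) / 3)
  have hu : 0 < u.re := sqrt_re_pos hsl
  have hn := Complex.normSq_pos.2 hm
  have h2 := congrArg Complex.im (sqrt_sq ((1 + 3 / m ^ 2) / 3))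
  rw [boxArg_re_im.2, pow_two, Complex.mul_im] at h2
  have h3 : u.im = -(m.re * m.im) / (Complex.normSq m ^ 2 * u.re) := by
    have : u.re * u.im + u.im * u.re = -(2 * m.re * m.im) / Complex.normSq m ^ 2 := h2
    field_simp at this ⊢
    linarith
  refine ⟨u.re + m.im ^ 2 / (Complex.normSq m ^ 2 * u.re), by positivity, ?_⟩
  rw [Complex.mul_re, h3, Complex.neg_re, Complex.neg_im]
  field_simp
  ring

theorem boxSqrt_eq_neg {z : ℂ} (hz : z ≠ 0) (h : 0 < (pairM z).re) :
    boxSqrt z = -mainSqrt z := by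
  obtain ⟨κ, hκ, he⟩ := boxSqrt_re hz (Or.inl h.ne')
  have h1 : boxSqrt z ^ 2 = mainSqrt z ^ 2 := by rw [boxSqrt_sq hz, mainSqrt_sq]
  rcases sq_eq_sq_iff_eq_or_eq_neg.1 h1 with h2 | h2
  · rw [h2] at he
    have h3 : 0 ≤ (mainSqrt z).re := sqrt_re_nonneg _
    nlinarith [mul_pos h hκ]
  · exact h2

theorem boxSqrt_eq {z : ℂ} (hz : z ≠ 0) (h : (pairM z).re < 0) :
    boxSqrt z = mainSqrt z := by
  obtain ⟨κ, hκ, he⟩ := boxSqrt_re hz (Or.inl h.ne)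
  have h1 : boxSqrt z ^ 2 = mainSqrt z ^ 2 := by rw [boxSqrt_sq hz, mainSqrt_sq]
  rcases sq_eq_sq_iff_eq_or_eq_neg.1 h1 with h2 | h2
  · exact h2
  · rw [h2, Complex.neg_re] at he
    have h3 : 0 ≤ (mainSqrt z).re := sqrt_re_nonneg _
    nlinarith [mul_neg_of_neg_of_pos h hκ]

theorem continuousAt_pairD {z : ℂ} (hz : z.re ≤ 0) (hz0 : z ≠ 0) : ContinuousAt pairD z := by
  unfold pairD
  have := continuousAt_pairM hz hz0
  fun_prop

theorem continuousAt_mainSqrt {z : ℂ} (hz : z.re ≤ 0) (hz0 : z ≠ 0)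
    (h : (pairM z).re ≠ 0 ∨ (pairM z).im ^ 2 < 3) : ContinuousAt mainSqrt z :=
  ContinuousAt.comp (continuousAt_sqrt_of_slit (pairD_mem_slitPlane h))
    (continuousAt_pairD hz hz0)

theorem continuousAt_boxSqrt {z : ℂ} (hz : z.re ≤ 0) (hz0 : z ≠ 0)
    (h : (pairM z).re ≠ 0 ∨ 3 < (pairM z).im ^ 2) : ContinuousAt boxSqrt z := by
  have h1 := continuousAt_pairM hz hz0
  have h0 := pairM_ne_zero hz0
  have h2 := boxArg_mem_slitPlane h0 h
  refine h1.neg.mul ?_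
  refine ContinuousAt.comp (f := fun z => (1 + 3 / pairM z ^ 2) / 3)
    (continuousAt_sqrt_of_slit h2) ?_
  fun_prop (disch := positivity)

/-- The preimage in the unordered pair that belongs to the square root `s` of `pairD z`. -/
def pairRoot (z s : ℂ) : ℂ := (-(1 + pairM z) * maxRoot z + s) / 2

theorem isTriple_pairRoot {z s : ℂ} (hz : z ≠ 0) (hs : s ^ 2 = pairD z) :
    IsTriple z (maxRoot z) (pairRoot z s) (pairRoot z (-s)) := by
  have := isTriple_of_sq hz hs
  unfold pairRoot
  convert this using 2
  ring

theorem pairRoot_sub (z s : ℂ) : pairRoot z s - pairRoot z (-s) = s := by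
  unfold pairRoot
  ring

theorem isPreimage_pairRoot {z s : ℂ} (hz : z ≠ 0) (hs : s ^ 2 = pairD z) :
    IsPreimage z (pairRoot z s) :=
  ((isTriple_pairRoot hz hs).isPreimage_iff _).2 (by simp)

theorem pairRoot_re_lt {z s : ℂ} (hz : z.re ≤ 0) (hz0 : z ≠ 0) (hs : s ^ 2 = pairD z) :
    (pairRoot z s).re < (maxRoot z).re :=
  ((isTriple_pairRoot hz0 hs).re_lt_maxRoot hz).1

theorem zMapDeriv_pairRoot_ne {z s : ℂ} (hz : z.re ≤ 0) (hz0 : z ≠ 0) (hs : s ^ 2 = pairD z)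
    (h0 : s ≠ 0) : zMapDeriv (pairRoot z s) ≠ 0 := by
  have h := isTriple_pairRoot hz0 hs
  refine h.rotate.zMapDeriv_ne_zero ?_ ?_
  · intro he
    apply h0
    rw [← pairRoot_sub z s, he, sub_self]
  · intro he
    have := pairRoot_re_lt hz hz0 hs
    rw [he] at this
    exact lt_irrefl _ this

theorem zMapDeriv_maxRoot_ne {z : ℂ} (hz : z.re ≤ 0) (hz0 : z ≠ 0) :
    zMapDeriv (maxRoot z) ≠ 0 := by
  have h := isTriple_pairRoot hz0 (mainSqrt_sq z)
  obtain ⟨h1, h2⟩ := h.re_lt_maxRoot hz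
  exact h.zMapDeriv_ne_zero (fun he => h1.ne (congrArg Complex.re he.symm))
    (fun he => h2.ne (congrArg Complex.re he.symm))

/-! ### The primitive of `3 w dz` -/

/-- The real part of the primitive `3 ∫ w dz` on the Riemann surface of the inverse of `zMap`. -/
def hFun (w : ℂ) : ℝ := (2 / (w ^ 2 - 1)).re - Real.log ‖w * (w ^ 2 - 1)‖

/-- The primitive `3 ∫ w dz`, with branches of the logarithms given by `k₀, k₁, k₂`. -/
def prim (k₀ k₁ k₂ w : ℂ) : ℂ :=
  2 / (w ^ 2 - 1) - Complex.log (k₀ * w) - Complex.log (k₁ * (w - 1)) -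
    Complex.log (k₂ * (w + 1))

/-- The factors `k` rotate the cuts of the logarithms and change the real part by a constant only.
Hence `hFun` needs no choice of branches. -/
theorem prim_re {k₀ k₁ k₂ z w : ℂ} (h0 : k₀ ≠ 0) (h1 : k₁ ≠ 0) (h2 : k₂ ≠ 0)
    (h : IsPreimage z w) : (prim k₀ k₁ k₂ w).re = hFun w -
      (Real.log ‖k₀‖ + Real.log ‖k₁‖ + Real.log ‖k₂‖) := by
  have n0 := norm_ne_zero_iff.2 h.ne_zero
  have n1 := norm_ne_zero_iff.2 h.sub_one_ne
  have n2 := norm_ne_zero_iff.2 h.add_one_ne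
  have e : w ^ 2 - 1 = (w - 1) * (w + 1) := by ring
  simp only [prim, hFun, Complex.sub_re, Complex.log_re, norm_mul]
  rw [Real.log_mul (norm_ne_zero_iff.2 h0) n0, Real.log_mul (norm_ne_zero_iff.2 h1) n1,
    Real.log_mul (norm_ne_zero_iff.2 h2) n2, e, norm_mul, Real.log_mul n0 (mul_ne_zero n1 n2),
    Real.log_mul n1 n2]
  ring

/-- Since `3 z'(w) = -(w⁻² + (w-1)⁻² + (w+1)⁻²)`, the partial fractions of `3 w z'(w)` integrate to
`1/(w-1) - 1/(w+1)` minus the three logarithms. -/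
theorem hasDerivAt_prim {k₀ k₁ k₂ z w : ℂ} (h : IsPreimage z w) (h0 : k₀ * w ∈ Complex.slitPlane)
    (h1 : k₁ * (w - 1) ∈ Complex.slitPlane) (h2 : k₂ * (w + 1) ∈ Complex.slitPlane) :
    HasDerivAt (prim k₀ k₁ k₂) (3 * w * zMapDeriv w) w := by
  have n0 := h.ne_zero
  have n1 := h.sub_one_ne
  have n2 := h.add_one_ne
  have n3 := sub_ne_zero.2 h.sq_ne_one
  have k0 : k₀ ≠ 0 := by rintro rfl; simp at h0
  have k1 : k₁ ≠ 0 := by rintro rfl; simp at h1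
  have k2 : k₂ ≠ 0 := by rintro rfl; simp at h2
  have hi := hasDerivAt_id w
  have d := (((hasDerivAt_const w (2 : ℂ)).div ((hi.pow 2).sub_const 1) n3).sub
    ((hi.const_mul k₀).clog h0)).sub ((((hi.sub_const 1).const_mul k₁)).clog h1) |>.sub
    ((((hi.add_const 1).const_mul k₂)).clog h2)
  refine d.congr_deriv ?_
  have e : w ^ 2 - 1 = (w - 1) * (w + 1) := by ring
  simp only [id, Pi.pow_apply, zMapDeriv, e]
  field_simp
  push_cast
  ring

theorem hasDerivAt_hFun_comp {q γ : ℝ → ℂ} {γ' : ℂ} {t : ℝ} (hγ : HasDerivAt γ γ' t)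
    (hq : ContinuousAt q t) (hr : ∀ᶠ u in 𝓝 t, IsPreimage (γ u) (q u))
    (hd : zMapDeriv (q t) ≠ 0) :
    HasDerivAt (fun u => hFun (q u)) (3 * (q t * γ')).re t := by
  have h := hr.self_of_nhds
  have h1 := hasDerivAt_of_isPreimage hγ hq hr hd
  have one : (1 : ℂ) ∈ Complex.slitPlane := Complex.one_mem_slitPlane
  have n0 := inv_ne_zero h.ne_zero
  have n1 := inv_ne_zero h.sub_one_ne
  have n2 := inv_ne_zero h.add_one_ne
  -- With these factors the arguments of all three logarithms equal `1` at the parameter `t`, away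
  -- from the cuts.
  have h2 := hasDerivAt_prim (k₀ := (q t)⁻¹) (k₁ := (q t - 1)⁻¹) (k₂ := (q t + 1)⁻¹) h
    (by rwa [inv_mul_cancel₀ h.ne_zero]) (by rwa [inv_mul_cancel₀ h.sub_one_ne])
    (by rwa [inv_mul_cancel₀ h.add_one_ne])
  have h3 := h2.comp t h1
  have e : 3 * q t * zMapDeriv (q t) * ((zMapDeriv (q t))⁻¹ * γ') = 3 * (q t * γ') := by
    field_simp
  rw [e] at h3
  have h4 : HasDerivAt (fun u => (prim (q t)⁻¹ (q t - 1)⁻¹ (q t + 1)⁻¹ (q u)).re)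
      (3 * (q t * γ')).re t := by
    exact Complex.reCLM.hasFDerivAt.comp_hasDerivAt t h3
  have h5 := h4.add_const (Real.log ‖(q t)⁻¹‖ + Real.log ‖(q t - 1)⁻¹‖ +
    Real.log ‖(q t + 1)⁻¹‖)
  refine h5.congr_of_eventuallyEq ?_
  filter_upwards [hr] with u hu
  rw [prim_re n0 n1 n2 hu]
  ring

/-! ### Behaviour at the origin and at infinity -/

theorem maxRoot_zero_sq : maxRoot 0 ^ 2 = 1 / 3 := by
  have := maxRoot_isPreimage 0
  unfold IsPreimage at this
  linear_combination -this

/-- A strictly differentiable map with nonzero derivative is open at the point. In contrast to the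
product estimates, this works also at `z₀ = 0`, where the cubic loses a root. -/
theorem IsPreimage.eventually_exists {z₀ w₀ : ℂ} (h : IsPreimage z₀ w₀) (hd : zMapDeriv w₀ ≠ 0)
    {ε : ℝ} (hε : 0 < ε) : ∀ᶠ z in 𝓝 z₀, ∃ w, IsPreimage z w ∧ ‖w - w₀‖ < ε := by
  have h1 := h.hasStrictDerivAt.map_nhds_eq hd
  rw [h.zMap_eq] at h1
  have h2 : ∀ᶠ w in 𝓝 w₀, w ≠ 0 ∧ w ^ 2 ≠ 1 ∧ ‖w - w₀‖ < ε := by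
    have c1 : ContinuousAt (fun w : ℂ => w ^ 2) w₀ := by fun_prop
    have c2 : ContinuousAt (fun w : ℂ => ‖w - w₀‖) w₀ := by fun_prop
    filter_upwards [eventually_ne_nhds h.ne_zero, c1.eventually_ne h.sq_ne_one,
      c2.eventually (gt_mem_nhds (by simpa using hε))] with w a b c using ⟨a, b, c⟩
  rw [← h1]
  filter_upwards [image_mem_map h2] with z ⟨w, ⟨a, b, c⟩, hz⟩
  exact ⟨w, (inverse_iff_cubic z w).1 ⟨a, b, hz⟩, c⟩

theorem IsPreimage.exists_isTriple {z r r' : ℂ} (hz : z ≠ 0) (h : IsPreimage z r)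
    (h' : IsPreimage z r') (hne : r ≠ r') : ∃ t, IsTriple z r r' t := by
  obtain ⟨a, b, c, ht⟩ := HermitePade.exists_isTriple hz
  rcases (ht.isPreimage_iff r).1 h with rfl | rfl | rfl <;>
    rcases (ht.isPreimage_iff r').1 h' with rfl | rfl | rfl
  · exact absurd rfl hne
  · exact ⟨_, ht⟩
  · exact ⟨_, ht.swap23⟩
  · exact ⟨_, ht.swap12⟩
  · exact absurd rfl hne
  · exact ⟨_, ht.rotate⟩
  · exact ⟨_, ht.rotate.rotate⟩
  · exact ⟨_, ht.rotate.swap12⟩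
  · exact absurd rfl hne

theorem zMapDeriv_ne_of_sq {w : ℂ} (h : w ^ 2 = 1 / 3) : zMapDeriv w ≠ 0 := by
  have e : zMapDeriv w = -3 := by
    rw [zMapDeriv, show w ^ 4 = (w ^ 2) ^ 2 by ring, h]
    norm_num
  rw [e]
  norm_num

theorem inv_re_nonpos {z : ℂ} (hz : z.re ≤ 0) : (1 / z).re ≤ 0 := by
  rw [one_div, Complex.inv_re]
  exact div_nonpos_of_nonpos_of_nonneg hz (Complex.normSq_nonneg _)

/-- The closed left half plane without the origin. -/
def leftSet : Set ℂ := {z | z.re ≤ 0 ∧ z ≠ 0}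

/-- Two of the roots are close to `±1/√3`, and the third is `1/z` minus their sum. In the closed
left half plane `Re (1/z) ≤ 0`, so the third root cannot have the greatest real part. -/
theorem tendsto_maxRoot_zero : Tendsto maxRoot (𝓝[leftSet] 0) (𝓝 (maxRoot 0)) := by
  have hk := maxRoot_re_pos (z := 0) (by simp)
  have hp := maxRoot_isPreimage 0
  have hd := zMapDeriv_ne_of_sq maxRoot_zero_sq
  have hp' : IsPreimage 0 (-maxRoot 0) := by simpa using hp.neg
  have hd' : zMapDeriv (-maxRoot 0) ≠ 0 := zMapDeriv_ne_of_sq (by rw [neg_sq, maxRoot_zero_sq])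
  rw [Metric.tendsto_nhds]
  intro ε hε
  set δ := min ε ((maxRoot 0).re / 4) with hδ
  have hδ0 : 0 < δ := lt_min hε (by linarith)
  have d1 : δ ≤ ε := min_le_left _ _
  have d2 : δ ≤ (maxRoot 0).re / 4 := min_le_right _ _
  filter_upwards [mem_nhdsWithin_of_mem_nhds (hp.eventually_exists hd hδ0),
    mem_nhdsWithin_of_mem_nhds (hp'.eventually_exists hd' hδ0),
    self_mem_nhdsWithin] with z ⟨r, hr, hr1⟩ ⟨r', hr', hr1'⟩ ⟨hz, hz0⟩
  have a1 := abs_re_sub_lt hr1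
  have a2 := abs_re_sub_lt hr1'
  rw [Complex.neg_re] at a2
  obtain ⟨t, ht⟩ := hr.exists_isTriple hz0 hr' (by rintro rfl; linarith)
  have e : t = 1 / z - r - r' := by
    have := ht.1
    field_simp
    linear_combination this
  have a3 : t.re = (1 / z).re - r.re - r'.re := by rw [e]; simp
  have a4 := inv_re_nonpos hz
  have a5 := re_le_maxRoot hr
  rw [dist_eq_norm]
  rcases (ht.isPreimage_iff _).1 (maxRoot_isPreimage z) with h | h | h
  · rw [h]
    exact hr1.trans_le d1
  · rw [h] at a5
    linarith
  · rw [h] at a5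
    linarith

theorem tendsto_inv_pairM_zero :
    Tendsto (fun z => 3 / pairM z ^ 2) (𝓝[leftSet] 0) (𝓝 0) := by
  have h1 : Tendsto (fun z : ℂ => 3 * (z * maxRoot z) ^ 2) (𝓝[leftSet] 0)
      (𝓝 (3 * (0 * maxRoot 0) ^ 2)) :=
    (((tendsto_nhdsWithin_of_tendsto_nhds tendsto_id).mul tendsto_maxRoot_zero).pow 2).const_mul 3
  rw [zero_mul, zero_pow two_ne_zero, mul_zero] at h1
  refine h1.congr' ?_
  filter_upwards [self_mem_nhdsWithin] with z ⟨_, hz0⟩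
  have := pairM_mul hz0
  have := pairM_ne_zero hz0
  field_simp
  linear_combination (pairM z * z * maxRoot z - 1) * pairM_mul hz0

theorem sqrt_third : Complex.sqrt (1 / 3) = maxRoot 0 := by
  have h : Complex.sqrt (1 / 3) ^ 2 = maxRoot 0 ^ 2 := by rw [sqrt_sq, maxRoot_zero_sq]
  rcases sq_eq_sq_iff_eq_or_eq_neg.1 h with h | h
  · exact h
  · have h1 := sqrt_re_nonneg (1 / 3)
    have h2 := maxRoot_re_pos (z := 0) (by simp)
    rw [h, Complex.neg_re] at h1
    linarith

/-- The root selected by `boxSqrt` is the one that escapes to infinity like `1/z`; it carries the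
pole of `ψ_Q` at the origin. -/
theorem tendsto_mul_upper_zero :
    Tendsto (fun z => z * pairRoot z (boxSqrt z)) (𝓝[leftSet] 0) (𝓝 1) := by
  have hk : maxRoot 0 ≠ 0 := (maxRoot_isPreimage 0).ne_zero
  have hid : Tendsto (fun z : ℂ => z) (𝓝[leftSet] 0) (𝓝 0) :=
    tendsto_nhdsWithin_of_tendsto_nhds tendsto_id
  have hsl : (1 / 3 : ℂ) ∈ Complex.slitPlane := by
    rw [show (1 / 3 : ℂ) = ((1 / 3 : ℝ) : ℂ) by norm_num, Complex.ofReal_mem_slitPlane]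
    norm_num
  have h1 : Tendsto (fun z => Complex.sqrt ((1 + 3 / pairM z ^ 2) / 3)) (𝓝[leftSet] 0)
      (𝓝 (maxRoot 0)) := by
    rw [← sqrt_third]
    have h3 : Tendsto (fun z => (1 + 3 / pairM z ^ 2) / 3) (𝓝[leftSet] 0) (𝓝 (1 / 3)) := by
      have := (tendsto_inv_pairM_zero.const_add 1).div_const 3
      rwa [add_zero] at this
    exact (continuousAt_sqrt_of_slit hsl).tendsto.comp h3
  have h2 : Tendsto (fun z => (-(z * maxRoot z) + 1 + (maxRoot z)⁻¹ *
      Complex.sqrt ((1 + 3 / pairM z ^ 2) / 3)) / 2) (𝓝[leftSet] 0)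
      (𝓝 ((-(0 * maxRoot 0) + 1 + (maxRoot 0)⁻¹ * maxRoot 0) / 2)) :=
    ((((hid.mul tendsto_maxRoot_zero).neg.add_const 1).add
      ((tendsto_maxRoot_zero.inv₀ hk).mul h1))).div_const 2
  rw [inv_mul_cancel₀ hk] at h2
  norm_num at h2
  refine h2.congr' ?_
  filter_upwards [self_mem_nhdsWithin] with z ⟨_, hz0⟩
  have hc := (maxRoot_isPreimage z).ne_zero
  have hm := pairM_mul hz0
  have e : (maxRoot z)⁻¹ = -(z * pairM z) := by
    field_simp
    linear_combination hm
  rw [e, pairRoot, boxSqrt]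
  linear_combination 1 / 2 * hm

/-- The product of the three roots is `-1/(3z)`, so the limits of the other two determine the third.
-/
theorem tendsto_lower_zero :
    Tendsto (fun z => pairRoot z (-boxSqrt z)) (𝓝[leftSet] 0) (𝓝 (-maxRoot 0)) := by
  have hk : maxRoot 0 ≠ 0 := (maxRoot_isPreimage 0).ne_zero
  have h1 : Tendsto (fun z => -1 / (3 * maxRoot z * (z * pairRoot z (boxSqrt z))))
      (𝓝[leftSet] 0) (𝓝 (-1 / (3 * maxRoot 0 * 1))) :=
    tendsto_const_nhds.div ((tendsto_maxRoot_zero.const_mul 3).mul tendsto_mul_upper_zero)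
      (by simpa using hk)
  have e : -1 / (3 * maxRoot 0 * 1) = -maxRoot 0 := by
    field_simp
    linear_combination 3 * maxRoot_zero_sq
  rw [e] at h1
  refine h1.congr' ?_
  filter_upwards [self_mem_nhdsWithin] with z ⟨_, hz0⟩
  have ht := isTriple_pairRoot hz0 (boxSqrt_sq hz0)
  have n1 := (maxRoot_isPreimage z).ne_zero
  have n2 := (isPreimage_pairRoot hz0 (boxSqrt_sq hz0)).ne_zero
  field_simp
  linear_combination -ht.2.2

theorem tendsto_hFun_cobounded : Tendsto hFun (Bornology.cobounded ℂ) atBot := by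
  have h1 : ∀ᶠ w : ℂ in Bornology.cobounded ℂ, 2 ≤ ‖w‖ :=
    tendsto_norm_cobounded_atTop.eventually (eventually_ge_atTop 2)
  have h2 : Tendsto (fun w : ℂ => 2 - Real.log ‖w‖) (Bornology.cobounded ℂ) atBot :=
    tendsto_atBot_add_const_left _ _
      (tendsto_neg_atTop_atBot.comp (Real.tendsto_log_atTop.comp tendsto_norm_cobounded_atTop))
  refine tendsto_atBot_mono' _ ?_ h2
  filter_upwards [h1] with w hw
  have e1 : 1 ≤ ‖w ^ 2 - 1‖ := by
    have := norm_sub_norm_le (w ^ 2) 1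
    rw [norm_pow, norm_one] at this
    nlinarith
  have e2 : ‖2 / (w ^ 2 - 1)‖ ≤ 2 := by
    rw [norm_div, Complex.norm_ofNat, div_le_iff₀ (by linarith)]
    linarith
  have e3 := (Complex.re_le_norm (2 / (w ^ 2 - 1))).trans e2
  have e4 : Real.log ‖w‖ ≤ Real.log ‖w * (w ^ 2 - 1)‖ := by
    apply Real.log_le_log (by linarith)
    rw [norm_mul]
    nlinarith
  rw [hFun]
  linarith

theorem tendsto_hFun_upper_zero :
    Tendsto (fun z => hFun (pairRoot z (boxSqrt z))) (𝓝[leftSet] 0) atBot := by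
  refine tendsto_hFun_cobounded.comp ?_
  rw [← tendsto_norm_atTop_iff_cobounded]
  have h1 : Tendsto (fun z : ℂ => ‖z‖⁻¹) (𝓝[leftSet] 0) atTop := by
    have h0 : Tendsto (fun z : ℂ => ‖z‖) (𝓝[leftSet] 0) (𝓝[>] 0) := by
      refine (tendsto_norm_nhdsNE_zero).mono_left (nhdsWithin_mono _ ?_)
      exact fun z hz => hz.2
    exact tendsto_inv_nhdsGT_zero.comp h0
  have h2 := h1.atTop_mul_pos one_pos (by simpa using tendsto_mul_upper_zero.norm)
  refine h2.congr' ?_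
  filter_upwards [self_mem_nhdsWithin] with z ⟨_, hz0⟩
  have : ‖z‖ ≠ 0 := norm_ne_zero_iff.2 hz0
  field_simp

theorem tendsto_pairM_cobounded : Tendsto pairM (Bornology.cobounded ℂ) (𝓝 0) := by
  have h1 : Tendsto (fun z : ℂ => -z⁻¹ * (maxRoot z)⁻¹) (Bornology.cobounded ℂ)
      (𝓝 (-0 * (1 : ℂ)⁻¹)) :=
    (tendsto_inv₀_cobounded.neg).mul (tendsto_maxRoot_cobounded.inv₀ one_ne_zero)
  rw [neg_zero, zero_mul] at h1
  refine h1.congr fun z => ?_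
  rw [pairM, pairCoord, div_eq_mul_inv, mul_inv]
  ring

theorem tendsto_mainSqrt_cobounded : Tendsto mainSqrt (Bornology.cobounded ℂ) (𝓝 1) := by
  have h1 : Tendsto pairD (Bornology.cobounded ℂ) (𝓝 1) := by
    have := ((tendsto_pairM_cobounded.pow 2).add_const 3).div_const 3
    norm_num at this
    exact this
  have h2 := (continuousAt_sqrt_of_slit Complex.one_mem_slitPlane).tendsto.comp h1
  rw [Complex.sqrt_one] at h2
  exact h2

theorem tendsto_pairRoot_cobounded {S : ℂ → ℂ} {l : ℂ}
    (h : Tendsto S (Bornology.cobounded ℂ) (𝓝 l)) :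
    Tendsto (fun z => pairRoot z (S z)) (Bornology.cobounded ℂ) (𝓝 ((-1 + l) / 2)) := by
  have := ((((tendsto_pairM_cobounded.const_add 1).neg).mul tendsto_maxRoot_cobounded).add
    h).div_const 2
  simpa [pairRoot] using this

theorem tendsto_upper_cobounded :
    Tendsto (fun z => pairRoot z (mainSqrt z)) (Bornology.cobounded ℂ) (𝓝 0) := by
  simpa using tendsto_pairRoot_cobounded tendsto_mainSqrt_cobounded

theorem tendsto_lower_cobounded :
    Tendsto (fun z => pairRoot z (-mainSqrt z)) (Bornology.cobounded ℂ) (𝓝 (-1)) := by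
  have := tendsto_pairRoot_cobounded tendsto_mainSqrt_cobounded.neg
  norm_num at this
  exact this

/-! ### The sign of `Re m` on horizontal lines -/

/-- The point `x + i y`. -/
def pt (x y : ℝ) : ℂ := ⟨x, y⟩

@[simp] theorem pt_re (x y : ℝ) : (pt x y).re = x := rfl
@[simp] theorem pt_im (x y : ℝ) : (pt x y).im = y := rfl

theorem pt_eta (z : ℂ) : pt z.re z.im = z := rfl

theorem conj_pt (x y : ℝ) : starRingEnd ℂ (pt x y) = pt x (-y) := rfl

theorem continuous_pt : Continuous fun p : ℝ × ℝ => pt p.1 p.2 := by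
  have : (fun p : ℝ × ℝ => pt p.1 p.2) = fun p => (p.1 : ℂ) + p.2 * Complex.I := by
    funext p
    apply Complex.ext <;> simp
  rw [this]
  fun_prop

theorem pt_ne_zero {x y : ℝ} (h : x ≠ 0 ∨ y ≠ 0) : pt x y ≠ 0 := by
  intro h0
  have h1 := congrArg Complex.re h0
  have h2 := congrArg Complex.im h0
  simp at h1 h2
  tauto

theorem hasDerivAt_pt_left (x y : ℝ) : HasDerivAt (fun u => pt u y) 1 x := by
  have : (fun u => pt u y) = fun u : ℝ => (u : ℂ) + y * Complex.I := by
    funext p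
    apply Complex.ext <;> simp
  rw [this]
  exact (hasDerivAt_id x).ofReal_comp.add_const _

theorem hasDerivAt_pt_right (x y : ℝ) : HasDerivAt (fun u => pt x u) Complex.I y := by
  have : (fun u => pt x u) = fun u : ℝ => (x : ℂ) + u * Complex.I := by
    funext p
    apply Complex.ext <;> simp
  rw [this]
  simpa using ((hasDerivAt_id y).ofReal_comp.mul_const Complex.I).const_add (x : ℂ)

theorem tendsto_pt_atBot (y : ℝ) : Tendsto (fun x => pt x y) atBot (Bornology.cobounded ℂ) := by
  rw [← tendsto_norm_atTop_iff_cobounded]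
  refine tendsto_atTop_mono (fun x => ?_) tendsto_neg_atBot_atTop
  have := Complex.abs_re_le_norm (pt x y)
  exact (neg_le_abs _).trans this

/-- Far out the greatest root is near `1`, so `m` is close to `-1/z`, whose real part is positive at
the left end of a horizontal line. -/
theorem eventually_pairM_re_pos (y : ℝ) : ∀ᶠ x in atBot, 0 < (pairM (pt x y)).re := by
  have h1 := tendsto_maxRoot_cobounded.comp (tendsto_pt_atBot y)
  have h2 := (Complex.continuous_re.tendsto _).comp h1
  have h3 := (Complex.continuous_im.tendsto _).comp h1
  rw [Complex.one_re] at h2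
  rw [Complex.one_im] at h3
  filter_upwards [h2.eventually (lt_mem_nhds (by norm_num : (1 / 2 : ℝ) < 1)),
    h3.eventually (lt_mem_nhds (by norm_num : (-1 : ℝ) < 0)),
    h3.eventually (gt_mem_nhds (by norm_num : (0 : ℝ) < 1)),
    eventually_lt_atBot (-2 * |y|), eventually_lt_atBot (0 : ℝ)] with x a1 a2 a3 a4 a5
  have hz0 : pt x y ≠ 0 := pt_ne_zero (Or.inl a5.ne)
  have hn : 0 < Complex.normSq (pt x y * maxRoot (pt x y)) :=
    Complex.normSq_pos.2 (mul_ne_zero hz0 (maxRoot_isPreimage _).ne_zero)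
  have e2 : (pairM (pt x y)).re =
      -(pt x y * maxRoot (pt x y)).re / Complex.normSq (pt x y * maxRoot (pt x y)) := by
    simp [pairM, pairCoord, Complex.div_re]
  rw [e2]
  apply div_pos _ hn
  rw [Complex.mul_re, pt_re, pt_im]
  simp only [Function.comp_apply] at a1 a2 a3
  set c := maxRoot (pt x y)
  have b1 : |y * c.im| ≤ |y| := by
    rw [abs_mul]
    exact mul_le_of_le_one_right (abs_nonneg _) (abs_le.2 ⟨a2.le, a3.le⟩)
  have b2 := neg_le_abs (y * c.im)
  nlinarith

theorem continuousOn_pairM_line (y : ℝ) (hy : 0 < y) :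
    ContinuousOn (fun x => (pairM (pt x y)).re) (Iic 0) := by
  intro x hx
  have h1 : ContinuousAt pairM (pt x y) := continuousAt_pairM hx (pt_ne_zero (Or.inr hy.ne'))
  exact (Complex.continuous_re.continuousAt.comp
    (h1.comp (f := fun x => pt x y) (hasDerivAt_pt_left x y).continuousAt)).continuousWithinAt

theorem exists_zero_left {x y : ℝ} (hy : 0 < y) (hx : x ≤ 0) (hm : (pairM (pt x y)).re ≤ 0) :
    ∃ x' ≤ x, (pairM (pt x' y)).re = 0 := by
  obtain ⟨X, hX, hXx⟩ := ((eventually_pairM_re_pos y).and (eventually_le_atBot x)).exists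
  have hc := (continuousOn_pairM_line y hy).mono
    (show Icc X x ⊆ Iic 0 from fun u hu => hu.2.trans hx)
  obtain ⟨x', hx', h⟩ := intermediate_value_Icc' hXx hc ⟨hm, hX.le⟩
  exact ⟨x', hx'.2, h⟩

theorem exists_zero_right {x y : ℝ} (hy : 0 < y) (hx : x ≤ 0) (hm : 0 ≤ (pairM (pt x y)).re) :
    ∃ x', x ≤ x' ∧ x' < 0 ∧ (pairM (pt x' y)).re = 0 := by
  have h0 : (pairM (pt 0 y)).re < 0 := pairM_re_neg_of_imaginary rfl hy
  have hc := (continuousOn_pairM_line y hy).mono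
    (show Icc x 0 ⊆ Iic 0 from fun u hu => hu.2)
  obtain ⟨x', hx', h⟩ := intermediate_value_Icc' hx hc ⟨h0.le, hm⟩
  refine ⟨x', hx'.1, lt_of_le_of_ne hx'.2 ?_, h⟩
  rintro rfl
  exact h0.ne h

/-- A return to a nonnegative value would produce two zeros of `Re m` on one horizontal line,
against `curve_unique`. -/
theorem pairM_re_neg_right {x x' y : ℝ} (hy : 0 < y) (hx : x < x') (hx' : x' ≤ 0)
    (hm : (pairM (pt x y)).re ≤ 0) : (pairM (pt x' y)).re < 0 := by
  by_contra hcon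
  push Not at hcon
  obtain ⟨u, hu, h1⟩ := exists_zero_left hy (hx.le.trans hx') hm
  obtain ⟨v, hv, hv0, h2⟩ := exists_zero_right hy hx' hcon
  have := curve_unique (z := pt u y) (z' := pt v y) (by simp; linarith) hy (by simp; linarith)
    h1 h2 rfl
  have := congrArg Complex.re this
  simp at this
  linarith

/-- Otherwise there is a zero of `Re m` to the left of `Re z₁`, against `curve_below`. -/
theorem pairM_re_pos_of_le {x y : ℝ} (hy : 0 < y) (hy1 : y < z1.im) (hx : x ≤ z1.re) :
    0 < (pairM (pt x y)).re := by
  by_contra hcon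
  push Not at hcon
  have h0 := z1_re_neg
  obtain ⟨u, hu, h1⟩ := exists_zero_left hy (hx.trans h0.le) hcon
  have := curve_below (z := pt u y) (by simp; linarith) hy h1 hy1
  simp at this
  linarith

theorem pairM_re_pos_of_lt {x : ℝ} (hx : x < z1.re) : 0 < (pairM (pt x z1.im)).re := by
  by_contra hcon
  push Not at hcon
  have h0 := z1_re_neg
  obtain ⟨u, hu, h1⟩ := exists_zero_left z1_im_pos (hx.le.trans h0.le) hcon
  have := curve_unique (z := pt u z1.im) (z' := z1) (by simp; linarith) z1_im_pos h0.le
    h1 (by simp [pairM_z1]) rfl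
  have := congrArg Complex.re this
  simp at this
  linarith

theorem pairM_re_neg_of_gt {x : ℝ} (hx : z1.re < x) (hx0 : x ≤ 0) :
    (pairM (pt x z1.im)).re < 0 :=
  pairM_re_neg_right z1_im_pos hx hx0 (by rw [pt_eta]; simp [pairM_z1])

/-- Along the curve the height is strictly decreasing in `Im m`, and the branch point corresponds to
`Im m = √3`. -/
theorem pairM_height {z : ℂ} (hz : z.re ≤ 0) (hi : 0 < z.im) (hm : (pairM z).re = 0) :
    (z1.im < z.im → (pairM z).im ^ 2 < 3) ∧ (z.im < z1.im → 3 < (pairM z).im ^ 2) := by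
  have ne : z ≠ 0 := by rintro rfl; simp at hi
  obtain ⟨h1, h2⟩ := curve_eqs ne hm
  have hm1 : (pairM z1).re = 0 := by simp [pairM_z1]
  obtain ⟨h1', h2'⟩ := curve_eqs z1_ne_zero hm1
  have t := pairM_im_pos hz hi
  have e1 : (pairM z1).im = √3 := by simp [pairM_z1]
  rw [e1] at h1' h2'
  have s0 : (0 : ℝ) < √3 := by positivity
  have hs : √3 ^ 2 = 3 := Real.sq_sqrt (by norm_num)
  have heq : (pairM z).im = √3 → z.im = z1.im := by
    intro h
    have := curve_unique (z := z1) (z' := z1) z1_re_neg.le z1_im_pos z1_re_neg.le hm1 hm1 rfl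
    rw [h] at h1 h2
    have a1 : z.re ^ 2 - z.im ^ 2 = z1.re ^ 2 - z1.im ^ 2 :=
      mul_right_cancel₀ (b := √3 ^ 2 * (9 + √3 ^ 2)) (by positivity) (h1.trans h1'.symm)
    have a2 : z.re * z.im = z1.re * z1.im :=
      mul_right_cancel₀ (b := √3 * (9 + √3 ^ 2)) (by positivity) (h2.trans h2'.symm)
    have a3 : z ^ 2 = z1 ^ 2 := by
      apply Complex.ext <;> simp [pow_two] <;> linarith
    rcases sq_eq_sq_iff_eq_or_eq_neg.1 a3 with h | h
    · rw [h]
    · rw [h] at hi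
      have := z1_im_pos
      simp at hi
      linarith
  rcases lt_trichotomy (pairM z).im √3 with h | h | h
  · refine ⟨fun _ => by nlinarith, fun hlt => ?_⟩
    have := curve_height_lt hi t h h1 h2 h1' h2'
    linarith
  · have := heq h
    exact ⟨fun hh => by linarith, fun hh => by linarith⟩
  · refine ⟨fun hlt => ?_, fun _ => by nlinarith⟩
    have := curve_height_lt z1_im_pos s0 h h1' h2' h1 h2
    linarith

/-- Beyond the branch heights the curve `Re m = 0` does not meet the cut of `mainSqrt`; between them
it does not meet the cut of `boxSqrt` (`slit_box`). Conjugation reduces the lower half plane to the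
upper one. -/
theorem slit_above {z : ℂ} (hz : z.re ≤ 0) (hi : z1.im < |z.im|) :
    (pairM z).re ≠ 0 ∨ (pairM z).im ^ 2 < 3 := by
  have h1 := z1_im_pos
  rw [or_iff_not_imp_left, not_not]
  intro hm
  rcases lt_abs.1 hi with h | h
  · exact (pairM_height hz (h1.trans h) hm).1 h
  · have hz0 : z ≠ 0 := by rintro rfl; simp at h; linarith
    have hc := conj_pairM hz hz0
    have := (pairM_height (z := starRingEnd ℂ z) (by simpa using hz) (by simp; linarith)
      (by rw [hc]; simpa using hm)).1 (by simpa using h)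
    rw [hc] at this
    simpa using this

theorem slit_box {z : ℂ} (hz : z.re ≤ 0) (hz0 : z ≠ 0) (hi : |z.im| < z1.im) :
    (pairM z).re ≠ 0 ∨ 3 < (pairM z).im ^ 2 := by
  have h1 := z1_im_pos
  rw [or_iff_not_imp_left, not_not]
  intro hm
  obtain ⟨h2, h3⟩ := abs_lt.1 hi
  rcases lt_trichotomy z.im 0 with h | h | h
  · have hc := conj_pairM hz hz0
    have := (pairM_height (z := starRingEnd ℂ z) (by simpa using hz) (by simpa using h)
      (by rw [hc]; simpa using hm)).2 (by simp; linarith)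
    rw [hc] at this
    simpa using this
  · have hlt : z.re < 0 := lt_of_le_of_ne hz fun h' => hz0 (Complex.ext h' h)
    exact absurd hm (pairM_of_real hlt h).1.ne'
  · exact (pairM_height hz h hm).2 h3

/-! ### Differences of `hFun` on the two smaller sheets -/

theorem continuousAt_hFun {z w : ℂ} (h : IsPreimage z w) : ContinuousAt hFun w := by
  have h1 := h.ne_zero
  have h2 := sub_ne_zero.2 h.sq_ne_one
  unfold hFun
  refine ContinuousAt.sub ?_ (ContinuousAt.log ?_ (norm_ne_zero_iff.2 (mul_ne_zero h1 h2)))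
  · refine Complex.continuous_re.continuousAt.comp (f := fun w : ℂ => 2 / (w ^ 2 - 1)) ?_
    fun_prop (disch := exact h2)
  · fun_prop

theorem hFun_neg (w : ℂ) : hFun (-w) = hFun w := by
  simp [hFun]

theorem hFun_conj (w : ℂ) : hFun (starRingEnd ℂ w) = hFun w := by
  have e1 : 2 / (starRingEnd ℂ w ^ 2 - 1) = starRingEnd ℂ (2 / (w ^ 2 - 1)) := by
    simp [map_ofNat (starRingEnd ℂ) 2]
  have e2 : starRingEnd ℂ w * (starRingEnd ℂ w ^ 2 - 1) = starRingEnd ℂ (w * (w ^ 2 - 1)) := by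
    simp
  rw [hFun, e1, e2, Complex.conj_re, Complex.norm_conj, hFun]

/-- The difference of `hFun` at the two preimages given by the square root `S`. -/
def hDiff (S : ℂ → ℂ) (z : ℂ) : ℝ := hFun (pairRoot z (S z)) - hFun (pairRoot z (-S z))

theorem hDiff_neg {S S' : ℂ → ℂ} {z : ℂ} (h : S' z = -S z) : hDiff S' z = -hDiff S z := by
  rw [hDiff, hDiff, h, neg_neg]
  ring

theorem hDiff_congr {S S' : ℂ → ℂ} {z : ℂ} (h : S' z = S z) : hDiff S' z = hDiff S z := by
  rw [hDiff, hDiff, h]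

theorem conj_pairRoot {z s : ℂ} (hz : z.re ≤ 0) (hz0 : z ≠ 0) :
    pairRoot (starRingEnd ℂ z) (starRingEnd ℂ s) = starRingEnd ℂ (pairRoot z s) := by
  rw [pairRoot, pairRoot, conj_pairM hz hz0, conj_maxRoot hz hz0]
  simp [map_ofNat (starRingEnd ℂ) 2]

theorem hDiff_conj {S : ℂ → ℂ} {z : ℂ} (hz : z.re ≤ 0) (hz0 : z ≠ 0)
    (h : S (starRingEnd ℂ z) = starRingEnd ℂ (S z)) :
    hDiff S (starRingEnd ℂ z) = hDiff S z := by
  rw [hDiff, h, ← map_neg, conj_pairRoot hz hz0, conj_pairRoot hz hz0, hFun_conj, hFun_conj, hDiff]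

theorem sqrt_conj {a : ℂ} (ha : a ∈ Complex.slitPlane) :
    Complex.sqrt (starRingEnd ℂ a) = starRingEnd ℂ (Complex.sqrt a) := by
  have h : Complex.sqrt (starRingEnd ℂ a) ^ 2 = (starRingEnd ℂ (Complex.sqrt a)) ^ 2 := by
    rw [sqrt_sq, ← map_pow, sqrt_sq]
  rcases sq_eq_sq_iff_eq_or_eq_neg.1 h with h | h
  · exact h
  · have h1 := sqrt_re_nonneg (starRingEnd ℂ a)
    have h2 := sqrt_re_pos ha
    rw [h, Complex.neg_re, Complex.conj_re] at h1
    linarith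

theorem conj_mainSqrt {z : ℂ} (hz : z.re ≤ 0) (hz0 : z ≠ 0)
    (h : (pairM z).re ≠ 0 ∨ (pairM z).im ^ 2 < 3) :
    mainSqrt (starRingEnd ℂ z) = starRingEnd ℂ (mainSqrt z) := by
  rw [mainSqrt, mainSqrt, ← sqrt_conj (pairD_mem_slitPlane h)]
  congr 1
  rw [pairD, pairD, conj_pairM hz hz0]
  simp [map_ofNat (starRingEnd ℂ) 3]

theorem conj_boxSqrt {z : ℂ} (hz : z.re ≤ 0) (hz0 : z ≠ 0)
    (h : (pairM z).re ≠ 0 ∨ 3 < (pairM z).im ^ 2) :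
    boxSqrt (starRingEnd ℂ z) = starRingEnd ℂ (boxSqrt z) := by
  rw [boxSqrt, boxSqrt, map_mul, ← sqrt_conj (boxArg_mem_slitPlane (pairM_ne_zero hz0) h),
    conj_pairM hz hz0]
  simp [map_ofNat (starRingEnd ℂ) 3]

theorem continuousAt_pairRoot {S : ℂ → ℂ} {z : ℂ} (hz : z.re ≤ 0) (hz0 : z ≠ 0)
    (hS : ContinuousAt S z) : ContinuousAt (fun w => pairRoot w (S w)) z := by
  unfold pairRoot
  have := continuousAt_pairM hz hz0
  have := continuousAt_maxRoot hz hz0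
  fun_prop

theorem continuousAt_hDiff {S : ℂ → ℂ} {z : ℂ} (hz : z.re ≤ 0) (hz0 : z ≠ 0)
    (hS : ContinuousAt S z) (hsq : S z ^ 2 = pairD z) : ContinuousAt (hDiff S) z := by
  refine ContinuousAt.sub ?_ ?_
  · exact ContinuousAt.comp (f := fun w => pairRoot w (S w))
      (continuousAt_hFun (isPreimage_pairRoot hz0 hsq)) (continuousAt_pairRoot hz hz0 hS)
  · exact ContinuousAt.comp (f := fun w => pairRoot w (-S w))
      (continuousAt_hFun (isPreimage_pairRoot hz0 (by rwa [neg_sq])))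
      (continuousAt_pairRoot hz hz0 hS.neg)

theorem hasDerivAt_hFun_pairRoot {S : ℂ → ℂ} {γ : ℝ → ℂ} {γ' : ℂ} {t : ℝ}
    (hγ : HasDerivAt γ γ' t) (hz : (γ t).re ≤ 0) (hz0 : γ t ≠ 0) (hS : ContinuousAt S (γ t))
    (hsq : ∀ z ≠ 0, S z ^ 2 = pairD z) (h0 : S (γ t) ≠ 0) :
    HasDerivAt (fun u => hFun (pairRoot (γ u) (S (γ u))))
      (3 * (pairRoot (γ t) (S (γ t)) * γ')).re t := by
  refine hasDerivAt_hFun_comp (q := fun u => pairRoot (γ u) (S (γ u))) hγ ?_ ?_ ?_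
  · exact ContinuousAt.comp (f := γ) (g := fun w => pairRoot w (S w))
      (continuousAt_pairRoot hz hz0 hS) hγ.continuousAt
  · filter_upwards [hγ.continuousAt.eventually_ne hz0] with u hu
      using isPreimage_pairRoot hu (hsq _ hu)
  · exact zMapDeriv_pairRoot_ne hz hz0 (hsq _ hz0) h0

/-- The common term of the two roots drops out of their difference, so the derivative involves only
the chosen square root. -/
theorem hasDerivAt_hDiff {S : ℂ → ℂ} {γ : ℝ → ℂ} {γ' : ℂ} {t : ℝ}
    (hγ : HasDerivAt γ γ' t) (hz : (γ t).re ≤ 0) (hz0 : γ t ≠ 0) (hS : ContinuousAt S (γ t))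
    (hsq : ∀ z ≠ 0, S z ^ 2 = pairD z) (h0 : S (γ t) ≠ 0) :
    HasDerivAt (fun u => hDiff S (γ u)) (3 * (S (γ t) * γ').re) t := by
  have h1 := hasDerivAt_hFun_pairRoot hγ hz hz0 hS hsq h0
  have h2 := hasDerivAt_hFun_pairRoot (S := fun z => -S z) hγ hz hz0 hS.neg
    (fun z hz => by rw [neg_sq, hsq z hz]) (neg_ne_zero.2 h0)
  refine (h1.sub h2).congr_deriv ?_
  have e : S (γ t) = pairRoot (γ t) (S (γ t)) - pairRoot (γ t) (-S (γ t)) :=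
    (pairRoot_sub _ _).symm
  conv_rhs => rw [e]
  simp
  ring

theorem hasDerivAt_hFun_maxRoot {γ : ℝ → ℂ} {γ' : ℂ} {t : ℝ}
    (hγ : HasDerivAt γ γ' t) (hz : (γ t).re ≤ 0) (hz0 : γ t ≠ 0) :
    HasDerivAt (fun u => hFun (maxRoot (γ u))) (3 * (maxRoot (γ t) * γ').re) t := by
  refine (hasDerivAt_hFun_comp (q := fun u => maxRoot (γ u)) hγ ?_ ?_ ?_).congr_deriv ?_
  · exact ContinuousAt.comp (f := γ) (continuousAt_maxRoot hz hz0) hγ.continuousAt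
  · exact Eventually.of_forall fun u => maxRoot_isPreimage _
  · exact zMapDeriv_maxRoot_ne hz hz0
  · simp

/-- The difference of `hFun` at the two smaller preimages, in the order of the real parts. -/
def mainH : ℂ → ℝ := hDiff mainSqrt

/-- The difference of `hFun` at the two smaller preimages, in the order given by `boxSqrt`. -/
def boxH : ℂ → ℝ := hDiff boxSqrt

theorem mainSqrt_re_pos {z : ℂ} (h : (pairM z).re ≠ 0 ∨ (pairM z).im ^ 2 < 3) :
    0 < (mainSqrt z).re := sqrt_re_pos (pairD_mem_slitPlane h)

theorem mainSqrt_mul_im (z : ℂ) :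
    3 * ((mainSqrt z).re * (mainSqrt z).im) = (pairM z).re * (pairM z).im := by
  have h := congrArg Complex.im (mainSqrt_sq z)
  have e : (pairD z).im = 2 * ((pairM z).re * (pairM z).im) / 3 := by
    rw [pairD, show (3 : ℂ) = ((3 : ℝ) : ℂ) by norm_num, Complex.div_ofReal_im]
    simp [pow_two]
    ring
  rw [e, pow_two, Complex.mul_im] at h
  linarith

theorem boxH_eq_neg {z : ℂ} (hz : z ≠ 0) (h : 0 < (pairM z).re) : boxH z = -mainH z :=
  hDiff_neg (boxSqrt_eq_neg hz h)

theorem boxH_eq {z : ℂ} (hz : z ≠ 0) (h : (pairM z).re < 0) : boxH z = mainH z :=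
  hDiff_congr (boxSqrt_eq hz h)

theorem mainH_conj {z : ℂ} (hz : z.re ≤ 0) (hz0 : z ≠ 0)
    (h : (pairM z).re ≠ 0 ∨ (pairM z).im ^ 2 < 3) :
    mainH (starRingEnd ℂ z) = mainH z := hDiff_conj hz hz0 (conj_mainSqrt hz hz0 h)

theorem continuousAt_mainH {z : ℂ} (hz : z.re ≤ 0) (hz0 : z ≠ 0)
    (h : (pairM z).re ≠ 0 ∨ (pairM z).im ^ 2 < 3) : ContinuousAt mainH z :=
  continuousAt_hDiff hz hz0 (continuousAt_mainSqrt hz hz0 h) (mainSqrt_sq z)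

theorem continuousAt_boxH {z : ℂ} (hz : z.re ≤ 0) (hz0 : z ≠ 0)
    (h : (pairM z).re ≠ 0 ∨ 3 < (pairM z).im ^ 2) : ContinuousAt boxH z :=
  continuousAt_hDiff hz hz0 (continuousAt_boxSqrt hz hz0 h) (boxSqrt_sq hz0)

theorem pairD_z1 : pairD z1 = 0 := by
  have hs : ((√3 : ℝ) : ℂ) ^ 2 = 3 := by
    rw [← Complex.ofReal_pow, Real.sq_sqrt (by norm_num)]
    norm_num
  rw [pairD, pairM_z1, mul_pow, hs, Complex.I_sq]
  norm_num

theorem mainSqrt_z1 : mainSqrt z1 = 0 := by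
  rw [mainSqrt, pairD_z1, Complex.sqrt_zero]

theorem mainH_z1 : mainH z1 = 0 := by
  rw [mainH, hDiff, mainSqrt_z1, neg_zero, sub_self]

theorem pairD_conj {z : ℂ} (hz : z.re ≤ 0) (hz0 : z ≠ 0) :
    pairD (starRingEnd ℂ z) = starRingEnd ℂ (pairD z) := by
  rw [pairD, pairD, conj_pairM hz hz0]
  simp [map_ofNat (starRingEnd ℂ) 3]

theorem pairD_z2 : pairD z2 = 0 := by
  rw [z2_eq, pairD_conj z1_re_neg.le z1_ne_zero, pairD_z1, map_zero]

theorem mainSqrt_eq_zero {z : ℂ} (h : pairD z = 0) : mainSqrt z = 0 := by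
  rw [mainSqrt, h, Complex.sqrt_zero]

theorem mainH_eq_zero {z : ℂ} (h : pairD z = 0) : mainH z = 0 := by
  rw [mainH, hDiff, mainSqrt_eq_zero h, neg_zero, sub_self]

theorem continuousAt_mainH_of_pairD {z : ℂ} (hz : z.re ≤ 0) (hz0 : z ≠ 0) (h : pairD z = 0) :
    ContinuousAt mainH z := by
  refine continuousAt_hDiff hz hz0 ?_ (mainSqrt_sq z)
  refine ContinuousAt.comp (Complex.continuousAt_sqrt ?_) (continuousAt_pairD hz hz0)
  left
  rw [h, Complex.zero_re]

theorem mainSqrt_ne_zero {z : ℂ} (h : (pairM z).re ≠ 0 ∨ (pairM z).im ^ 2 < 3) :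
    mainSqrt z ≠ 0 := by
  intro h0
  have := mainSqrt_re_pos h
  simp [h0] at this

theorem hasDerivAt_mainH {γ : ℝ → ℂ} {γ' : ℂ} {t : ℝ} (hγ : HasDerivAt γ γ' t)
    (hz : (γ t).re ≤ 0) (hz0 : γ t ≠ 0)
    (h : (pairM (γ t)).re ≠ 0 ∨ (pairM (γ t)).im ^ 2 < 3) :
    HasDerivAt (fun u => mainH (γ u)) (3 * (mainSqrt (γ t) * γ').re) t :=
  hasDerivAt_hDiff hγ hz hz0 (continuousAt_mainSqrt hz hz0 h) (fun z _ => mainSqrt_sq z)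
    (mainSqrt_ne_zero h)

theorem pairM_re_pos_strip {x y : ℝ} (hy : |y| < z1.im) (hx : x ≤ z1.re) :
    0 < (pairM (pt x y)).re := by
  have h0 := z1_re_neg
  have hx0 : x < 0 := hx.trans_lt h0
  obtain ⟨h2, h3⟩ := abs_lt.1 hy
  rcases lt_trichotomy y 0 with h | h | h
  · have := pairM_re_pos_of_le (y := -y) (by linarith) (by linarith) hx
    rw [← conj_pt, conj_pairM (z := pt x y) hx0.le (pt_ne_zero (Or.inl hx0.ne))] at this
    simpa using this
  · exact (pairM_of_real (z := pt x y) hx0 h).1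
  · exact pairM_re_pos_of_le h h3 hx

/-- Above the real axis `Re m` and `Im m` are positive on this vertical line, hence so is `Im
mainSqrt`, and `mainH` decreases upwards to its value `0` at the branch point. Conjugation gives the
lower half. -/
theorem mainH_vertical_pos {y : ℝ} (hy : |y| < z1.im) : 0 < mainH (pt z1.re y) := by
  have h0 := z1_re_neg
  have key : ∀ y, 0 ≤ y → y < z1.im → 0 < mainH (pt z1.re y) := by
    intro y hy0 hy1
    have hne : ∀ u, pt z1.re u ≠ 0 := fun u => pt_ne_zero (Or.inl h0.ne)
    have hm : ∀ u ∈ Ico y z1.im, 0 < (pairM (pt z1.re u)).re := fun u hu =>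
      pairM_re_pos_strip (by rw [abs_of_nonneg (hy0.trans hu.1)]; exact hu.2) le_rfl
    have hanti : StrictAntiOn (fun u => mainH (pt z1.re u)) (Icc y z1.im) := by
      apply strictAntiOn_of_deriv_neg (convex_Icc _ _)
      · intro u hu
        have hcp : ContinuousAt (fun u => pt z1.re u) u := (hasDerivAt_pt_right _ u).continuousAt
        rcases hu.2.lt_or_eq with h | h
        · exact (ContinuousAt.comp (f := fun v : ℝ => pt z1.re v) (x := u) (g := mainH)
            (continuousAt_mainH h0.le (hne u) (Or.inl (hm u ⟨hu.1, h⟩).ne'))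
            hcp).continuousWithinAt
        · rw [h] at hcp ⊢
          exact (ContinuousAt.comp (f := fun v : ℝ => pt z1.re v) (x := z1.im) (g := mainH)
            (by rw [pt_eta]; exact (continuousAt_mainH_of_pairD z1_re_neg.le z1_ne_zero pairD_z1)) hcp).continuousWithinAt
      · intro u hu
        rw [interior_Icc] at hu
        have hmu := hm u ⟨hu.1.le, hu.2⟩
        rw [(hasDerivAt_mainH (hasDerivAt_pt_right z1.re u) h0.le (hne u) (Or.inl hmu.ne')).deriv]
        have h1 := mainSqrt_mul_im (pt z1.re u)
        have h2 := mainSqrt_re_pos (z := pt z1.re u) (Or.inl hmu.ne')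
        have h3 : 0 < (pairM (pt z1.re u)).im := pairM_im_pos h0.le (hy0.trans_lt hu.1)
        have h4 := mul_pos hmu h3
        have h5 : 0 < (mainSqrt (pt z1.re u)).im := by
          by_contra hcon
          push Not at hcon
          have := mul_nonpos_of_nonneg_of_nonpos h2.le hcon
          linarith
        simp
        linarith
    have := hanti ⟨le_rfl, hy1.le⟩ ⟨hy1.le, le_rfl⟩ hy1
    simp only [pt_eta, mainH_z1] at this
    exact this
  rcases le_total 0 y with h | h
  · exact key y h (by rwa [abs_of_nonneg h] at hy)
  · have h1 := key (-y) (by linarith) (by rwa [abs_of_nonpos h] at hy)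
    rwa [← conj_pt, mainH_conj (z := pt z1.re y) h0.le (pt_ne_zero (Or.inl h0.ne))
      (Or.inl (pairM_re_pos_strip hy le_rfl).ne')] at h1

/-! ### The level curve on the far side of the branch points -/

/-- The part of the line of height `y` in the left half plane that lies on the far side of the
curve on which the two smaller preimages have equal real parts. -/
def farSide (y : ℝ) : Set ℝ := {x | x ≤ 0 ∧ (|y| < z1.im → x ≤ z1.re)}

theorem strictMonoOn_mainH_line {y : ℝ} {s : Set ℝ} (hs : Convex ℝ s) (hs0 : s ⊆ Iic 0)
    (hc : ∀ x ∈ s, pt x y ≠ 0 ∧ ContinuousAt mainH (pt x y))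
    (hm : ∀ x ∈ interior s, (pairM (pt x y)).re ≠ 0 ∨ (pairM (pt x y)).im ^ 2 < 3) :
    StrictMonoOn (fun x => mainH (pt x y)) s := by
  apply strictMonoOn_of_deriv_pos hs
  · intro x hx
    exact (ContinuousAt.comp (f := fun x => pt x y) (hc x hx).2
      (hasDerivAt_pt_left x y).continuousAt).continuousWithinAt
  · intro x hx
    have h1 : x ∈ s := interior_subset hx
    rw [(hasDerivAt_mainH (hasDerivAt_pt_left x y) (hs0 h1) (hc x h1).1 (hm x hx)).deriv, mul_one]
    have := mainSqrt_re_pos (hm x hx)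
    positivity

/-- The horizontal derivative of `mainH` is `3 Re mainSqrt`, positive off the cut. The far side
meets that cut only at the branch points, where `mainH` is still continuous and two intervals of
monotonicity are joined. -/
theorem strictMonoOn_mainH_farSide (y : ℝ) :
    StrictMonoOn (fun x => mainH (pt x y)) (farSide y) := by
  have h0 := z1_re_neg
  have hy1 := z1_im_pos
  rcases lt_trichotomy |y| z1.im with h | h | h
  · have e : farSide y = Iic z1.re := by
      ext x
      simp only [farSide, Set.mem_ofPred_eq, mem_Iic, h, true_implies]
      exact ⟨fun h => h.2, fun h => ⟨h.trans h0.le, h⟩⟩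
    rw [e]
    have hm : ∀ x ∈ Iic z1.re, (pairM (pt x y)).re ≠ 0 := fun x hx =>
      (pairM_re_pos_strip h hx).ne'
    refine strictMonoOn_mainH_line (convex_Iic _) (fun x hx => le_trans hx h0.le)
      (fun x hx => ?_) (fun x hx => Or.inl (hm x (interior_subset hx)))
    have hx0 : x < 0 := lt_of_le_of_lt hx h0
    have hne : pt x y ≠ 0 := pt_ne_zero (Or.inl hx0.ne)
    exact ⟨hne, continuousAt_mainH hx0.le hne (Or.inl (hm x hx))⟩
  · have hy0 : y ≠ 0 := by rintro rfl; simp at h; linarith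
    have e : farSide y = Iic 0 := by
      ext x
      simp only [farSide, Set.mem_ofPred_eq, mem_Iic, h, lt_irrefl, false_implies, and_true]
    have base : StrictMonoOn (fun x => mainH (pt x z1.im)) (Iic 0) := by
      have hne : ∀ x, pt x z1.im ≠ 0 := fun x => pt_ne_zero (Or.inr hy1.ne')
      have hc : ∀ x ∈ Iic (0 : ℝ), pt x z1.im ≠ 0 ∧ ContinuousAt mainH (pt x z1.im) := by
        intro x hx
        refine ⟨hne x, ?_⟩
        rcases lt_trichotomy x z1.re with h | h | h
        · exact continuousAt_mainH hx (hne x) (Or.inl (pairM_re_pos_of_lt h).ne')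
        · rw [h]
          exact (continuousAt_mainH_of_pairD z1_re_neg.le z1_ne_zero pairD_z1)
        · exact continuousAt_mainH hx (hne x) (Or.inl (pairM_re_neg_of_gt h hx).ne)
      have m1 : StrictMonoOn (fun x => mainH (pt x z1.im)) (Iic z1.re) := by
        refine strictMonoOn_mainH_line (convex_Iic _) (fun x hx => le_trans hx h0.le)
          (fun x hx => hc x (le_trans hx h0.le)) (fun x hx => ?_)
        rw [interior_Iic] at hx
        exact Or.inl (pairM_re_pos_of_lt hx).ne'
      have m2 : StrictMonoOn (fun x => mainH (pt x z1.im)) (Icc z1.re 0) := by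
        refine strictMonoOn_mainH_line (convex_Icc _ _) (fun x hx => hx.2)
          (fun x hx => hc x hx.2) (fun x hx => ?_)
        rw [interior_Icc] at hx
        exact Or.inl (pairM_re_neg_of_gt hx.1 hx.2.le).ne
      have := m1.union m2 isGreatest_Iic (isLeast_Icc h0.le)
      rwa [Iic_union_Icc_eq_Iic h0.le] at this
    rw [e]
    rcases (abs_eq hy1.le).1 h with h | h
    · rw [h]
      exact base
    · refine base.congr fun x hx => ?_
      simp only
      rw [h]
      by_cases hx1 : x = z1.re
      · have e1 : pt x (-z1.im) = starRingEnd ℂ z1 := by rw [hx1]; rfl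
        have e2 : pt x z1.im = z1 := by rw [hx1]; rfl
        rw [e1, e2, mainH_z1, ← z2_eq, mainH_eq_zero pairD_z2]
      · rw [← conj_pt, mainH_conj (z := pt x z1.im) hx (pt_ne_zero (Or.inr hy1.ne'))]
        rcases lt_or_gt_of_ne hx1 with h | h
        · exact Or.inl (pairM_re_pos_of_lt h).ne'
        · exact Or.inl (pairM_re_neg_of_gt h hx).ne
  · have e : farSide y = Iic 0 := by
      ext x
      simp only [farSide, Set.mem_ofPred_eq, mem_Iic, not_lt_of_gt h, false_implies, and_true]
    have hy0 : y ≠ 0 := by rintro rfl; simp at h; linarith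
    rw [e]
    refine strictMonoOn_mainH_line (convex_Iic _) le_rfl (fun x hx => ?_)
      (fun x hx => slit_above (interior_subset hx : x ∈ Iic 0) h)
    have hne : pt x y ≠ 0 := pt_ne_zero (Or.inr hy0)
    exact ⟨hne, continuousAt_mainH hx hne (slit_above hx h)⟩

/-- On the axis `Re m < 0 < Im m`, so `Im mainSqrt` is negative, and the vertical derivative of
`mainH` is `-3 Im mainSqrt`. -/
theorem strictMonoOn_mainH_imaginary : StrictMonoOn (fun y => mainH (pt 0 y)) (Ioi 0) := by
  have hm : ∀ y ∈ Ioi (0 : ℝ), (pairM (pt 0 y)).re < 0 := fun y hy =>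
    pairM_re_neg_of_imaginary rfl hy
  have hne : ∀ y ∈ Ioi (0 : ℝ), pt 0 y ≠ 0 := fun y hy =>
    pt_ne_zero (Or.inr (ne_of_gt hy))
  apply strictMonoOn_of_deriv_pos (convex_Ioi _)
  · intro y hy
    exact (ContinuousAt.comp (f := fun y => pt 0 y) (continuousAt_mainH le_rfl (hne y hy)
      (Or.inl (hm y hy).ne)) (hasDerivAt_pt_right 0 y).continuousAt).continuousWithinAt
  · intro y hy
    rw [interior_Ioi] at hy
    have hmy := hm y hy
    rw [(hasDerivAt_mainH (hasDerivAt_pt_right 0 y) le_rfl (hne y hy) (Or.inl hmy.ne)).deriv]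
    have h1 := mainSqrt_mul_im (pt 0 y)
    have h2 := mainSqrt_re_pos (z := pt 0 y) (Or.inl hmy.ne)
    have h3 : 0 < (pairM (pt 0 y)).im := pairM_im_pos le_rfl hy
    have h4 := mul_neg_of_neg_of_pos hmy h3
    have h5 : (mainSqrt (pt 0 y)).im < 0 := by
      by_contra hcon
      push Not at hcon
      have := mul_nonneg h2.le hcon
      linarith
    simp
    linarith

theorem mainH_imaginary_pos {y : ℝ} (hy : z1.im ≤ |y|) : 0 < mainH (pt 0 y) := by
  have h0 := z1_re_neg
  have hy1 := z1_im_pos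
  have h1 : 0 < mainH (pt 0 z1.im) := by
    have := strictMonoOn_mainH_farSide z1.im (a := z1.re) (b := 0)
      ⟨h0.le, fun _ => le_rfl⟩ ⟨le_rfl, fun h => by rw [abs_of_pos hy1] at h; linarith⟩ h0
    simp only [pt_eta, mainH_z1] at this
    exact this
  have key : ∀ y, z1.im ≤ y → 0 < mainH (pt 0 y) := by
    intro y hy
    rcases hy.lt_or_eq with h | h
    · exact h1.trans (strictMonoOn_mainH_imaginary hy1 (hy1.trans h) h)
    · rwa [← h]
  rcases le_total 0 y with h | h
  · exact key y (by rwa [abs_of_nonneg h] at hy)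
  · rw [abs_of_nonpos h] at hy
    have h2 := key (-y) hy
    have h3 : 0 < -y := hy1.trans_le hy
    have h4 := mainH_conj (z := pt 0 (-y)) le_rfl (pt_ne_zero (Or.inr h3.ne'))
      (Or.inl (pairM_re_neg_of_imaginary (z := pt 0 (-y)) rfl h3).ne)
    rw [conj_pt, neg_neg] at h4
    rwa [h4]

/-- Since `mainSqrt` tends to `1`, the derivative `3 Re mainSqrt` exceeds `1` far out, and `mainH`
falls below any bound. The witness lies far enough to the left for a decrease at unit rate to reach
a negative value. -/
theorem exists_mainH_neg (y : ℝ) : ∃ x ∈ farSide y, mainH (pt x y) < 0 := by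
  have h0 := z1_re_neg
  have hy1 := z1_im_pos
  have e1 := (Complex.continuous_re.tendsto _).comp
    (tendsto_mainSqrt_cobounded.comp (tendsto_pt_atBot y))
  rw [Complex.one_re] at e1
  obtain ⟨X, hX⟩ := eventually_atBot.1 ((e1.eventually (lt_mem_nhds
    (by norm_num : (1 / 3 : ℝ) < 1))).and ((eventually_pairM_re_pos y).and
      (eventually_le_atBot z1.re)))
  have hle : ∀ x ≤ X, x < 0 := fun x hx => (hX x hx).2.2.trans_lt h0
  have hd : ∀ x ≤ X, HasDerivAt (fun x => mainH (pt x y)) (3 * (mainSqrt (pt x y) * 1).re) x :=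
    fun x hx => hasDerivAt_mainH (hasDerivAt_pt_left x y) (hle x hx).le
      (pt_ne_zero (Or.inl (hle x hx).ne)) (Or.inl (hX x hx).2.1.ne')
  have hmono : MonotoneOn (fun x => mainH (pt x y) - x) (Iic X) := by
    have hd' : ∀ x ≤ X, HasDerivAt (fun x => mainH (pt x y) - x)
      (3 * (mainSqrt (pt x y) * 1).re - 1) x := fun x hx => (hd x hx).sub (hasDerivAt_id x)
    apply monotoneOn_of_deriv_nonneg (convex_Iic _)
    · exact fun x hx => (hd' x hx).continuousAt.continuousWithinAt
    · exact fun x hx => (hd' x (interior_subset hx : x ∈ Iic X)).differentiableAt.differentiableWithinAt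
    · intro x hx
      have hx' : x ∈ Iic X := interior_subset hx
      rw [(hd' x hx').deriv, mul_one]
      have : 1 / 3 < (mainSqrt (pt x y)).re := (hX x hx').1
      linarith
  set x₀ := min X (X - mainH (pt X y) - 1)
  have hx0 : x₀ ≤ X := min_le_left _ _
  refine ⟨x₀, ⟨(hle x₀ hx0).le, fun _ => (hX x₀ hx0).2.2⟩, ?_⟩
  have h1 := hmono hx0 (le_refl X) hx0
  have h2 : x₀ ≤ X - mainH (pt X y) - 1 := min_le_right _ _
  simp only at h1
  linarith

theorem farSide_cases {x y : ℝ} (hx : x ∈ farSide y) : pt x y ≠ 0 ∧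
    (((pairM (pt x y)).re ≠ 0 ∨ (pairM (pt x y)).im ^ 2 < 3) ∨ pt x y = z1 ∨ pt x y = z2) := by
  have h0 := z1_re_neg
  have hy1 := z1_im_pos
  rcases lt_trichotomy |y| z1.im with h | h | h
  · have hx1 := hx.2 h
    exact ⟨pt_ne_zero (Or.inl (hx1.trans_lt h0).ne),
      Or.inl (Or.inl (pairM_re_pos_strip h hx1).ne')⟩
  · have hy0 : y ≠ 0 := by rintro rfl; simp at h; linarith
    refine ⟨pt_ne_zero (Or.inr hy0), ?_⟩
    have key : x ≠ z1.re → (pairM (pt x z1.im)).re ≠ 0 := fun hne => by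
      rcases lt_or_gt_of_ne hne with h | h
      · exact (pairM_re_pos_of_lt h).ne'
      · exact (pairM_re_neg_of_gt h hx.1).ne
    by_cases hx1 : x = z1.re
    · right
      rcases (abs_eq hy1.le).1 h with h | h
      · left
        rw [h, hx1]
        rfl
      · right
        rw [h, hx1, z2_eq]
        rfl
    · left
      left
      rcases (abs_eq hy1.le).1 h with h | h
      · rw [h]
        exact key hx1
      · rw [h, ← conj_pt, conj_pairM (z := pt x z1.im) hx.1 (pt_ne_zero (Or.inr hy1.ne')),
          Complex.conj_re]
        exact key hx1
  · have hy0 : y ≠ 0 := by rintro rfl; simp at h; linarith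
    exact ⟨pt_ne_zero (Or.inr hy0), Or.inl (slit_above hx.1 h)⟩

theorem continuousAt_mainH_farSide {x y : ℝ} (hx : x ∈ farSide y) :
    ContinuousAt mainH (pt x y) := by
  obtain ⟨h, h' | h' | h'⟩ := farSide_cases hx
  · exact continuousAt_mainH hx.1 h h'
  · exact continuousAt_mainH_of_pairD hx.1 h (by rw [h', pairD_z1])
  · exact continuousAt_mainH_of_pairD hx.1 h (by rw [h', pairD_z2])

/-- On every horizontal line there is exactly one zero of `mainH` on the far side. -/
theorem exists_farSide_zero (y : ℝ) : ∃ x ∈ farSide y, mainH (pt x y) = 0 := by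
  have h0 := z1_re_neg
  have hy1 := z1_im_pos
  obtain ⟨a, ha, hav⟩ := exists_mainH_neg y
  obtain ⟨b, hb, hbv⟩ : ∃ b ∈ farSide y, 0 < mainH (pt b y) := by
    by_cases h : |y| < z1.im
    · exact ⟨z1.re, ⟨h0.le, fun _ => le_rfl⟩, mainH_vertical_pos h⟩
    · exact ⟨0, ⟨le_rfl, fun h' => absurd h' h⟩, mainH_imaginary_pos (not_lt.1 h)⟩
  have hab : a < b := by
    by_contra hcon
    push Not at hcon
    have := (strictMonoOn_mainH_farSide y).monotoneOn hb ha hcon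
    linarith
  have hcont : ContinuousOn (fun x => mainH (pt x y)) (Icc a b) := fun x hx =>
    (ContinuousAt.comp (f := fun x => pt x y) (continuousAt_mainH_farSide
      ⟨hx.2.trans hb.1, fun h => hx.2.trans (hb.2 h)⟩)
      (hasDerivAt_pt_left x y).continuousAt).continuousWithinAt
  obtain ⟨x, hx, hx0⟩ := intermediate_value_Icc hab.le hcont ⟨hav.le, hbv.le⟩
  exact ⟨x, ⟨hx.2.trans hb.1, fun h => hx.2.trans (hb.2 h)⟩, hx0⟩

/-- The abscissa at height `y` of the level curve of `mainH` on the far side. -/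
def levelX (y : ℝ) : ℝ := (exists_farSide_zero y).choose

theorem levelX_mem (y : ℝ) : levelX y ∈ farSide y := (exists_farSide_zero y).choose_spec.1

theorem mainH_levelX (y : ℝ) : mainH (pt (levelX y) y) = 0 :=
  (exists_farSide_zero y).choose_spec.2

theorem mainH_neg_of_lt {x y : ℝ} (h : x < levelX y) : mainH (pt x y) < 0 := by
  have hm := levelX_mem y
  have h1 : x ∈ farSide y := ⟨h.le.trans hm.1, fun h' => h.le.trans (hm.2 h')⟩
  have := strictMonoOn_mainH_farSide y h1 hm h
  simpa only [mainH_levelX] using this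

theorem mainH_pos_of_gt {x y : ℝ} (hx : x ∈ farSide y) (h : levelX y < x) :
    0 < mainH (pt x y) := by
  have := strictMonoOn_mainH_farSide y (levelX_mem y) hx h
  simpa only [mainH_levelX] using this

theorem eq_levelX {x y : ℝ} (hx : x ∈ farSide y) (h : mainH (pt x y) = 0) : x = levelX y :=
  (strictMonoOn_mainH_farSide y).injOn hx (levelX_mem y) (by simp only [h, mainH_levelX])

theorem farSide_neg (y : ℝ) : farSide (-y) = farSide y := by
  unfold farSide
  rw [abs_neg]

theorem levelX_y1 : levelX z1.im = z1.re :=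
  (eq_levelX ⟨z1_re_neg.le, fun _ => le_rfl⟩ mainH_z1).symm

theorem levelX_neg (y : ℝ) : levelX (-y) = levelX y := by
  refine (eq_levelX (by rw [farSide_neg]; exact levelX_mem y) ?_).symm
  obtain ⟨h, h' | h' | h'⟩ := farSide_cases (levelX_mem y)
  · rw [← conj_pt, mainH_conj (levelX_mem y).1 h h', mainH_levelX]
  · rw [← conj_pt, h', ← z2_eq, mainH_eq_zero pairD_z2]
  · rw [← conj_pt, h', z2_eq, Complex.conj_conj, mainH_z1]

theorem levelX_lt {y : ℝ} (h : |y| < z1.im) : levelX y < z1.re := by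
  refine lt_of_le_of_ne ((levelX_mem y).2 h) fun h' => ?_
  have h1 := mainH_vertical_pos h
  rw [← h', mainH_levelX] at h1
  exact h1.false

theorem levelX_lt_zero (y : ℝ) : levelX y < 0 := by
  by_cases h : |y| < z1.im
  · exact (levelX_lt h).trans z1_re_neg
  · refine lt_of_le_of_ne (levelX_mem y).1 fun h' => ?_
    have h1 := mainH_imaginary_pos (not_lt.1 h)
    rw [show pt 0 y = pt (levelX y) y by rw [h'], mainH_levelX] at h1
    exact h1.false

theorem continuousAt_curve_left {f : ℂ → ℝ} {x y : ℝ} (h : ContinuousAt f (pt x y)) :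
    ContinuousAt (fun v => f (pt x v)) y :=
  ContinuousAt.comp (f := fun v : ℝ => pt x v) (x := y) (g := f) h
    (hasDerivAt_pt_right x y).continuousAt

/-- The function `mainH` changes sign strictly at `levelX`, and strict signs at a fixed abscissa
persist on neighbouring lines. The abscissa must lie on the far side of those lines too, which is
why the branch heights are treated separately. -/
theorem continuous_levelX : Continuous levelX := by
  rw [continuous_iff_continuousAt]
  intro y₀
  have h0 := z1_re_neg
  have low : ∀ a, a < levelX y₀ → ∀ᶠ y in 𝓝 y₀, a < levelX y := by
    intro a ha
    have hm := levelX_mem y₀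
    have hf : a ∈ farSide y₀ := ⟨ha.le.trans hm.1, fun h => ha.le.trans (hm.2 h)⟩
    have h1 := continuousAt_curve_left (continuousAt_mainH_farSide hf)
    by_cases hx : a < z1.re
    · filter_upwards [h1.eventually (gt_mem_nhds (mainH_neg_of_lt ha))] with y hy
      by_contra hcon
      push Not at hcon
      have ha' : a ∈ farSide y := ⟨(hx.trans h0).le, fun _ => hx.le⟩
      rcases hcon.lt_or_eq with h | h
      · exact (mainH_pos_of_gt ha' h).not_gt hy
      · rw [← h, mainH_levelX] at hy
        exact hy.false
    · have hgt : z1.im < |y₀| := by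
        by_contra hcon
        push Not at hcon
        rcases hcon.lt_or_eq with h | h
        · exact hx (ha.trans (levelX_lt h))
        · have : levelX y₀ = z1.re := by
            rcases (abs_eq z1_im_pos.le).1 h with h | h
            · rw [h, levelX_y1]
            · rw [h, levelX_neg, levelX_y1]
          exact hx (this ▸ ha)
      filter_upwards [h1.eventually (gt_mem_nhds (mainH_neg_of_lt ha)),
        continuous_abs.continuousAt.eventually (lt_mem_nhds hgt)] with y hy hy'
      by_contra hcon
      push Not at hcon
      have ha' : a ∈ farSide y := ⟨ha.le.trans hm.1, fun h => absurd h hy'.not_gt⟩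
      rcases hcon.lt_or_eq with h | h
      · exact (mainH_pos_of_gt ha' h).not_gt hy
      · rw [← h, mainH_levelX] at hy
        exact hy.false
  have high : ∀ a, levelX y₀ < a → ∀ᶠ y in 𝓝 y₀, levelX y < a := by
    have key : ∀ a ∈ farSide y₀, levelX y₀ < a → ∀ᶠ y in 𝓝 y₀, levelX y < a := by
      intro a hf ha
      have h1 := continuousAt_curve_left (continuousAt_mainH_farSide hf)
      filter_upwards [h1.eventually (lt_mem_nhds (mainH_pos_of_gt hf ha))] with y hy
      by_contra hcon
      push Not at hcon
      rcases hcon.lt_or_eq with h | h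
      · exact (mainH_neg_of_lt h).not_gt hy
      · rw [h, mainH_levelX] at hy
        exact hy.false
    intro a ha
    by_cases hy : |y₀| < z1.im
    · have hb : min a z1.re ∈ farSide y₀ := ⟨(min_le_right _ _).trans h0.le, fun _ => min_le_right _ _⟩
      filter_upwards [key _ hb (lt_min ha (levelX_lt hy))] with y hy
      exact hy.trans_le (min_le_left _ _)
    · have hb : min a 0 ∈ farSide y₀ := ⟨min_le_right _ _, fun h => absurd h hy⟩
      filter_upwards [key _ hb (lt_min ha (levelX_lt_zero _))] with y hy
      exact hy.trans_le (min_le_left _ _)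
  exact tendsto_order.2 ⟨low, high⟩

/-! ### The critical height on the imaginary axis -/

theorem tendsto_boxH_zero : Tendsto boxH (𝓝[leftSet] 0) atBot := by
  have h1 : Tendsto (fun z => hFun (pairRoot z (-boxSqrt z))) (𝓝[leftSet] 0)
      (𝓝 (hFun (-maxRoot 0))) := by
    have hp : IsPreimage (-0) (-maxRoot 0) := (maxRoot_isPreimage 0).neg
    exact (continuousAt_hFun hp).tendsto.comp tendsto_lower_zero
  -- The upper sheet has its pole at the origin, where `hFun` tends to `-∞`; the lower sheet stays
  -- finite there.
  exact (tendsto_hFun_upper_zero.atBot_add h1.neg).congr fun z => (sub_eq_add_neg _ _).symm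

theorem mainH_imaginary_neg_eventually : ∀ᶠ y in 𝓝[>] (0 : ℝ), mainH (pt 0 y) < 0 := by
  have h1 : Tendsto (fun y : ℝ => pt 0 y) (𝓝[>] 0) (𝓝[leftSet] 0) := by
    refine tendsto_nhdsWithin_iff.2 ⟨?_, ?_⟩
    · have := (hasDerivAt_pt_right 0 0).continuousAt.tendsto
      exact this.mono_left nhdsWithin_le_nhds
    · filter_upwards [self_mem_nhdsWithin] with y hy
      exact ⟨le_rfl, pt_ne_zero (Or.inr (ne_of_gt hy))⟩
  filter_upwards [(tendsto_boxH_zero.comp h1).eventually (eventually_lt_atBot 0),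
    self_mem_nhdsWithin] with y hy hy0
  rwa [← boxH_eq (pt_ne_zero (Or.inr (ne_of_gt hy0)))
    (pairM_re_neg_of_imaginary (z := pt 0 y) rfl hy0)]

theorem exists_critHeight : ∃ y, 0 < y ∧ y < z1.im ∧ mainH (pt 0 y) = 0 := by
  have hy1 := z1_im_pos
  obtain ⟨a, ha, ha0, ha1⟩ := (mainH_imaginary_neg_eventually.and
    (Ioo_mem_nhdsGT hy1)).exists
  have hpos := mainH_imaginary_pos (y := z1.im) (le_abs_self _)
  have hc : ContinuousOn (fun y => mainH (pt 0 y)) (Icc a z1.im) := fun y hy => by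
    have h1 : 0 < y := ha0.trans_le hy.1
    exact (continuousAt_curve_left (continuousAt_mainH (z := pt 0 y) le_rfl
      (pt_ne_zero (Or.inr h1.ne')) (Or.inl (pairM_re_neg_of_imaginary (z := pt 0 y) rfl
      h1).ne))).continuousWithinAt
  obtain ⟨y, hy, h⟩ := intermediate_value_Ioo ha1.le hc ⟨ha, hpos⟩
  exact ⟨y, ha0.trans hy.1, hy.2, h⟩

/-- The height at which `mainH` vanishes on the imaginary axis. -/
def critHeight : ℝ := exists_critHeight.choose

theorem critHeight_pos : 0 < critHeight := exists_critHeight.choose_spec.1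
theorem critHeight_lt : critHeight < z1.im := exists_critHeight.choose_spec.2.1
theorem mainH_critHeight : mainH (pt 0 critHeight) = 0 := exists_critHeight.choose_spec.2.2

theorem mainH_pt_neg_zero {y : ℝ} (hy : y ≠ 0) : mainH (pt 0 (-y)) = mainH (pt 0 y) := by
  have key : ∀ y, 0 < y → mainH (pt 0 (-y)) = mainH (pt 0 y) := fun y h => by
    rw [← conj_pt, mainH_conj (z := pt 0 y) le_rfl (pt_ne_zero (Or.inr h.ne'))
      (Or.inl (pairM_re_neg_of_imaginary (z := pt 0 y) rfl h).ne)]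
  rcases lt_or_gt_of_ne hy with h | h
  · have := key (-y) (by linarith)
    rw [neg_neg] at this
    exact this.symm
  · exact key y h

theorem mainH_pt_abs {y : ℝ} (hy : y ≠ 0) : mainH (pt 0 |y|) = mainH (pt 0 y) := by
  rcases abs_choice y with h | h
  · rw [h]
  · rw [h, mainH_pt_neg_zero hy]

theorem mainH_imaginary_neg_iff {y : ℝ} (hy : y ≠ 0) :
    mainH (pt 0 y) < 0 ↔ |y| < critHeight := by
  have h : mainH (pt 0 |y|) < mainH (pt 0 critHeight) ↔ |y| < critHeight :=
    strictMonoOn_mainH_imaginary.lt_iff_lt (abs_pos.2 hy) critHeight_pos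
  rwa [mainH_pt_abs hy, mainH_critHeight] at h

theorem mainH_imaginary_eq_iff {y : ℝ} (hy : y ≠ 0) :
    mainH (pt 0 y) = 0 ↔ |y| = critHeight := by
  have h : mainH (pt 0 |y|) = mainH (pt 0 critHeight) ↔ |y| = critHeight :=
    strictMonoOn_mainH_imaginary.eq_iff_eq (abs_pos.2 hy) critHeight_pos
  rwa [mainH_pt_abs hy, mainH_critHeight] at h

/-! ### The level curve to the right of the branch points -/

theorem pairM_re_neg_imaginary {y : ℝ} (hy : y ≠ 0) : (pairM (pt 0 y)).re < 0 := by
  rcases lt_or_gt_of_ne hy with h | h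
  · have := pairM_re_neg_of_imaginary (z := pt 0 (-y)) rfl (by simpa using h)
    rwa [← conj_pt, conj_pairM (z := pt 0 y) le_rfl (pt_ne_zero (Or.inr hy)),
      Complex.conj_re] at this
  · exact pairM_re_neg_of_imaginary (z := pt 0 y) rfl h

theorem boxH_imaginary {y : ℝ} (hy : y ≠ 0) : boxH (pt 0 y) = mainH (pt 0 y) :=
  boxH_eq (pt_ne_zero (Or.inr hy)) (pairM_re_neg_imaginary hy)

theorem pairM_re_neg_of_right {x x' y : ℝ} (hy : y ≠ 0) (hx : x < x') (hx' : x' ≤ 0)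
    (hm : (pairM (pt x y)).re ≤ 0) : (pairM (pt x' y)).re < 0 := by
  rcases lt_or_gt_of_ne hy with h | h
  · have hc : ∀ x ≤ 0, (pairM (pt x (-y))).re = (pairM (pt x y)).re := fun x hx => by
      rw [← conj_pt, conj_pairM (z := pt x y) hx (pt_ne_zero (Or.inr hy)), Complex.conj_re]
    rw [← hc x' hx']
    exact pairM_re_neg_right (by linarith) hx hx' (by rw [hc x (hx.le.trans hx')]; exact hm)
  · exact pairM_re_neg_right h hx hx' hm

theorem continuousAt_curve_right {f : ℂ → ℝ} {x y : ℝ} (h : ContinuousAt f (pt x y)) :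
    ContinuousAt (fun u => f (pt u y)) x :=
  ContinuousAt.comp (f := fun u : ℝ => pt u y) (x := x) (g := f) h
    (hasDerivAt_pt_left x y).continuousAt

/-- As long as `Re m > 0`, the square root `boxSqrt` is `-mainSqrt`, and `boxH` decreases to the
right. It starts from a negative value on the vertical line through the branch points. -/
theorem boxH_neg_of_pairM {x y : ℝ} (hy : |y| < z1.im) (hx : z1.re ≤ x) (hx0 : x ≤ 0)
    (hne : pt x y ≠ 0) (hm : 0 ≤ (pairM (pt x y)).re) : boxH (pt x y) < 0 := by
  have h0 := z1_re_neg
  have h1 : boxH (pt z1.re y) < 0 := by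
    rw [boxH_eq_neg (pt_ne_zero (Or.inl h0.ne)) (pairM_re_pos_strip hy le_rfl)]
    linarith [mainH_vertical_pos hy]
  have hpos : ∀ u ≤ x, pt u y ≠ 0 ∧ u ≤ 0 := by
    intro u hu
    refine ⟨?_, hu.trans hx0⟩
    rcases hu.lt_or_eq with h | h
    · exact pt_ne_zero (Or.inl (h.trans_le hx0).ne)
    · rwa [h]
  have hm' : ∀ u < x, 0 < (pairM (pt u y)).re := by
    intro u hu
    by_cases hy0 : y = 0
    · exact (pairM_of_real (z := pt u y) (hu.trans_le hx0) hy0).1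
    · by_contra hcon
      push Not at hcon
      exact (pairM_re_neg_of_right hy0 hu hx0 hcon).not_ge hm
  have hcont : ∀ u ≤ x, ContinuousAt boxH (pt u y) := fun u hu =>
    continuousAt_boxH (hpos u hu).2 (hpos u hu).1
      (slit_box (hpos u hu).2 (hpos u hu).1 hy)
  have hanti : AntitoneOn (fun u => boxH (pt u y)) (Icc z1.re x) := by
    apply antitoneOn_of_deriv_nonpos (convex_Icc _ _)
    · exact fun u hu => (continuousAt_curve_right (hcont u hu.2)).continuousWithinAt
    · intro u hu
      rw [interior_Icc] at hu
      have hd := hasDerivAt_hDiff (S := boxSqrt) (hasDerivAt_pt_left u y) (hpos u hu.2.le).2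
        (hpos u hu.2.le).1 (continuousAt_boxSqrt (hpos u hu.2.le).2 (hpos u hu.2.le).1
        (Or.inl (hm' u hu.2).ne')) (fun z hz => boxSqrt_sq hz) ?_
      · exact hd.differentiableAt.differentiableWithinAt
      · rw [boxSqrt_eq_neg (hpos u hu.2.le).1 (hm' u hu.2)]
        exact neg_ne_zero.2 (mainSqrt_ne_zero (Or.inl (hm' u hu.2).ne'))
    · intro u hu
      rw [interior_Icc] at hu
      have hd := hasDerivAt_hDiff (S := boxSqrt) (hasDerivAt_pt_left u y) (hpos u hu.2.le).2
        (hpos u hu.2.le).1 (continuousAt_boxSqrt (hpos u hu.2.le).2 (hpos u hu.2.le).1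
        (Or.inl (hm' u hu.2).ne')) (fun z hz => boxSqrt_sq hz) ?_
      · have e : deriv (fun u => boxH (pt u y)) u = _ := hd.deriv
        rw [e, boxSqrt_eq_neg (hpos u hu.2.le).1 (hm' u hu.2)]
        have := mainSqrt_re_pos (z := pt u y) (Or.inl (hm' u hu.2).ne')
        simp
        exact this.le
      · rw [boxSqrt_eq_neg (hpos u hu.2.le).1 (hm' u hu.2)]
        exact neg_ne_zero.2 (mainSqrt_ne_zero (Or.inl (hm' u hu.2).ne'))
  exact (hanti (left_mem_Icc.2 hx) (right_mem_Icc.2 hx) hx).trans_lt h1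

theorem pairM_re_neg_of_boxH {x y : ℝ} (hy : |y| < z1.im) (hx : z1.re ≤ x) (hx0 : x ≤ 0)
    (hne : pt x y ≠ 0) (h : 0 ≤ boxH (pt x y)) : (pairM (pt x y)).re < 0 := by
  by_contra hcon
  exact (boxH_neg_of_pairM hy hx hx0 hne (not_lt.1 hcon)).not_ge h

/-- Where `boxH ≥ 0`, necessarily `Re m < 0`, and this persists to the right. There `boxH` is the
increasing function `mainH`, so a line carries at most one zero. -/
theorem boxH_lt_boxH {x x' y : ℝ} (hy : |y| < z1.im) (hx : z1.re ≤ x) (hxx : x < x')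
    (hx' : x' ≤ 0) (h : 0 ≤ boxH (pt x y)) : boxH (pt x y) < boxH (pt x' y) := by
  have hx0 : x < 0 := hxx.trans_le hx'
  have hm := pairM_re_neg_of_boxH hy hx hx0.le (pt_ne_zero (Or.inl hx0.ne)) h
  have hy0 : y ≠ 0 := by
    rintro rfl
    exact (pairM_of_real (z := pt x 0) hx0 rfl).1.not_gt hm
  have hm' : ∀ u ∈ Icc x x', (pairM (pt u y)).re < 0 := fun u hu => by
    rcases hu.1.lt_or_eq with h | h
    · exact pairM_re_neg_of_right hy0 h (hu.2.trans hx') hm.le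
    · rwa [← h]
  have hne : ∀ u, pt u y ≠ 0 := fun u => pt_ne_zero (Or.inr hy0)
  have := strictMonoOn_mainH_line (y := y) (convex_Icc x x') (fun u hu => hu.2.trans hx')
    (fun u hu => ⟨hne u, continuousAt_mainH (z := pt u y) (hu.2.trans hx') (hne u)
      (Or.inl (hm' u hu).ne)⟩) (fun u hu => Or.inl (hm' u (interior_subset hu)).ne)
    (left_mem_Icc.2 hxx.le) (right_mem_Icc.2 hxx.le) hxx
  rw [boxH_eq (hne x) hm, boxH_eq (hne x') (hm' x' (right_mem_Icc.2 hxx.le))]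
  exact this

/-- The difference of `hFun` at the largest preimage and at the lower of the other two. -/
def lowH (z : ℂ) : ℝ := hFun (maxRoot z) - hFun (pairRoot z (-boxSqrt z))

/-- The difference of `hFun` at the upper of the two smaller preimages and at the largest one. -/
def upH (z : ℂ) : ℝ := hFun (pairRoot z (boxSqrt z)) - hFun (maxRoot z)

theorem upH_add_lowH (z : ℂ) : upH z + lowH z = boxH z := by
  unfold upH lowH boxH hDiff
  ring

theorem boxSqrt_ne_zero {z : ℂ} (hz : z ≠ 0) (h : (pairM z).re ≠ 0 ∨ 3 < (pairM z).im ^ 2) :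
    boxSqrt z ≠ 0 := by
  intro h0
  have h1 := boxSqrt_sq hz
  have h2 := mainSqrt_sq z
  rw [h0, zero_pow two_ne_zero] at h1
  rw [pairD] at h1
  have h3 : pairM z ^ 2 = -3 := by linear_combination -3 * h1
  obtain ⟨e1, e2⟩ := eq_mul_I_of_sq (d := 0) (by rw [h3]; norm_num) le_rfl
  rcases h with h | h
  · exact h e1
  · linarith

theorem hasDerivAt_lowH {x y : ℝ} (hx : x ≤ 0) (hz0 : pt x y ≠ 0)
    (h : (pairM (pt x y)).re ≠ 0 ∨ 3 < (pairM (pt x y)).im ^ 2) :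
    ∃ d > 0, HasDerivAt (fun u => lowH (pt u y)) d x := by
  have h1 := hasDerivAt_hFun_maxRoot (hasDerivAt_pt_left x y) hx hz0
  have h2 := hasDerivAt_hFun_pairRoot (S := fun z => -boxSqrt z) (hasDerivAt_pt_left x y) hx hz0
    (continuousAt_boxSqrt hx hz0 h).neg (fun z hz => by rw [neg_sq, boxSqrt_sq hz])
    (neg_ne_zero.2 (boxSqrt_ne_zero hz0 h))
  refine ⟨_, ?_, h1.sub h2⟩
  have := pairRoot_re_lt (s := -boxSqrt (pt x y)) hx hz0 (by rw [neg_sq, boxSqrt_sq hz0])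
  simp
  exact this

theorem hasDerivAt_upH {x y : ℝ} (hx : x ≤ 0) (hz0 : pt x y ≠ 0)
    (h : (pairM (pt x y)).re ≠ 0 ∨ 3 < (pairM (pt x y)).im ^ 2) :
    ∃ d < 0, HasDerivAt (fun u => upH (pt u y)) d x := by
  have h1 := hasDerivAt_hFun_maxRoot (hasDerivAt_pt_left x y) hx hz0
  have h2 := hasDerivAt_hFun_pairRoot (S := boxSqrt) (hasDerivAt_pt_left x y) hx hz0
    (continuousAt_boxSqrt hx hz0 h) (fun z hz => boxSqrt_sq hz) (boxSqrt_ne_zero hz0 h)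
  refine ⟨_, ?_, h2.sub h1⟩
  have := pairRoot_re_lt (s := boxSqrt (pt x y)) hx hz0 (boxSqrt_sq hz0)
  simp
  exact this

theorem strictMonoOn_lowH {y : ℝ} (hy : |y| < z1.im) {s : Set ℝ} (hs : Convex ℝ s)
    (hs0 : ∀ x ∈ s, x ≤ 0 ∧ pt x y ≠ 0) : StrictMonoOn (fun x => lowH (pt x y)) s := by
  have hd : ∀ x ∈ s, ∃ d > 0, HasDerivAt (fun u => lowH (pt u y)) d x := fun x hx =>
    hasDerivAt_lowH (hs0 x hx).1 (hs0 x hx).2 (slit_box (hs0 x hx).1 (hs0 x hx).2 hy)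
  apply strictMonoOn_of_deriv_pos hs
  · intro x hx
    obtain ⟨d, _, h⟩ := hd x hx
    exact h.continuousAt.continuousWithinAt
  · intro x hx
    obtain ⟨d, h0, h⟩ := hd x (interior_subset hx)
    rwa [h.deriv]

theorem strictAntiOn_upH {y : ℝ} (hy : |y| < z1.im) {s : Set ℝ} (hs : Convex ℝ s)
    (hs0 : ∀ x ∈ s, x ≤ 0 ∧ pt x y ≠ 0) : StrictAntiOn (fun x => upH (pt x y)) s := by
  have hd : ∀ x ∈ s, ∃ d < 0, HasDerivAt (fun u => upH (pt u y)) d x := fun x hx =>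
    hasDerivAt_upH (hs0 x hx).1 (hs0 x hx).2 (slit_box (hs0 x hx).1 (hs0 x hx).2 hy)
  apply strictAntiOn_of_deriv_neg hs
  · intro x hx
    obtain ⟨d, _, h⟩ := hd x hx
    exact h.continuousAt.continuousWithinAt
  · intro x hx
    obtain ⟨d, h0, h⟩ := hd x (interior_subset hx)
    rwa [h.deriv]

/-- On the imaginary axis the lower preimage is the reflection of the largest one. -/
theorem pairRoot_imaginary {y : ℝ} (hy : y ≠ 0) :
    pairRoot (pt 0 y) (-mainSqrt (pt 0 y)) = -starRingEnd ℂ (maxRoot (pt 0 y)) := by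
  have hz0 : pt 0 y ≠ 0 := pt_ne_zero (Or.inr hy)
  have hc := maxRoot_re_pos (z := pt 0 y) le_rfl
  have ht := isTriple_pairRoot hz0 (mainSqrt_sq (pt 0 y))
  have hs := mainSqrt_re_pos (Or.inl (pairM_re_neg_imaginary hy).ne)
  have hp : IsPreimage (pt 0 y) (-starRingEnd ℂ (maxRoot (pt 0 y))) := by
    have h := (maxRoot_isPreimage (pt 0 y)).conj.neg
    have e : -starRingEnd ℂ (pt 0 y) = pt 0 y := by
      apply Complex.ext <;> simp
    rwa [e] at h
  have hsum : (maxRoot (pt 0 y)).re + (pairRoot (pt 0 y) (mainSqrt (pt 0 y))).re +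
      (pairRoot (pt 0 y) (-mainSqrt (pt 0 y))).re = 0 := by
    have h := ht.1
    have e : maxRoot (pt 0 y) + pairRoot (pt 0 y) (mainSqrt (pt 0 y)) +
      pairRoot (pt 0 y) (-mainSqrt (pt 0 y)) = 1 / pt 0 y := by
      rw [eq_div_iff hz0, mul_comm]
      exact h
    have := congrArg Complex.re e
    rw [one_div, Complex.inv_re, pt_re, zero_div] at this
    simpa using this
  have hsub := congrArg Complex.re (pairRoot_sub (pt 0 y) (mainSqrt (pt 0 y)))
  rw [Complex.sub_re] at hsub
  rcases (ht.isPreimage_iff _).1 hp with h | h | h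
  · have := congrArg Complex.re h
    simp at this
    linarith
  · have := congrArg Complex.re h
    simp at this
    linarith
  · exact h.symm

theorem lowH_imaginary {y : ℝ} (hy : y ≠ 0) : lowH (pt 0 y) = 0 := by
  have hz0 : pt 0 y ≠ 0 := pt_ne_zero (Or.inr hy)
  rw [lowH, boxSqrt_eq hz0 (pairM_re_neg_imaginary hy), pairRoot_imaginary hy, hFun_neg, hFun_conj,
    sub_self]

theorem upH_imaginary {y : ℝ} (hy : y ≠ 0) : upH (pt 0 y) = mainH (pt 0 y) := by
  rw [← boxH_imaginary hy, ← upH_add_lowH, lowH_imaginary hy, add_zero]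

theorem tendsto_pt_left_zero : Tendsto (fun x : ℝ => pt x 0) (𝓝[<] 0) (𝓝[leftSet] 0) := by
  refine tendsto_nhdsWithin_iff.2 ⟨?_, ?_⟩
  · have := (hasDerivAt_pt_left 0 0).continuousAt.tendsto
    exact this.mono_left nhdsWithin_le_nhds
  · filter_upwards [self_mem_nhdsWithin] with x hx
    exact ⟨le_of_lt hx, pt_ne_zero (Or.inl (ne_of_lt hx))⟩

theorem tendsto_hFun_maxRoot_zero :
    Tendsto (fun z => hFun (maxRoot z)) (𝓝[leftSet] 0) (𝓝 (hFun (maxRoot 0))) :=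
  (continuousAt_hFun (maxRoot_isPreimage 0)).tendsto.comp tendsto_maxRoot_zero

theorem tendsto_lowH_zero : Tendsto lowH (𝓝[leftSet] 0) (𝓝 0) := by
  have hp : IsPreimage (-0) (-maxRoot 0) := (maxRoot_isPreimage 0).neg
  have := tendsto_hFun_maxRoot_zero.sub ((continuousAt_hFun hp).tendsto.comp tendsto_lower_zero)
  rwa [hFun_neg, sub_self] at this

theorem tendsto_upH_zero : Tendsto upH (𝓝[leftSet] 0) atBot :=
  (tendsto_hFun_upper_zero.atBot_add tendsto_hFun_maxRoot_zero.neg).congr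
    fun _ => (sub_eq_add_neg _ _).symm

/-- The horizontal derivative is positive because `maxRoot` has the greatest real part, and the
value on the imaginary axis is `0`. On the real axis the value at the origin is replaced by the
limit. -/
theorem lowH_neg {x y : ℝ} (hy : |y| < z1.im) (hx : x < 0) : lowH (pt x y) < 0 := by
  by_cases hy0 : y = 0
  · rw [hy0] at hy ⊢
    have hm := strictMonoOn_lowH hy (convex_Iio 0)
      (fun x hx => ⟨le_of_lt hx, pt_ne_zero (Or.inl (ne_of_lt hx))⟩)
    have hx2 : x < x / 2 := by linarith
    have hx2' : x / 2 < 0 := by linarith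
    have h1 : lowH (pt (x / 2) 0) ≤ 0 := by
      refine ge_of_tendsto (tendsto_lowH_zero.comp tendsto_pt_left_zero) ?_
      filter_upwards [Ioo_mem_nhdsLT hx2'] with u hu
      exact (hm hx2' hu.2 hu.1).le
    exact (hm hx hx2' hx2).trans_le h1
  · have hm := strictMonoOn_lowH hy (convex_Iic 0) (fun x hx => ⟨hx, pt_ne_zero (Or.inr hy0)⟩)
      hx.le (self_mem_Iic) hx
    simp only [lowH_imaginary hy0] at hm
    exact hm

theorem levelX_re_pos {y : ℝ} (hy : |y| < z1.im) : 0 < (pairM (pt (levelX y) y)).re :=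
  pairM_re_pos_strip hy (levelX_lt hy).le

/-- At `levelX` the sum `upH + lowH` vanishes and `lowH` is negative, so `upH` is positive. Below
the critical height `upH` is negative near the imaginary axis, since it equals `mainH` on the axis
and tends to `-∞` at the origin. -/
theorem exists_upH_zero {y : ℝ} (hy : |y| < critHeight) : ∃ x < 0, upH (pt x y) = 0 := by
  have hy1 : |y| < z1.im := hy.trans critHeight_lt
  have ha : 0 < upH (pt (levelX y) y) := by
    have h1 := upH_add_lowH (pt (levelX y) y)
    have h2 := lowH_neg hy1 (levelX_lt_zero y)
    rw [boxH_eq_neg (pt_ne_zero (Or.inl (levelX_lt_zero y).ne)) (levelX_re_pos hy1),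
      mainH_levelX] at h1
    linarith
  obtain ⟨b, hb, hb0, hb1⟩ : ∃ b, upH (pt b y) < 0 ∧ levelX y < b ∧ b < 0 := by
    by_cases hy0 : y = 0
    · rw [hy0]
      obtain ⟨b, hb, hb'⟩ := (((tendsto_upH_zero.comp tendsto_pt_left_zero).eventually
        (eventually_lt_atBot 0)).and (Ioo_mem_nhdsLT (levelX_lt_zero 0))).exists
      exact ⟨b, hb, hb'⟩
    · have h0 : upH (pt 0 y) < 0 := by
        rw [upH_imaginary hy0]
        exact (mainH_imaginary_neg_iff hy0).2 hy
      have hz0 : pt 0 y ≠ 0 := pt_ne_zero (Or.inr hy0)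
      obtain ⟨d, _, hd⟩ := hasDerivAt_upH le_rfl hz0 (slit_box le_rfl hz0 hy1)
      have h2 := (hd.continuousAt.eventually (gt_mem_nhds h0)).filter_mono
        (nhdsWithin_le_nhds (s := Iio 0))
      obtain ⟨b, hb, hb'⟩ := (h2.and (Ioo_mem_nhdsLT (levelX_lt_zero y))).exists
      exact ⟨b, hb, hb'⟩
  have hc : ContinuousOn (fun x => upH (pt x y)) (Icc (levelX y) b) := fun x hx => by
    have hx0 : x < 0 := hx.2.trans_lt hb1
    have hz0 : pt x y ≠ 0 := pt_ne_zero (Or.inl hx0.ne)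
    obtain ⟨d, _, hd⟩ := hasDerivAt_upH hx0.le hz0 (slit_box (z := pt x y) hx0.le hz0 hy1)
    exact hd.continuousAt.continuousWithinAt
  obtain ⟨x, hx, h⟩ := intermediate_value_Icc' hb0.le hc ⟨hb.le, ha.le⟩
  exact ⟨x, hx.2.trans_lt hb1, h⟩

theorem upH_injOn {y : ℝ} (hy : |y| < z1.im) {x x' : ℝ} (hx : x < 0) (hx' : x' < 0)
    (h : upH (pt x y) = upH (pt x' y)) : x = x' :=
  (strictAntiOn_upH hy (convex_Iio 0)
    (fun _ hx => ⟨le_of_lt hx, pt_ne_zero (Or.inl (ne_of_lt hx))⟩)).injOn hx hx' h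

theorem upH_pos {x y : ℝ} (hy : critHeight ≤ |y|) (hy1 : |y| < z1.im) (hx : x < 0) :
    0 < upH (pt x y) := by
  have hy0 : y ≠ 0 := by
    rintro rfl
    rw [abs_zero] at hy
    exact critHeight_pos.not_ge hy
  have h := strictAntiOn_upH hy1 (convex_Iic 0) (fun x hx => ⟨hx, pt_ne_zero (Or.inr hy0)⟩)
    hx.le (self_mem_Iic) hx
  simp only [upH_imaginary hy0] at h
  refine lt_of_le_of_lt ?_ h
  have := (mainH_imaginary_neg_iff hy0).not.2 (not_lt.2 hy)
  exact not_lt.1 this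

theorem exists_boxH_zero {y : ℝ} (hy : critHeight ≤ |y|) (hy1 : |y| < z1.im) :
    ∃ x, z1.re ≤ x ∧ x ≤ 0 ∧ boxH (pt x y) = 0 := by
  have hy0 : y ≠ 0 := by
    rintro rfl
    rw [abs_zero] at hy
    exact critHeight_pos.not_ge hy
  have h0 := z1_re_neg
  have hne : ∀ u, pt u y ≠ 0 := fun u => pt_ne_zero (Or.inr hy0)
  have hc : ContinuousOn (fun x => boxH (pt x y)) (Icc z1.re 0) := fun x hx =>
    (continuousAt_curve_right (continuousAt_boxH (z := pt x y) hx.2 (hne x)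
      (slit_box (z := pt x y) hx.2 (hne x) hy1))).continuousWithinAt
  have ha : boxH (pt z1.re y) < 0 :=
    boxH_neg_of_pairM hy1 le_rfl h0.le (hne _) (pairM_re_pos_strip hy1 le_rfl).le
  have hb : 0 ≤ boxH (pt 0 y) := by
    rw [boxH_imaginary hy0]
    exact not_lt.1 ((mainH_imaginary_neg_iff hy0).not.2 (not_lt.2 hy))
  obtain ⟨x, hx, h⟩ := intermediate_value_Icc h0.le hc ⟨ha.le, hb⟩
  exact ⟨x, hx.1, hx.2, h⟩

theorem boxH_zero_unique {x x' y : ℝ} (hy1 : |y| < z1.im) (hx : z1.re ≤ x) (hx0 : x ≤ 0)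
    (hx' : z1.re ≤ x') (hx0' : x' ≤ 0) (h : boxH (pt x y) = 0) (h' : boxH (pt x' y) = 0) :
    x = x' := by
  rcases lt_trichotomy x x' with h1 | h1 | h1
  · have := boxH_lt_boxH hy1 hx h1 hx0' h.ge
    linarith
  · exact h1
  · have := boxH_lt_boxH hy1 hx' h1 hx0 h'.ge
    linarith

/-- Below the critical height there are no zeros of `boxH` to the right of the branch point. -/
theorem critHeight_le_of_boxH {x y : ℝ} (hy1 : |y| < z1.im) (hx : z1.re ≤ x) (hx0 : x ≤ 0)
    (hne : pt x y ≠ 0) (h : boxH (pt x y) = 0) : critHeight ≤ |y| ∧ (x = 0 → |y| = critHeight) ∧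
      (|y| = critHeight → x = 0) := by
  have hy0 : y ≠ 0 := by
    rintro rfl
    have hm := pairM_re_neg_of_boxH hy1 hx hx0 hne h.ge
    have hx1 : x < 0 := lt_of_le_of_ne hx0 (by rintro rfl; exact hne rfl)
    exact (pairM_of_real (z := pt x 0) hx1 rfl).1.not_gt hm
  have h0 : 0 ≤ mainH (pt 0 y) ∧ (mainH (pt 0 y) = 0 → x = 0) := by
    rcases hx0.lt_or_eq with h1 | h1
    · have := boxH_lt_boxH hy1 hx h1 le_rfl h.ge
      rw [boxH_imaginary hy0, h] at this
      exact ⟨this.le, fun h => absurd h this.ne'⟩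
    · refine ⟨?_, fun _ => h1⟩
      rw [h1] at h
      rw [← boxH_imaginary hy0, h]
  refine ⟨not_lt.1 fun h' => ?_, fun h' => ?_, fun h' => ?_⟩
  · have := (mainH_imaginary_neg_iff hy0).2 h'
    linarith
  · rw [h', boxH_imaginary hy0] at h
    exact (mainH_imaginary_eq_iff hy0).1 h
  · exact h0.2 ((mainH_imaginary_eq_iff hy0).2 h')

/-- Below the critical height the curve runs in the right half plane and is described through the
reflected point; between the critical and the branch height it runs in the left half plane. Beyond
the branch height `Re z₁` is a default value that makes the function continuous at the ends. -/
theorem exists_starX (y : ℝ) : ∃ x : ℝ, (|y| < critHeight → 0 < x ∧ upH (pt (-x) y) = 0) ∧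
    (critHeight ≤ |y| → |y| < z1.im → z1.re ≤ x ∧ x ≤ 0 ∧ boxH (pt x y) = 0) ∧
    (z1.im ≤ |y| → x = z1.re) := by
  have := critHeight_lt
  rcases lt_or_ge |y| critHeight with h | h
  · obtain ⟨x, hx, hx'⟩ := exists_upH_zero h
    exact ⟨-x, fun _ => ⟨by linarith, by rwa [neg_neg]⟩, fun h' => by linarith,
      fun h' => by linarith⟩
  · rcases lt_or_ge |y| z1.im with h' | h'
    · obtain ⟨x, hx, hx'⟩ := exists_boxH_zero h h'
      exact ⟨x, fun h' => by linarith, fun _ _ => ⟨hx, hx'⟩, fun h' => by linarith⟩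
    · exact ⟨z1.re, fun h' => by linarith, fun _ h' => by linarith, fun _ => rfl⟩

/-- The abscissa at height `y` of the closed-up level curve on the near side. -/
def starX (y : ℝ) : ℝ := (exists_starX y).choose

theorem starX_below {y : ℝ} (h : |y| < critHeight) : 0 < starX y ∧ upH (pt (-starX y) y) = 0 :=
  (exists_starX y).choose_spec.1 h

theorem starX_above {y : ℝ} (h : critHeight ≤ |y|) (h' : |y| < z1.im) :
    z1.re ≤ starX y ∧ starX y ≤ 0 ∧ boxH (pt (starX y) y) = 0 :=
  (exists_starX y).choose_spec.2.1 h h'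

theorem starX_end {y : ℝ} (h : z1.im ≤ |y|) : starX y = z1.re :=
  (exists_starX y).choose_spec.2.2 h

theorem starX_crit {y : ℝ} (h : |y| = critHeight) : starX y = 0 := by
  have h' : |y| < z1.im := h.le.trans_lt critHeight_lt
  obtain ⟨h1, h2, h3⟩ := starX_above h.ge h'
  have hy0 : y ≠ 0 := by
    rintro rfl
    rw [abs_zero] at h
    exact critHeight_pos.ne h
  exact (critHeight_le_of_boxH h' h1 h2 (pt_ne_zero (Or.inr hy0)) h3).2.2 h

theorem eq_starX_of_boxH {x y : ℝ} (hy1 : |y| < z1.im) (hx : z1.re ≤ x) (hx0 : x ≤ 0)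
    (hne : pt x y ≠ 0) (h : boxH (pt x y) = 0) : x = starX y := by
  have hy := (critHeight_le_of_boxH hy1 hx hx0 hne h).1
  obtain ⟨h1, h2, h3⟩ := starX_above hy hy1
  exact boxH_zero_unique hy1 hx hx0 h1 h2 h h3

theorem eq_starX_of_upH {x y : ℝ} (hy1 : |y| < z1.im) (hx : 0 < x)
    (h : upH (pt (-x) y) = 0) : x = starX y := by
  have hy : |y| < critHeight := by
    by_contra hcon
    exact (upH_pos (not_lt.1 hcon) hy1 (neg_lt_zero.2 hx)).ne' h
  obtain ⟨h1, h2⟩ := starX_below hy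
  have := upH_injOn hy1 (neg_lt_zero.2 hx) (neg_lt_zero.2 h1) (by rw [h, h2])
  linarith

/-- The near-side curve tends to the branch points at the ends. -/
theorem tendsto_starX {y₀ : ℝ} (h : |y₀| = z1.im) : ContinuousAt starX y₀ := by
  have h0 := z1_re_neg
  have hy0 : y₀ ≠ 0 := by
    rintro rfl
    rw [abs_zero] at h
    exact z1_im_pos.ne h
  have hcrit : ∀ᶠ y in 𝓝 y₀, critHeight ≤ |y| := by
    have := continuous_abs.continuousAt.eventually (lt_mem_nhds (h ▸ critHeight_lt :
      critHeight < |y₀|))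
    exact this.mono fun y hy => hy.le
  have key : ∀ ε > 0, ∀ᶠ y in 𝓝 y₀, starX y < z1.re + ε := by
    intro ε hε
    set b := min (z1.re + ε) 0
    have hb0 : b ≤ 0 := min_le_right _ _
    have hb1 : z1.re < b := lt_min (by linarith) h0
    have hbf : b ∈ farSide y₀ := ⟨hb0, fun h' => by rw [h] at h'; exact absurd h' (lt_irrefl _)⟩
    have hb : levelX y₀ < b := by
      have : levelX y₀ = z1.re := by
        rcases (abs_eq z1_im_pos.le).1 h with h | h
        · rw [h, levelX_y1]
        · rw [h, levelX_neg, levelX_y1]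
      rwa [this]
    have hne : ∀ y, y ≠ 0 → pt b y ≠ 0 := fun y hy => pt_ne_zero (Or.inr hy)
    have hm : (pairM (pt b y₀)).re < 0 := by
      have h3 := pairM_re_neg_of_gt hb1 hb0
      rcases (abs_eq z1_im_pos.le).1 h with h | h
      · rwa [h]
      · rwa [h, ← conj_pt, conj_pairM (z := pt b z1.im) hb0
          (pt_ne_zero (Or.inr z1_im_pos.ne')), Complex.conj_re]
    have c1 := continuousAt_curve_left (continuousAt_mainH_farSide hbf)
    have c2 : ContinuousAt (fun v => (pairM (pt b v)).re) y₀ :=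
      continuousAt_curve_left (f := fun z => (pairM z).re)
        (Complex.continuous_re.continuousAt.comp (continuousAt_pairM hb0 (hne _ hy0)))
    -- To the right of a branch point, at its height, `mainH > 0` and `Re m < 0`. Both persist on
    -- nearby lines, where then `boxH > 0` at `b`, so that the zero lies to the left of `b`.
    filter_upwards [c1.eventually (lt_mem_nhds (mainH_pos_of_gt hbf hb)),
      c2.eventually (gt_mem_nhds hm), hcrit, eventually_ne_nhds hy0] with y h1 h2 h3 h4
    rcases lt_or_ge |y| z1.im with h' | h'
    · obtain ⟨e1, e2, e3⟩ := starX_above h3 h'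
      rw [← boxH_eq (hne y h4) h2] at h1
      have : starX y < b := by
        by_contra hcon
        push Not at hcon
        rcases hcon.lt_or_eq with h5 | h5
        · have := boxH_lt_boxH h' hb1.le h5 e2 h1.le
          linarith
        · rw [← h5] at e3
          linarith
      exact this.trans_le (min_le_left _ _)
    · rw [starX_end h']
      linarith
  have hge : ∀ᶠ y in 𝓝 y₀, z1.re ≤ starX y := by
    filter_upwards [hcrit] with y hy
    rcases lt_or_ge |y| z1.im with h' | h'
    · exact (starX_above hy h').1
    · rw [starX_end h']
  unfold ContinuousAt
  rw [starX_end h.ge]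
  refine tendsto_order.2 ⟨fun a ha => ?_, fun a ha => ?_⟩
  · exact hge.mono fun y hy => ha.trans_le hy
  · filter_upwards [key (a - z1.re) (by linarith)] with y hy
    linarith

/-! ### Local branches and analyticity of level curves -/

/-- Near `z₀` the function `q` is a continuous inverse branch of `zMap`. -/
def IsBranchNear (q : ℂ → ℂ) (z₀ : ℂ) : Prop :=
  (∀ᶠ z in 𝓝 z₀, ContinuousAt q z ∧ IsPreimage z (q z)) ∧ zMapDeriv (q z₀) ≠ 0

theorem continuousAt_zMapDeriv {z w : ℂ} (h : IsPreimage z w) : ContinuousAt zMapDeriv w := by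
  have h0 := h.ne_zero
  have h2 : w ^ 2 - 1 ≠ 0 := sub_ne_zero.2 h.sq_ne_one
  unfold zMapDeriv
  fun_prop (disch := simp [h0, h2])

theorem IsBranchNear.continuousAt {q : ℂ → ℂ} {z : ℂ} (h : IsBranchNear q z) :
    ContinuousAt q z := h.1.self_of_nhds.1

theorem IsBranchNear.isPreimage {q : ℂ → ℂ} {z : ℂ} (h : IsBranchNear q z) :
    IsPreimage z (q z) := h.1.self_of_nhds.2

theorem IsBranchNear.eventually {q : ℂ → ℂ} {z₀ : ℂ} (h : IsBranchNear q z₀) :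
    ∀ᶠ z in 𝓝 z₀, IsBranchNear q z := by
  have h1 : ContinuousAt (fun z => zMapDeriv (q z)) z₀ :=
    ContinuousAt.comp (f := q) (continuousAt_zMapDeriv h.isPreimage) h.continuousAt
  filter_upwards [h.1.eventually_nhds, h1.eventually_ne h.2] with z h2 h3
  exact ⟨h2, h3⟩

theorem IsBranchNear.hasDerivAt {q : ℂ → ℂ} {z : ℂ} (h : IsBranchNear q z) :
    HasDerivAt q (zMapDeriv (q z))⁻¹ z :=
  hasDerivAt_of_isPreimage_complex h.continuousAt (h.1.mono fun _ h => h.2) h.2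

theorem IsBranchNear.analyticAt {q : ℂ → ℂ} {z : ℂ} (h : IsBranchNear q z) :
    AnalyticAt ℂ q z := by
  rw [Complex.analyticAt_iff_eventually_differentiableAt]
  exact h.eventually.mono fun w hw => hw.hasDerivAt.differentiableAt

theorem IsBranchNear.exists_primitive {q : ℂ → ℂ} {z₀ : ℂ} (h : IsBranchNear q z₀) :
    ∃ F : ℂ → ℂ, ∀ᶠ z in 𝓝 z₀, (F z).re = hFun (q z) ∧ HasDerivAt F (3 * q z) z := by
  set w := q z₀ with hw
  have hp : IsPreimage z₀ w := h.isPreimage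
  have n0 := inv_ne_zero hp.ne_zero
  have n1 := inv_ne_zero hp.sub_one_ne
  have n2 := inv_ne_zero hp.add_one_ne
  have hs : ∀ (f : ℂ → ℂ), Continuous f → f w ≠ 0 →
      ∀ᶠ z in 𝓝 z₀, (f w)⁻¹ * f (q z) ∈ Complex.slitPlane := by
    intro f hf h0
    have hc : ContinuousAt (fun z => (f w)⁻¹ * f (q z)) z₀ :=
      continuousAt_const.mul (hf.continuousAt.comp h.continuousAt)
    refine hc.eventually (Complex.isOpen_slitPlane.mem_nhds ?_)
    simp only [← hw, inv_mul_cancel₀ h0]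
    exact Complex.one_mem_slitPlane
  refine ⟨fun z => prim w⁻¹ (w - 1)⁻¹ (w + 1)⁻¹ (q z) +
    ((Real.log ‖w⁻¹‖ + Real.log ‖(w - 1)⁻¹‖ + Real.log ‖(w + 1)⁻¹‖ : ℝ) : ℂ), ?_⟩
  filter_upwards [h.eventually, hs (fun w => w) continuous_id hp.ne_zero,
    hs (fun w => w - 1) (by fun_prop) hp.sub_one_ne,
    hs (fun w => w + 1) (by fun_prop) hp.add_one_ne] with z hz h0 h1 h2
  constructor
  · rw [Complex.add_re, prim_re n0 n1 n2 hz.isPreimage, Complex.ofReal_re]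
    ring
  · have hd := ((hasDerivAt_prim hz.isPreimage h0 h1 h2).comp z hz.hasDerivAt).add_const
      (((Real.log ‖w⁻¹‖ + Real.log ‖(w - 1)⁻¹‖ + Real.log ‖(w + 1)⁻¹‖ : ℝ)) : ℂ)
    refine hd.congr_deriv ?_
    have := hz.2
    field_simp

theorem exists_primitive_sub {p q : ℂ → ℂ} {z₀ : ℂ} (hq : IsBranchNear q z₀)
    (hp : IsBranchNear p z₀) : ∃ F : ℂ → ℂ, AnalyticAt ℂ F z₀ ∧
      ∀ᶠ z in 𝓝 z₀, (F z).re = hFun (q z) - hFun (p z) ∧ HasDerivAt F (3 * (q z - p z)) z := by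
  obtain ⟨F, hF⟩ := hq.exists_primitive
  obtain ⟨G, hG⟩ := hp.exists_primitive
  have h : ∀ᶠ z in 𝓝 z₀, (F z - G z).re = hFun (q z) - hFun (p z) ∧
      HasDerivAt (fun z => F z - G z) (3 * (q z - p z)) z := by
    filter_upwards [hF, hG] with z h1 h2
    refine ⟨by rw [Complex.sub_re, h1.1, h2.1], (h1.2.sub h2.2).congr_deriv (by ring)⟩
  refine ⟨fun z => F z - G z, ?_, h⟩
  rw [Complex.analyticAt_iff_eventually_differentiableAt]
  exact h.mono fun z hz => hz.2.differentiableAt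

/-- A level curve of the real part of an analytic function that is a graph over the imaginary
axis is real analytic where the partial derivative in the real direction does not vanish. -/
theorem analyticAt_graph {F : ℂ → ℂ} {g : ℝ → ℝ} {y₀ : ℝ}
    (hF : AnalyticAt ℂ F (pt (g y₀) y₀)) (h0 : (F (pt (g y₀) y₀)).re = 0)
    (hd : (deriv F (pt (g y₀) y₀)).re ≠ 0)
    (hg : ∀ᶠ z in 𝓝 (pt (g y₀) y₀), (F z).re = 0 → z.re = g z.im) :
    AnalyticAt ℝ (fun y => pt (g y) y) y₀ := by
  set z₀ := pt (g y₀) y₀ with hz₀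
  have hd0 : deriv F z₀ ≠ 0 := fun h => hd (by rw [h, Complex.zero_re])
  have hs := hF.hasStrictDerivAt
  set Ψ := hs.localInverse _ _ _ hd0 with hΨdef
  have hΨ : AnalyticAt ℂ Ψ (F z₀) := hF.analyticAt_localInverse hd0
  have hΨ0 : Ψ (F z₀) = z₀ := (hs.eventually_left_inverse hd0).self_of_nhds
  have hΨd : HasDerivAt Ψ (deriv F z₀)⁻¹ (F z₀) := (hs.to_localInverse hd0).hasDerivAt
  set s₀ := (F z₀).im with hs₀
  set ι : ℝ → ℂ := fun s => (s : ℂ) * Complex.I with hι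
  have hι0 : ι s₀ = F z₀ := by
    apply Complex.ext <;> simp [hι, h0, hs₀]
  have hιa : AnalyticAt ℝ ι s₀ :=
    ((Complex.ofRealCLM.analyticAt _).mul analyticAt_const)
  have hιd : HasDerivAt ι Complex.I s₀ := by
    simpa using (hasDerivAt_id s₀).ofReal_comp.mul_const Complex.I
  -- The level set is first parametrized by `Im F`, as the image of a line parallel to the imaginary
  -- direction under the local inverse of `F`. Its height is then inverted, which needs `Re F' ≠ 0`.
  set κ : ℝ → ℂ := fun s => Ψ (ι s) with hκ
  have hκ0 : κ s₀ = z₀ := by rw [hκ]; simp only [hι0, hΨ0]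
  have hκa : AnalyticAt ℝ κ s₀ := by
    have h1 : AnalyticAt ℝ Ψ (ι s₀) := by
      rw [hι0]
      exact hΨ.restrictScalars
    exact h1.comp hιa
  have hκd : HasDerivAt κ ((deriv F z₀)⁻¹ * Complex.I) s₀ := by
    rw [← hι0] at hΨd
    exact HasDerivAt.comp (h₂ := Ψ) s₀ hΨd hιd
  have hκg : ∀ᶠ s in 𝓝 s₀, κ s = pt (g (κ s).im) (κ s).im := by
    have h1 : ∀ᶠ s in 𝓝 s₀, F (κ s) = ι s := by
      refine hιa.continuousAt.tendsto.eventually (p := fun w => F (Ψ w) = w) ?_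
      rw [hι0]
      exact hs.eventually_right_inverse hd0
    have h2 : ∀ᶠ s in 𝓝 s₀, (F (κ s)).re = 0 → (κ s).re = g (κ s).im := by
      refine hκa.continuousAt.tendsto.eventually
        (p := fun z => (F z).re = 0 → z.re = g z.im) ?_
      rw [hκ0]
      exact hg
    filter_upwards [h1, h2] with s a b
    rw [← b (by rw [a]; simp [hι])]
    rfl
  set η : ℝ → ℝ := fun s => (κ s).im with hη
  have hη0 : η s₀ = y₀ := by simp only [hη, hκ0]; rfl
  have hηa : AnalyticAt ℝ η s₀ := (Complex.imCLM.analyticAt _).comp hκa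
  have hηd : HasDerivAt η ((deriv F z₀)⁻¹ * Complex.I).im s₀ :=
    Complex.imCLM.hasFDerivAt.comp_hasDerivAt s₀ hκd
  have hη1 : deriv η s₀ ≠ 0 := by
    rw [hηd.deriv]
    simp [Complex.inv_re, hd, hd0]
  have hηs := hηa.hasStrictDerivAt
  set σ := hηs.localInverse _ _ _ hη1 with hσ
  have hσa : AnalyticAt ℝ σ y₀ := by
    have := hηa.analyticAt_localInverse hη1
    rwa [hη0] at this
  have hσ0 : σ y₀ = s₀ := by
    rw [← hη0]
    exact (hηs.eventually_left_inverse hη1).self_of_nhds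
  have h3 : AnalyticAt ℝ (fun y => κ (σ y)) y₀ := by
    have h4 : AnalyticAt ℝ κ (σ y₀) := by rwa [hσ0]
    exact h4.comp hσa
  refine h3.congr ?_
  have h5 : ∀ᶠ y in 𝓝 y₀, η (σ y) = y := by
    have := hηs.eventually_right_inverse hη1
    rwa [hη0] at this
  have h6 : ∀ᶠ y in 𝓝 y₀, κ (σ y) = pt (g (κ (σ y)).im) (κ (σ y)).im := by
    refine hσa.continuousAt.tendsto.eventually
      (p := fun s => κ s = pt (g (κ s).im) (κ s).im) ?_
    rwa [hσ0]
  filter_upwards [h5, h6] with y a b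
  have a' : (κ (σ y)).im = y := a
  rw [b, a']

theorem analyticAt_level_graph {p q : ℂ → ℂ} {g : ℝ → ℝ} {y₀ : ℝ}
    (hq : IsBranchNear q (pt (g y₀) y₀)) (hp : IsBranchNear p (pt (g y₀) y₀))
    (h0 : hFun (q (pt (g y₀) y₀)) = hFun (p (pt (g y₀) y₀)))
    (hd : (q (pt (g y₀) y₀)).re ≠ (p (pt (g y₀) y₀)).re)
    (hg : ∀ᶠ z in 𝓝 (pt (g y₀) y₀), hFun (q z) = hFun (p z) → z.re = g z.im) :
    AnalyticAt ℝ (fun y => pt (g y) y) y₀ := by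
  obtain ⟨F, hF, hF'⟩ := exists_primitive_sub hq hp
  obtain ⟨e1, e2⟩ := hF'.self_of_nhds
  refine analyticAt_graph hF ?_ ?_ ?_
  · rw [e1, h0, sub_self]
  · rw [e2.deriv]
    simpa using sub_ne_zero.2 hd
  · filter_upwards [hg, hF'] with z a b h
    rw [b.1] at h
    exact a (sub_eq_zero.1 h)

/-! ### Explicit inverse mappings on the cut plane -/

/-- The part of the level curve of `mainH` between the two branch points. -/
def levelCut : Set ℂ := {z | |z.im| ≤ z1.im ∧ z.re = levelX z.im}

theorem isClosed_levelCut : IsClosed levelCut := by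
  have h1 : Continuous fun z : ℂ => |z.im| := by fun_prop
  have h2 : Continuous fun z : ℂ => levelX z.im := continuous_levelX.comp Complex.continuous_im
  exact (isClosed_le h1 continuous_const).inter (isClosed_eq Complex.continuous_re h2)

theorem re_neg_of_mem_levelCut {z : ℂ} (h : z ∈ levelCut) : z.re < 0 := by
  rw [h.2]
  exact levelX_lt_zero _

theorem z1_mem_levelCut : z1 ∈ levelCut :=
  ⟨(abs_of_pos z1_im_pos).le, levelX_y1.symm⟩

theorem z2_mem_levelCut : z2 ∈ levelCut := by
  rw [z2_eq]
  refine ⟨?_, ?_⟩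
  · rw [Complex.conj_im, abs_neg]
    exact z1_mem_levelCut.1
  · rw [Complex.conj_im, Complex.conj_re, levelX_neg]
    exact levelX_y1.symm

/-- The difference of the two smaller preimages, continued analytically across the box to the
right of `levelCut`. -/
def canonS (z : ℂ) : ℂ :=
  open Classical in if |z.im| < z1.im ∧ levelX z.im < z.re then boxSqrt z else mainSqrt z

theorem canonS_box {z : ℂ} (h : |z.im| < z1.im) (h' : levelX z.im < z.re) :
    canonS z = boxSqrt z := if_pos ⟨h, h'⟩

theorem canonS_main {z : ℂ} (h : ¬ (|z.im| < z1.im ∧ levelX z.im < z.re)) :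
    canonS z = mainSqrt z := if_neg h

theorem canonS_of_re_neg {z : ℂ} (hz0 : z ≠ 0) (h : (pairM z).re < 0) :
    canonS z = mainSqrt z := by
  unfold canonS
  split_ifs
  · exact boxSqrt_eq hz0 h
  · rfl

theorem canonS_sq {z : ℂ} (hz0 : z ≠ 0) : canonS z ^ 2 = pairD z := by
  unfold canonS
  split_ifs
  · exact boxSqrt_sq hz0
  · exact mainSqrt_sq z

theorem canonS_imaginary {y : ℝ} (hy : y ≠ 0) : canonS (pt 0 y) = mainSqrt (pt 0 y) :=
  canonS_of_re_neg (pt_ne_zero (Or.inr hy)) (pairM_re_neg_imaginary hy)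

theorem pairD_ne_zero {z : ℂ} (hz : z.re ≤ 0) (hz0 : z ≠ 0) (h1 : z ≠ z1) (h2 : z ≠ z2) :
    pairD z ≠ 0 := by
  rcases lt_or_ge |z.im| z1.im with h | h
  · rw [← boxSqrt_sq hz0]
    exact pow_ne_zero 2 (boxSqrt_ne_zero hz0 (slit_box hz hz0 h))
  · have hf : z.re ∈ farSide z.im := ⟨hz, fun h' => absurd h' h.not_gt⟩
    obtain ⟨_, h' | h' | h'⟩ := farSide_cases hf
    · rw [← mainSqrt_sq]
      exact pow_ne_zero 2 (mainSqrt_ne_zero h')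
    · exact absurd h' h1
    · exact absurd h' h2

theorem canonS_ne_zero {z : ℂ} (hz : z.re ≤ 0) (hz0 : z ≠ 0) (h : z ∉ levelCut) :
    canonS z ≠ 0 := by
  intro h0
  have h1 := canonS_sq hz0
  rw [h0, zero_pow two_ne_zero] at h1
  refine pairD_ne_zero hz hz0 ?_ ?_ h1.symm
  · rintro rfl
    exact h z1_mem_levelCut
  · rintro rfl
    exact h z2_mem_levelCut

theorem continuousAt_mainSqrt_farSide {z : ℂ} (hz : z.re ∈ farSide z.im) (h1 : z ≠ z1)
    (h2 : z ≠ z2) : ContinuousAt mainSqrt z := by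
  obtain ⟨h, h' | h' | h'⟩ := farSide_cases hz
  · exact continuousAt_mainSqrt hz.1 h h'
  · exact absurd h' h1
  · exact absurd h' h2

/-- The two formulas meet at the branch heights to the right of the branch points; there `Re m < 0`
and both square roots agree. Across the open part of `levelCut` they are opposite, which makes it a
genuine cut. -/
theorem continuousAt_canonS {z : ℂ} (hz : z.re ≤ 0) (hz0 : z ≠ 0) (h : z ∉ levelCut) :
    ContinuousAt canonS z := by
  have hz1 : z ≠ z1 := by rintro rfl; exact h z1_mem_levelCut
  have hz2 : z ≠ z2 := by rintro rfl; exact h z2_mem_levelCut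
  have c1 : ContinuousAt (fun w : ℂ => |w.im|) z := by fun_prop
  have c2 : ContinuousAt (fun w : ℂ => w.re - levelX w.im) z :=
    (Complex.continuous_re.sub (continuous_levelX.comp Complex.continuous_im)).continuousAt
  have hmain : (∀ᶠ w in 𝓝 z, canonS w = mainSqrt w) → z.re ∈ farSide z.im →
      ContinuousAt canonS z := fun h hf =>
    (continuousAt_mainSqrt_farSide hf hz1 hz2).congr (h.mono fun _ => Eq.symm)
  rcases lt_trichotomy z.re (levelX z.im) with hx | hx | hx
  · refine hmain ?_ ⟨hz, fun h' => (hx.trans (levelX_lt h')).le⟩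
    filter_upwards [c2.eventually (gt_mem_nhds (sub_neg.2 hx))] with w hw
    exact canonS_main fun h' => (sub_neg.1 hw).not_gt h'.2
  · have hy : z1.im < |z.im| := by
      by_contra hcon
      exact h ⟨not_lt.1 hcon, hx⟩
    refine hmain ?_ ⟨hz, fun h' => absurd h' hy.not_gt⟩
    filter_upwards [c1.eventually (lt_mem_nhds hy)] with w hw
    exact canonS_main fun h' => h'.1.not_gt hw
  · rcases lt_trichotomy |z.im| z1.im with hy | hy | hy
    · refine (continuousAt_boxSqrt hz hz0 (slit_box hz hz0 hy)).congr ?_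
      filter_upwards [c2.eventually (lt_mem_nhds (sub_pos.2 hx)),
        c1.eventually (gt_mem_nhds hy)] with w h1 h2
      exact (canonS_box h2 (sub_pos.1 h1)).symm
    · have hm : (pairM z).re < 0 := by
        rcases (abs_eq z1_im_pos.le).1 hy with h' | h'
        · rw [h', levelX_y1] at hx
          have := pairM_re_neg_of_gt hx hz
          rwa [← h', pt_eta] at this
        · rw [h', levelX_neg, levelX_y1] at hx
          have := pairM_re_neg_of_gt hx hz
          have e : pt z.re z1.im = starRingEnd ℂ z := by
            apply Complex.ext <;> simp [h']
          rwa [e, conj_pairM hz hz0, Complex.conj_re] at this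
      have c3 : ContinuousAt (fun w => (pairM w).re) z :=
        Complex.continuous_re.continuousAt.comp (continuousAt_pairM hz hz0)
      refine hmain ?_ ⟨hz, fun h' => absurd hy h'.ne⟩
      filter_upwards [c3.eventually (gt_mem_nhds hm), eventually_ne_nhds hz0] with w h1 h2
      exact canonS_of_re_neg h2 h1
    · refine hmain ?_ ⟨hz, fun h' => absurd h' hy.not_gt⟩
      filter_upwards [c1.eventually (lt_mem_nhds hy)] with w hw
      exact canonS_main fun h' => h'.1.not_gt hw

open Classical in
/-- The inverse branch of `zMap` that tends to `-1` at infinity and is cut along `levelCut`. -/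
def canonP (z : ℂ) : ℂ :=
  if z = 0 then -maxRoot 0 else if z.re ≤ 0 then pairRoot z (-canonS z) else -maxRoot (-z)

open Classical in
/-- The inverse branch of `zMap` that tends to `0` at infinity. -/
def canonQ (z : ℂ) : ℂ :=
  if z.re ≤ 0 then pairRoot z (canonS z) else -pairRoot (-z) (canonS (-z))

theorem canonP_left {z : ℂ} (hz : z.re ≤ 0) (hz0 : z ≠ 0) :
    canonP z = pairRoot z (-canonS z) := by
  rw [canonP, if_neg hz0, if_pos hz]

theorem canonP_right {z : ℂ} (hz : 0 < z.re) : canonP z = -maxRoot (-z) := by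
  rw [canonP, if_neg (by rintro rfl; simp at hz), if_neg hz.not_ge]

theorem canonP_zero : canonP 0 = -maxRoot 0 := if_pos rfl

theorem canonQ_left {z : ℂ} (hz : z.re ≤ 0) : canonQ z = pairRoot z (canonS z) := if_pos hz

theorem canonQ_right {z : ℂ} (hz : 0 < z.re) : canonQ z = -pairRoot (-z) (canonS (-z)) :=
  if_neg hz.not_ge

theorem eq_pt_of_re {z : ℂ} (h : z.re = 0) : z = pt 0 z.im := by
  rw [← h]
  rfl

theorem im_ne_zero_of_re {z : ℂ} (h : z.re = 0) (hz0 : z ≠ 0) : z.im ≠ 0 := fun h' =>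
  hz0 (Complex.ext h h')

/-- On the imaginary axis the reflection `w ↦ -conj w` exchanges the lower root with the greatest
one. Hence the branch continues into the right half plane as the reflected `maxRoot`. -/
theorem lower_imaginary {z : ℂ} (h : z.re = 0) (hz0 : z ≠ 0) :
    pairRoot z (-canonS z) = -maxRoot (-z) := by
  have hy := im_ne_zero_of_re h hz0
  rw [eq_pt_of_re h, canonS_imaginary hy, pairRoot_imaginary hy,
    ← conj_maxRoot (z := pt 0 z.im) le_rfl (pt_ne_zero (Or.inr hy))]
  congr 2
  apply Complex.ext <;> simp

/-- The other two roots are matched at `z` and `-z`, so the sum of all roots, `1/z`, matches the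
remaining ones. -/
theorem upper_imaginary {z : ℂ} (h : z.re = 0) (hz0 : z ≠ 0) :
    pairRoot z (canonS z) = -pairRoot (-z) (canonS (-z)) := by
  have h' : (-z).re = 0 := by simp [h]
  have e1 := isTriple_pairRoot hz0 (canonS_sq hz0)
  have e2 := isTriple_pairRoot (neg_ne_zero.2 hz0) (canonS_sq (neg_ne_zero.2 hz0))
  have l1 := lower_imaginary h hz0
  have l2 := lower_imaginary h' (neg_ne_zero.2 hz0)
  rw [neg_neg] at l2
  have : z * (pairRoot z (canonS z) + pairRoot (-z) (canonS (-z))) = 0 := by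
    have a := e1.1
    have b := e2.1
    rw [l1] at a
    rw [l2] at b
    linear_combination a - b
  have := (mul_eq_zero.1 this).resolve_left hz0
  linear_combination this

theorem continuousAt_of_glue {A B f : ℂ → ℂ} {z : ℂ} (hA : ContinuousAt A z)
    (hB : ContinuousAt B z) (hAB : A z = B z) (h : ∀ᶠ w in 𝓝 z, f w = A w ∨ f w = B w)
    (hf : f z = A z) : ContinuousAt f z := by
  unfold ContinuousAt at *
  rw [hf]
  rw [← hAB] at hB
  rw [tendsto_def] at *
  intro s hs
  filter_upwards [hA s hs, hB s hs, h] with w h1 h2 h3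
  rcases h3 with h3 | h3
  · simp only [mem_preimage, h3]
    exact h1
  · simp only [mem_preimage, h3]
    exact h2

theorem isPreimage_canonP (z : ℂ) : IsPreimage z (canonP z) := by
  by_cases hz0 : z = 0
  · rw [hz0, canonP_zero]
    simpa using (maxRoot_isPreimage 0).neg
  · rcases le_or_gt z.re 0 with h | h
    · rw [canonP_left h hz0]
      exact isPreimage_pairRoot hz0 (by rw [neg_sq, canonS_sq hz0])
    · rw [canonP_right h]
      simpa using (maxRoot_isPreimage (-z)).neg

theorem isPreimage_canonQ {z : ℂ} (hz0 : z ≠ 0) : IsPreimage z (canonQ z) := by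
  rcases le_or_gt z.re 0 with h | h
  · rw [canonQ_left h]
    exact isPreimage_pairRoot hz0 (canonS_sq hz0)
  · rw [canonQ_right h]
    simpa using (isPreimage_pairRoot (neg_ne_zero.2 hz0) (canonS_sq (neg_ne_zero.2 hz0))).neg

theorem canonS_eventually_zero : ∀ᶠ z in 𝓝 (0 : ℂ), canonS z = boxSqrt z := by
  have c1 : Continuous fun w : ℂ => |w.im| := by fun_prop
  have c2 : Continuous fun w : ℂ => w.re - levelX w.im :=
    Complex.continuous_re.sub (continuous_levelX.comp Complex.continuous_im)
  have h1 : |(0 : ℂ).im| < z1.im := by simpa using z1_im_pos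
  have h2 : 0 < (0 : ℂ).re - levelX (0 : ℂ).im := by simpa using levelX_lt_zero 0
  filter_upwards [c1.continuousAt.eventually (gt_mem_nhds h1),
    c2.continuousAt.eventually (lt_mem_nhds h2)] with w h1 h2
  exact canonS_box h1 (sub_pos.1 h2)

theorem continuousAt_canonP {z : ℂ} (h : z ∉ levelCut) : ContinuousAt canonP z := by
  by_cases hz0 : z = 0
  · rw [hz0]
    rw [continuousAt_iff_punctured_nhds, canonP_zero]
    -- At the origin the coordinate of the pair is infinite, so the two one-sided limits are
    -- compared instead; both equal `-1/√3`.
    have h1 : Tendsto (fun w => pairRoot w (-canonS w)) (𝓝[leftSet] 0) (𝓝 (-maxRoot 0)) := by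
      refine tendsto_lower_zero.congr' ?_
      filter_upwards [mem_nhdsWithin_of_mem_nhds canonS_eventually_zero] with w hw
      rw [hw]
    have h2 : Tendsto (fun w => -maxRoot (-w)) (𝓝[{w | 0 < w.re}] 0) (𝓝 (-maxRoot 0)) := by
      refine (tendsto_maxRoot_zero.comp ?_).neg
      refine tendsto_nhdsWithin_iff.2 ⟨?_, ?_⟩
      · have : Tendsto (fun w : ℂ => -w) (𝓝 0) (𝓝 (-0)) := continuous_neg.continuousAt
        rw [neg_zero] at this
        exact this.mono_left nhdsWithin_le_nhds
      · filter_upwards [self_mem_nhdsWithin] with w hw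
        have hw' : 0 < w.re := hw
        refine ⟨by simpa using hw'.le, neg_ne_zero.2 ?_⟩
        rintro rfl
        simp at hw'
    have h3 : ({0}ᶜ : Set ℂ) ⊆ leftSet ∪ {w | 0 < w.re} := fun w hw => by
      rcases le_or_gt w.re 0 with h | h
      · exact Or.inl ⟨h, hw⟩
      · exact Or.inr h
    refine Tendsto.mono_left ?_ (nhdsWithin_mono _ h3)
    rw [nhdsWithin_union]
    refine Tendsto.sup ?_ ?_
    · refine h1.congr' ?_
      filter_upwards [self_mem_nhdsWithin] with w hw
      exact (canonP_left hw.1 hw.2).symm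
    · refine h2.congr' ?_
      filter_upwards [self_mem_nhdsWithin] with w hw
      exact (canonP_right hw).symm
  · have hA : z.re ≤ 0 → ContinuousAt (fun w => pairRoot w (-canonS w)) z := fun hz =>
      continuousAt_pairRoot hz hz0 (continuousAt_canonS hz hz0 h).neg
    have hB : 0 ≤ z.re → ContinuousAt (fun w => -maxRoot (-w)) z := fun hz => by
      refine ContinuousAt.neg (ContinuousAt.comp (f := fun w : ℂ => -w) (g := maxRoot) ?_ (by fun_prop))
      exact continuousAt_maxRoot (by simpa using hz) (neg_ne_zero.2 hz0)
    rcases lt_trichotomy z.re 0 with hz | hz | hz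
    · refine (hA hz.le).congr ?_
      filter_upwards [Complex.continuous_re.continuousAt.eventually (gt_mem_nhds hz)] with w hw
      exact (canonP_left (le_of_lt hw) (by rintro rfl; simp at hw)).symm
    · refine continuousAt_of_glue (hA hz.le) (hB hz.ge) (lower_imaginary hz hz0) ?_
        (canonP_left hz.le hz0)
      filter_upwards [eventually_ne_nhds hz0] with w hw
      rcases le_or_gt w.re 0 with h' | h'
      · exact Or.inl (canonP_left h' hw)
      · exact Or.inr (canonP_right h')
    · refine (hB hz.le).congr ?_
      filter_upwards [Complex.continuous_re.continuousAt.eventually (lt_mem_nhds hz)] with w hw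
      exact (canonP_right hw).symm

theorem continuousAt_canonQ {z : ℂ} (hz0 : z ≠ 0) (h : z ∉ levelCut) (h' : -z ∉ levelCut) :
    ContinuousAt canonQ z := by
  have hA : z.re ≤ 0 → ContinuousAt (fun w => pairRoot w (canonS w)) z := fun hz =>
    continuousAt_pairRoot hz hz0 (continuousAt_canonS hz hz0 h)
  have hB : 0 ≤ z.re → ContinuousAt (fun w => -pairRoot (-w) (canonS (-w))) z := fun hz => by
    refine ContinuousAt.neg (ContinuousAt.comp (f := fun w : ℂ => -w)
      (g := fun w => pairRoot w (canonS w)) ?_ (by fun_prop))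
    exact continuousAt_pairRoot (by simpa using hz) (neg_ne_zero.2 hz0)
      (continuousAt_canonS (by simpa using hz) (neg_ne_zero.2 hz0) h')
  rcases lt_trichotomy z.re 0 with hz | hz | hz
  · refine (hA hz.le).congr ?_
    filter_upwards [Complex.continuous_re.continuousAt.eventually (gt_mem_nhds hz)] with w hw
    exact (canonQ_left (le_of_lt hw)).symm
  · refine continuousAt_of_glue (hA hz.le) (hB hz.ge) (upper_imaginary hz hz0) ?_
      (canonQ_left hz.le)
    refine Eventually.of_forall fun w => ?_
    rcases le_or_gt w.re 0 with h' | h'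
    · exact Or.inl (canonQ_left h')
    · exact Or.inr (canonQ_right h')
  · refine (hB hz.le).congr ?_
    filter_upwards [Complex.continuous_re.continuousAt.eventually (lt_mem_nhds hz)] with w hw
    exact (canonQ_right hw).symm

theorem zMapDeriv_neg (w : ℂ) : zMapDeriv (-w) = zMapDeriv w := by
  unfold zMapDeriv
  congr 1 <;> ring

theorem isBranchNear_canonP {z : ℂ} (h : z ∉ levelCut) : IsBranchNear canonP z := by
  refine ⟨?_, ?_⟩
  · filter_upwards [isClosed_levelCut.isOpen_compl.mem_nhds h] with w hw
    exact ⟨continuousAt_canonP hw, isPreimage_canonP w⟩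
  · by_cases hz0 : z = 0
    · rw [hz0, canonP_zero]
      exact zMapDeriv_ne_of_sq (by rw [neg_sq, maxRoot_zero_sq])
    · rcases le_or_gt z.re 0 with hz | hz
      · rw [canonP_left hz hz0]
        exact zMapDeriv_pairRoot_ne hz hz0 (by rw [neg_sq, canonS_sq hz0])
          (neg_ne_zero.2 (canonS_ne_zero hz hz0 h))
      · rw [canonP_right hz, zMapDeriv_neg]
        exact zMapDeriv_maxRoot_ne (by simpa using hz.le) (neg_ne_zero.2 hz0)

theorem isBranchNear_canonQ {z : ℂ} (hz0 : z ≠ 0) (h : z ∉ levelCut) (h' : -z ∉ levelCut) :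
    IsBranchNear canonQ z := by
  refine ⟨?_, ?_⟩
  · filter_upwards [isClosed_levelCut.isOpen_compl.mem_nhds h, eventually_ne_nhds hz0,
      continuous_neg.continuousAt.eventually (isClosed_levelCut.isOpen_compl.mem_nhds h')]
      with w h1 h2 h3
    exact ⟨continuousAt_canonQ h2 h1 h3, isPreimage_canonQ h2⟩
  · rcases le_or_gt z.re 0 with hz | hz
    · rw [canonQ_left hz]
      exact zMapDeriv_pairRoot_ne hz hz0 (canonS_sq hz0) (canonS_ne_zero hz hz0 h)
    · rw [canonQ_right hz, zMapDeriv_neg]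
      exact zMapDeriv_pairRoot_ne (by simpa using hz.le) (neg_ne_zero.2 hz0)
        (canonS_sq (neg_ne_zero.2 hz0))
        (canonS_ne_zero (by simpa using hz.le) (neg_ne_zero.2 hz0) h')

theorem canonS_cobounded :
    ∀ᶠ z in Bornology.cobounded ℂ, z.re ≤ 0 → canonS z = mainSqrt z := by
  obtain ⟨b, hb⟩ := (isCompact_Icc (a := -z1.im) (b := z1.im)).bddBelow_image
    continuous_levelX.continuousOn
  filter_upwards [tendsto_norm_cobounded_atTop.eventually (eventually_gt_atTop (|b| + z1.im))]
    with z hz hz0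
  refine canonS_main fun h => ?_
  have h1 : b ≤ levelX z.im := hb ⟨z.im, abs_le.1 h.1.le, rfl⟩
  have h2 := Complex.norm_le_abs_re_add_abs_im z
  have h3 : |z.re| ≤ |b| := by
    rw [abs_of_nonpos hz0]
    have := neg_abs_le b
    linarith [h.2]
  linarith [h.1]

theorem tendsto_glue_cobounded {A B f : ℂ → ℂ} {l : Filter ℂ} {a : ℂ} (hA : Tendsto A l (𝓝 a))
    (hB : Tendsto B l (𝓝 a)) (h : ∀ᶠ w in l, f w = A w ∨ f w = B w) : Tendsto f l (𝓝 a) := by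
  rw [tendsto_def] at *
  intro s hs
  filter_upwards [hA s hs, hB s hs, h] with w h1 h2 h3
  rcases h3 with h3 | h3
  · simp only [mem_preimage, h3]
    exact h1
  · simp only [mem_preimage, h3]
    exact h2

theorem tendsto_neg_cobounded' :
    Tendsto (fun z : ℂ => -z) (Bornology.cobounded ℂ) (Bornology.cobounded ℂ) := by
  rw [← tendsto_norm_atTop_iff_cobounded]
  simpa using tendsto_norm_cobounded_atTop

theorem tendsto_canonP : Tendsto canonP (Bornology.cobounded ℂ) (𝓝 (-1)) := by
  refine tendsto_glue_cobounded tendsto_lower_cobounded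
    ((tendsto_maxRoot_cobounded.comp tendsto_neg_cobounded').neg) ?_
  filter_upwards [canonS_cobounded, tendsto_norm_cobounded_atTop.eventually
    (eventually_gt_atTop 0)] with z h1 h2
  rcases le_or_gt z.re 0 with h | h
  · left
    rw [canonP_left h (norm_pos_iff.1 h2), h1 h]
  · exact Or.inr (canonP_right h)

theorem tendsto_canonQ : Tendsto canonQ (Bornology.cobounded ℂ) (𝓝 0) := by
  have hB := (tendsto_upper_cobounded.comp tendsto_neg_cobounded').neg
  rw [neg_zero] at hB
  refine tendsto_glue_cobounded tendsto_upper_cobounded hB ?_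
  filter_upwards [canonS_cobounded, tendsto_neg_cobounded'.eventually canonS_cobounded] with z h1 h2
  rcases le_or_gt z.re 0 with h | h
  · left
    rw [canonQ_left h, h1 h]
  · right
    rw [canonQ_right h, h2 (by simpa using h.le)]
    rfl

/-! ### Real line elements along level curves -/

theorem IsBranchNear.hasDerivAt_hFun {q : ℂ → ℂ} {γ : ℝ → ℂ} {γ' : ℂ} {t : ℝ}
    (hq : IsBranchNear q (γ t)) (hγ : HasDerivAt γ γ' t) :
    HasDerivAt (fun u => hFun (q (γ u))) (3 * (q (γ t) * γ')).re t :=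
  hasDerivAt_hFun_comp (q := fun u => q (γ u)) hγ
    (ContinuousAt.comp (f := γ) hq.continuousAt hγ.continuousAt)
    (hγ.continuousAt.eventually (hq.1.mono fun _ h => h.2)) hq.2

/-- Along a curve on which `hFun` takes equal values at two branches, the difference of the
branches times the tangent vector is purely imaginary. -/
theorem mul_deriv_re_eq_zero {p q : ℂ → ℂ} {γ : ℝ → ℂ} {γ' : ℂ} {t : ℝ}
    (hq : IsBranchNear q (γ t)) (hp : IsBranchNear p (γ t)) (hγ : HasDerivAt γ γ' t)
    (h : ∀ᶠ u in 𝓝 t, hFun (q (γ u)) = hFun (p (γ u))) :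
    ((q (γ t) - p (γ t)) * γ').re = 0 := by
  have h1 := (hq.hasDerivAt_hFun hγ).sub (hp.hasDerivAt_hFun hγ)
  have h2 : HasDerivAt (fun u => hFun (q (γ u)) - hFun (p (γ u))) 0 t := by
    refine (hasDerivAt_const t (0 : ℝ)).congr_of_eventuallyEq ?_
    filter_upwards [h] with u hu
    rw [hu, sub_self]
  have h3 := h1.unique h2
  have e : ((q (γ t) - p (γ t)) * γ').re =
    ((3 * (q (γ t) * γ')).re - (3 * (p (γ t) * γ')).re) / 3 := by
    simp
    ring
  rw [e, h3, zero_div]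

/-- For a difference `s` of sheets and a tangent `d` with `s d` imaginary, the sign of the line
element is that of `Re s · Im d`. Positivity is read off in this way from the order of the sheets
and the direction of travel. -/
theorem mul_im_of_re_eq_zero {s d : ℂ} (h : (s * d).re = 0) :
    (s * d).im * s.re = Complex.normSq s * d.im := by
  rw [Complex.mul_re] at h
  rw [Complex.mul_im, Complex.normSq_apply]
  linear_combination s.im * h

theorem lineForm_eq {γ h : ℝ → ℂ} {t : ℝ} (h0 : (h t * deriv γ t).re = 0) :
    lineForm γ h t = ((3 / (2 * Real.pi) * (h t * deriv γ t).im : ℝ) : ℂ) := by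
  have e : h t * deriv γ t = ((h t * deriv γ t).im : ℝ) * Complex.I := by
    apply Complex.ext <;> simp [h0]
  have hpi : (Real.pi : ℂ) ≠ 0 := Complex.ofReal_ne_zero.2 Real.pi_ne_zero
  rw [lineForm, e]
  simp only [Complex.ofReal_mul, Complex.ofReal_div, Complex.mul_I_im, Complex.ofReal_re]
  push_cast
  field_simp

/-- The parameter intervals of the curves. -/
def IsParamInterval (T : Set ℝ) : Prop := T = Icc 0 1 ∨ T = Ici 0 ∨ T = Iic 0

theorem IsParamInterval.ordConnected {T : Set ℝ} (hT : IsParamInterval T) : T.OrdConnected := by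
  rcases hT with rfl | rfl | rfl <;> infer_instance

theorem IsParamInterval.mem_interior {T : Set ℝ} (hT : IsParamInterval T) {t : ℝ} (ht : t ∈ T)
    (h0 : t ≠ 0) (h1 : t ≠ 1) : t ∈ interior T := by
  rcases hT with rfl | rfl | rfl
  · rw [interior_Icc]
    exact ⟨lt_of_le_of_ne ht.1 h0.symm, lt_of_le_of_ne ht.2 h1⟩
  · rw [interior_Ici]
    exact lt_of_le_of_ne ht h0.symm
  · rw [interior_Iic]
    exact lt_of_le_of_ne ht h0

theorem IsParamInterval.exists_Icc {T : Set ℝ} (hT : IsParamInterval T) {t : ℝ} (ht : t ∈ T)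
    (hti : t ∉ interior T) {s : Set ℝ} (hs : s ∈ 𝓝[T] t) :
    ∃ c d, c < d ∧ Icc c d ∈ 𝓝[T] t ∧ Icc c d ⊆ s ∩ T ∧ Ioo c d ⊆ interior T ∧
      Icc c d \ {t} ⊆ interior T := by
  have right : ∀ b, 0 < b → t = 0 → s ∈ 𝓝[≥] (0 : ℝ) → T ⊆ Ici 0 → Ico 0 b ⊆ T →
      Ioo 0 b ⊆ interior T →
      ∃ c d, c < d ∧ Icc c d ∈ 𝓝[T] t ∧ Icc c d ⊆ s ∩ T ∧ Ioo c d ⊆ interior T ∧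
      Icc c d \ {t} ⊆ interior T := by
    intro b hb h0 hs' hT' hT'' hT3
    obtain ⟨u, hu, hsub⟩ := (mem_nhdsGE_iff_exists_Icc_subset (a := (0 : ℝ))).1
      (inter_mem hs' (Ico_mem_nhdsGE hb))
    subst h0
    have hu' : (0 : ℝ) < u := hu
    have hub : u < b := (hsub (right_mem_Icc.2 hu'.le)).2.2
    refine ⟨0, u, hu, nhdsWithin_mono _ hT' (Icc_mem_nhdsGE hu'), fun x hx =>
      ⟨(hsub hx).1, hT'' (hsub hx).2⟩, fun x hx => hT3 ⟨hx.1, hx.2.trans hub⟩, fun x hx =>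
      hT3 ⟨lt_of_le_of_ne hx.1.1 (Ne.symm hx.2), hx.1.2.trans_lt hub⟩⟩
  have left : ∀ e b, b < e → t = e → s ∈ 𝓝[≤] e → T ⊆ Iic e → Ioc b e ⊆ T →
      Ioo b e ⊆ interior T →
      ∃ c d, c < d ∧ Icc c d ∈ 𝓝[T] t ∧ Icc c d ⊆ s ∩ T ∧ Ioo c d ⊆ interior T ∧
      Icc c d \ {t} ⊆ interior T := by
    intro e b hb h0 hs' hT' hT'' hT3
    obtain ⟨u, hu, hsub⟩ := (mem_nhdsLE_iff_exists_Icc_subset (a := e)).1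
      (inter_mem hs' (Ioc_mem_nhdsLE hb))
    subst h0
    have hu' : u < t := hu
    have hub : b < u := (hsub (left_mem_Icc.2 hu'.le)).2.1
    refine ⟨u, t, hu, nhdsWithin_mono _ hT' (Icc_mem_nhdsLE hu'), fun x hx =>
      ⟨(hsub hx).1, hT'' (hsub hx).2⟩, fun x hx => hT3 ⟨hub.trans hx.1, hx.2⟩, fun x hx =>
      hT3 ⟨hub.trans_le hx.1.1, lt_of_le_of_ne hx.1.2 hx.2⟩⟩
  rcases hT with rfl | rfl | rfl
  · by_cases h0 : t = 0
    · refine right 1 one_pos h0 ?_ Icc_subset_Ici_self Ico_subset_Icc_self (by rw [interior_Icc])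
      rw [h0, nhdsWithin_Icc_eq_nhdsGE one_pos] at hs
      exact hs
    · by_cases h1 : t = 1
      · refine left 1 0 one_pos h1 ?_ Icc_subset_Iic_self Ioc_subset_Icc_self
          (by rw [interior_Icc])
        rw [h1, nhdsWithin_Icc_eq_nhdsLE one_pos] at hs
        exact hs
      · exact absurd (IsParamInterval.mem_interior (Or.inl rfl) ht h0 h1) hti
  · have h0 : t = 0 := by
      rw [interior_Ici] at hti
      exact le_antisymm (not_lt.1 hti) ht
    refine right 1 one_pos h0 (h0 ▸ hs) le_rfl Ico_subset_Ici_self ?_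
    rw [interior_Ici]
    exact Ioo_subset_Ioi_self
  · have h0 : t = 0 := by
      rw [interior_Iic] at hti
      exact le_antisymm ht (not_lt.1 hti)
    refine left 0 (-1) (by norm_num) h0 (h0 ▸ hs) le_rfl Ioc_subset_Iic_self ?_
    rw [interior_Iic]
    exact Ioo_subset_Iio_self

/-- The difference of two branches is integrable along a level curve up to a point where the two
branches coincide. -/
theorem integrableOn_level {p q : ℂ → ℂ} {γ : ℝ → ℂ} {c d σ : ℝ} {k₀ k₁ k₂ : ℂ}
    (hγ : ∀ t ∈ Ioo c d, DifferentiableAt ℝ γ t)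
    (hq : ∀ t ∈ Ioo c d, IsBranchNear q (γ t)) (hp : ∀ t ∈ Ioo c d, IsBranchNear p (γ t))
    (hqc : ContinuousOn (fun t => q (γ t)) (Icc c d))
    (hpc : ContinuousOn (fun t => p (γ t)) (Icc c d))
    (hr : ∀ t ∈ Icc c d, IsPreimage (γ t) (q (γ t)) ∧ IsPreimage (γ t) (p (γ t)))
    (hk : ∀ t ∈ Icc c d, ∀ w, w = q (γ t) ∨ w = p (γ t) → k₀ * w ∈ Complex.slitPlane ∧
      k₁ * (w - 1) ∈ Complex.slitPlane ∧ k₂ * (w + 1) ∈ Complex.slitPlane)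
    (hσ0 : σ ≠ 0)
    (hσ : ∀ t ∈ Ioo c d, 0 ≤ σ * ((q (γ t) - p (γ t)) * deriv γ t).im) :
    IntegrableOn (fun t => ((q (γ t) - p (γ t)) * deriv γ t).im) (Icc c d) := by
  set W := prim k₀ k₁ k₂
  have hWc : ∀ (r : ℂ → ℂ), ContinuousOn (fun t => r (γ t)) (Icc c d) →
      (∀ t ∈ Icc c d, IsPreimage (γ t) (r (γ t)) ∧ (r (γ t) = q (γ t) ∨ r (γ t) = p (γ t))) →
      ContinuousOn (fun t => W (r (γ t))) (Icc c d) := by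
    intro r hc h t ht
    obtain ⟨h0, h1, h2⟩ := hk t ht _ (h t ht).2
    exact ContinuousAt.comp_continuousWithinAt (f := fun t => r (γ t)) (g := W)
      (hasDerivAt_prim (h t ht).1 h0 h1 h2).continuousAt (hc t ht)
  have hWd : ∀ (r : ℂ → ℂ), (∀ t ∈ Ioo c d, IsBranchNear r (γ t)) →
      (∀ t ∈ Icc c d, (r (γ t) = q (γ t) ∨ r (γ t) = p (γ t))) →
      ∀ t ∈ Ioo c d, HasDerivAt (fun t => W (r (γ t))) (3 * (r (γ t) * deriv γ t)) t := by
    intro r hb h t ht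
    obtain ⟨h0, h1, h2⟩ := hk t (Ioo_subset_Icc_self ht) _ (h t (Ioo_subset_Icc_self ht))
    have e1 := (hasDerivAt_prim (hb t ht).isPreimage h0 h1 h2).comp (γ t) (hb t ht).hasDerivAt
    have e2 := HasDerivAt.comp (h₂ := fun z => W (r z)) t e1 (hγ t ht).hasDerivAt
    refine e2.congr_deriv ?_
    have := (hb t ht).2
    field_simp
  have hq' := hWc q hqc fun t ht => ⟨(hr t ht).1, Or.inl rfl⟩
  have hp' := hWc p hpc fun t ht => ⟨(hr t ht).2, Or.inr rfl⟩
  have hG : ContinuousOn (fun t => σ * (W (q (γ t)) - W (p (γ t))).im) (Icc c d) :=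
    continuousOn_const.mul (Complex.continuous_im.comp_continuousOn (hq'.sub hp'))
  have hG' : ∀ t ∈ Ioo c d, HasDerivAt (fun t => σ * (W (q (γ t)) - W (p (γ t))).im)
      (σ * (3 * ((q (γ t) - p (γ t)) * deriv γ t).im)) t := by
    intro t ht
    have e := (hWd q hq (fun _ _ => Or.inl rfl) t ht).sub (hWd p hp (fun _ _ => Or.inr rfl) t ht)
    have e' : HasDerivAt (fun t => (W (q (γ t)) - W (p (γ t))).im) _ t :=
      Complex.imCLM.hasFDerivAt.comp_hasDerivAt t e
    refine (e'.const_mul σ).congr_deriv ?_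
    rw [Complex.imCLM_apply, show 3 * (q (γ t) * deriv γ t) - 3 * (p (γ t) * deriv γ t) =
      ((3 : ℝ) : ℂ) * ((q (γ t) - p (γ t)) * deriv γ t) by push_cast; ring, Complex.im_ofReal_mul]
  -- No bound for `γ'` at the ends is available. Integrability comes from the constant sign of the
  -- derivative of a function that is continuous up to the ends.
  have hint := intervalIntegral.integrableOn_deriv_of_nonneg hG hG'
    (fun t ht => by have := hσ t ht; linarith)
  rw [integrableOn_Icc_iff_integrableOn_Ioc]
  have := hint.const_mul (σ⁻¹ * 3⁻¹)
  refine this.congr ?_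
  filter_upwards with t
  field_simp

theorem eventually_slit {w₀ : ℂ} (h : w₀ ≠ 0) (h1 : w₀ - 1 ≠ 0) (h2 : w₀ + 1 ≠ 0) :
    ∀ᶠ w in 𝓝 w₀, w₀⁻¹ * w ∈ Complex.slitPlane ∧ (w₀ - 1)⁻¹ * (w - 1) ∈ Complex.slitPlane ∧
      (w₀ + 1)⁻¹ * (w + 1) ∈ Complex.slitPlane := by
  have key : ∀ f : ℂ → ℂ, Continuous f → f w₀ ≠ 0 →
      ∀ᶠ w in 𝓝 w₀, (f w₀)⁻¹ * f w ∈ Complex.slitPlane := by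
    intro f hf h0
    have hc : ContinuousAt (fun w => (f w₀)⁻¹ * f w) w₀ :=
      continuousAt_const.mul hf.continuousAt
    refine hc.eventually (Complex.isOpen_slitPlane.mem_nhds ?_)
    simp only [inv_mul_cancel₀ h0]
    exact Complex.one_mem_slitPlane
  filter_upwards [key (fun w => w) continuous_id h, key (fun w => w - 1) (by fun_prop) h1,
    key (fun w => w + 1) (by fun_prop) h2] with w a b c using ⟨a, b, c⟩

/-- Equal values of `hFun` make the line element real in the interior. At an end of the parameter
interval the two sheets coincide, and integrability follows from the constant sign, recorded by `σ`.
-/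
theorem realAlong_of_level {q p : ℂ → ℂ} {γ h : ℝ → ℂ} {T : Set ℝ} {a σ : ℝ}
    (hT : IsParamInterval T) (ha : a ∈ T) (hγ : IsAnalyticCurve γ T)
    (hb : ∀ t ∈ interior T, IsBranchNear q (γ t) ∧ IsBranchNear p (γ t) ∧
      hFun (q (γ t)) = hFun (p (γ t)) ∧ h t = q (γ t) - p (γ t) ∧
      0 < σ * ((q (γ t) - p (γ t)).re * (deriv γ t).im))
    (he : ∀ t ∈ T, t ∉ interior T → ContinuousAt q (γ t) ∧ ContinuousAt p (γ t) ∧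
      q (γ t) = p (γ t) ∧ IsPreimage (γ t) (q (γ t))) : RealAlong γ T a h := by
  have hre : ∀ t ∈ interior T, ((q (γ t) - p (γ t)) * deriv γ t).re = 0 := fun t ht =>
    mul_deriv_re_eq_zero (hb t ht).1 (hb t ht).2.1 (hγ.analytic t ht).differentiableAt.hasDerivAt
      (by filter_upwards [isOpen_interior.mem_nhds ht] with u hu using (hb u hu).2.2.1)
  have hsgn : ∀ t ∈ interior T, 0 ≤ σ * ((q (γ t) - p (γ t)) * deriv γ t).im := by
    intro t ht
    have h1 := mul_im_of_re_eq_zero (hre t ht)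
    have h2 := (hb t ht).2.2.2.2
    have h3 : (q (γ t) - p (γ t)).re ≠ 0 := by
      intro h
      rw [h, zero_mul, mul_zero] at h2
      exact h2.false
    have h4 : 0 < Complex.normSq (q (γ t) - p (γ t)) := by
      rw [Complex.normSq_pos]
      intro h
      exact h3 (by rw [h, Complex.zero_re])
    have h5 : σ * ((q (γ t) - p (γ t)) * deriv γ t).im * (q (γ t) - p (γ t)).re ^ 2 =
        Complex.normSq (q (γ t) - p (γ t)) *
          (σ * ((q (γ t) - p (γ t)).re * (deriv γ t).im)) := by
      linear_combination σ * (q (γ t) - p (γ t)).re * h1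
    have h6 := mul_pos h4 h2
    rw [← h5] at h6
    exact (pos_of_mul_pos_left h6 (sq_nonneg _)).le
  have hσ0 : interior T ≠ ∅ → σ ≠ 0 := by
    intro hne hσ
    obtain ⟨t, ht⟩ := nonempty_iff_ne_empty.2 hne
    have := (hb t ht).2.2.2.2
    rw [hσ, zero_mul] at this
    exact this.false
  have hcc : ∀ r : ℂ → ℂ, (∀ t ∈ T, ContinuousAt r (γ t)) →
      ContinuousOn (fun t => r (γ t)) T := fun r hr t ht =>
    ContinuousAt.comp_continuousWithinAt (f := γ) (g := r) (hr t ht) (hγ.continuousOn t ht)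
  have hqc := hcc q fun t ht => by
    by_cases h : t ∈ interior T
    · exact (hb t h).1.continuousAt
    · exact (he t ht h).1
  have hpc := hcc p fun t ht => by
    by_cases h : t ∈ interior T
    · exact (hb t h).2.1.continuousAt
    · exact (he t ht h).2.1
  have hr : ∀ t ∈ T, IsPreimage (γ t) (q (γ t)) ∧ IsPreimage (γ t) (p (γ t)) := fun t ht => by
    by_cases h : t ∈ interior T
    · exact ⟨(hb t h).1.isPreimage, (hb t h).2.1.isPreimage⟩
    · obtain ⟨_, _, h1, h2⟩ := he t ht h
      exact ⟨h2, h1 ▸ h2⟩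
  have hloc : LocallyIntegrableOn (fun t => ((q (γ t) - p (γ t)) * deriv γ t).im) T := by
    intro t ht
    by_cases hti : t ∈ interior T
    · have hc : ContinuousOn (fun t => ((q (γ t) - p (γ t)) * deriv γ t).im) (interior T) := by
        refine Complex.continuous_im.comp_continuousOn (((hqc.mono interior_subset).sub
          (hpc.mono interior_subset)).mul ?_)
        exact fun u hu => (hγ.analytic u hu).deriv.continuousAt.continuousWithinAt
      have h1 := (hc.locallyIntegrableOn (μ := volume) isOpen_interior.measurableSet) t hti
      rw [isOpen_interior.nhdsWithin_eq hti] at h1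
      exact h1.filter_mono nhdsWithin_le_nhds
    · obtain ⟨e1, e2, e3, e4⟩ := he t ht hti
      have hs := eventually_slit e4.ne_zero e4.sub_one_ne e4.add_one_ne
      have f1 := (hqc t ht).eventually hs
      have f2 := (hpc t ht).eventually (e3 ▸ hs)
      obtain ⟨c, d, hcd, hn, hsub, hint, hint'⟩ := hT.exists_Icc ht hti (f1.and f2)
      refine ⟨Icc c d, hn, ?_⟩
      have hsT : Icc c d ⊆ T := fun u hu => (hsub hu).2
      refine integrableOn_level (σ := σ) (k₀ := (q (γ t))⁻¹) (k₁ := (q (γ t) - 1)⁻¹)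
        (k₂ := (q (γ t) + 1)⁻¹)
        (fun u hu => (hγ.analytic u (hint hu)).differentiableAt) (fun u hu => (hb u (hint hu)).1)
        (fun u hu => (hb u (hint hu)).2.1) (hqc.mono hsT) (hpc.mono hsT)
        (fun u hu => hr u (hsT hu)) ?_ (hσ0 ?_) (fun u hu => hsgn u (hint hu))
      · intro u hu w hw
        rcases hw with rfl | rfl
        · exact (hsub hu).1.1
        · exact e3 ▸ (hsub hu).1.2
      · exact nonempty_iff_ne_empty.1 ⟨(c + d) / 2, hint ⟨by linarith, by linarith⟩⟩
  intro t ht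
  have hsub : uIcc a t ⊆ T := hT.ordConnected.uIcc_subset ha ht
  have hI : IntegrableOn (fun t => ((q (γ t) - p (γ t)) * deriv γ t).im) (uIcc a t) :=
    hloc.integrableOn_compact_subset hsub isCompact_uIcc
  have hI' : IntervalIntegrable (fun t => ((3 / (2 * Real.pi) *
      ((q (γ t) - p (γ t)) * deriv γ t).im : ℝ) : ℂ)) volume a t := by
    rw [intervalIntegrable_iff]
    exact ((hI.mono_set uIoc_subset_uIcc).const_mul _).ofReal
  have hae : ∀ᵐ u, u ∈ uIoc a t → ((3 / (2 * Real.pi) *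
      ((q (γ u) - p (γ u)) * deriv γ u).im : ℝ) : ℂ) = lineForm γ h u := by
    have h0 : ∀ᵐ u : ℝ, u ≠ 0 := by simp [ae_iff]
    have h1 : ∀ᵐ u : ℝ, u ≠ 1 := by simp [ae_iff]
    filter_upwards [h0, h1] with u hu0 hu1 hu
    have hi := hT.mem_interior (hsub (uIoc_subset_uIcc hu)) hu0 hu1
    have e := (hb u hi).2.2.2.1
    rw [lineForm_eq (by rw [e]; exact hre u hi), e]
  refine ⟨hI'.congr_ae ?_, ?_⟩
  · exact (ae_restrict_iff' measurableSet_uIoc).2 hae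
  · rw [← intervalIntegral.integral_congr_ae hae, intervalIntegral.integral_ofReal,
      Complex.ofReal_im]

/-! ### Analyticity of the graphs `levelX` and `starX` -/

theorem isBranchNear_pairRoot {S : ℂ → ℂ} {z : ℂ} (hz : z.re < 0)
    (hS : ∀ᶠ w in 𝓝 z, ContinuousAt S w) (hsq : ∀ w ≠ 0, S w ^ 2 = pairD w) (h0 : S z ≠ 0) :
    IsBranchNear (fun w => pairRoot w (S w)) z := by
  have hz0 : z ≠ 0 := by rintro rfl; simp at hz
  refine ⟨?_, zMapDeriv_pairRoot_ne hz.le hz0 (hsq z hz0) h0⟩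
  filter_upwards [hS, eventually_ne_nhds hz0,
    Complex.continuous_re.continuousAt.eventually (gt_mem_nhds hz)] with w h1 h2 h3
  exact ⟨continuousAt_pairRoot (le_of_lt h3) h2 h1, isPreimage_pairRoot h2 (hsq w h2)⟩

theorem eventually_continuousAt_mainSqrt {z : ℂ} (hz : z.re < 0)
    (h : (pairM z).re ≠ 0 ∨ (pairM z).im ^ 2 < 3) : ∀ᶠ w in 𝓝 z, ContinuousAt mainSqrt w := by
  have hz0 : z ≠ 0 := by rintro rfl; simp at hz
  have hc := continuousAt_pairM hz.le hz0
  have c1 : ContinuousAt (fun w => (pairM w).re) z := Complex.continuous_re.continuousAt.comp hc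
  have c2 : ContinuousAt (fun w => (pairM w).im ^ 2) z :=
    (Complex.continuous_im.continuousAt.comp hc).pow 2
  have h' : ∀ᶠ w in 𝓝 z, (pairM w).re ≠ 0 ∨ (pairM w).im ^ 2 < 3 := by
    rcases h with h | h
    · exact (c1.eventually_ne h).mono fun _ => Or.inl
    · exact (c2.eventually (gt_mem_nhds h)).mono fun _ => Or.inr
  filter_upwards [h', eventually_ne_nhds hz0,
    Complex.continuous_re.continuousAt.eventually (gt_mem_nhds hz)] with w h1 h2 h3
  exact continuousAt_mainSqrt (le_of_lt h3) h2 h1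

theorem isBranchNear_main {z : ℂ} (hz : z.re < 0)
    (h : (pairM z).re ≠ 0 ∨ (pairM z).im ^ 2 < 3) :
    IsBranchNear (fun w => pairRoot w (mainSqrt w)) z ∧
      IsBranchNear (fun w => pairRoot w (-mainSqrt w)) z :=
  ⟨isBranchNear_pairRoot hz (eventually_continuousAt_mainSqrt hz h) (fun w _ => mainSqrt_sq w)
    (mainSqrt_ne_zero h), isBranchNear_pairRoot (S := fun w => -mainSqrt w) hz
    ((eventually_continuousAt_mainSqrt hz h).mono fun _ h => h.neg)
    (fun w _ => by rw [neg_sq, mainSqrt_sq]) (neg_ne_zero.2 (mainSqrt_ne_zero h))⟩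

theorem levelX_ne_branch {y : ℝ} (hy : |y| ≠ z1.im) :
    pt (levelX y) y ≠ z1 ∧ pt (levelX y) y ≠ z2 := by
  constructor
  · intro h
    have := congrArg Complex.im h
    rw [pt_im] at this
    exact hy (by rw [this, abs_of_pos z1_im_pos])
  · intro h
    have := congrArg Complex.im h
    rw [pt_im, z2_eq, Complex.conj_im] at this
    exact hy (by rw [this, abs_neg, abs_of_pos z1_im_pos])

theorem slit_levelX {y : ℝ} (hy : |y| ≠ z1.im) :
    (pairM (pt (levelX y) y)).re ≠ 0 ∨ (pairM (pt (levelX y) y)).im ^ 2 < 3 := by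
  obtain ⟨_, h | h | h⟩ := farSide_cases (levelX_mem y)
  · exact h
  · exact absurd h (levelX_ne_branch hy).1
  · exact absurd h (levelX_ne_branch hy).2

theorem mem_farSide_eventually {y : ℝ} (hy : |y| ≠ z1.im) :
    ∀ᶠ z in 𝓝 (pt (levelX y) y), z.re ∈ farSide z.im := by
  have c0 := Complex.continuous_re.continuousAt.eventually
    (gt_mem_nhds (show (pt (levelX y) y).re < 0 from levelX_lt_zero y))
  have c1 : ContinuousAt (fun w : ℂ => |w.im|) (pt (levelX y) y) := by fun_prop
  rcases lt_or_gt_of_ne hy with h | h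
  · filter_upwards [c0, Complex.continuous_re.continuousAt.eventually
      (gt_mem_nhds (show (pt (levelX y) y).re < z1.re from levelX_lt h))] with z h1 h2
    exact ⟨le_of_lt h1, fun _ => le_of_lt h2⟩
  · filter_upwards [c0, c1.eventually (lt_mem_nhds (show z1.im < |(pt (levelX y) y).im| from h))]
      with z h1 h2
    exact ⟨le_of_lt h1, fun h' => absurd h' h2.not_gt⟩

theorem analyticAt_levelX {y : ℝ} (hy : |y| ≠ z1.im) :
    AnalyticAt ℝ (fun y => pt (levelX y) y) y := by
  have hs := slit_levelX hy
  obtain ⟨h1, h2⟩ := isBranchNear_main (z := pt (levelX y) y) (levelX_lt_zero y) hs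
  refine analyticAt_level_graph h1 h2 (sub_eq_zero.1 (mainH_levelX y)) ?_ ?_
  · have := mainSqrt_re_pos hs
    rw [← pairRoot_sub (pt (levelX y) y) (mainSqrt _), Complex.sub_re] at this
    exact (sub_pos.1 this).ne'
  · filter_upwards [mem_farSide_eventually hy] with z hz h
    exact eq_levelX hz (sub_eq_zero.2 h)

theorem upH_conj {z : ℂ} (hz : z.re ≤ 0) (hz0 : z ≠ 0) (h : |z.im| < z1.im) :
    upH (starRingEnd ℂ z) = upH z := by
  rw [upH, conj_boxSqrt hz hz0 (slit_box hz hz0 h), conj_pairRoot hz hz0, conj_maxRoot hz hz0,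
    hFun_conj, hFun_conj, upH]

theorem canon_sub_left {z : ℂ} (h : |z.im| < z1.im) (hx : levelX z.im < z.re) (hx0 : z.re ≤ 0)
    (hz0 : z ≠ 0) : hFun (canonQ z) - hFun (canonP z) = boxH z := by
  rw [canonQ_left hx0, canonP_left hx0 hz0, canonS_box h hx]
  rfl

theorem canon_sub_right {z : ℂ} (h : |z.im| < z1.im) (hx : levelX z.im < -z.re) (hx0 : 0 < z.re) :
    hFun (canonQ z) - hFun (canonP z) = upH (pt (-z.re) z.im) := by
  have hn : (-z).re ≤ 0 := by simpa using hx0.le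
  have hz0 : -z ≠ 0 := neg_ne_zero.2 (by rintro rfl; simp at hx0)
  have e : pt (-z.re) z.im = starRingEnd ℂ (-z) := by apply Complex.ext <;> simp
  rw [canonQ_right hx0, canonP_right hx0, canonS_box (by simpa using h)
    (by simpa [levelX_neg] using hx), hFun_neg, hFun_neg, e,
    upH_conj hn hz0 (by simpa using h)]
  rfl

theorem upH_levelX_pos {y : ℝ} (hy : |y| < z1.im) : 0 < upH (pt (levelX y) y) := by
  have h1 := upH_add_lowH (pt (levelX y) y)
  have h2 := lowH_neg hy (levelX_lt_zero y)
  rw [boxH_eq_neg (pt_ne_zero (Or.inl (levelX_lt_zero y).ne)) (levelX_re_pos hy),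
    mainH_levelX] at h1
  linarith

theorem ne_zero_of_critHeight_le {y : ℝ} (h : critHeight ≤ |y|) : y ≠ 0 := by
  rintro rfl
  rw [abs_zero] at h
  exact critHeight_pos.not_ge h

theorem starX_bounds {y : ℝ} (hy : |y| < z1.im) : z1.re < starX y ∧ levelX y < -starX y ∧
    pt (starX y) y ≠ 0 := by
  have h0 := z1_re_neg
  rcases lt_or_ge |y| critHeight with h | h
  · obtain ⟨h1, h2⟩ := starX_below h
    refine ⟨h0.trans h1, ?_, pt_ne_zero (Or.inl h1.ne')⟩
    by_contra hcon
    push Not at hcon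
    have h3 := (strictAntiOn_upH hy (convex_Iio 0)
      (fun x hx => ⟨le_of_lt hx, pt_ne_zero (Or.inl (ne_of_lt hx))⟩)).antitoneOn
      (neg_lt_zero.2 h1) (levelX_lt_zero y) hcon
    simp only [h2] at h3
    exact h3.not_gt (upH_levelX_pos hy)
  · obtain ⟨h1, h2, h3⟩ := starX_above h hy
    refine ⟨lt_of_le_of_ne h1 fun h4 => ?_, (levelX_lt_zero y).trans_le (by linarith),
      pt_ne_zero (Or.inr (ne_zero_of_critHeight_le h))⟩
    have := boxH_neg_of_pairM hy le_rfl h0.le (pt_ne_zero (Or.inl h0.ne))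
      (pairM_re_pos_strip hy le_rfl).le
    rw [h4, h3] at this
    exact this.false

theorem starX_notMem {y : ℝ} (hy : |y| < z1.im) :
    pt (starX y) y ∉ levelCut ∧ -pt (starX y) y ∉ levelCut := by
  obtain ⟨h1, h2, _⟩ := starX_bounds hy
  constructor
  · intro h
    have := h.2
    simp only [pt_re, pt_im] at this
    linarith [levelX_lt hy]
  · intro h
    have := h.2
    simp only [Complex.neg_re, Complex.neg_im, pt_re, pt_im, levelX_neg] at this
    linarith

theorem canon_eq_starX {y : ℝ} (hy : |y| < z1.im) :
    hFun (canonQ (pt (starX y) y)) = hFun (canonP (pt (starX y) y)) := by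
  obtain ⟨h1, h2, h3⟩ := starX_bounds hy
  rw [← sub_eq_zero]
  rcases lt_or_ge |y| critHeight with h | h
  · obtain ⟨e1, e2⟩ := starX_below h
    rw [canon_sub_right hy h2 e1]
    exact e2
  · obtain ⟨e1, e2, e3⟩ := starX_above h hy
    rw [canon_sub_left hy ((levelX_lt hy).trans h1) e2 h3, e3]

theorem canon_re_starX {y : ℝ} (hy : |y| < z1.im) :
    0 < (canonQ (pt (starX y) y) - canonP (pt (starX y) y)).re := by
  obtain ⟨h1, h2, h3⟩ := starX_bounds hy
  rcases lt_or_ge |y| critHeight with h | h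
  · obtain ⟨e1, e2⟩ := starX_below h
    have hz0 : -pt (starX y) y ≠ 0 := neg_ne_zero.2 h3
    have := pairRoot_re_lt (z := -pt (starX y) y) (by simpa using e1.le) hz0 (canonS_sq hz0)
    rw [canonQ_right (z := pt (starX y) y) e1, canonP_right (z := pt (starX y) y) e1,
      Complex.sub_re, Complex.neg_re, Complex.neg_re]
    linarith
  · obtain ⟨e1, e2, e3⟩ := starX_above h hy
    have hm := pairM_re_neg_of_boxH hy e1 e2 h3 e3.ge
    rw [canonQ_left (z := pt (starX y) y) e2, canonP_left (z := pt (starX y) y) e2 h3,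
      pairRoot_sub, canonS_of_re_neg h3 hm]
    exact mainSqrt_re_pos (Or.inl hm.ne)

theorem analyticAt_starX {y : ℝ} (hy : |y| < z1.im) :
    AnalyticAt ℝ (fun y => pt (starX y) y) y := by
  obtain ⟨h1, h2, h3⟩ := starX_bounds hy
  obtain ⟨n1, n2⟩ := starX_notMem hy
  refine analyticAt_level_graph (isBranchNear_canonQ h3 n1 n2) (isBranchNear_canonP n1)
    (canon_eq_starX hy) (sub_pos.1 (by simpa using canon_re_starX hy)).ne' ?_
  have c1 : ContinuousAt (fun w : ℂ => |w.im|) (pt (starX y) y) := by fun_prop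
  have c2 : ContinuousAt (fun w : ℂ => -w.re - levelX w.im) (pt (starX y) y) :=
    (Complex.continuous_re.neg.sub (continuous_levelX.comp Complex.continuous_im)).continuousAt
  have c3 := Complex.continuous_re.continuousAt (x := pt (starX y) y)
  filter_upwards [c1.eventually (gt_mem_nhds (show |(pt (starX y) y).im| < z1.im from hy)),
    c2.eventually (lt_mem_nhds (show 0 < -(pt (starX y) y).re - levelX (pt (starX y) y).im from
      sub_pos.2 h2)), c3.eventually (lt_mem_nhds (show z1.re < (pt (starX y) y).re from h1)),
    eventually_ne_nhds h3] with z a b c d h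
  rcases le_or_gt z.re 0 with h' | h'
  · refine eq_starX_of_boxH a (le_of_lt c) h' d ?_
    rw [pt_eta, ← canon_sub_left a ((levelX_lt a).trans c) h' d, h, sub_self]
  · refine eq_starX_of_upH a h' ?_
    rw [← canon_sub_right a (sub_pos.1 b) h', h, sub_self]

theorem continuousOn_starX : ContinuousOn starX (Icc (-z1.im) z1.im) := by
  intro y hy
  have h : |y| ≤ z1.im := abs_le.2 hy
  rcases h.lt_or_eq with h | h
  · have := (analyticAt_starX h).continuousAt
    exact (Complex.continuous_re.continuousAt.comp this).continuousWithinAt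
  · exact (tendsto_starX h).continuousWithinAt

/-! ### Parametrized curves and boundary values -/

/-- The graph of `g`, traversed with constant vertical speed. -/
def graphCurve (g : ℝ → ℝ) (a b t : ℝ) : ℂ := pt (g (a * t + b)) (a * t + b)

theorem deriv_graphCurve_im {g : ℝ → ℝ} {a b t : ℝ}
    (h : AnalyticAt ℝ (fun y => pt (g y) y) (a * t + b)) :
    AnalyticAt ℝ (graphCurve g a b) t ∧ (deriv (graphCurve g a b) t).im = a := by
  have h1 : AnalyticAt ℝ (fun t : ℝ => a * t + b) t := by fun_prop
  have h2 : AnalyticAt ℝ (graphCurve g a b) t := AnalyticAt.comp (g := fun y => pt (g y) y) h h1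
  refine ⟨h2, ?_⟩
  have h3 : HasDerivAt (fun t => (graphCurve g a b t).im) (deriv (graphCurve g a b) t).im t :=
    Complex.imCLM.hasFDerivAt.comp_hasDerivAt t h2.differentiableAt.hasDerivAt
  have h4 : HasDerivAt (fun t => (graphCurve g a b t).im) a t := by
    have := ((hasDerivAt_id t).const_mul a).add_const b
    rw [mul_one] at this
    exact this
  exact h3.unique h4

theorem isAnalyticCurve_graph {g : ℝ → ℝ} {a b : ℝ} {T : Set ℝ} (ha : a ≠ 0)
    (hc : ContinuousOn g ((fun t => a * t + b) '' T))
    (han : ∀ t ∈ interior T, AnalyticAt ℝ (fun y => pt (g y) y) (a * t + b)) :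
    IsAnalyticCurve (graphCurve g a b) T where
  continuousOn := by
    have h1 : ContinuousOn (fun t : ℝ => a * t + b) T := by fun_prop
    exact continuous_pt.comp_continuousOn ((hc.comp h1 (mapsTo_image _ _)).prodMk h1)
  injOn := by
    intro t _ u _ h
    have := congrArg Complex.im h
    simp only [graphCurve, pt_im] at this
    exact mul_left_cancel₀ ha (by linarith)
  analytic := fun t ht => (deriv_graphCurve_im (han t ht)).1
  regular := fun t ht h => by
    have := (deriv_graphCurve_im (han t ht)).2
    rw [h, Complex.zero_im] at this
    exact ha this.symm

theorem IsAnalyticCurve.neg {γ : ℝ → ℂ} {T : Set ℝ} (h : IsAnalyticCurve γ T) :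
    IsAnalyticCurve (fun t => -γ t) T where
  continuousOn := h.continuousOn.neg
  injOn := fun t ht u hu he => h.injOn ht hu (neg_injective he)
  analytic := fun t ht => (h.analytic t ht).neg
  regular := fun t ht he => h.regular t ht (by
    have : deriv (fun t => -γ t) t = -deriv γ t := deriv.neg
    rw [this] at he
    exact neg_eq_zero.1 he)

theorem lineForm_neg (γ h : ℝ → ℂ) : lineForm (fun t => -γ t) (fun t => -h t) = lineForm γ h := by
  funext t
  have : deriv (fun t => -γ t) t = -deriv γ t := deriv.neg
  rw [lineForm, lineForm, this, neg_mul_neg]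

theorem RealAlong.congr {γ h h' : ℝ → ℂ} {T : Set ℝ} {a : ℝ} (hT : IsParamInterval T)
    (ha : a ∈ T) (H : RealAlong γ T a h) (hh : ∀ t ∈ interior T, h t = h' t) :
    RealAlong γ T a h' := by
  intro t ht
  have hsub : uIcc a t ⊆ T := hT.ordConnected.uIcc_subset ha ht
  have hae : ∀ᵐ u, u ∈ uIoc a t → lineForm γ h u = lineForm γ h' u := by
    have h0 : ∀ᵐ u : ℝ, u ≠ 0 := by simp [ae_iff]
    have h1 : ∀ᵐ u : ℝ, u ≠ 1 := by simp [ae_iff]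
    filter_upwards [h0, h1] with u hu0 hu1 hu
    rw [lineForm, lineForm, hh u (hT.mem_interior (hsub (uIoc_subset_uIcc hu)) hu0 hu1)]
  obtain ⟨H1, H2⟩ := H t ht
  refine ⟨H1.congr_ae ((ae_restrict_iff' measurableSet_uIoc).2 hae), ?_⟩
  rwa [← intervalIntegral.integral_congr_ae hae]

theorem RealAlong.neg {γ h : ℝ → ℂ} {T : Set ℝ} {a : ℝ} (H : RealAlong γ T a h) :
    RealAlong (fun t => -γ t) T a (fun t => -h t) := by
  unfold RealAlong
  rw [lineForm_neg]
  exact H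

theorem HasPlusValue.neg {γ : ℝ → ℂ} {f : ℂ → ℂ} {t : ℝ} {L : ℂ} (h : HasPlusValue γ f t L) :
    HasPlusValue (fun t => -γ t) (fun z => -f (-z)) t (-L) := by
  unfold HasPlusValue at *
  have : deriv (fun t => -γ t) t = -deriv γ t := deriv.neg
  rw [this]
  refine h.neg.congr fun ε => ?_
  congr 2
  ring

theorem HasPlusValue.plusValue_eq {γ : ℝ → ℂ} {f : ℂ → ℂ} {t : ℝ} {L : ℂ}
    (h : HasPlusValue γ f t L) : plusValue γ f t = L := h.limUnder_eq

/-- To the left of a downward parametrization of `levelCut` lies the box, and the boundary value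
of `canonS` is there the negative of `mainSqrt`. -/
theorem tendsto_canonS_plus {γ : ℝ → ℂ} {t : ℝ} (hc : γ t ∈ levelCut) (hy : |(γ t).im| ≠ z1.im)
    (hre : (mainSqrt (γ t) * deriv γ t).re = 0) (him : (deriv γ t).im < 0) :
    (∀ᶠ ε : ℝ in 𝓝[>] 0, (γ t + ε * (Complex.I * deriv γ t)).re < 0 ∧
      γ t + ε * (Complex.I * deriv γ t) ∉ levelCut) ∧ HasPlusValue γ canonS t (-mainSqrt (γ t)) := by
  have hy' : |(γ t).im| < z1.im := lt_of_le_of_ne hc.1 hy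
  have hx := re_neg_of_mem_levelCut hc
  have hz0 : γ t ≠ 0 := by
    intro h
    rw [h] at hx
    simp at hx
  have hpt : γ t = pt (levelX (γ t).im) (γ t).im := by
    rw [← hc.2]
    rfl
  have hm : 0 < (pairM (γ t)).re := by
    rw [hpt]
    exact levelX_re_pos hy'
  have hs := mainSqrt_re_pos (Or.inl hm.ne')
  set n : ℝ → ℂ := fun ε => γ t + ε * (Complex.I * deriv γ t) with hn
  have hn0 : n 0 = γ t := by simp [hn]
  have hnd : HasDerivAt n (Complex.I * deriv γ t) 0 := by
    have := ((hasDerivAt_id (0 : ℝ)).ofReal_comp.mul_const (Complex.I * deriv γ t)).const_add (γ t)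
    exact this.congr_deriv (by simp)
  -- The derivative of `mainH` along the left normal is `-3 Im (mainSqrt · γ')`, positive for a
  -- downward curve. So the normal enters the region to the right of `levelCut`.
  have hd : HasDerivAt (fun ε => mainH (n ε)) (3 * (mainSqrt (n 0) * (Complex.I * deriv γ t)).re) 0 :=
    hasDerivAt_mainH hnd (by rw [hn0]; exact hx.le) (by rwa [hn0]) (by rw [hn0]; exact Or.inl hm.ne')
  have hpos : 0 < 3 * (mainSqrt (n 0) * (Complex.I * deriv γ t)).re := by
    have h1 := mul_im_of_re_eq_zero hre
    have h2 : (mainSqrt (γ t) * (Complex.I * deriv γ t)).re = -(mainSqrt (γ t) * deriv γ t).im := by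
      simp
      ring
    rw [hn0, h2]
    have h3 : 0 < Complex.normSq (mainSqrt (γ t)) := by
      rw [Complex.normSq_pos]
      exact mainSqrt_ne_zero (Or.inl hm.ne')
    have h4 := mul_neg_of_pos_of_neg h3 him
    rw [← h1] at h4
    have := neg_of_mul_neg_left h4 hs.le
    linarith
  have h0 : mainH (n 0) = 0 := by
    rw [hn0, hpt]
    exact mainH_levelX _
  have hslope : ∀ᶠ ε in 𝓝[>] (0 : ℝ), 0 < mainH (n ε) := by
    have h1 := hd.tendsto_slope.mono_left (nhdsWithin_mono (0 : ℝ) (fun x (hx : 0 < x) => hx.ne'))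
    filter_upwards [h1.eventually (lt_mem_nhds hpos), self_mem_nhdsWithin] with ε h2 h3
    have h3' : (0 : ℝ) < ε := h3
    rw [slope_def_field, h0, sub_zero, sub_zero] at h2
    exact (div_pos_iff_of_pos_right h3').1 h2
  have hnc : Tendsto n (𝓝[>] 0) (𝓝 (γ t)) := by
    have := hnd.continuousAt.tendsto
    rw [hn0] at this
    exact this.mono_left nhdsWithin_le_nhds
  have c1 : ContinuousAt (fun w : ℂ => |w.im|) (γ t) := by fun_prop
  have c3 : ContinuousAt (fun w => (pairM w).re) (γ t) :=
    Complex.continuous_re.continuousAt.comp (continuousAt_pairM hx.le hz0)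
  have hbox : ∀ᶠ ε in 𝓝[>] (0 : ℝ), (n ε).re < 0 ∧ |(n ε).im| < z1.im ∧
      levelX (n ε).im < (n ε).re ∧ 0 < (pairM (n ε)).re ∧ n ε ≠ 0 := by
    filter_upwards [hslope, hnc.eventually (c1.eventually (gt_mem_nhds hy')),
      hnc.eventually (Complex.continuous_re.continuousAt.eventually (gt_mem_nhds hx)),
      hnc.eventually (c3.eventually (lt_mem_nhds hm)),
      hnc.eventually (eventually_ne_nhds hz0)] with ε a b c d e
    refine ⟨c, b, ?_, d, e⟩
    by_contra hcon
    push Not at hcon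
    have a' : 0 < mainH (pt (n ε).re (n ε).im) := a
    rcases hcon.lt_or_eq with h | h
    · exact (mainH_neg_of_lt h).not_gt a'
    · rw [h, mainH_levelX] at a'
      exact a'.false
  refine ⟨?_, ?_⟩
  · filter_upwards [hbox] with ε h
    exact ⟨h.1, fun h' => h.2.2.1.ne' h'.2⟩
  · have h1 : Tendsto (fun ε => -mainSqrt (n ε)) (𝓝[>] 0) (𝓝 (-mainSqrt (γ t))) :=
      ((continuousAt_mainSqrt hx.le hz0 (Or.inl hm.ne')).tendsto.comp hnc).neg
    refine h1.congr' ?_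
    filter_upwards [hbox] with ε h
    rw [← boxSqrt_eq_neg h.2.2.2.2 h.2.2.2.1]
    exact (canonS_box h.2.1 h.2.2.1).symm

theorem canonQ_neg {z : ℂ} (hz0 : z ≠ 0) : canonQ (-z) = -canonQ z := by
  rcases lt_trichotomy z.re 0 with h | h | h
  · rw [canonQ_right (z := -z) (by simpa using h), canonQ_left h.le, neg_neg]
  · rw [canonQ_left (z := -z) (by simp [h]), canonQ_left h.le, upper_imaginary h hz0, neg_neg]
  · rw [canonQ_left (z := -z) (by simpa using h.le), canonQ_right h, neg_neg]

/-! ### Existence: the canonical configuration -/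

/-- The inverse branches and curves. -/
def canonConfig : Config where
  psiP := canonP
  psiQ := canonQ
  psiR := fun z => -canonP (-z)
  gP := graphCurve levelX (-2 * z1.im) z1.im
  gR := fun t => -graphCurve levelX (-2 * z1.im) z1.im t
  gPstar := graphCurve starX (2 * z1.im) (-z1.im)
  gRstar := fun t => -graphCurve starX (2 * z1.im) (-z1.im) t
  gE1 := graphCurve levelX 1 z1.im
  gE2 := graphCurve levelX 1 (-z1.im)
  gE3 := fun t => -graphCurve levelX 1 z1.im t
  gE4 := fun t => -graphCurve levelX 1 (-z1.im) t
  ystar := critHeight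

theorem graphCurve_re (g : ℝ → ℝ) (a b t : ℝ) : (graphCurve g a b t).re = g (a * t + b) := rfl

theorem canon_GammaP : canonConfig.GammaP = levelCut := by
  have h1 := z1_im_pos
  ext z
  constructor
  · rintro ⟨t, ht, rfl⟩
    refine ⟨?_, rfl⟩
    change |-2 * z1.im * t + z1.im| ≤ z1.im
    rw [abs_le]
    constructor <;> nlinarith [ht.1, ht.2]
  · rintro ⟨hz1, hz2⟩
    obtain ⟨h3, h4⟩ := abs_le.1 hz1
    have e : -2 * z1.im * ((z1.im - z.im) / (2 * z1.im)) + z1.im = z.im := by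
      field_simp
      ring
    refine ⟨(z1.im - z.im) / (2 * z1.im), ⟨by apply div_nonneg <;> linarith,
      by rw [div_le_one (by linarith)]; linarith⟩, ?_⟩
    apply Complex.ext
    · change levelX (-2 * z1.im * ((z1.im - z.im) / (2 * z1.im)) + z1.im) = z.re
      rw [e, hz2]
    · exact e

theorem mem_canon_GammaR {z : ℂ} : z ∈ canonConfig.GammaR ↔ -z ∈ levelCut := by
  rw [← canon_GammaP]
  constructor
  · rintro ⟨t, ht, rfl⟩
    exact ⟨t, ht, (neg_neg _).symm⟩
  · rintro ⟨t, ht, h⟩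
    refine ⟨t, ht, ?_⟩
    change -canonConfig.gP t = z
    rw [h, neg_neg]

theorem canon_curveP : IsAnalyticCurve canonConfig.gP (Icc 0 1) := by
  have h1 := z1_im_pos
  refine isAnalyticCurve_graph (by linarith) continuous_levelX.continuousOn fun t ht => ?_
  rw [interior_Icc] at ht
  refine analyticAt_levelX (ne_of_lt ?_)
  rw [abs_lt]
  constructor <;> nlinarith [ht.1, ht.2]

theorem canon_curvePstar : IsAnalyticCurve canonConfig.gPstar (Icc 0 1) := by
  have h1 := z1_im_pos
  refine isAnalyticCurve_graph (by linarith) (continuousOn_starX.mono ?_) fun t ht => ?_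
  · rintro _ ⟨t, ht, rfl⟩
    constructor <;> nlinarith [ht.1, ht.2]
  · rw [interior_Icc] at ht
    refine analyticAt_starX ?_
    rw [abs_lt]
    constructor <;> nlinarith [ht.1, ht.2]

theorem canon_curveE1 : IsAnalyticCurve canonConfig.gE1 (Ici 0) := by
  have h1 := z1_im_pos
  refine isAnalyticCurve_graph one_ne_zero continuous_levelX.continuousOn fun t ht => ?_
  rw [interior_Ici] at ht
  have ht' : 0 < t := ht
  refine analyticAt_levelX (ne_of_gt (lt_abs.2 (Or.inl ?_)))
  linarith

theorem canon_curveE2 : IsAnalyticCurve canonConfig.gE2 (Iic 0) := by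
  have h1 := z1_im_pos
  refine isAnalyticCurve_graph one_ne_zero continuous_levelX.continuousOn fun t ht => ?_
  rw [interior_Iic] at ht
  have ht' : t < 0 := ht
  refine analyticAt_levelX (ne_of_gt (lt_abs.2 (Or.inr ?_)))
  linarith

theorem levelX_branch {y : ℝ} (h : |y| = z1.im) : levelX y = z1.re := by
  rcases (abs_eq z1_im_pos.le).1 h with h | h
  · rw [h, levelX_y1]
  · rw [h, levelX_neg, levelX_y1]

/-- The modulus of any square root is `√‖pairD‖`, which tends to `0` at a zero of `pairD`, however
the signs are chosen. -/
theorem continuousAt_of_sq {S : ℂ → ℂ} {z : ℂ} (hz : z.re ≤ 0) (hz0 : z ≠ 0) (h : pairD z = 0)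
    (hS : ∀ w ≠ 0, S w ^ 2 = pairD w) : S z = 0 ∧ ContinuousAt S z := by
  have h0 : S z = 0 := by
    have := hS z hz0
    rw [h] at this
    exact pow_eq_zero_iff two_ne_zero |>.1 this
  refine ⟨h0, ?_⟩
  unfold ContinuousAt
  rw [h0, tendsto_zero_iff_norm_tendsto_zero]
  have h1 : Tendsto (fun w => √‖pairD w‖) (𝓝 z) (𝓝 0) := by
    have : ContinuousAt (fun w => √‖pairD w‖) z := (continuousAt_pairD hz hz0).norm.sqrt
    have h2 := this.tendsto
    simpa [h] using h2
  refine h1.congr' ?_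
  filter_upwards [eventually_ne_nhds hz0] with w hw
  rw [← hS w hw, norm_pow, Real.sqrt_sq (norm_nonneg _)]

theorem branch_facts {z : ℂ} (h : z = z1 ∨ z = z2) : z.re < 0 ∧ z ≠ 0 ∧ pairD z = 0 := by
  have h0 := z1_re_neg
  have h2 : z2.re < 0 := by rw [z2_eq, Complex.conj_re]; exact h0
  rcases h with rfl | rfl
  · exact ⟨h0, z1_ne_zero, pairD_z1⟩
  · exact ⟨h2, by rintro h; rw [h] at h2; simp at h2, pairD_z2⟩

theorem pairRoot_branch {S : ℂ → ℂ} {z : ℂ} (h : z = z1 ∨ z = z2)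
    (hS : ∀ w ≠ 0, S w ^ 2 = pairD w) :
    ContinuousAt (fun w => pairRoot w (S w)) z ∧ ContinuousAt (fun w => pairRoot w (-S w)) z ∧
      pairRoot z (S z) = pairRoot z (-S z) ∧ IsPreimage z (pairRoot z (S z)) := by
  obtain ⟨h1, h2, h3⟩ := branch_facts h
  obtain ⟨e1, e2⟩ := continuousAt_of_sq h1.le h2 h3 hS
  exact ⟨continuousAt_pairRoot h1.le h2 e2, continuousAt_pairRoot (S := fun w => -S w) h1.le h2 e2.neg,
    by rw [e1, neg_zero], isPreimage_pairRoot h2 (hS z h2)⟩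

theorem canon_branch {z : ℂ} (h : z = z1 ∨ z = z2) : ContinuousAt canonQ z ∧
    ContinuousAt canonP z ∧ canonQ z = canonP z ∧ IsPreimage z (canonQ z) := by
  obtain ⟨h1, h2, h3⟩ := branch_facts h
  obtain ⟨e1, e2, e3, e4⟩ := pairRoot_branch h (S := canonS) (fun w hw => canonS_sq hw)
  have hre := Complex.continuous_re.continuousAt.eventually (gt_mem_nhds h1)
  refine ⟨e1.congr ?_, e2.congr ?_, ?_, isPreimage_canonQ h2⟩
  · filter_upwards [hre] with w hw using (canonQ_left (le_of_lt hw)).symm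
  · filter_upwards [hre, eventually_ne_nhds h2] with w hw hw0
      using (canonP_left (le_of_lt hw) hw0).symm
  · rw [canonQ_left h1.le, canonP_left h1.le h2, e3]

theorem level_facts {y : ℝ} (hy : |y| ≠ z1.im) :
    0 < (mainSqrt (pt (levelX y) y)).re ∧
    hFun (pairRoot (pt (levelX y) y) (mainSqrt (pt (levelX y) y))) =
      hFun (pairRoot (pt (levelX y) y) (-mainSqrt (pt (levelX y) y))) :=
  ⟨mainSqrt_re_pos (slit_levelX hy), sub_eq_zero.1 (mainH_levelX y)⟩

theorem pt_graph_mem {y : ℝ} (hy : |y| ≤ z1.im) : pt (levelX y) y ∈ levelCut := ⟨hy, rfl⟩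

/-- The differences of the branches along the curves in the level set of `mainH`. -/
theorem realAlong_levelX {a b σ : ℝ} {T : Set ℝ} {h : ℝ → ℂ} (hT : IsParamInterval T) {t₀ : ℝ}
    (ht₀ : t₀ ∈ T) (hγ : IsAnalyticCurve (graphCurve levelX a b) T)
    (hy : ∀ t ∈ interior T, |a * t + b| ≠ z1.im) (hy' : ∀ t ∈ T, t ∉ interior T →
      |a * t + b| = z1.im)
    (hh : ∀ t ∈ interior T, h t = σ * mainSqrt (graphCurve levelX a b t)) (hσ : σ = 1 ∨ σ = -1)
    (ha : a ≠ 0) : RealAlong (graphCurve levelX a b) T t₀ h := by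
  have han : ∀ t ∈ interior T, AnalyticAt ℝ (fun y => pt (levelX y) y) (a * t + b) :=
    fun t ht => analyticAt_levelX (hy t ht)
  have hend : ∀ t ∈ T, t ∉ interior T → graphCurve levelX a b t = z1 ∨
      graphCurve levelX a b t = z2 := by
    intro t ht hti
    have h1 := hy' t ht hti
    have h2 := levelX_branch h1
    rcases (abs_eq z1_im_pos.le).1 h1 with h | h
    · left
      rw [graphCurve, h2, h]
      rfl
    · right
      rw [graphCurve, h2, h, z2_eq]
      rfl
  have hbr : ∀ t ∈ interior T, IsBranchNear (fun w => pairRoot w (mainSqrt w))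
      (graphCurve levelX a b t) ∧ IsBranchNear (fun w => pairRoot w (-mainSqrt w))
      (graphCurve levelX a b t) := fun t ht =>
    isBranchNear_main (levelX_lt_zero _) (slit_levelX (hy t ht))
  rcases hσ with rfl | rfl
  · refine realAlong_of_level (q := fun w => pairRoot w (mainSqrt w))
      (p := fun w => pairRoot w (-mainSqrt w)) (σ := a) hT ht₀ hγ (fun t ht => ?_) fun t ht hti => ?_
    · obtain ⟨f1, f2⟩ := level_facts (hy t ht)
      refine ⟨(hbr t ht).1, (hbr t ht).2, f2, ?_, ?_⟩
      · rw [hh t ht, pairRoot_sub, Complex.ofReal_one, one_mul]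
      · rw [pairRoot_sub, (deriv_graphCurve_im (han t ht)).2]
        have : 0 < a * a := mul_self_pos.2 ha
        have := mul_pos f1 this
        have e : (graphCurve levelX a b t) = pt (levelX (a * t + b)) (a * t + b) := rfl
        rw [e]
        linarith
    · exact pairRoot_branch (hend t ht hti) fun w _ => mainSqrt_sq w
  · refine realAlong_of_level (q := fun w => pairRoot w (-mainSqrt w))
      (p := fun w => pairRoot w (mainSqrt w)) (σ := -a) hT ht₀ hγ (fun t ht => ?_) fun t ht hti => ?_
    · obtain ⟨f1, f2⟩ := level_facts (hy t ht)
      have e1 : pairRoot (graphCurve levelX a b t) (-mainSqrt (graphCurve levelX a b t)) -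
          pairRoot (graphCurve levelX a b t) (mainSqrt (graphCurve levelX a b t)) =
          -mainSqrt (graphCurve levelX a b t) := by
        rw [← neg_sub, pairRoot_sub]
      refine ⟨(hbr t ht).2, (hbr t ht).1, f2.symm, ?_, ?_⟩
      · rw [hh t ht, e1]
        push_cast
        ring
      · rw [e1, (deriv_graphCurve_im (han t ht)).2]
        have : 0 < a * a := mul_self_pos.2 ha
        have := mul_pos f1 this
        have e : (graphCurve levelX a b t) = pt (levelX (a * t + b)) (a * t + b) := rfl
        rw [e, Complex.neg_re]
        linarith
    · obtain ⟨e1, e2, e3, e4⟩ := pairRoot_branch (hend t ht hti) (S := mainSqrt)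
        fun w _ => mainSqrt_sq w
      exact ⟨e2, e1, e3.symm, e3 ▸ e4⟩

theorem canon_QP_left {z : ℂ} (hz : z.re ≤ 0) (hz0 : z ≠ 0) : canonConfig.QP z = canonS z := by
  change canonQ z - canonP z = canonS z
  rw [canonQ_left hz, canonP_left hz hz0, pairRoot_sub]

theorem canon_QR {z : ℂ} (hz0 : z ≠ 0) : canonConfig.QR z = -canonConfig.QP (-z) := by
  change canonQ z - -canonP (-z) = -(canonQ (-z) - canonP (-z))
  rw [canonQ_neg hz0]
  ring

theorem canon_plusP {t : ℝ} (ht : t ∈ Ioo (0 : ℝ) 1) :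
    HasPlusValue canonConfig.gP canonConfig.QP t (-mainSqrt (canonConfig.gP t)) := by
  have h1 := z1_im_pos
  have hy : |-2 * z1.im * t + z1.im| < z1.im := by
    rw [abs_lt]
    constructor <;> nlinarith [ht.1, ht.2]
  have han := analyticAt_levelX hy.ne
  obtain ⟨ha, him⟩ := deriv_graphCurve_im han
  have hre : (mainSqrt (canonConfig.gP t) * deriv canonConfig.gP t).re = 0 := by
    obtain ⟨b1, b2⟩ := isBranchNear_main (z := canonConfig.gP t) (levelX_lt_zero _)
      (slit_levelX hy.ne)
    have := mul_deriv_re_eq_zero b1 b2 ha.differentiableAt.hasDerivAt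
      (Eventually.of_forall fun u => sub_eq_zero.1 (mainH_levelX (-2 * z1.im * u + z1.im)))
    rwa [pairRoot_sub] at this
  obtain ⟨h2, h3⟩ := tendsto_canonS_plus (γ := canonConfig.gP) (t := t) (pt_graph_mem hy.le)
    hy.ne hre (by
      have e : deriv canonConfig.gP t = deriv (graphCurve levelX (-2 * z1.im) z1.im) t := rfl
      rw [e, him]
      linarith)
  refine h3.congr' ?_
  filter_upwards [h2] with ε h
  refine (canon_QP_left h.1.le ?_).symm
  intro h0
  have := h.1
  rw [h0] at this
  simp at this

theorem canon_plusR {t : ℝ} (ht : t ∈ Ioo (0 : ℝ) 1) :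
    HasPlusValue canonConfig.gR canonConfig.QR t (mainSqrt (canonConfig.gP t)) := by
  have h1 := (canon_plusP ht).neg
  rw [neg_neg] at h1
  have e : (fun t => -canonConfig.gP t) = canonConfig.gR := rfl
  rw [e] at h1
  refine h1.congr' ?_
  have hx : (canonConfig.gR t).re ≠ 0 := by
    have h2 := levelX_lt_zero (-2 * z1.im * t + z1.im)
    change (-(graphCurve levelX (-2 * z1.im) z1.im t)).re ≠ 0
    rw [Complex.neg_re, graphCurve_re]
    linarith
  have hc : Tendsto (fun ε : ℝ => canonConfig.gR t + ε * (Complex.I * deriv canonConfig.gR t))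
      (𝓝[>] 0) (𝓝 (canonConfig.gR t)) := by
    have : Continuous fun ε : ℝ => canonConfig.gR t +
      ε * (Complex.I * deriv canonConfig.gR t) := by fun_prop
    have h3 := this.tendsto 0
    simp only [Complex.ofReal_zero, zero_mul, add_zero] at h3
    exact h3.mono_left nhdsWithin_le_nhds
  have h0 : canonConfig.gR t ≠ 0 := by
    intro h
    rw [h] at hx
    exact hx rfl
  filter_upwards [hc.eventually (eventually_ne_nhds h0)] with ε h
  exact (canon_QR h).symm

theorem canon_realP :
    RealAlong canonConfig.gP (Icc 0 1) 0 (plusValue canonConfig.gP canonConfig.QP) := by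
  have h1 := z1_im_pos
  refine realAlong_levelX (σ := -1) (Or.inl rfl) (left_mem_Icc.2 zero_le_one) canon_curveP
    (fun t ht => ?_) (fun t ht hti => ?_) (fun t ht => ?_) (Or.inr rfl) (by linarith)
  · rw [interior_Icc] at ht
    refine (abs_lt.2 ⟨?_, ?_⟩).ne <;> nlinarith [ht.1, ht.2]
  · have : t = 0 ∨ t = 1 := by
      by_contra hcon
      push Not at hcon
      exact hti (IsParamInterval.mem_interior (Or.inl rfl) ht hcon.1 hcon.2)
    rcases this with rfl | rfl
    · rw [mul_zero, zero_add, abs_of_pos h1]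
    · rw [show -2 * z1.im * 1 + z1.im = -z1.im by ring, abs_neg, abs_of_pos h1]
  · rw [interior_Icc] at ht
    rw [(canon_plusP ht).plusValue_eq]
    push_cast
    rw [neg_one_mul]
    rfl

theorem canon_realR :
    RealAlong canonConfig.gR (Icc 0 1) 0 (plusValue canonConfig.gR canonConfig.QR) := by
  refine canon_realP.neg.congr (Or.inl rfl) (left_mem_Icc.2 zero_le_one) fun t ht => ?_
  rw [interior_Icc] at ht
  rw [(canon_plusP ht).plusValue_eq, (canon_plusR ht).plusValue_eq, neg_neg]

theorem canon_end_eq {g : ℝ → ℝ} {a b t y : ℝ} (h : a * t + b = y) :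
    graphCurve g a b t = pt (g y) y := by
  rw [graphCurve, h]

theorem pt_levelX_y1 : pt (levelX z1.im) z1.im = z1 := by
  rw [levelX_y1, pt_eta]

theorem pt_levelX_neg : pt (levelX (-z1.im)) (-z1.im) = z2 := by
  rw [levelX_neg, levelX_y1, z2_eq]
  rfl

theorem pt_starX_y1 : pt (starX z1.im) z1.im = z1 := by
  rw [starX_end (le_abs_self _), pt_eta]

theorem pt_starX_neg : pt (starX (-z1.im)) (-z1.im) = z2 := by
  rw [starX_end (by rw [abs_neg]; exact le_abs_self _), z2_eq]
  rfl

theorem analyticOnNhd_canonP : AnalyticOnNhd ℂ canonP levelCutᶜ := fun _ hz =>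
  (isBranchNear_canonP hz).analyticAt

theorem isInverse_of_isPreimage {z w : ℂ} (h : IsPreimage z w) :
    w ≠ 0 ∧ w ^ 2 ≠ 1 ∧ zMap w = z := (inverse_iff_cubic z w).2 h

theorem canon_sheets : canonConfig.IsSheetStructure where
  curveP := canon_curveP
  startP := (canon_end_eq (by ring)).trans pt_levelX_y1
  endP := (canon_end_eq (by ring)).trans pt_levelX_neg
  leftP := fun z hz => re_neg_of_mem_levelCut (canon_GammaP ▸ hz)
  curveR := canon_curveP.neg
  startR := by
    change -graphCurve levelX (-2 * z1.im) z1.im 0 = z3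
    rw [canon_end_eq (y := z1.im) (by ring), pt_levelX_y1, z3_eq]
  endR := by
    change -graphCurve levelX (-2 * z1.im) z1.im 1 = z4
    rw [canon_end_eq (y := -z1.im) (by ring), pt_levelX_neg, z4_eq]
  rightR := fun z hz => by
    have := re_neg_of_mem_levelCut (mem_canon_GammaR.1 hz)
    simpa using this
  analyticP := by
    rw [canon_GammaP]
    exact analyticOnNhd_canonP
  analyticQ := by
    intro z hz
    simp only [mem_compl_iff, mem_union, not_or, canon_GammaP, mem_canon_GammaR,
      mem_singleton_iff] at hz
    exact (isBranchNear_canonQ hz.2 hz.1.1 hz.1.2).analyticAt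
  analyticR := by
    intro z hz
    have h1 : -z ∈ levelCutᶜ := fun h => hz (mem_canon_GammaR.2 h)
    have h2 : AnalyticAt ℂ (fun z : ℂ => -z) z := by fun_prop
    exact (AnalyticAt.comp (g := canonP) (f := fun z => -z) (analyticOnNhd_canonP _ h1) h2).neg
  inverseP := fun z _ => isInverse_of_isPreimage (isPreimage_canonP z)
  inverseQ := fun z hz => isInverse_of_isPreimage (isPreimage_canonQ fun h => hz (Or.inr h))
  inverseR := fun z _ => isInverse_of_isPreimage (w := -canonP (-z))
    (by simpa using (isPreimage_canonP (-z)).neg)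
  inftyP := tendsto_canonP
  inftyQ := tendsto_canonQ
  inftyR := by
    have := (tendsto_canonP.comp tendsto_neg_cobounded').neg
    rw [neg_neg] at this
    exact this
  realP := canon_realP
  realR := canon_realR

theorem starParam {t : ℝ} (ht : t ∈ Ioo (0 : ℝ) 1) : |2 * z1.im * t + -z1.im| < z1.im := by
  have h1 := z1_im_pos
  rw [abs_lt]
  constructor <;> nlinarith [ht.1, ht.2]

theorem mem_canon_Pstar {y : ℝ} (hy : |y| ≤ z1.im) : pt (starX y) y ∈ canonConfig.GammaPstar := by
  have h1 := z1_im_pos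
  obtain ⟨h3, h4⟩ := abs_le.1 hy
  refine ⟨(y + z1.im) / (2 * z1.im), ⟨by apply div_nonneg <;> linarith,
    by rw [div_le_one (by linarith)]; linarith⟩, ?_⟩
  exact canon_end_eq (by field_simp; ring)

theorem mem_canon_Rstar {z : ℂ} (h : -z ∈ canonConfig.GammaPstar) : z ∈ canonConfig.GammaRstar := by
  obtain ⟨t, ht, h⟩ := h
  refine ⟨t, ht, ?_⟩
  change -canonConfig.gPstar t = z
  rw [h, neg_neg]

theorem canon_avoidP {t : ℝ} (ht : t ∈ Ioo (0 : ℝ) 1) :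
    canonConfig.gPstar t ∉ canonConfig.GammaP ∪ canonConfig.GammaR ∪ {0} := by
  obtain ⟨n1, n2⟩ := starX_notMem (starParam ht)
  obtain ⟨_, _, n3⟩ := starX_bounds (starParam ht)
  rintro ((h | h) | h)
  · exact n1 (canon_GammaP ▸ h)
  · exact n2 (mem_canon_GammaR.1 h)
  · exact n3 h

theorem canon_realPstar :
    RealAlong canonConfig.gPstar (Icc 0 1) 1 (fun t => canonConfig.QP (canonConfig.gPstar t)) := by
  have h1 := z1_im_pos
  refine realAlong_of_level (q := canonQ) (p := canonP) (σ := 1) (Or.inl rfl)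
    (right_mem_Icc.2 zero_le_one) canon_curvePstar (fun t ht => ?_) fun t ht hti => ?_
  · rw [interior_Icc] at ht
    have hy := starParam ht
    obtain ⟨n1, n2⟩ := starX_notMem hy
    obtain ⟨_, _, n3⟩ := starX_bounds hy
    refine ⟨isBranchNear_canonQ n3 n1 n2, isBranchNear_canonP n1, canon_eq_starX hy, rfl, ?_⟩
    have e : (deriv canonConfig.gPstar t).im = 2 * z1.im :=
      (deriv_graphCurve_im (analyticAt_starX hy)).2
    rw [e, one_mul]
    exact mul_pos (canon_re_starX hy) (by linarith)
  · have : t = 0 ∨ t = 1 := by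
      by_contra hcon
      push Not at hcon
      exact hti (IsParamInterval.mem_interior (Or.inl rfl) ht hcon.1 hcon.2)
    refine canon_branch ?_
    rcases this with rfl | rfl
    · exact Or.inr ((canon_end_eq (by ring)).trans pt_starX_neg)
    · exact Or.inl ((canon_end_eq (by ring)).trans pt_starX_y1)

theorem segment_eq (y : ℝ) : (y : ℂ) * Complex.I = pt 0 y := by
  apply Complex.ext <;> simp

theorem canon_starred : canonConfig.IsStarred := by
  have h1 := z1_im_pos
  have hc := critHeight_pos
  have hup : pt 0 critHeight ∈ canonConfig.GammaPstar := by
    have := mem_canon_Pstar (y := critHeight) (by rw [abs_of_pos hc]; exact critHeight_lt.le)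
    rwa [starX_crit (abs_of_pos hc)] at this
  have hlow : pt 0 (-critHeight) ∈ canonConfig.GammaPstar := by
    have hn : |-critHeight| = critHeight := by rw [abs_neg, abs_of_pos hc]
    have := mem_canon_Pstar (y := -critHeight) (by rw [hn]; exact critHeight_lt.le)
    rwa [starX_crit hn] at this
  have eneg : -pt 0 critHeight = pt 0 (-critHeight) := by apply Complex.ext <;> simp
  have hz : |(0 : ℝ)| < critHeight := by rwa [abs_zero]
  have hx := mem_canon_Pstar (y := 0) (by rw [abs_zero]; exact h1.le)
  have ex : pt (starX 0) 0 = ((starX 0 : ℝ) : ℂ) := rfl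
  rw [ex] at hx
  exact {
    curveP := canon_curvePstar
    startP := (canon_end_eq (by ring)).trans pt_starX_neg
    endP := (canon_end_eq (by ring)).trans pt_starX_y1
    avoidP := fun t ht => canon_avoidP ht
    crossP := ⟨starX 0, (starX_below hz).1, hx⟩
    realP := canon_realPstar
    curveR := canon_curvePstar.neg
    startR := by
      change -graphCurve starX (2 * z1.im) (-z1.im) 0 = z4
      rw [canon_end_eq (y := -z1.im) (by ring), pt_starX_neg, z4_eq]
    endR := by
      change -graphCurve starX (2 * z1.im) (-z1.im) 1 = z3
      rw [canon_end_eq (y := z1.im) (by ring), pt_starX_y1, z3_eq]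
    avoidR := by
      intro t ht
      have h := canon_avoidP ht
      change -canonConfig.gPstar t ∉ _
      simp only [mem_union, not_or, canon_GammaP, mem_canon_GammaR, mem_singleton_iff,
        neg_neg, neg_eq_zero] at h ⊢
      exact ⟨⟨h.1.2, h.1.1⟩, h.2⟩
    crossR := ⟨-starX 0, neg_lt_zero.2 (starX_below hz).1, mem_canon_Rstar (by simpa using hx)⟩
    realR := by
      refine canon_realPstar.neg.congr (Or.inl rfl) (right_mem_Icc.2 zero_le_one) fun t ht => ?_
      rw [interior_Icc] at ht
      obtain ⟨_, _, n3⟩ := starX_bounds (starParam ht)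
      have := canon_QR (z := -canonConfig.gPstar t) (neg_ne_zero.2 n3)
      rw [neg_neg] at this
      exact this.symm
    ystar_pos := hc
    meet_upper := by
      change (critHeight : ℂ) * Complex.I ∈ _ ∩ _
      rw [segment_eq]
      exact ⟨hup, mem_canon_Rstar (eneg ▸ hlow)⟩
    meet_lower := by
      change -((critHeight : ℂ) * Complex.I) ∈ _ ∩ _
      rw [segment_eq]
      exact ⟨eneg ▸ hlow, mem_canon_Rstar (by rwa [neg_neg])⟩ }

theorem tendsto_graph_cobounded {l : Filter ℝ} {γ : ℝ → ℂ}
    (h : Tendsto (fun t => |(γ t).im|) l atTop) : Tendsto γ l (Bornology.cobounded ℂ) := by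
  rw [← tendsto_norm_atTop_iff_cobounded]
  exact tendsto_atTop_mono (fun t => Complex.abs_im_le_norm _) h

theorem canon_realE {b : ℝ} {T : Set ℝ} (hT : IsParamInterval T) (h0 : (0 : ℝ) ∈ T)
    (hγ : IsAnalyticCurve (graphCurve levelX 1 b) T)
    (hy : ∀ t ∈ interior T, z1.im < |1 * t + b|)
    (hy' : ∀ t ∈ T, t ∉ interior T → |1 * t + b| = z1.im) :
    RealAlong (graphCurve levelX 1 b) T 0
      (fun t => canonConfig.QP (graphCurve levelX 1 b t)) := by
  refine realAlong_levelX (σ := 1) hT h0 hγ (fun t ht => (hy t ht).ne') hy' (fun t ht => ?_)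
    (Or.inl rfl) one_ne_zero
  have hx : (graphCurve levelX 1 b t).re < 0 := levelX_lt_zero _
  rw [Complex.ofReal_one, one_mul, canon_QP_left hx.le (by intro h; rw [h] at hx; simp at hx)]
  exact canonS_main fun h => (hy t ht).not_gt h.1

theorem canon_realE_neg {b : ℝ} {T : Set ℝ} (hT : IsParamInterval T) (h0 : (0 : ℝ) ∈ T)
    (H : RealAlong (graphCurve levelX 1 b) T 0
      (fun t => canonConfig.QP (graphCurve levelX 1 b t))) :
    RealAlong (fun t => -graphCurve levelX 1 b t) T 0
      (fun t => canonConfig.QR (-graphCurve levelX 1 b t)) := by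
  refine H.neg.congr hT h0 fun t _ => ?_
  have hx : (graphCurve levelX 1 b t).re < 0 := levelX_lt_zero _
  rw [canon_QR (neg_ne_zero.2 (by intro h; rw [h] at hx; simp at hx)), neg_neg]

theorem canon_unbounded : canonConfig.IsUnbounded := by
  have h1 := z1_im_pos
  have y1 : ∀ t ∈ interior (Ici (0 : ℝ)), z1.im < |1 * t + z1.im| := fun t ht => by
    rw [interior_Ici] at ht
    have ht' : 0 < t := ht
    exact lt_abs.2 (Or.inl (by linarith))
  have y2 : ∀ t ∈ interior (Iic (0 : ℝ)), z1.im < |1 * t + -z1.im| := fun t ht => by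
    rw [interior_Iic] at ht
    have ht' : t < 0 := ht
    exact lt_abs.2 (Or.inr (by linarith))
  have e1 : ∀ t ∈ Ici (0 : ℝ), t ∉ interior (Ici (0 : ℝ)) → |1 * t + z1.im| = z1.im :=
    fun t ht hti => by
    have : t = 0 := by
      rw [interior_Ici] at hti
      exact le_antisymm (not_lt.1 hti) ht
    rw [this, mul_zero, zero_add, abs_of_pos h1]
  have e2 : ∀ t ∈ Iic (0 : ℝ), t ∉ interior (Iic (0 : ℝ)) → |1 * t + -z1.im| = z1.im :=
    fun t ht hti => by
    have : t = 0 := by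
      rw [interior_Iic] at hti
      exact le_antisymm ht (not_lt.1 hti)
    rw [this, mul_zero, zero_add, abs_neg, abs_of_pos h1]
  have r1 := canon_realE (b := z1.im) (Or.inr (Or.inl rfl)) self_mem_Ici canon_curveE1 y1 e1
  have r2 := canon_realE (b := -z1.im) (Or.inr (Or.inr rfl)) self_mem_Iic canon_curveE2 y2 e2
  have t1 : Tendsto canonConfig.gE1 atTop (Bornology.cobounded ℂ) := by
    refine tendsto_graph_cobounded (tendsto_abs_atTop_atTop.comp ?_)
    change Tendsto (fun t => 1 * t + z1.im) atTop atTop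
    simp only [one_mul]
    exact tendsto_atTop_add_const_right _ _ tendsto_id
  have t2 : Tendsto canonConfig.gE2 atBot (Bornology.cobounded ℂ) := by
    refine tendsto_graph_cobounded (tendsto_abs_atBot_atTop.comp ?_)
    change Tendsto (fun t => 1 * t + -z1.im) atBot atBot
    simp only [one_mul]
    exact tendsto_atBot_add_const_right _ _ tendsto_id
  have a1 : ∀ t ∈ Ioi (0 : ℝ), canonConfig.gE1 t ∉ levelCut := fun t ht h =>
    (y1 t (by rwa [interior_Ici])).not_ge h.1
  have a2 : ∀ t ∈ Iio (0 : ℝ), canonConfig.gE2 t ∉ levelCut := fun t ht h =>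
    (y2 t (by rwa [interior_Iic])).not_ge h.1
  exact {
    curve1 := canon_curveE1
    start1 := (canon_end_eq (by ring)).trans pt_levelX_y1
    infty1 := t1
    left1 := fun t _ => levelX_lt_zero _
    avoid1 := fun t ht => canon_GammaP ▸ a1 t ht
    real1 := r1
    curve2 := canon_curveE2
    end2 := (canon_end_eq (by ring)).trans pt_levelX_neg
    infty2 := t2
    left2 := fun t _ => levelX_lt_zero _
    avoid2 := fun t ht => canon_GammaP ▸ a2 t ht
    real2 := r2
    curve3 := canon_curveE1.neg
    start3 := by
      change -graphCurve levelX 1 z1.im 0 = z3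
      rw [canon_end_eq (y := z1.im) (by ring), pt_levelX_y1, z3_eq]
    infty3 := tendsto_neg_cobounded'.comp t1
    right3 := fun t _ => neg_pos.2 (levelX_lt_zero _)
    avoid3 := fun t ht h => a1 t ht (by
      have := mem_canon_GammaR.1 h
      rwa [show canonConfig.gE3 t = -canonConfig.gE1 t from rfl, neg_neg] at this)
    real3 := canon_realE_neg (Or.inr (Or.inl rfl)) self_mem_Ici r1
    curve4 := canon_curveE2.neg
    end4 := by
      change -graphCurve levelX 1 (-z1.im) 0 = z4
      rw [canon_end_eq (y := -z1.im) (by ring), pt_levelX_neg, z4_eq]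
    infty4 := tendsto_neg_cobounded'.comp t2
    right4 := fun t _ => neg_pos.2 (levelX_lt_zero _)
    avoid4 := fun t ht h => a2 t ht (by
      have := mem_canon_GammaR.1 h
      rwa [show canonConfig.gE4 t = -canonConfig.gE2 t from rfl, neg_neg] at this)
    real4 := canon_realE_neg (Or.inr (Or.inr rfl)) self_mem_Iic r2 }

theorem canonConfig_isAdmissible : canonConfig.IsAdmissible :=
  ⟨canon_sheets, canon_starred, canon_unbounded⟩

/-! ### Arcs do not separate the plane -/

theorem exists_log_lift {X : Type} [TopologicalSpace X] [ContractibleSpace X]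
    [LocallyPathConnectedSpace X] {g : X → ℂ} (hg : Continuous g) (h0 : ∀ x, g x ≠ 0) :
    ∃ f : X → ℂ, Continuous f ∧ ∀ x, Complex.exp (f x) = g x := by
  have hsc : IsSimplyConnected (univ : Set X) :=
    (Homeomorph.Set.univ X).toHomotopyEquiv.simplyConnectedSpace_iff.2 inferInstance
  obtain ⟨f, hf, hfe⟩ := Complex.exists_continuousOn_eqOn_exp_comp hsc isOpen_univ hg.continuousOn
    (by rintro ⟨x, _, hx⟩; exact h0 x hx)
  exact ⟨f, continuousOn_univ.1 hf, fun x => hfe (mem_univ x)⟩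

/-- There is no continuous logarithm of `z - p` on a circle about `p`. -/
theorem no_log_on_circle {F : ℂ → ℂ} (hF : Continuous F) (p : ℂ) {R : ℝ} (hR : 0 < R)
    (h : ∀ θ : ℝ, Complex.exp (F (p + R * Complex.exp (θ * Complex.I))) =
      R * Complex.exp (θ * Complex.I)) : False := by
  set D : ℝ → ℂ := fun θ => F (p + R * Complex.exp (θ * Complex.I)) - θ * Complex.I - Real.log R
  have hD : Continuous D := by fun_prop
  have hint : ∀ θ, ∃ n : ℤ, D θ = n * (2 * Real.pi * Complex.I) := by
    intro θ
    rw [← Complex.exp_eq_one_iff]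
    have hR' : (R : ℂ) ≠ 0 := Complex.ofReal_ne_zero.2 hR.ne'
    rw [Complex.exp_sub, Complex.exp_sub, h, ← Complex.ofReal_exp, Real.exp_log hR]
    have := Complex.exp_ne_zero (θ * Complex.I)
    field_simp
  have hper : D (2 * Real.pi) = D 0 - 2 * Real.pi * Complex.I := by
    simp only [D]
    push_cast
    rw [Complex.exp_two_pi_mul_I, zero_mul, Complex.exp_zero]
    ring
  have hpi := Real.pi_pos
  obtain ⟨n, hn⟩ := hint 0
  have him : ∀ (θ : ℝ) (m : ℤ), D θ = m * (2 * Real.pi * Complex.I) →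
      (D θ).im = m * (2 * Real.pi) := by
    intro θ m h
    rw [h]
    simp
  have e0 := him 0 n hn
  have e1 : (D (2 * Real.pi)).im = n * (2 * Real.pi) - 2 * Real.pi := by
    rw [hper, Complex.sub_im, e0]
    simp
  have hc : ContinuousOn (fun θ => (D θ).im) (Icc 0 (2 * Real.pi)) :=
    (Complex.continuous_im.comp hD).continuousOn
  -- The continuous function `D` takes values in `2πiℤ` but drops by `2πi` around the circle; it
  -- would have to attain the value halfway between.
  obtain ⟨θ, _, hθ⟩ := intermediate_value_Icc' (by positivity) hc
    (show n * (2 * Real.pi) - Real.pi ∈ Icc (D (2 * Real.pi)).im (D 0).im by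
      rw [e0, e1]
      constructor <;> linarith)
  obtain ⟨m, hm⟩ := hint θ
  simp only [him θ m hm] at hθ
  have h2 : ((2 * m : ℤ) : ℝ) = ((2 * n - 1 : ℤ) : ℝ) := by
    push_cast
    have : (2 * (m : ℝ) - (2 * n - 1)) * Real.pi = 0 := by linarith
    have := (mul_eq_zero.1 this).resolve_right hpi.ne'
    linarith
  have := Int.cast_injective h2
  omega

/-- On the arc `z - p` has a continuous logarithm, which extends to the plane by Tietze. Replacing
`z - p` on `A` by the exponential of the extension gives a continuous function without zeros on the
plane that equals `z - p` on a large circle; its logarithm contradicts `no_log_on_circle`. -/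
theorem not_bounded_of_arc {γ : ℝ → ℂ} (hc : ContinuousOn γ (Icc 0 1)) (hi : InjOn γ (Icc 0 1))
    {A B : Set ℂ} (hA : IsOpen A) (hB : IsOpen B) (hAB : Disjoint A B)
    (hu : (γ '' Icc 0 1)ᶜ ⊆ A ∪ B) (hK : Disjoint A (γ '' Icc 0 1)) (hb : Bornology.IsBounded A)
    {p : ℂ} (hp : p ∈ A) : False := by
  classical
  set e : Icc (0 : ℝ) 1 → ℂ := fun t => γ t
  have he : Continuous e := continuousOn_iff_continuous_domRestrict.1 hc
  have hei : Function.Injective e := fun s t h => Subtype.ext (hi s.2 t.2 h)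
  have hemb : IsClosedEmbedding e := he.isClosedEmbedding hei
  have hne : ∀ t, e t - p ≠ 0 := fun t h =>
    hK.le_bot ⟨hp, ⟨t, t.2, sub_eq_zero.1 h⟩⟩
  obtain ⟨f, hf, hfe⟩ : ∃ f : Icc (0 : ℝ) 1 → ℂ, Continuous f ∧
      ∀ t, Complex.exp (f t) = e t - p := by
    have hcont : Continuous fun t : ℝ => e (projIcc 0 1 zero_le_one t) - p :=
      (he.comp continuous_projIcc).sub continuous_const
    obtain ⟨f, hf, hfe⟩ := exists_log_lift hcont fun t => hne _
    refine ⟨fun t => f t, hf.comp continuous_subtype_val, fun t => ?_⟩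
    rw [hfe, projIcc_val]
  obtain ⟨G, hG⟩ := ContinuousMap.exists_extension' hemb ⟨f, hf⟩
  have hGe : ∀ t, G (e t) = f t := fun t => congrFun hG t
  set h : ℂ → ℂ := A.piecewise (fun z => Complex.exp (G z)) (fun z => z - p)
  have hfr : ∀ a ∈ frontier A, Complex.exp (G a) = a - p := by
    intro a ha
    have ha' : a ∈ γ '' Icc 0 1 := by
      by_contra hcon
      rcases hu hcon with h | h
      · rw [hA.frontier_eq] at ha
        exact ha.2 h
      · have := hAB.closure_left hB
        exact this.le_bot ⟨ha.1, h⟩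
    obtain ⟨t, ht, rfl⟩ := ha'
    have := hGe ⟨t, ht⟩
    rw [← hfe ⟨t, ht⟩, ← this]
  have hh : Continuous h := Continuous.piecewise hfr (by fun_prop) (by fun_prop)
  have hh0 : ∀ z, h z ≠ 0 := by
    intro z
    by_cases hz : z ∈ A
    · simp only [h, piecewise_eq_of_mem _ _ _ hz]
      exact Complex.exp_ne_zero _
    · simp only [h, piecewise_eq_of_notMem _ _ _ hz]
      intro h'
      rw [sub_eq_zero.1 h'] at hz
      exact hz hp
  obtain ⟨F, hF, hFe⟩ := exists_log_lift hh hh0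
  obtain ⟨R, hR⟩ := hb.subset_closedBall p
  set R' := max R 0 + 1
  have hR' : 0 < R' := by positivity
  refine no_log_on_circle hF p hR' fun θ => ?_
  have hz : p + R' * Complex.exp (θ * Complex.I) ∉ A := by
    intro hmem
    have := hR hmem
    rw [Metric.mem_closedBall, dist_eq_norm, add_sub_cancel_left, norm_mul,
      Complex.norm_exp_ofReal_mul_I, mul_one, Complex.norm_real, Real.norm_of_nonneg hR'.le] at this
    have h2 : R < R' := (le_max_left R 0).trans_lt (lt_add_one _)
    linarith
  rw [hFe]
  simp only [h, piecewise_eq_of_notMem _ _ _ hz]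
  ring

theorem isPreconnected_exterior {R : ℝ} (hR : 0 ≤ R) : IsPreconnected {z : ℂ | R < ‖z‖} := by
  have : {z : ℂ | R < ‖z‖} = (fun p : ℝ × ℝ => (p.1 : ℂ) * Complex.exp (p.2 * Complex.I)) ''
      (Ioi R ×ˢ univ) := by
    ext z
    constructor
    · intro hz
      exact ⟨(‖z‖, z.arg), ⟨hz, mem_univ _⟩, Complex.norm_mul_exp_arg_mul_I z⟩
    · rintro ⟨⟨r, θ⟩, ⟨hr, _⟩, rfl⟩
      have hr' : R < r := hr
      change R < ‖(r : ℂ) * Complex.exp (θ * Complex.I)‖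
      rw [norm_mul, Complex.norm_exp_ofReal_mul_I, mul_one, Complex.norm_real,
        Real.norm_of_nonneg (hR.trans hr'.le)]
      exact hr'
  rw [this]
  refine (isPreconnected_Ioi.prod isPreconnected_univ).image _ ?_
  exact Continuous.continuousOn (by fun_prop)

/-- An arc does not separate the plane. -/
theorem isPreconnected_compl_arc {γ : ℝ → ℂ} (hc : ContinuousOn γ (Icc 0 1))
    (hi : InjOn γ (Icc 0 1)) : IsPreconnected (γ '' Icc 0 1)ᶜ := by
  have hK : IsCompact (γ '' Icc 0 1) := isCompact_Icc.image_of_continuousOn hc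
  intro u v hu hv hsub hnu hnv
  by_contra hcon
  rw [not_nonempty_iff_eq_empty] at hcon
  set s := (γ '' Icc 0 1)ᶜ
  have hs : IsOpen s := hK.isClosed.isOpen_compl
  have hdisj : Disjoint (s ∩ u) (s ∩ v) := by
    rw [disjoint_iff_inter_eq_empty, ← hcon]
    ext z
    simp only [mem_inter_iff]
    tauto
  obtain ⟨R, hR⟩ := hK.isBounded.subset_closedBall 0
  have hE : {z : ℂ | max R 0 < ‖z‖} ⊆ s := by
    intro z hz hzK
    have h1 := hR hzK
    rw [mem_closedBall_zero_iff] at h1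
    exact ((le_max_left R 0).trans_lt hz).not_ge h1
  have hbd : ∀ t, Disjoint {z : ℂ | max R 0 < ‖z‖} t → Bornology.IsBounded t := by
    intro t ht
    refine (Metric.isBounded_closedBall (x := (0 : ℂ)) (r := max R 0)).subset fun z hz => ?_
    rw [mem_closedBall_zero_iff]
    by_contra h
    exact ht.le_bot ⟨not_le.1 h, hz⟩
  have hsu : s ⊆ (s ∩ u) ∪ (s ∩ v) := fun z hz => by
    rcases hsub hz with h | h
    · exact Or.inl ⟨hz, h⟩
    · exact Or.inr ⟨hz, h⟩
  rcases (isPreconnected_exterior (le_max_right R 0)).subset_or_subset (hs.inter hu) (hs.inter hv)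
    hdisj (hE.trans hsu) with h | h
  · obtain ⟨p, hp⟩ := hnv
    exact not_bounded_of_arc hc hi (hs.inter hv) (hs.inter hu) hdisj.symm
      (hsu.trans (by rw [union_comm])) (disjoint_compl_left.mono_left inter_subset_left)
      (hbd _ (hdisj.mono_left h)) hp
  · obtain ⟨p, hp⟩ := hnu
    exact not_bounded_of_arc hc hi (hs.inter hu) (hs.inter hv) hdisj hsu
      (disjoint_compl_left.mono_left inter_subset_left) (hbd _ (hdisj.symm.mono_left h)) hp

/-- An arc in the left half plane does not separate it. -/
theorem isPreconnected_left_sdiff_arc {γ : ℝ → ℂ} (hc : ContinuousOn γ (Icc 0 1))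
    (hi : InjOn γ (Icc 0 1)) (hl : ∀ t ∈ Icc (0 : ℝ) 1, (γ t).re < 0) :
    IsPreconnected {z : ℂ | z.re < 0 ∧ z ∉ γ '' Icc 0 1} := by
  -- The substitution `x ↦ log (-x)` carries the left half plane to the whole plane.
  set φ : ℂ → ℂ := fun z => pt (Real.log (-z.re)) z.im
  set ψ : ℂ → ℂ := fun z => pt (-Real.exp z.re) z.im
  have hψφ : ∀ z : ℂ, z.re < 0 → ψ (φ z) = z := by
    intro z hz
    change pt (-Real.exp (Real.log (-z.re))) z.im = z
    rw [Real.exp_log (by linarith), neg_neg, pt_eta]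
  have hφψ : ∀ z : ℂ, φ (ψ z) = z := by
    intro z
    change pt (Real.log (- -Real.exp z.re)) z.im = z
    rw [neg_neg, Real.log_exp, pt_eta]
  have hψre : ∀ z, (ψ z).re < 0 := fun z => neg_lt_zero.2 (Real.exp_pos _)
  have hψc : Continuous ψ := continuous_pt.comp
    (((Real.continuous_exp.comp Complex.continuous_re).neg).prodMk Complex.continuous_im)
  have hφγ : ContinuousOn (fun t => φ (γ t)) (Icc 0 1) := by
    have h1 := Complex.continuous_re.comp_continuousOn hc
    have h2 := Complex.continuous_im.comp_continuousOn hc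
    exact continuous_pt.comp_continuousOn ((h1.neg.log
      (fun t ht => neg_ne_zero.2 (hl t ht).ne)).prodMk h2)
  have hφi : InjOn (fun t => φ (γ t)) (Icc 0 1) := by
    intro s hs t ht h
    have h' := congrArg ψ h
    simp only [hψφ _ (hl s hs), hψφ _ (hl t ht)] at h'
    exact hi hs ht h'
  have key := (isPreconnected_compl_arc hφγ hφi).image ψ hψc.continuousOn
  convert key using 1
  ext z
  constructor
  · rintro ⟨hz, hzK⟩
    refine ⟨φ z, ?_, hψφ z hz⟩
    rintro ⟨t, ht, h⟩
    refine hzK ⟨t, ht, ?_⟩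
    rw [← hψφ z hz, ← h, hψφ _ (hl t ht)]
  · rintro ⟨w, hw, rfl⟩
    refine ⟨hψre w, ?_⟩
    rintro ⟨t, ht, h⟩
    refine hw ⟨t, ht, ?_⟩
    simp only [h, hφψ]

/-! ### Identification of arbitrary inverse mappings up to the choice of cut -/

theorem isPreimage_iff_inverse {z w : ℂ} : IsPreimage z w ↔ w ≠ 0 ∧ w ^ 2 ≠ 1 ∧ zMap w = z :=
  (inverse_iff_cubic z w).symm

theorem IsInverseBranchOn.isPreimage {ψ : ℂ → ℂ} {U : Set ℂ} (h : IsInverseBranchOn ψ U) {z : ℂ}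
    (hz : z ∈ U) : IsPreimage z (ψ z) := isPreimage_iff_inverse.2 (h z hz)

theorem isBranchNear_maxRoot {z : ℂ} (hz : z.re < 0) : IsBranchNear maxRoot z := by
  have hz0 : z ≠ 0 := by rintro rfl; simp at hz
  refine ⟨?_, zMapDeriv_maxRoot_ne hz.le hz0⟩
  filter_upwards [Complex.continuous_re.continuousAt.eventually_lt_const hz] with w hw
  exact ⟨continuousAt_maxRoot hw.le (by rintro rfl; simp at hw), maxRoot_isPreimage w⟩

theorem analyticAt_maxRoot {z : ℂ} (hz : z.re < 0) : AnalyticAt ℂ maxRoot z :=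
  (isBranchNear_maxRoot hz).analyticAt

theorem analyticAt_pairM {z : ℂ} (hz : z.re < 0) : AnalyticAt ℂ pairM z := by
  have hz0 : z ≠ 0 := by rintro rfl; simp at hz
  have h := analyticAt_maxRoot hz
  have : z * maxRoot z ≠ 0 := mul_ne_zero hz0 (maxRoot_isPreimage z).ne_zero
  unfold pairM pairCoord
  fun_prop (disch := assumption)

theorem analyticAt_pairD {z : ℂ} (hz : z.re < 0) : AnalyticAt ℂ pairD z := by
  have h := analyticAt_pairM hz
  unfold pairD
  fun_prop (disch := norm_num)

/-- Near the limit point a root cannot coincide with either of the two sheets that have other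
limits, so it is the third. -/
theorem IsTriple.eventually_eq {a b c f : ℂ → ℂ} {la lb lc : ℂ} {l : Filter ℂ}
    (h : ∀ᶠ z in l, IsTriple z (a z) (b z) (c z)) (hf : ∀ᶠ z in l, IsPreimage z (f z))
    (tf : Tendsto f l (𝓝 la)) (tb : Tendsto b l (𝓝 lb)) (tc : Tendsto c l (𝓝 lc))
    (hb : la ≠ lb) (hc : la ≠ lc) : ∀ᶠ z in l, f z = a z := by
  filter_upwards [h, hf, (tf.sub tb).eventually_ne (sub_ne_zero.2 hb),
    (tf.sub tc).eventually_ne (sub_ne_zero.2 hc)] with z h hf h1 h2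
  rcases h.isPreimage_iff _ |>.1 hf with h | h | h
  · exact h
  · exact absurd (sub_eq_zero.2 h) h1
  · exact absurd (sub_eq_zero.2 h) h2

theorem exists_left_of_cobounded {p : ℂ → Prop} (h : ∀ᶠ z in Bornology.cobounded ℂ, p z) :
    ∃ z : ℂ, z.re < 0 ∧ ∀ᶠ w in 𝓝 z, p w := by
  obtain ⟨R, hR⟩ := (Metric.hasBasis_cobounded_compl_closedBall (0 : ℂ)).eventually_iff.1 h
  refine ⟨((-(|R| + 1) : ℝ) : ℂ), ?_, ?_⟩
  · rw [Complex.ofReal_re]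
    have := abs_nonneg R
    linarith
  · refine Filter.mem_of_superset (Metric.isClosed_closedBall.isOpen_compl.mem_nhds ?_)
      fun w hw => hR.2 hw
    rw [mem_compl_iff, mem_closedBall_zero_iff, Complex.norm_real, Real.norm_eq_abs, abs_neg,
      abs_of_nonneg (by positivity)]
    linarith [le_abs_self R]

namespace Config

variable {C : Config}

/-- The defining properties of the inverse mappings and their cuts, without the realness of the
integrals. -/
structure IsCut (C : Config) : Prop where
  curveP : IsAnalyticCurve C.gP (Icc 0 1)
  startP : C.gP 0 = z1
  endP : C.gP 1 = z2
  leftP : ∀ z ∈ C.GammaP, z.re < 0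
  curveR : IsAnalyticCurve C.gR (Icc 0 1)
  rightR : ∀ z ∈ C.GammaR, 0 < z.re
  analyticP : AnalyticOnNhd ℂ C.psiP C.GammaPᶜ
  analyticQ : AnalyticOnNhd ℂ C.psiQ (C.GammaP ∪ C.GammaR ∪ {0})ᶜ
  analyticR : AnalyticOnNhd ℂ C.psiR C.GammaRᶜ
  inverseP : IsInverseBranchOn C.psiP C.GammaPᶜ
  inverseQ : IsInverseBranchOn C.psiQ (C.GammaP ∪ C.GammaR ∪ {0})ᶜ
  inverseR : IsInverseBranchOn C.psiR C.GammaRᶜ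
  inftyP : Tendsto C.psiP (Bornology.cobounded ℂ) (𝓝 (-1))
  inftyQ : Tendsto C.psiQ (Bornology.cobounded ℂ) (𝓝 0)
  inftyR : Tendsto C.psiR (Bornology.cobounded ℂ) (𝓝 1)

theorem IsSheetStructure.cut (h : C.IsSheetStructure) : C.IsCut :=
  ⟨h.curveP, h.startP, h.endP, h.leftP, h.curveR, h.rightR, h.analyticP, h.analyticQ, h.analyticR,
    h.inverseP, h.inverseQ, h.inverseR, h.inftyP, h.inftyQ, h.inftyR⟩

theorem IsCut.isCompact_GammaP (h : C.IsCut) : IsCompact C.GammaP :=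
  isCompact_Icc.image_of_continuousOn h.curveP.continuousOn

theorem IsCut.isCompact_GammaR (h : C.IsCut) : IsCompact C.GammaR :=
  isCompact_Icc.image_of_continuousOn h.curveR.continuousOn

/-- The left half plane without `Γ_P`. -/
def cutLeft (C : Config) : Set ℂ := {z | z.re < 0 ∧ z ∉ C.GammaP}

theorem IsCut.isPreconnected_cutLeft (h : C.IsCut) :
    IsPreconnected C.cutLeft :=
  isPreconnected_left_sdiff_arc h.curveP.continuousOn h.curveP.injOn
    fun t ht => h.leftP _ ⟨t, ht, rfl⟩

theorem IsCut.notMem_GammaR (h : C.IsCut) {z : ℂ} (hz : z.re ≤ 0) :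
    z ∉ C.GammaR := fun hm => (h.rightR z hm).not_ge hz

theorem IsCut.notMem_union (h : C.IsCut) {z : ℂ} (hz : z ∈ C.cutLeft) :
    z ∈ (C.GammaP ∪ C.GammaR ∪ {0})ᶜ := by
  rintro ((h1 | h1) | h1)
  · exact hz.2 h1
  · exact h.notMem_GammaR hz.1.le h1
  · rw [mem_singleton_iff.1 h1] at hz
    simpa using hz.1

/-- At infinity the three sheets have the distinct limits `1`, `0` and `-1`, which identify the
inverse mappings there. -/
theorem IsCut.eventually_eq (h : C.IsCut) :
    ∀ᶠ z in Bornology.cobounded ℂ, C.psiR z = maxRoot z ∧ C.psiQ z = pairRoot z (mainSqrt z) ∧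
      C.psiP z = pairRoot z (-mainSqrt z) := by
  have e0 : ∀ᶠ z : ℂ in Bornology.cobounded ℂ, z ≠ 0 :=
    (tendsto_norm_cobounded_atTop.eventually (eventually_gt_atTop 0)).mono
      fun z hz => norm_pos_iff.1 hz
  have eP : ∀ᶠ z in Bornology.cobounded ℂ, z ∉ C.GammaP := h.isCompact_GammaP.isBounded
  have eR : ∀ᶠ z in Bornology.cobounded ℂ, z ∉ C.GammaR := h.isCompact_GammaR.isBounded
  have ht : ∀ᶠ z in Bornology.cobounded ℂ,
      IsTriple z (maxRoot z) (pairRoot z (mainSqrt z)) (pairRoot z (-mainSqrt z)) :=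
    e0.mono fun z hz => isTriple_pairRoot hz (mainSqrt_sq z)
  have tM := tendsto_maxRoot_cobounded
  have tU := tendsto_upper_cobounded
  have tL := tendsto_lower_cobounded
  have hR := IsTriple.eventually_eq ht (eR.mono fun z hz => h.inverseR.isPreimage hz) h.inftyR
    tU tL (by norm_num) (by norm_num)
  have hQ := IsTriple.eventually_eq (ht.mono fun z hz => hz.swap12)
    ((e0.and (eP.and eR)).mono fun z hz => h.inverseQ.isPreimage (z := z) (by
      rintro ((h1 | h1) | h1)
      exacts [hz.2.1 h1, hz.2.2 h1, hz.1 h1])) h.inftyQ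
    tM tL (by norm_num) (by norm_num)
  have hP := IsTriple.eventually_eq (ht.mono fun z hz => hz.rotate.rotate)
    (eP.mono fun z hz => h.inverseP.isPreimage hz) h.inftyP
    tM tU (by norm_num) (by norm_num)
  filter_upwards [hR, hQ, hP] with z h1 h2 h3
  exact ⟨h1, h2, h3⟩

theorem IsCut.psiR_eq (h : C.IsCut) {z : ℂ} (hz : z.re < 0) :
    C.psiR z = maxRoot z := by
  obtain ⟨w, hw, he⟩ := exists_left_of_cobounded h.eventually_eq
  exact AnalyticOnNhd.eqOn_of_preconnected_of_eventuallyEq (U := {z : ℂ | z.re < 0})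
    (fun z hz => h.analyticR z (h.notMem_GammaR (le_of_lt hz)))
    (fun z hz => analyticAt_maxRoot hz) (convex_halfSpace_re_lt 0).isPreconnected hw
    (he.mono fun _ h => h.1) hz

theorem IsCut.exists_start (h : C.IsCut) :
    ∃ w ∈ C.cutLeft, ∀ᶠ z in 𝓝 w, C.psiR z = maxRoot z ∧ C.psiQ z = pairRoot z (mainSqrt z) ∧
      C.psiP z = pairRoot z (-mainSqrt z) := by
  have eP : ∀ᶠ z in Bornology.cobounded ℂ, z ∉ C.GammaP := h.isCompact_GammaP.isBounded
  obtain ⟨w, hw, he⟩ := exists_left_of_cobounded (eP.and h.eventually_eq)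
  exact ⟨w, ⟨hw, he.self_of_nhds.1⟩, he.mono fun _ h => h.2⟩

theorem IsCut.analyticAt_QP (h : C.IsCut) {z : ℂ} (hz : z ∈ C.cutLeft) :
    AnalyticAt ℂ C.QP z := (h.analyticQ z (h.notMem_union hz)).sub (h.analyticP z hz.2)

/-- Only the square is compared: `pairD` is analytic in the whole left half plane, whereas the sign
of the difference depends on the position of the cut. The identity theorem applies because the arc
does not separate the half plane. -/
theorem IsCut.QP_sq (h : C.IsCut) {z : ℂ} (hz : z ∈ C.cutLeft) :
    C.QP z ^ 2 = pairD z := by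
  obtain ⟨w, hw, he⟩ := h.exists_start
  refine AnalyticOnNhd.eqOn_of_preconnected_of_eventuallyEq (f := fun z => C.QP z ^ 2)
    (fun z hz => (h.analyticAt_QP hz).pow 2) (fun z hz => analyticAt_pairD hz.1)
    h.isPreconnected_cutLeft hw (he.mono fun u hu => ?_) hz
  simp only
  rw [QP, hu.2.1, hu.2.2, pairRoot_sub, mainSqrt_sq]

/-- The sum of the two sheets is symmetric and therefore does not see the cut; with the square of
their difference it determines both up to their order. -/
theorem IsCut.add_eq (h : C.IsCut) {z : ℂ} (hz : z ∈ C.cutLeft) :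
    C.psiQ z + C.psiP z = -(1 + pairM z) * maxRoot z := by
  obtain ⟨w, hw, he⟩ := h.exists_start
  refine AnalyticOnNhd.eqOn_of_preconnected_of_eventuallyEq (f := fun z => C.psiQ z + C.psiP z)
    (g := fun z => -(1 + pairM z) * maxRoot z)
    (fun z hz => (h.analyticQ z (h.notMem_union hz)).add (h.analyticP z hz.2)) (fun z hz => ?_)
    h.isPreconnected_cutLeft hw (he.mono fun u hu => ?_) hz
  · have h1 := analyticAt_pairM hz.1
    have h2 := analyticAt_maxRoot hz.1
    fun_prop
  · simp only
    rw [hu.2.1, hu.2.2, pairRoot, pairRoot]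
    ring

theorem IsCut.psiQ_eq (h : C.IsCut) {z : ℂ} (hz : z ∈ C.cutLeft) :
    C.psiQ z = pairRoot z (C.QP z) := by
  rw [pairRoot, ← h.add_eq hz, QP]
  ring

theorem IsCut.psiP_eq (h : C.IsCut) {z : ℂ} (hz : z ∈ C.cutLeft) :
    C.psiP z = pairRoot z (-C.QP z) := by
  rw [pairRoot, ← h.add_eq hz, QP]
  ring

end Config

/-! ### From real integrals to level curves -/

theorem lineForm_im_eq_zero_iff {γ h : ℝ → ℂ} {t : ℝ} :
    (lineForm γ h t).im = 0 ↔ (h t * deriv γ t).re = 0 := by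
  have hpi := Real.pi_pos
  have e : lineForm γ h t = ((3 / (2 * Real.pi) : ℝ) : ℂ) * (h t * deriv γ t) * (-Complex.I) := by
    have hpi' : (Real.pi : ℂ) ≠ 0 := Complex.ofReal_ne_zero.2 Real.pi_ne_zero
    rw [lineForm]
    push_cast
    field_simp
    rw [Complex.I_sq]
    ring
  have h2 : (lineForm γ h t).im = -(3 / (2 * Real.pi) * (h t * deriv γ t).re) := by
    rw [e, mul_assoc, Complex.im_ofReal_mul]
    simp only [mul_neg, Complex.neg_im, Complex.mul_I_im]
  rw [h2, neg_eq_zero, mul_eq_zero, or_iff_right (by positivity)]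

/-- A closed condition that holds wherever the line element is real holds everywhere. -/
theorem RealAlong.forall_mem {γ h : ℝ → ℂ} {T : Set ℝ} {a : ℝ} (hr : RealAlong γ T a h)
    {S : Set ℂ} (hS : IsClosed S) {F : ℝ → ℂ} (hF : ContinuousOn F (interior T))
    (hm : ∀ t ∈ interior T, (h t * deriv γ t).re = 0 → F t ∈ S) :
    ∀ t ∈ interior T, F t ∈ S := by
  intro t ht
  by_contra hn
  have h1 : ∀ᶠ u in 𝓝 t, u ∈ interior T ∧ F u ∉ S :=
    (isOpen_interior.eventually_mem ht).and
      ((hF.continuousAt (isOpen_interior.mem_nhds ht)).eventually (hS.isOpen_compl.mem_nhds hn))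
  obtain ⟨c, d, hcd, hsub⟩ := mem_nhds_iff_exists_Ioo_subset.1 h1
  obtain ⟨c', hc', hc''⟩ := exists_between hcd.1
  obtain ⟨d', hd', hd''⟩ := exists_between hcd.2
  have hlt : c' < d' := hc''.trans hd'
  have hin : ∀ u ∈ Icc c' d', u ∈ interior T ∧ F u ∉ S := fun u hu =>
    hsub ⟨hc'.trans_le hu.1, hu.2.trans_lt hd''⟩
  have hc1 := hr c' (interior_subset (hin c' (left_mem_Icc.2 hlt.le)).1)
  have hint : ∀ u ∈ Icc c' d', IntervalIntegrable (lineForm γ h) volume c' u ∧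
      (∫ v in c'..u, lineForm γ h v).im = 0 := by
    intro u hu
    have hu1 := hr u (interior_subset (hin u hu).1)
    have hi := hc1.1.symm.trans hu1.1
    refine ⟨hi, ?_⟩
    rw [← intervalIntegral.integral_interval_sub_left hu1.1 hc1.1, Complex.sub_im, hu1.2, hc1.2,
      sub_zero]
  -- By Lebesgue differentiation the derivative of the integral is the line element almost
  -- everywhere, so a nondegenerate interval contains a point where the line element itself is real.
  have hae := (hint d' (right_mem_Icc.2 hlt.le)).1.ae_hasDerivAt_integral
  have hpos : volume (Ioo c' d') ≠ 0 := by
    rw [Real.volume_Ioo]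
    simpa using hlt
  obtain ⟨x, hx, hxd⟩ : ∃ x ∈ Ioo c' d', HasDerivAt (fun u => ∫ v in c'..u, lineForm γ h v)
      (lineForm γ h x) x := by
    by_contra! hcon
    refine hpos (measure_mono_null (fun x hx => ?_) hae)
    intro h'
    refine hcon x hx (h' ?_ c' left_mem_uIcc)
    rw [uIcc_of_le hlt.le]
    exact Ioo_subset_Icc_self hx
  have h2 : HasDerivAt (fun u => (∫ v in c'..u, lineForm γ h v).im) (lineForm γ h x).im x :=
    Complex.imCLM.hasFDerivAt.comp_hasDerivAt x hxd
  have h3 : HasDerivAt (fun u => (∫ v in c'..u, lineForm γ h v).im) 0 x := by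
    refine (hasDerivAt_const x (0 : ℝ)).congr_of_eventuallyEq ?_
    filter_upwards [Ioo_mem_nhds hx.1 hx.2] with u hu
    exact (hint u (Ioo_subset_Icc_self hu)).2
  have hx' := hin x (Ioo_subset_Icc_self hx)
  exact hx'.2 (hm x hx'.1 (lineForm_im_eq_zero_iff.1 (h2.unique h3)))

/-- Different choices of the square root change `mainH` by its sign only, so its square has no jump
across the cut of `mainSqrt`. -/
theorem continuousAt_mainH_sq {z : ℂ} (hz : z.re ≤ 0) (hz0 : z ≠ 0) :
    ContinuousAt (fun w => mainH w ^ 2) z := by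
  by_cases h : (pairM z).re ≠ 0 ∨ (pairM z).im ^ 2 < 3
  · exact (continuousAt_mainH hz hz0 h).pow 2
  · push Not at h
    rcases h.2.eq_or_lt with h3 | h3
    · refine (continuousAt_mainH_of_pairD hz hz0 ?_).pow 2
      have : pairM z ^ 2 = -3 := by
        apply Complex.ext
        · simp [pow_two, h.1]
          nlinarith
        · simp [pow_two, h.1]
      rw [pairD, this]
      norm_num
    · have e : ∀ w ≠ 0, mainH w ^ 2 = boxH w ^ 2 := by
        intro w hw
        rcases sq_eq_sq_iff_eq_or_eq_neg.1 ((mainSqrt_sq w).trans (boxSqrt_sq hw).symm) with h' | h'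
        · rw [mainH, boxH, hDiff_congr h']
        · rw [mainH, boxH, hDiff_neg h', neg_sq]
      refine ((continuousAt_boxH hz hz0 (Or.inr h3)).pow 2).congr ?_
      filter_upwards [eventually_ne_nhds hz0] with w hw using (e w hw).symm

/-- Near a point that is not a branch point there is a continuous square root of `pairD`. -/
theorem exists_sqrt {z : ℂ} (hz : z.re ≤ 0) (hz0 : z ≠ 0) (hd : pairD z ≠ 0) :
    ∃ S : ℂ → ℂ, ContinuousAt S z ∧ (∀ w ≠ 0, S w ^ 2 = pairD w) ∧ S z ≠ 0 ∧
      ∀ w ≠ 0, mainH w ^ 2 = hDiff S w ^ 2 := by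
  have key : ∀ S : ℂ → ℂ, (∀ w ≠ 0, S w ^ 2 = pairD w) → S z ≠ 0 ∧
      ∀ w ≠ 0, mainH w ^ 2 = hDiff S w ^ 2 := by
    refine fun S hS => ⟨fun h => hd ?_, fun w hw => ?_⟩
    · rw [← hS z hz0, h, zero_pow two_ne_zero]
    · rcases sq_eq_sq_iff_eq_or_eq_neg.1 ((mainSqrt_sq w).trans (hS w hw).symm) with h' | h'
      · rw [mainH, hDiff_congr h']
      · rw [mainH, hDiff_neg h', neg_sq]
  by_cases h : (pairM z).re ≠ 0 ∨ (pairM z).im ^ 2 < 3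
  · exact ⟨mainSqrt, continuousAt_mainSqrt hz hz0 h, fun w _ => mainSqrt_sq w,
      key _ fun w _ => mainSqrt_sq w⟩
  · push Not at h
    have h3 : 3 < (pairM z).im ^ 2 := by
      refine lt_of_le_of_ne h.2 fun h3 => hd ?_
      have : pairM z ^ 2 = -3 := by
        apply Complex.ext
        · simp [pow_two, h.1]
          nlinarith
        · simp [pow_two, h.1]
      rw [pairD, this]
      norm_num
    exact ⟨boxSqrt, continuousAt_boxSqrt hz hz0 (Or.inr h3), fun w hw => boxSqrt_sq hw,
      key _ fun w hw => boxSqrt_sq hw⟩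

theorem re_eq_zero_of_sq {a : ℂ} (h1 : (a ^ 2).re ≤ 0) (h2 : (a ^ 2).im = 0) : a.re = 0 := by
  simp only [pow_two, Complex.mul_re, Complex.mul_im] at h1 h2
  have : a.re * a.im = 0 := by linarith
  rcases mul_eq_zero.1 this with h | h
  · exact h
  · rw [h] at h1
    nlinarith [sq_nonneg a.re]

theorem sq_of_re_eq_zero {a : ℂ} (h : a.re = 0) : (a ^ 2).re ≤ 0 ∧ (a ^ 2).im = 0 := by
  simp only [pow_two, Complex.mul_re, Complex.mul_im, h]
  constructor <;> nlinarith [sq_nonneg a.im]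

/-- The condition on `pairD · γ'²` says that `S γ'` is imaginary for a local square root `S`, hence
that `hDiff S` is stationary along the curve. -/
theorem hasDerivAt_mainH_sq {γ : ℝ → ℂ} {γ' : ℂ} {t : ℝ} (hγ : HasDerivAt γ γ' t)
    (hz : (γ t).re ≤ 0) (hz0 : γ t ≠ 0) (hd : pairD (γ t) ≠ 0)
    (h1 : (pairD (γ t) * γ' ^ 2).re ≤ 0) (h2 : (pairD (γ t) * γ' ^ 2).im = 0) :
    HasDerivAt (fun u => mainH (γ u) ^ 2) 0 t := by
  obtain ⟨S, hS, hsq, hS0, he⟩ := exists_sqrt hz hz0 hd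
  rw [← hsq _ hz0, ← mul_pow] at h1 h2
  have h := (hasDerivAt_hDiff hγ hz hz0 hS hsq hS0).pow 2
  rw [re_eq_zero_of_sq h1 h2] at h
  refine (h.congr_deriv (by simp)).congr_of_eventuallyEq ?_
  filter_upwards [hγ.continuousAt.eventually_ne hz0] with u hu
  exact he _ hu

theorem mainH_eq_zero_of_level {γ : ℝ → ℂ} {T : Set ℝ} (hT : T.OrdConnected)
    (hγ : IsAnalyticCurve γ T) {a t : ℝ} (ha : a ∈ T) (ht : t ∈ T) (hioo : Ioo (min a t) (max a t) ⊆ interior T)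
    (hz : ∀ t ∈ T, (γ t).re < 0) (h0 : mainH (γ a) = 0)
    (hd : ∀ t ∈ interior T, pairD (γ t) ≠ 0)
    (h : ∀ t ∈ interior T, pairD (γ t) * deriv γ t ^ 2 ∈ {w : ℂ | w.re ≤ 0 ∧ w.im = 0}) :
    mainH (γ t) = 0 := by
  have hne : ∀ t ∈ T, γ t ≠ 0 := fun t ht h => by
    have := hz t ht
    rw [h] at this
    simp at this
  have hsub : uIcc a t ⊆ T := hT.uIcc_subset ha ht
  have hc : ContinuousOn (fun u => mainH (γ u) ^ 2) (Icc (min a t) (max a t)) := fun u hu =>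
    ContinuousAt.comp_continuousWithinAt (f := γ) (g := fun w => mainH w ^ 2)
      (continuousAt_mainH_sq (hz u (hsub hu)).le (hne u (hsub hu)))
      ((hγ.continuousOn u (hsub hu)).mono hsub)
  have hD : ∀ u ∈ Ioo (min a t) (max a t), HasDerivAt (fun u => mainH (γ u) ^ 2) 0 u := fun u hu =>
    have hu' := hioo hu
    hasDerivAt_mainH_sq (hγ.analytic u hu').differentiableAt.hasDerivAt
      (hz u (interior_subset hu')).le (hne u (interior_subset hu')) (hd u hu') (h u hu').1
      (h u hu').2
  have he : mainH (γ (max a t)) ^ 2 = mainH (γ (min a t)) ^ 2 := by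
    rcases (min_le_max (a := a) (b := t)).eq_or_lt with hlt | hlt
    · rw [hlt]
    · obtain ⟨c, hc, hc'⟩ := exists_hasDerivAt_eq_slope _ _ hlt hc hD
      rw [eq_comm, div_eq_iff (sub_pos.2 hlt).ne'] at hc'
      linarith
  have h2 : mainH (γ t) ^ 2 = 0 := by
    rcases le_total a t with hat | hat
    · rw [max_eq_right hat, min_eq_left hat, h0] at he
      simpa using he
    · rw [max_eq_left hat, min_eq_right hat, h0] at he
      simpa using he.symm
  simpa using h2

/-- The points on the left normal of a simple curve, close to the curve, are not on the curve. -/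
theorem IsAnalyticCurve.eventually_notMem {γ : ℝ → ℂ} (hγ : IsAnalyticCurve γ (Icc 0 1)) {t : ℝ}
    (ht : t ∈ Ioo (0 : ℝ) 1) :
    ∀ᶠ ε : ℝ in 𝓝[>] 0, γ t + ε * (Complex.I * deriv γ t) ∉ γ '' Icc 0 1 := by
  rw [← interior_Icc] at ht
  set d := deriv γ t
  have hd : 0 < ‖d‖ := norm_pos_iff.2 (hγ.regular t ht)
  have hder : HasDerivAt γ d t := (hγ.analytic t ht).differentiableAt.hasDerivAt
  have h1 := hder.isLittleO.def (c := ‖d‖ / 2) (by positivity)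
  obtain ⟨η, hη, hball⟩ := Metric.eventually_nhds_iff.1 h1
  have hK : IsCompact (γ '' (Icc 0 1 \ Metric.ball t η)) :=
    (isCompact_Icc.diff Metric.isOpen_ball).image_of_continuousOn
      (hγ.continuousOn.mono sdiff_subset)
  have hnot : γ t ∉ γ '' (Icc 0 1 \ Metric.ball t η) := by
    rintro ⟨u, hu, he⟩
    rw [hγ.injOn hu.1 (interior_subset ht) he] at hu
    exact hu.2 (Metric.mem_ball_self hη)
  have hlim : Tendsto (fun ε : ℝ => γ t + ε * (Complex.I * d)) (𝓝[>] 0) (𝓝 (γ t)) := by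
    have : Continuous fun ε : ℝ => γ t + ε * (Complex.I * d) := by fun_prop
    simpa using (this.tendsto 0).mono_left nhdsWithin_le_nhds
  filter_upwards [hlim.eventually (hK.isClosed.isOpen_compl.mem_nhds hnot), self_mem_nhdsWithin]
    with ε hε hpos
  rintro ⟨u, hu, he⟩
  by_cases hub : u ∈ Metric.ball t η
  · have h2 := hball hub
    rw [he, show γ t + ε * (Complex.I * d) - γ t - (u - t) • d
      = (-(u - t : ℝ) + ε * Complex.I) * d by rw [Complex.real_smul]; push_cast; ring, norm_mul] at h2
    -- The chord is `(u-t) γ'` up to half its length, and the offset is `iε γ'`. The real part of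
    -- the estimate forces `u = t`, and then the imaginary part forces `ε ≤ 0`.
    have h3 : ‖(-(u - t : ℝ) + ε * Complex.I : ℂ)‖ ≤ |u - t| / 2 := by
      rw [← mul_le_mul_iff_left₀ hd]
      calc _ ≤ _ := h2
        _ = _ := by rw [Real.norm_eq_abs]; ring
    have h4 := Complex.abs_re_le_norm (-(u - t : ℝ) + ε * Complex.I : ℂ)
    have h5 := Complex.abs_im_le_norm (-(u - t : ℝ) + ε * Complex.I : ℂ)
    simp only [Complex.add_re, Complex.neg_re, Complex.ofReal_re, Complex.mul_re, Complex.I_re,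
      Complex.ofReal_im, Complex.I_im, Complex.add_im, Complex.neg_im, Complex.mul_im, mul_zero,
      mul_one, sub_zero, add_zero, neg_zero, zero_add, abs_neg] at h4 h5
    rw [abs_of_pos (mem_Ioi.1 hpos)] at h5
    have := mem_Ioi.1 hpos
    linarith
  · exact hε ⟨u, ⟨hu, hub⟩, he⟩

namespace Config

variable {C : Config}

theorem IsCut.re_neg (h : C.IsCut) {t : ℝ} (ht : t ∈ Icc (0 : ℝ) 1) :
    (C.gP t).re < 0 := h.leftP _ ⟨t, ht, rfl⟩

theorem IsCut.z1_mem (h : C.IsCut) : z1 ∈ C.GammaP :=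
  ⟨0, by norm_num, h.startP⟩

theorem IsCut.z2_mem (h : C.IsCut) : z2 ∈ C.GammaP :=
  ⟨1, by norm_num, h.endP⟩

theorem IsCut.ne_branch (h : C.IsCut) {t : ℝ} (ht : t ∈ Ioo (0 : ℝ) 1) :
    C.gP t ≠ z1 ∧ C.gP t ≠ z2 := by
  have h1 := Ioo_subset_Icc_self ht
  refine ⟨fun he => ht.1.ne' (h.curveP.injOn h1 (by norm_num) (he.trans h.startP.symm)),
    fun he => ht.2.ne (h.curveP.injOn h1 (by norm_num) (he.trans h.endP.symm))⟩

theorem IsCut.pairD_ne_zero (h : C.IsCut) {t : ℝ} (ht : t ∈ Ioo (0 : ℝ) 1) :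
    pairD (C.gP t) ≠ 0 := by
  have h1 := h.re_neg (Ioo_subset_Icc_self ht)
  exact HermitePade.pairD_ne_zero h1.le (fun h0 => by rw [h0] at h1; simp at h1)
    (h.ne_branch ht).1 (h.ne_branch ht).2

theorem tendsto_normal (γ : ℝ → ℂ) (t : ℝ) :
    Tendsto (fun ε : ℝ => γ t + ε * (Complex.I * deriv γ t)) (𝓝[>] 0) (𝓝 (γ t)) := by
  have : Continuous fun ε : ℝ => γ t + ε * (Complex.I * deriv γ t) := by fun_prop
  simpa using (this.tendsto 0).mono_left nhdsWithin_le_nhds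

theorem IsCut.eventually_normal (h : C.IsCut) {t : ℝ}
    (ht : t ∈ Ioo (0 : ℝ) 1) :
    ∀ᶠ ε : ℝ in 𝓝[>] 0, C.gP t + ε * (Complex.I * deriv C.gP t) ∈ C.cutLeft := by
  filter_upwards [(tendsto_normal C.gP t).eventually
    (Complex.continuous_re.continuousAt.eventually_lt_const (h.re_neg (Ioo_subset_Icc_self ht))),
    h.curveP.eventually_notMem ht] with ε h1 h2 using ⟨h1, h2⟩

/-- Near an inner point of `Γ_P` there is a continuous square root of `pairD` without zeros. A short
piece of the normal is connected and avoids the cut, so the difference of the sheets equals this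
root or its negative throughout. -/
theorem IsCut.exists_hasPlusValue (h : C.IsCut) {t : ℝ}
    (ht : t ∈ Ioo (0 : ℝ) 1) : ∃ L, HasPlusValue C.gP C.QP t L ∧ L ^ 2 = pairD (C.gP t) := by
  set z := C.gP t
  have hz : z.re < 0 := h.re_neg (Ioo_subset_Icc_self ht)
  have hd : pairD z ≠ 0 := h.pairD_ne_zero ht
  set σ : ℂ → ℂ := fun w => mainSqrt z * Complex.sqrt (pairD w / pairD z)
  have hσsq : ∀ w, σ w ^ 2 = pairD w := by
    intro w
    simp only [σ]
    rw [mul_pow, mainSqrt_sq, sqrt_sq, mul_div_cancel₀ _ hd]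
  have hcD : ∀ᶠ w in 𝓝 z, ContinuousAt σ w ∧ σ w ≠ 0 := by
    have hc : ContinuousAt (fun w => pairD w / pairD z) z :=
      (analyticAt_pairD hz).continuousAt.div_const _
    have hm : pairD z / pairD z ∈ Complex.slitPlane := by
      rw [div_self hd]
      exact Complex.one_mem_slitPlane
    filter_upwards [hc.eventually (Complex.isOpen_slitPlane.mem_nhds hm),
      (analyticAt_pairD hz).eventually_analyticAt,
      (analyticAt_pairD hz).continuousAt.eventually_ne hd] with w h1 h2 h3
    refine ⟨continuousAt_const.mul ((continuousAt_sqrt_of_slit h1).comp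
      (f := fun w => pairD w / pairD z) (h2.continuousAt.div_const _)), fun h0 => h3 ?_⟩
    rw [← hσsq, h0, zero_pow two_ne_zero]
  obtain ⟨δ, hδ, hsub⟩ := mem_nhdsGT_iff_exists_Ioo_subset.1
    ((h.eventually_normal ht).and ((tendsto_normal C.gP t).eventually hcD))
  have hcont : Continuous fun ε : ℝ => z + ε * (Complex.I * deriv C.gP t) := by fun_prop
  have hdich := isPreconnected_Ioo.eq_or_eq_neg_of_sq_eq (S := Ioo 0 δ)
    (f := fun ε : ℝ => C.QP (z + ε * (Complex.I * deriv C.gP t)))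
    (g := fun ε : ℝ => σ (z + ε * (Complex.I * deriv C.gP t)))
    (fun ε hε => ((h.analyticAt_QP (hsub hε).1).continuousAt.comp
      (f := fun ε : ℝ => z + ε * (Complex.I * deriv C.gP t)) hcont.continuousAt).continuousWithinAt)
    (fun ε hε => ((hsub hε).2.1.comp
      (f := fun ε : ℝ => z + ε * (Complex.I * deriv C.gP t)) hcont.continuousAt).continuousWithinAt)
    (fun ε hε => by
      simp only [Pi.pow_apply]
      rw [h.QP_sq (hsub hε).1, hσsq]) (fun {ε} hε => (hsub hε).2.2)
  have hlim := (hcD.self_of_nhds.1.tendsto).comp (tendsto_normal C.gP t)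
  have hev : ∀ᶠ ε : ℝ in 𝓝[>] 0, ε ∈ Ioo 0 δ := Ioo_mem_nhdsGT hδ
  rcases hdich with hp | hn
  · exact ⟨σ z, hlim.congr' (hev.mono fun ε hε => (hp hε).symm), hσsq z⟩
  · exact ⟨-σ z, hlim.neg.congr' (hev.mono fun ε hε => (hn hε).symm), by rw [neg_sq, hσsq z]⟩

theorem IsCut.hasPlusValue (h : C.IsCut) {t : ℝ} (ht : t ∈ Ioo (0 : ℝ) 1) :
    HasPlusValue C.gP C.QP t (plusValue C.gP C.QP t) ∧
      plusValue C.gP C.QP t ^ 2 = pairD (C.gP t) := by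
  obtain ⟨L, hL, hsq⟩ := h.exists_hasPlusValue ht
  rw [hL.plusValue_eq]
  exact ⟨hL, hsq⟩

end Config

theorem IsAnalyticCurve.continuousOn_deriv {γ : ℝ → ℂ} {T : Set ℝ} (h : IsAnalyticCurve γ T) :
    ContinuousOn (deriv γ) (interior T) := fun t ht =>
  (h.analytic t ht).deriv.continuousAt.continuousWithinAt

/-- A curve in the left half plane that starts at a branch point, with a square root of `pairD` as
its density, is a level curve. -/
theorem mainH_eq_zero_of_realAlong {γ h : ℝ → ℂ} {T : Set ℝ} {a b : ℝ} (hT : T.OrdConnected)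
    (hγ : IsAnalyticCurve γ T) (hr : RealAlong γ T b h) (ha : a ∈ T)
    (hz : ∀ t ∈ T, (γ t).re < 0) (h0 : mainH (γ a) = 0)
    (hd : ∀ t ∈ interior T, pairD (γ t) ≠ 0) (hsq : ∀ t ∈ interior T, h t ^ 2 = pairD (γ t))
    {t : ℝ} (ht : t ∈ T) : mainH (γ t) = 0 := by
  have hsub : Ioo (min a t) (max a t) ⊆ interior T :=
    interior_maximal (Ioo_subset_Icc_self.trans (hT.uIcc_subset ha ht)) isOpen_Ioo
  refine mainH_eq_zero_of_level hT hγ ha ht hsub hz h0 hd ?_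
  -- The condition is put on the square of the density, which is continuous in the parameter;
  -- nothing of the kind is known for the boundary value itself.
  refine hr.forall_mem (F := fun t => pairD (γ t) * deriv γ t ^ 2) ?_ ?_ ?_
  · exact (isClosed_le Complex.continuous_re continuous_const).inter
      (isClosed_eq Complex.continuous_im continuous_const)
  · refine ContinuousOn.mul (fun u hu => ?_) (hγ.continuousOn_deriv.pow 2)
    exact ContinuousAt.comp_continuousWithinAt (f := γ)
      (analyticAt_pairD (hz u (interior_subset hu))).continuousAt
      ((hγ.continuousOn u (interior_subset hu)).mono interior_subset)
  · intro u hu hre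
    rw [← hsq u hu, ← mul_pow]
    exact sq_of_re_eq_zero hre

theorem Config.IsSheetStructure.mainH_eq_zero {C : Config} (h : C.IsSheetStructure) {t : ℝ}
    (ht : t ∈ Icc (0 : ℝ) 1) : mainH (C.gP t) = 0 := by
  have hi : ∀ u ∈ interior (Icc (0 : ℝ) 1), u ∈ Ioo (0 : ℝ) 1 := fun u hu => interior_Icc (a := (0 : ℝ)) ▸ hu
  exact mainH_eq_zero_of_realAlong ordConnected_Icc h.curveP h.realP (a := 0) (by norm_num)
    (fun u hu => h.cut.re_neg hu) (by rw [h.startP, mainH_z1]) (fun u hu => h.cut.pairD_ne_zero (hi u hu))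
    (fun u hu => (h.cut.hasPlusValue (hi u hu)).2) ht

/-! ### The components of the level set, and `Γ_P` -/

theorem mainH_sq_eq_boxH_sq {z : ℂ} (hz : z ≠ 0) : mainH z ^ 2 = boxH z ^ 2 := by
  rcases sq_eq_sq_iff_eq_or_eq_neg.1 ((mainSqrt_sq z).trans (boxSqrt_sq hz).symm) with h' | h'
  · rw [mainH, boxH, hDiff_congr h']
  · rw [mainH, boxH, hDiff_neg h', neg_sq]

theorem re_lt_of_strip {z : ℂ} (h : z.re = levelX z.im) (hy : |z.im| < z1.im) : z.re < z1.re :=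
  h ▸ levelX_lt hy

theorem mem_farSide_of_re_lt {z : ℂ} (h : z.re < z1.re) : z.re ∈ farSide z.im :=
  ⟨(h.trans z1_re_neg).le, fun _ => h.le⟩

theorem eq_levelX_or_starX {z : ℂ} (hz : z.re < 0) (h : mainH z = 0) :
    z.re = levelX z.im ∨ critHeight < |z.im| ∧ |z.im| < z1.im ∧ z1.re < z.re ∧
      z.re = starX z.im := by
  have hz0 : z ≠ 0 := by rintro rfl; simp at hz
  by_cases hf : z.re ∈ farSide z.im
  · exact Or.inl (eq_levelX hf h)
  · have hy : |z.im| < z1.im ∧ z1.re < z.re := by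
      by_contra hn
      rw [not_and, not_lt] at hn
      exact hf ⟨hz.le, hn⟩
    have hb : boxH (pt z.re z.im) = 0 := by
      have := mainH_sq_eq_boxH_sq hz0
      rw [h, zero_pow two_ne_zero] at this
      rw [pt_eta]
      exact pow_eq_zero_iff two_ne_zero |>.1 this.symm
    obtain ⟨c1, -, c3⟩ := critHeight_le_of_boxH hy.1 hy.2.le hz.le hz0 hb
    exact Or.inr ⟨c1.lt_of_ne fun he => hz.ne (c3 he.symm), hy.1, hy.2,
      eq_starX_of_boxH hy.1 hy.2.le hz.le hz0 hb⟩

/-- The level set of `mainH` in the left half plane has five components: two unbounded ones, the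
one in the strip `|Im z| < Im z₁` to the left of the branch points, and two to their right. -/
theorem level_component {s : Set ℂ} (hs : IsPreconnected s)
    (h : ∀ z ∈ s, z.re < 0 ∧ mainH z = 0 ∧ z ≠ z1 ∧ z ≠ z2) :
    (∀ z ∈ s, z1.im < z.im) ∨ (∀ z ∈ s, z.im < -z1.im) ∨
    (∀ z ∈ s, |z.im| < z1.im ∧ z.re < z1.re) ∨
    (∀ z ∈ s, 0 < z.im ∧ z.im < z1.im ∧ z1.re < z.re) ∨
    (∀ z ∈ s, z.im < 0 ∧ -z1.im < z.im ∧ z1.re < z.re) := by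
  have h1 := z1_im_pos
  have cr := Complex.continuous_re
  have ci := Complex.continuous_im
  set O1 := {z : ℂ | z1.im < z.im}
  set O2 := {z : ℂ | z.im < -z1.im}
  set O3 := {z : ℂ | |z.im| < z1.im ∧ z.re < z1.re}
  set O4 := {z : ℂ | 0 < z.im ∧ z.im < z1.im ∧ z1.re < z.re}
  set O5 := {z : ℂ | z.im < 0 ∧ -z1.im < z.im ∧ z1.re < z.re}
  have o1 : IsOpen O1 := isOpen_lt continuous_const ci
  have o2 : IsOpen O2 := isOpen_lt ci continuous_const
  have o3 : IsOpen O3 := (isOpen_lt ci.abs continuous_const).inter (isOpen_lt cr continuous_const)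
  have o4 : IsOpen O4 := (isOpen_lt continuous_const ci).inter
    ((isOpen_lt ci continuous_const).inter (isOpen_lt continuous_const cr))
  have o5 : IsOpen O5 := (isOpen_lt ci continuous_const).inter
    ((isOpen_lt continuous_const ci).inter (isOpen_lt continuous_const cr))
  have hcov : s ⊆ O1 ∪ (O2 ∪ (O3 ∪ (O4 ∪ O5))) := by
    intro z hz
    obtain ⟨hre, hH, hn1, hn2⟩ := h z hz
    have hne : z.re = levelX z.im → |z.im| ≠ z1.im := by
      intro hl ha
      rcases abs_eq h1.le |>.1 ha with he | he
      · rw [he, levelX_y1] at hl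
        exact hn1 (Complex.ext hl he)
      · rw [he, levelX_neg, levelX_y1] at hl
        refine hn2 (Complex.ext ?_ ?_) <;> rw [z2_eq]
        · rw [hl, Complex.conj_re]
        · rw [he, Complex.conj_im]
    rcases eq_levelX_or_starX hre hH with hl | ⟨c1, c2, c3, -⟩
    · rcases lt_or_gt_of_ne (hne hl) with hlt | hgt
      · exact Or.inr (Or.inr (Or.inl ⟨hlt, re_lt_of_strip hl hlt⟩))
      · rcases lt_abs.1 hgt with hg | hg
        · exact Or.inl hg
        · exact Or.inr (Or.inl (show z.im < -z1.im by linarith))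
    · have c0 := critHeight_pos
      rcases lt_abs.1 c1 with hg | hg
      · exact Or.inr (Or.inr (Or.inr (Or.inl ⟨by linarith, (le_abs_self _).trans_lt c2, c3⟩)))
      · exact Or.inr (Or.inr (Or.inr (Or.inr ⟨by linarith, (abs_lt.1 c2).1, c3⟩)))
  have step : ∀ {u v t : Set ℂ}, t ⊆ u ∪ v → IsPreconnected t → IsOpen u → IsOpen v →
      Disjoint u v → t ⊆ u ∨ t ⊆ v := fun hsub ht hu hv hd => ht.subset_or_subset hu hv hd hsub
  have dis : ∀ {u v : Set ℂ}, (∀ z, z ∈ u → z ∈ v → False) → Disjoint u v := fun hd =>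
    Set.disjoint_left.2 fun z hu hv => hd z hu hv
  rcases step hcov hs o1 (o2.union (o3.union (o4.union o5))) (dis fun z hu hv => by
    simp only [O1, O2, O3, O4, O5, mem_ofPred_eq, mem_union, abs_lt] at hu hv
    rcases hv with hv | hv | hv | hv <;> linarith) with hh | hh
  · exact Or.inl hh
  rcases step hh hs o2 (o3.union (o4.union o5)) (dis fun z hu hv => by
    simp only [O2, O3, O4, O5, mem_ofPred_eq, mem_union, abs_lt] at hu hv
    rcases hv with hv | hv | hv <;> linarith) with hh | hh
  · exact Or.inr (Or.inl hh)
  rcases step hh hs o3 (o4.union o5) (dis fun z hu hv => by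
    simp only [O3, O4, O5, mem_ofPred_eq, mem_union, abs_lt] at hu hv
    rcases hv with hv | hv <;> linarith) with hh | hh
  · exact Or.inr (Or.inr (Or.inl hh))
  rcases step hh hs o4 o5 (dis fun z hu hv => by
    simp only [O4, O5, mem_ofPred_eq] at hu hv
    linarith) with hh | hh
  · exact Or.inr (Or.inr (Or.inr (Or.inl hh)))
  · exact Or.inr (Or.inr (Or.inr (Or.inr hh)))

theorem mem_levelCut_of_strip {z : ℂ} (hH : mainH z = 0) (h : |z.im| < z1.im ∧ z.re < z1.re) :
    z ∈ levelCut := ⟨h.1.le, eq_levelX (mem_farSide_of_re_lt h.2) hH⟩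

theorem slit_of_level {z : ℂ} (h : z.re = levelX z.im) (hy : |z.im| ≠ z1.im) :
    (pairM z).re ≠ 0 ∨ (pairM z).im ^ 2 < 3 := by
  have := slit_levelX hy
  rwa [← h, pt_eta] at this

theorem eq_of_mem_levelCut {z w : ℂ} (hz : z ∈ levelCut) (hw : w ∈ levelCut) (h : z.im = w.im) :
    z = w := Complex.ext (by rw [hz.2, hw.2, h]) h

/-- If `Re (s γ') = 0` with `Re s ≠ 0` and `γ' ≠ 0`, then `γ'` is not real. -/
theorem im_ne_zero_of_mul_re {s d : ℂ} (h : (s * d).re = 0) (hs : s.re ≠ 0) (hd : d ≠ 0) :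
    d.im ≠ 0 := by
  intro h0
  rw [Complex.mul_re, h0, mul_zero, sub_zero, mul_eq_zero, or_iff_right hs] at h
  exact hd (Complex.ext h h0)

/-- A curve whose tangent vector is never real moves monotonically upwards or downwards. -/
theorem deriv_im_sign {γ : ℝ → ℂ} {s : Set ℝ} (hs : IsPreconnected s)
    (hc : ContinuousOn (deriv γ) s) (h : ∀ t ∈ s, (deriv γ t).im ≠ 0) :
    (∀ t ∈ s, 0 < (deriv γ t).im) ∨ ∀ t ∈ s, (deriv γ t).im < 0 := by
  by_contra! hn
  obtain ⟨⟨a, ha, ha'⟩, b, hb, hb'⟩ := hn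
  obtain ⟨c, hc, hc'⟩ := hs.intermediate_value ha hb (Complex.continuous_im.comp_continuousOn hc)
    ⟨ha', hb'⟩
  exact h c hc hc'

theorem hasDerivAt_im {γ : ℝ → ℂ} {t : ℝ} (h : DifferentiableAt ℝ γ t) :
    HasDerivAt (fun u => (γ u).im) (deriv γ t).im t :=
  Complex.imCLM.hasFDerivAt.comp_hasDerivAt t h.hasDerivAt

theorem mul_deriv_re_of_mainH {γ : ℝ → ℂ} {t : ℝ} (h : DifferentiableAt ℝ γ t)
    (hz : (γ t).re < 0) (hs : (pairM (γ t)).re ≠ 0 ∨ (pairM (γ t)).im ^ 2 < 3)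
    (h0 : ∀ᶠ u in 𝓝 t, mainH (γ u) = 0) : (mainSqrt (γ t) * deriv γ t).re = 0 := by
  have h1 := hasDerivAt_mainH h.hasDerivAt hz.le (fun h0 => by rw [h0] at hz; simp at hz) hs
  have h2 : HasDerivAt (fun u => mainH (γ u)) 0 t :=
    (hasDerivAt_const t (0 : ℝ)).congr_of_eventuallyEq h0
  have := h1.unique h2
  linarith

theorem mem_of_isClosed_Ioo {γ : ℝ → ℂ} {a b : ℝ} (hab : a ≠ b) (hc : ContinuousOn γ (Icc a b))
    {K : Set ℂ} (hK : IsClosed K) (h : ∀ t ∈ Ioo a b, γ t ∈ K) {t : ℝ} (ht : t ∈ Icc a b) :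
    γ t ∈ K := by
  have hcl := closure_Ioo hab
  have := ContinuousOn.image_closure (s := Ioo a b) (hcl.symm ▸ hc)
  refine closure_minimal (image_subset_iff.2 h) hK (this ?_)
  exact mem_image_of_mem _ (hcl.symm ▸ ht)

namespace Config

variable {C : Config}

/-- The open arc lies in one of the five pieces. Its ends have heights `Im z₁` and `-Im z₁`, and the
closures of four pieces stay on one side of the real axis. -/
theorem IsSheetStructure.strip (h : C.IsSheetStructure) :
    ∀ t ∈ Ioo (0 : ℝ) 1, |(C.gP t).im| < z1.im ∧ (C.gP t).re < z1.re := by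
  have h1 := z1_im_pos
  have hsub : Ioo (0 : ℝ) 1 ⊆ Icc 0 1 := Ioo_subset_Icc_self
  have hcomp := level_component (s := C.gP '' Ioo 0 1)
    (isPreconnected_Ioo.image _ (h.curveP.continuousOn.mono hsub)) (by
      rintro _ ⟨t, ht, rfl⟩
      exact ⟨h.cut.re_neg (hsub ht), h.mainH_eq_zero (hsub ht), h.cut.ne_branch ht⟩)
  simp only [forall_mem_image] at hcomp
  have hz2 : z2.im = -z1.im := by rw [z2_eq, Complex.conj_im]
  have lower : (∀ t ∈ Ioo (0 : ℝ) 1, 0 < (C.gP t).im) → False := fun hp => by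
    have := mem_of_isClosed_Ioo zero_ne_one h.curveP.continuousOn
      (isClosed_le continuous_const Complex.continuous_im) (K := {z : ℂ | 0 ≤ z.im})
      (fun t ht => (hp t ht).le) (t := 1) (by norm_num)
    rw [h.endP] at this
    have : 0 ≤ z2.im := this
    linarith
  have upper : (∀ t ∈ Ioo (0 : ℝ) 1, (C.gP t).im < 0) → False := fun hp => by
    have := mem_of_isClosed_Ioo zero_ne_one h.curveP.continuousOn
      (isClosed_le Complex.continuous_im continuous_const) (K := {z : ℂ | z.im ≤ 0})
      (fun t ht => (hp t ht).le) (t := 0) (by norm_num)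
    rw [h.startP] at this
    have : z1.im ≤ 0 := this
    linarith
  rcases hcomp with hc | hc | hc | hc | hc
  · exact (lower fun t ht => h1.trans (hc ht)).elim
  · exact (upper fun t ht => (hc ht).trans (by linarith)).elim
  · exact fun t ht => hc ht
  · exact (lower fun t ht => (hc ht).1).elim
  · exact (upper fun t ht => (hc ht).1).elim

theorem IsSheetStructure.mem_levelCut (h : C.IsSheetStructure) {t : ℝ} (ht : t ∈ Icc (0 : ℝ) 1) :
    C.gP t ∈ levelCut :=
  mem_of_isClosed_Ioo zero_ne_one h.curveP.continuousOn isClosed_levelCut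
    (fun t ht => mem_levelCut_of_strip (h.mainH_eq_zero (Ioo_subset_Icc_self ht)) (h.strip t ht)) ht

theorem IsSheetStructure.GammaP_eq (h : C.IsSheetStructure) : C.GammaP = levelCut := by
  refine Subset.antisymm (by rintro _ ⟨t, ht, rfl⟩; exact h.mem_levelCut ht) fun z hz => ?_
  have h0 : (C.gP 0).im = z1.im := by rw [h.startP]
  have h1 : (C.gP 1).im = -z1.im := by rw [h.endP, z2_eq, Complex.conj_im]
  obtain ⟨t, ht, he⟩ := intermediate_value_Icc' zero_le_one
    (Complex.continuous_im.comp_continuousOn h.curveP.continuousOn)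
    (show z.im ∈ Icc ((C.gP 1).im) ((C.gP 0).im) by rw [h0, h1]; exact abs_le.1 hz.1)
  exact ⟨t, ht, eq_of_mem_levelCut (h.mem_levelCut ht) hz he⟩

theorem IsSheetStructure.differentiableAt (h : C.IsSheetStructure) {t : ℝ}
    (ht : t ∈ Ioo (0 : ℝ) 1) : DifferentiableAt ℝ C.gP t :=
  (h.curveP.analytic t (by rwa [interior_Icc])).differentiableAt

theorem IsSheetStructure.slit (h : C.IsSheetStructure) {t : ℝ} (ht : t ∈ Ioo (0 : ℝ) 1) :
    (pairM (C.gP t)).re ≠ 0 ∨ (pairM (C.gP t)).im ^ 2 < 3 :=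
  slit_of_level (h.mem_levelCut (Ioo_subset_Icc_self ht)).2 (h.strip t ht).1.ne

theorem IsSheetStructure.mainSqrt_mul_re (h : C.IsSheetStructure) {t : ℝ}
    (ht : t ∈ Ioo (0 : ℝ) 1) : (mainSqrt (C.gP t) * deriv C.gP t).re = 0 :=
  mul_deriv_re_of_mainH (h.differentiableAt ht) (h.cut.re_neg (Ioo_subset_Icc_self ht)) (h.slit ht)
    (by filter_upwards [Ioo_mem_nhds ht.1 ht.2] with u hu using
      h.mainH_eq_zero (Ioo_subset_Icc_self hu))

/-- A tangent of a level curve with `Re mainSqrt ≠ 0` is never real, so the height is monotone, and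
the ends fix the direction. -/
theorem IsSheetStructure.deriv_im_neg (h : C.IsSheetStructure) {t : ℝ} (ht : t ∈ Ioo (0 : ℝ) 1) :
    (deriv C.gP t).im < 0 := by
  have h1 := z1_im_pos
  have hI : interior (Icc (0 : ℝ) 1) = Ioo 0 1 := interior_Icc
  refine (deriv_im_sign isPreconnected_Ioo (hI ▸ h.curveP.continuousOn_deriv) fun t ht =>
    im_ne_zero_of_mul_re (h.mainSqrt_mul_re ht) (mainSqrt_re_pos (h.slit ht)).ne'
      (h.curveP.regular t (hI.symm ▸ ht))).resolve_left (fun hp => ?_) t ht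
  obtain ⟨c, hc, hc'⟩ := exists_hasDerivAt_eq_slope (fun u => (C.gP u).im) _ zero_lt_one
    (Complex.continuous_im.comp_continuousOn h.curveP.continuousOn)
    (fun u hu => hasDerivAt_im (h.differentiableAt hu))
  have := hp c hc
  rw [hc', h.startP, h.endP, z2_eq, Complex.conj_im] at this
  linarith

/-- Both sides are continuous square roots of `pairD` without zeros on a connected set, and they
agree far out to the left. -/
theorem IsSheetStructure.QP_eq (h : C.IsSheetStructure) {z : ℂ} (hz : z.re < 0)
    (hc : z ∉ levelCut) : C.QP z = canonS z := by
  have hmem : ∀ {z}, z ∈ C.cutLeft → z ≠ 0 ∧ z.re < 0 ∧ z ∉ levelCut := fun {z} hz =>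
    ⟨by rintro rfl; simpa using hz.1, hz.1, h.GammaP_eq ▸ hz.2⟩
  have eP : ∀ᶠ z in Bornology.cobounded ℂ, z ∉ C.GammaP := h.cut.isCompact_GammaP.isBounded
  obtain ⟨w, hw, he⟩ := exists_left_of_cobounded (eP.and (h.cut.eventually_eq.and canonS_cobounded))
  have he' := he.self_of_nhds
  refine h.cut.isPreconnected_cutLeft.eq_of_sq_eq (f := C.QP) (g := canonS)
    (fun u hu => (h.cut.analyticAt_QP hu).continuousAt.continuousWithinAt)
    (fun u hu => (continuousAt_canonS (hmem hu).2.1.le (hmem hu).1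
      (hmem hu).2.2).continuousWithinAt)
    (fun u hu => ?_) (fun {u} hu => canonS_ne_zero (hmem hu).2.1.le (hmem hu).1 (hmem hu).2.2)
    (y := w) ⟨hw, he'.1⟩ ?_ ⟨hz, h.GammaP_eq.symm ▸ hc⟩
  · simp only [Pi.pow_apply]
    rw [h.cut.QP_sq hu, canonS_sq (hmem hu).1]
  · rw [he'.2.2 hw.le, QP, he'.2.1.2.1, he'.2.1.2.2, pairRoot_sub]

theorem IsSheetStructure.mem_cutLeft (h : C.IsSheetStructure) {z : ℂ} (hz : z.re < 0)
    (hc : z ∉ levelCut) : z ∈ C.cutLeft := ⟨hz, h.GammaP_eq.symm ▸ hc⟩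

theorem IsSheetStructure.psiQ_left (h : C.IsSheetStructure) {z : ℂ} (hz : z.re < 0)
    (hc : z ∉ levelCut) : C.psiQ z = canonQ z := by
  rw [h.cut.psiQ_eq (h.mem_cutLeft hz hc), h.QP_eq hz hc, canonQ_left hz.le]

theorem IsSheetStructure.psiP_left (h : C.IsSheetStructure) {z : ℂ} (hz : z.re < 0)
    (hc : z ∉ levelCut) : C.psiP z = canonP z := by
  rw [h.cut.psiP_eq (h.mem_cutLeft hz hc), h.QP_eq hz hc,
    canonP_left hz.le (by rintro rfl; simp at hz)]

theorem IsSheetStructure.psiR_left (h : C.IsSheetStructure) {z : ℂ} (hz : z.re < 0) :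
    C.psiR z = -canonP (-z) := by
  rw [h.cut.psiR_eq hz, canonP_right (by simpa using hz), neg_neg, neg_neg]

/-- The boundary value on `Γ_P`. -/
theorem IsSheetStructure.plusValue_eq (h : C.IsSheetStructure) {t : ℝ} (ht : t ∈ Ioo (0 : ℝ) 1) :
    plusValue C.gP C.QP t = -mainSqrt (C.gP t) := by
  obtain ⟨h1, h2⟩ := tendsto_canonS_plus (h.mem_levelCut (Ioo_subset_Icc_self ht))
    (h.strip t ht).1.ne (h.mainSqrt_mul_re ht) (h.deriv_im_neg ht)
  refine HasPlusValue.plusValue_eq (h2.congr' ?_)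
  filter_upwards [h1] with ε hε
  exact (h.QP_eq hε.1 hε.2).symm

/-! ### The symmetry `z ↦ -z` -/

/-- The image of the configuration under `z ↦ -z`. -/
def mirror (C : Config) : Config where
  psiP := fun z => -C.psiR (-z)
  psiQ := fun z => -C.psiQ (-z)
  psiR := fun z => -C.psiP (-z)
  gP := fun t => -C.gR t
  gR := fun t => -C.gP t
  gPstar := fun t => -C.gRstar t
  gRstar := fun t => -C.gPstar t
  gE1 := fun t => -C.gE3 t
  gE2 := fun t => -C.gE4 t
  gE3 := fun t => -C.gE1 t
  gE4 := fun t => -C.gE2 t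
  ystar := C.ystar

theorem neg_mem_image {γ : ℝ → ℂ} {T : Set ℝ} {z : ℂ} : -z ∈ γ '' T ↔ z ∈ (fun t => -γ t) '' T := by
  constructor
  · rintro ⟨t, ht, h⟩
    exact ⟨t, ht, by simp [h]⟩
  · rintro ⟨t, ht, rfl⟩
    exact ⟨t, ht, (neg_neg _).symm⟩

theorem mirror_QP (z : ℂ) : C.mirror.QP z = -C.QR (-z) := by
  simp only [QP, QR, mirror]
  ring

theorem mirror_QR (z : ℂ) : C.mirror.QR z = -C.QP (-z) := by
  simp only [QP, QR, mirror]
  ring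

theorem plusValue_neg {γ : ℝ → ℂ} {f : ℂ → ℂ} {t : ℝ} {L : ℂ} (h : HasPlusValue γ f t L) :
    plusValue (fun t => -γ t) (fun z => -f (-z)) t = -plusValue γ f t := by
  rw [h.plusValue_eq, h.neg.plusValue_eq]

end Config

theorem AnalyticOnNhd.neg_comp_neg {ψ : ℂ → ℂ} {U V : Set ℂ} (h : AnalyticOnNhd ℂ ψ U)
    (hV : ∀ z ∈ V, -z ∈ U) : AnalyticOnNhd ℂ (fun z => -ψ (-z)) V := fun z hz =>
  ((h (-z) (hV z hz)).comp_of_eq (g := ψ) (f := fun z => -z) analyticAt_id.neg rfl).neg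

theorem IsInverseBranchOn.neg_comp_neg {ψ : ℂ → ℂ} {U V : Set ℂ} (h : IsInverseBranchOn ψ U)
    (hV : ∀ z ∈ V, -z ∈ U) : IsInverseBranchOn (fun z => -ψ (-z)) V := fun z hz => by
  have := (h.isPreimage (hV z hz)).neg
  rw [neg_neg] at this
  exact isPreimage_iff_inverse.1 this

theorem tendsto_neg_comp_neg {ψ : ℂ → ℂ} {l l' : ℂ} (h : Tendsto ψ (Bornology.cobounded ℂ) (𝓝 l))
    (hl : -l = l') : Tendsto (fun z => -ψ (-z)) (Bornology.cobounded ℂ) (𝓝 l') := by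
  rw [← hl]
  exact (h.comp tendsto_neg_cobounded').neg

namespace Config

variable {C : Config}

theorem mem_mirror_GammaP {z : ℂ} : z ∈ C.mirror.GammaP ↔ -z ∈ C.GammaR := neg_mem_image.symm

theorem mem_mirror_GammaR {z : ℂ} : z ∈ C.mirror.GammaR ↔ -z ∈ C.GammaP := neg_mem_image.symm

theorem mem_mirror_union {z : ℂ} :
    z ∈ C.mirror.GammaP ∪ C.mirror.GammaR ∪ {0} ↔ -z ∈ C.GammaP ∪ C.GammaR ∪ {0} := by
  simp only [mem_union, mem_mirror_GammaP, mem_mirror_GammaR, mem_singleton_iff, neg_eq_zero]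
  tauto

/-- This part of the symmetry does not involve the integrals. It first yields the existence of the
boundary values on `Γ_R`, which is needed to reflect the conditions on the integrals. -/
theorem IsSheetStructure.mirror_cut (h : C.IsSheetStructure) : C.mirror.IsCut where
  curveP := h.curveR.neg
  startP := by simp only [mirror]; rw [h.startR, z3_eq, neg_neg]
  endP := by simp only [mirror]; rw [h.endR, z4_eq, neg_neg]
  leftP := fun z hz => by simpa using h.rightR _ (mem_mirror_GammaP.1 hz)
  curveR := h.curveP.neg
  rightR := fun z hz => by simpa using h.leftP _ (mem_mirror_GammaR.1 hz)
  analyticP := AnalyticOnNhd.neg_comp_neg h.analyticR fun z hz => mt mem_mirror_GammaP.2 hz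
  analyticQ := AnalyticOnNhd.neg_comp_neg h.analyticQ fun z hz => mt mem_mirror_union.2 hz
  analyticR := AnalyticOnNhd.neg_comp_neg h.analyticP fun z hz => mt mem_mirror_GammaR.2 hz
  inverseP := h.inverseR.neg_comp_neg fun z hz => mt mem_mirror_GammaP.2 hz
  inverseQ := h.inverseQ.neg_comp_neg fun z hz => mt mem_mirror_union.2 hz
  inverseR := h.inverseP.neg_comp_neg fun z hz => mt mem_mirror_GammaR.2 hz
  inftyP := tendsto_neg_comp_neg h.inftyR rfl
  inftyQ := tendsto_neg_comp_neg h.inftyQ neg_zero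
  inftyR := tendsto_neg_comp_neg h.inftyP (neg_neg 1)

theorem hasPlusValue_of_mirror {t L : _} (h : HasPlusValue C.mirror.gP C.mirror.QP t L) :
    HasPlusValue C.gR C.QR t (-L) := by
  have h1 := h.neg
  have e1 : (fun t => -C.mirror.gP t) = C.gR := by funext t; simp [mirror]
  have e2 : (fun z => -C.mirror.QP (-z)) = C.QR := by funext z; simp [mirror_QP]
  rwa [e1, e2] at h1

theorem IsSheetStructure.hasPlusValueR (h : C.IsSheetStructure) {t : ℝ} (ht : t ∈ Ioo (0 : ℝ) 1) :
    HasPlusValue C.gR C.QR t (plusValue C.gR C.QR t) := by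
  have := hasPlusValue_of_mirror (h.mirror_cut.hasPlusValue ht).1
  rwa [this.plusValue_eq]

theorem mirror_QP_eq : C.mirror.QP = fun z => -C.QR (-z) := funext mirror_QP

theorem mirror_QR_eq : C.mirror.QR = fun z => -C.QP (-z) := funext mirror_QR

theorem IsSheetStructure.mirror (h : C.IsSheetStructure) : C.mirror.IsSheetStructure := by
  have hI : interior (Icc (0 : ℝ) 1) = Ioo 0 1 := interior_Icc
  have hc := h.mirror_cut
  refine ⟨hc.curveP, hc.startP, hc.endP, hc.leftP, hc.curveR, ?_, ?_, hc.rightR, hc.analyticP,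
    hc.analyticQ, hc.analyticR, hc.inverseP, hc.inverseQ, hc.inverseR, hc.inftyP, hc.inftyQ,
    hc.inftyR, ?_, ?_⟩
  · simp only [Config.mirror]
    rw [h.startP, z3_eq]
  · simp only [Config.mirror]
    rw [h.endP, z4_eq]
  · refine RealAlong.congr (Or.inl rfl) (by norm_num) h.realR.neg fun t ht => ?_
    rw [mirror_QP_eq]
    exact (plusValue_neg (h.hasPlusValueR (hI ▸ ht))).symm
  · refine RealAlong.congr (Or.inl rfl) (by norm_num) h.realP.neg fun t ht => ?_
    rw [mirror_QR_eq]
    exact (plusValue_neg (h.cut.hasPlusValue (hI ▸ ht)).1).symm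

theorem neg_mem_union {t : ℝ} {γ : ℝ → ℂ} (h : γ t ∉ C.GammaP ∪ C.GammaR ∪ {0}) :
    -γ t ∉ C.mirror.GammaP ∪ C.mirror.GammaR ∪ {0} := by
  rwa [mem_mirror_union, neg_neg]

theorem mirror_QP_neg (z : ℂ) : C.mirror.QP (-z) = -C.QR z := by rw [mirror_QP, neg_neg]

theorem mirror_QR_neg (z : ℂ) : C.mirror.QR (-z) = -C.QP z := by rw [mirror_QR, neg_neg]

theorem realAlong_mirror_QP {γ : ℝ → ℂ} {T : Set ℝ} {a : ℝ}
    (h : RealAlong γ T a fun t => C.QR (γ t)) :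
    RealAlong (fun t => -γ t) T a fun t => C.mirror.QP (-γ t) := by
  simp only [mirror_QP_neg]
  exact h.neg

theorem realAlong_mirror_QR {γ : ℝ → ℂ} {T : Set ℝ} {a : ℝ}
    (h : RealAlong γ T a fun t => C.QP (γ t)) :
    RealAlong (fun t => -γ t) T a fun t => C.mirror.QR (-γ t) := by
  simp only [mirror_QR_neg]
  exact h.neg

theorem IsStarred.mirror (h : C.IsStarred) : C.mirror.IsStarred where
  curveP := h.curveR.neg
  startP := by simp only [Config.mirror]; rw [h.startR, z4_eq, neg_neg]
  endP := by simp only [Config.mirror]; rw [h.endR, z3_eq, neg_neg]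
  avoidP := fun t ht => neg_mem_union (h.avoidR t ht)
  crossP := by
    obtain ⟨x, hx, t, ht, he⟩ := h.crossR
    exact ⟨-x, by linarith, t, ht, by simp [Config.mirror, he]⟩
  realP := realAlong_mirror_QP h.realR
  curveR := h.curveP.neg
  startR := by simp only [Config.mirror]; rw [h.startP, z4_eq]
  endR := by simp only [Config.mirror]; rw [h.endP, z3_eq]
  avoidR := fun t ht => neg_mem_union (h.avoidP t ht)
  crossR := by
    obtain ⟨x, hx, t, ht, he⟩ := h.crossP
    exact ⟨-x, by linarith, t, ht, by simp [Config.mirror, he]⟩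
  realR := realAlong_mirror_QR h.realP
  ystar_pos := h.ystar_pos
  meet_upper := ⟨neg_mem_image.1 h.meet_lower.2, neg_mem_image.1 h.meet_lower.1⟩
  meet_lower := ⟨neg_mem_image.1 (by rw [neg_neg]; exact h.meet_upper.2),
    neg_mem_image.1 (by rw [neg_neg]; exact h.meet_upper.1)⟩

theorem tendsto_neg_curve {γ : ℝ → ℂ} {l : Filter ℝ} (h : Tendsto γ l (Bornology.cobounded ℂ)) :
    Tendsto (fun t => -γ t) l (Bornology.cobounded ℂ) := tendsto_neg_cobounded'.comp h

theorem IsUnbounded.mirror (h : C.IsUnbounded) : C.mirror.IsUnbounded where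
  curve1 := h.curve3.neg
  start1 := by simp only [Config.mirror]; rw [h.start3, z3_eq, neg_neg]
  infty1 := tendsto_neg_curve h.infty3
  left1 := fun t ht => by simpa [Config.mirror] using h.right3 t ht
  avoid1 := fun t ht hm => h.avoid3 t ht (by simpa [Config.mirror] using mem_mirror_GammaP.1 hm)
  real1 := realAlong_mirror_QP h.real3
  curve2 := h.curve4.neg
  end2 := by simp only [Config.mirror]; rw [h.end4, z4_eq, neg_neg]
  infty2 := tendsto_neg_curve h.infty4
  left2 := fun t ht => by simpa [Config.mirror] using h.right4 t ht
  avoid2 := fun t ht hm => h.avoid4 t ht (by simpa [Config.mirror] using mem_mirror_GammaP.1 hm)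
  real2 := realAlong_mirror_QP h.real4
  curve3 := h.curve1.neg
  start3 := by simp only [Config.mirror]; rw [h.start1, z3_eq]
  infty3 := tendsto_neg_curve h.infty1
  right3 := fun t ht => by simpa [Config.mirror] using h.left1 t ht
  avoid3 := fun t ht hm => h.avoid1 t ht (by simpa [Config.mirror] using mem_mirror_GammaR.1 hm)
  real3 := realAlong_mirror_QR h.real1
  curve4 := h.curve2.neg
  end4 := by simp only [Config.mirror]; rw [h.end2, z4_eq]
  infty4 := tendsto_neg_curve h.infty2
  right4 := fun t ht => by simpa [Config.mirror] using h.left2 t ht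
  avoid4 := fun t ht hm => h.avoid2 t ht (by simpa [Config.mirror] using mem_mirror_GammaR.1 hm)
  real4 := realAlong_mirror_QR h.real2

theorem IsAdmissible.mirror (h : C.IsAdmissible) : C.mirror.IsAdmissible :=
  ⟨h.sheets.mirror, h.starred.mirror, h.unbounded.mirror⟩

theorem IsSheetStructure.mem_GammaR (h : C.IsSheetStructure) {z : ℂ} :
    z ∈ C.GammaR ↔ -z ∈ levelCut := by
  rw [← h.mirror.GammaP_eq, mem_mirror_GammaP, neg_neg]

/-- Two functions that are continuous at a point of the imaginary axis and agree to its left are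
equal there. -/
theorem eq_of_left {f g : ℂ → ℂ} {z : ℂ} (hf : ContinuousAt f z) (hg : ContinuousAt g z)
    (h : ∀ᶠ w in 𝓝 z, w.re < 0 → f w = g w) (hz : z.re = 0) : f z = g z := by
  have hlim : Tendsto (fun ε : ℝ => z - ε) (𝓝[>] 0) (𝓝 z) := by
    have : Continuous fun ε : ℝ => z - ε := by fun_prop
    simpa using (this.tendsto 0).mono_left nhdsWithin_le_nhds
  refine tendsto_nhds_unique ((hf.tendsto.comp hlim).congr' ?_) (hg.tendsto.comp hlim)
  filter_upwards [hlim.eventually h, self_mem_nhdsWithin] with ε hε hpos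
  exact hε (by simpa [hz] using hpos)

/-- In the right half plane this is the description of the reflected `ψ_R`; on the imaginary axis it
follows by continuity from the left. -/
theorem IsSheetStructure.psiP_eq (h : C.IsSheetStructure) {z : ℂ} (hz : z ∉ levelCut) :
    C.psiP z = canonP z := by
  rcases lt_trichotomy z.re 0 with hn | h0 | hp
  · exact h.psiP_left hn hz
  · refine eq_of_left (h.analyticP z (h.GammaP_eq ▸ hz)).continuousAt (continuousAt_canonP hz) ?_ h0
    filter_upwards [isClosed_levelCut.isOpen_compl.mem_nhds hz] with w hw hn
    exact h.psiP_left hn hw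
  · have := h.mirror.psiR_left (z := -z) (by simpa using hp)
    simpa [Config.mirror] using this

theorem IsSheetStructure.psiQ_eq (h : C.IsSheetStructure) {z : ℂ} (hz0 : z ≠ 0)
    (hz : z ∉ levelCut) (hz' : -z ∉ levelCut) : C.psiQ z = canonQ z := by
  rcases lt_trichotomy z.re 0 with hn | h0 | hp
  · exact h.psiQ_left hn hz
  · refine eq_of_left (h.analyticQ z ?_).continuousAt (continuousAt_canonQ hz0 hz hz') ?_ h0
    · rintro ((h1 | h1) | h1)
      exacts [hz (h.GammaP_eq ▸ h1), hz' (h.mem_GammaR.1 h1), hz0 h1]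
    filter_upwards [isClosed_levelCut.isOpen_compl.mem_nhds hz] with w hw hn
    exact h.psiQ_left hn hw
  · have := h.mirror.psiQ_left (z := -z) (by simpa using hp) hz'
    rw [canonQ_neg hz0] at this
    simpa [Config.mirror] using this

theorem IsSheetStructure.psiR_eq (h : C.IsSheetStructure) {z : ℂ} (hz : -z ∉ levelCut) :
    C.psiR z = -canonP (-z) := by
  have := h.mirror.psiP_eq hz
  rw [← this]
  simp [Config.mirror]

end Config

/-! ### The unbounded curves -/

theorem not_isBounded_of_tendsto {γ : ℝ → ℂ} {l : Filter ℝ} [l.NeBot] {s : Set ℝ}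
    (h : Tendsto γ l (Bornology.cobounded ℂ)) (hs : ∀ᶠ t in l, t ∈ s) :
    ¬ Bornology.IsBounded (γ '' s) := fun hb => by
  have hev : ∀ᶠ z in Bornology.cobounded ℂ, z ∉ γ '' s := hb
  obtain ⟨t, ht, ht'⟩ := ((h.eventually hev).and hs).exists
  exact ht ⟨t, ht', rfl⟩

/-- A curve as in the level set, with the density `mainSqrt`, is given by a real line element. -/
theorem lineForm_eq_of_level {γ h : ℝ → ℂ} {t : ℝ} {s : ℂ} (hs : h t = s)
    (hre : (s * deriv γ t).re = 0) :
    lineForm γ h t = ((3 / (2 * Real.pi) * (s * deriv γ t).im : ℝ) : ℂ) := by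
  rw [lineForm_eq (by rwa [hs]), hs]

theorem mul_im_pos {s d : ℂ} (h : (s * d).re = 0) (hs : 0 < s.re) (hd : 0 < d.im) :
    0 < (s * d).im := by
  have h1 := mul_im_of_re_eq_zero h
  have h2 : 0 < Complex.normSq s := Complex.normSq_pos.2 (by rintro rfl; simp at hs)
  nlinarith [mul_pos h2 hd]

namespace Config

variable {C : Config}

theorem IsSheetStructure.pairD_ne_zero_of_notMem (h : C.IsSheetStructure) {z : ℂ} (hz : z.re < 0)
    (hc : z ∉ C.GammaP) : pairD z ≠ 0 :=
  HermitePade.pairD_ne_zero hz.le (by rintro rfl; simp at hz)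
    (fun he => hc (he ▸ h.cut.z1_mem)) (fun he => hc (he ▸ h.cut.z2_mem))

/-- Of the five pieces of the level set, the one in the strip is occupied by `Γ_P`, and the two to
the right of the branch points are bounded. The finite endpoint selects between the remaining two,
and on these the curve moves upwards: away from `z₁`, or towards `z₂` from below. -/
theorem IsSheetStructure.unbounded_level (h : C.IsSheetStructure) {γ : ℝ → ℂ} {T : Set ℝ}
    (hT : T = Ici 0 ∨ T = Iic 0) (hγ : IsAnalyticCurve γ T)
    (hstart : T = Ici 0 ∧ γ 0 = z1 ∨ T = Iic 0 ∧ γ 0 = z2)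
    (hunb : ¬ Bornology.IsBounded (γ '' interior T)) (hleft : ∀ t ∈ T, (γ t).re < 0)
    (havoid : ∀ t ∈ interior T, γ t ∉ C.GammaP)
    (hr : RealAlong γ T 0 fun t => C.QP (γ t)) :
    ∀ t ∈ interior T, (mainSqrt (γ t) * deriv γ t).re = 0 ∧
      0 < (mainSqrt (γ t) * deriv γ t).im ∧ C.QP (γ t) = mainSqrt (γ t) := by
  have h1 := z1_im_pos
  have hord : T.OrdConnected := by rcases hT with rfl | rfl <;> infer_instance
  have h0 : (0 : ℝ) ∈ T := by rcases hT with rfl | rfl <;> simp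
  have hz2 : z2.im = -z1.im := by rw [z2_eq, Complex.conj_im]
  have hpre : IsPreconnected (interior T) := by
    rcases hT with rfl | rfl
    · rw [interior_Ici]; exact isPreconnected_Ioi
    · rw [interior_Iic]; exact isPreconnected_Iio
  have hcl : (0 : ℝ) ∈ closure (interior T) := by rcases hT with rfl | rfl <;> simp
  have hm0 : mainH (γ 0) = 0 := by
    rcases hstart with ⟨-, he⟩ | ⟨-, he⟩ <;> rw [he]
    · exact mainH_z1
    · exact HermitePade.mainH_eq_zero pairD_z2
  have hH : ∀ t ∈ T, mainH (γ t) = 0 := fun t ht =>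
    mainH_eq_zero_of_realAlong hord hγ hr h0 hleft hm0
      (fun u hu => h.pairD_ne_zero_of_notMem (hleft u (interior_subset hu)) (havoid u hu))
      (fun u hu => h.cut.QP_sq ⟨hleft u (interior_subset hu), havoid u hu⟩) ht
  have hcomp := level_component (s := γ '' interior T)
    (hpre.image _ (hγ.continuousOn.mono interior_subset)) (by
      rintro _ ⟨t, ht, rfl⟩
      exact ⟨hleft t (interior_subset ht), hH t (interior_subset ht),
        fun he => havoid t ht (he ▸ h.cut.z1_mem), fun he => havoid t ht (he ▸ h.cut.z2_mem)⟩)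
  simp only [forall_mem_image] at hcomp
  have hlim : ∀ K : Set ℂ, IsClosed K → (∀ t ∈ interior T, γ t ∈ K) → γ 0 ∈ K := fun K hK hm =>
    closure_minimal (image_subset_iff.2 hm) hK
      ((hγ.continuousOn 0 h0).mono interior_subset |>.mem_closure_image hcl)
  have hne : ∃ t, t ∈ interior T := by
    rcases hT with rfl | rfl
    · exact ⟨1, by simp⟩
    · exact ⟨-1, by simp⟩
  have hbdd : (∀ t ∈ interior T, |(γ t).im| < z1.im ∧ z1.re < (γ t).re) → False := fun hb => by
    refine hunb ((Metric.isBounded_closedBall (x := (0 : ℂ)) (r := -z1.re + z1.im)).subset ?_)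
    rintro _ ⟨t, ht, rfl⟩
    rw [mem_closedBall_zero_iff]
    have h2 := Complex.norm_le_abs_re_add_abs_im (γ t)
    have h3 := hleft t (interior_subset ht)
    rw [abs_of_neg h3] at h2
    linarith [(hb t ht).1, (hb t ht).2]
  have hkey : ∀ t ∈ interior T, z1.im < |(γ t).im| ∧ 0 < (γ t).im - (γ 0).im ∧ 0 < t ∨
      z1.im < |(γ t).im| ∧ (γ t).im - (γ 0).im < 0 ∧ t < 0 := by
    rcases hcomp with hc | hc | hc | hc | hc
    · rcases hstart with ⟨rfl, he⟩ | ⟨-, he⟩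
      · intro t ht
        rw [he]
        rw [interior_Ici] at ht
        have := hc (interior_Ici (a := (0 : ℝ)) ▸ ht)
        exact Or.inl ⟨lt_abs.2 (Or.inl this), by linarith, ht⟩
      · have := hlim {z | z1.im ≤ z.im} (isClosed_le continuous_const Complex.continuous_im)
          fun t ht => (hc ht).le
        rw [he] at this
        have : z1.im ≤ z2.im := this
        linarith
    · rcases hstart with ⟨-, he⟩ | ⟨rfl, he⟩
      · have := hlim {z | z.im ≤ -z1.im} (isClosed_le Complex.continuous_im continuous_const)
          fun t ht => (hc ht).le
        rw [he] at this
        have : z1.im ≤ -z1.im := this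
        linarith
      · intro t ht
        rw [he, hz2]
        rw [interior_Iic] at ht
        have := hc (interior_Iic (a := (0 : ℝ)) ▸ ht)
        exact Or.inr ⟨lt_abs.2 (Or.inr (by linarith)), by linarith, ht⟩
    · obtain ⟨t, ht⟩ := hne
      exact (havoid t ht (h.GammaP_eq.symm ▸
        mem_levelCut_of_strip (hH t (interior_subset ht)) (hc ht))).elim
    · exact (hbdd fun t ht => ⟨abs_lt.2 ⟨by linarith [(hc ht).1], (hc ht).2.1⟩, (hc ht).2.2⟩).elim
    · exact (hbdd fun t ht => ⟨abs_lt.2 ⟨(hc ht).2.1, by linarith [(hc ht).1]⟩, (hc ht).2.2⟩).elim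
  have habs : ∀ t ∈ interior T, z1.im < |(γ t).im| := fun t ht =>
    (hkey t ht).elim (fun h => h.1) fun h => h.1
  have hslit : ∀ t ∈ interior T, (pairM (γ t)).re ≠ 0 ∨ (pairM (γ t)).im ^ 2 < 3 := fun t ht =>
    slit_above (hleft t (interior_subset ht)).le (habs t ht)
  have hd : ∀ t ∈ interior T, DifferentiableAt ℝ γ t := fun t ht =>
    (hγ.analytic t ht).differentiableAt
  have hre : ∀ t ∈ interior T, (mainSqrt (γ t) * deriv γ t).re = 0 := fun t ht =>
    mul_deriv_re_of_mainH (hd t ht) (hleft t (interior_subset ht)) (hslit t ht) (by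
      filter_upwards [isOpen_interior.mem_nhds ht] with u hu using hH u (interior_subset hu))
  have hpos : ∀ t ∈ interior T, 0 < (deriv γ t).im := by
    refine (deriv_im_sign hpre hγ.continuousOn_deriv fun t ht =>
      im_ne_zero_of_mul_re (hre t ht) (mainSqrt_re_pos (hslit t ht)).ne'
        (hγ.regular t ht)).resolve_right fun hn => ?_
    obtain ⟨t, ht⟩ := hne
    have mvt : ∀ a b, a < b → a ∈ T → b ∈ T → (γ b).im < (γ a).im := fun a b hab ha hb => by
      have hsub : Icc a b ⊆ T := hord.out ha hb
      have hsub' : Ioo a b ⊆ interior T :=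
        interior_maximal (Ioo_subset_Icc_self.trans hsub) isOpen_Ioo
      obtain ⟨c, hc, hc'⟩ := exists_hasDerivAt_eq_slope (fun u => (γ u).im) _ hab
        (Complex.continuous_im.comp_continuousOn (hγ.continuousOn.mono hsub))
        (fun u hu => hasDerivAt_im (hd u (hsub' hu)))
      have := hn c (hsub' hc)
      rw [hc', div_lt_iff₀ (sub_pos.2 hab)] at this
      linarith
    rcases hkey t ht with ⟨-, h2, h3⟩ | ⟨-, h2, h3⟩
    · linarith [mvt 0 t h3 h0 (interior_subset ht)]
    · linarith [mvt t 0 h3 (interior_subset ht) h0]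
  refine fun t ht => ⟨hre t ht, mul_im_pos (hre t ht) (mainSqrt_re_pos (hslit t ht)) (hpos t ht),
    ?_⟩
  rw [h.QP_eq (hleft t (interior_subset ht)) (h.GammaP_eq ▸ havoid t ht),
    canonS_main fun hb => absurd hb.1 (habs t ht).not_gt]

theorem IsAdmissible.level1 (h : C.IsAdmissible) : ∀ t ∈ Ioi (0 : ℝ), ∃ r : ℝ, 0 ≤ r ∧
    lineForm C.gE1 (fun t => C.QP (C.gE1 t)) t = r := by
  have hu := h.unbounded
  have hI : interior (Ici (0 : ℝ)) = Ioi 0 := interior_Ici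
  intro t ht
  obtain ⟨h1, h2, h3⟩ := h.sheets.unbounded_level (Or.inl rfl) hu.curve1 (Or.inl ⟨rfl, hu.start1⟩)
    (not_isBounded_of_tendsto hu.infty1 (by rw [hI]; exact eventually_gt_atTop 0)) hu.left1
    (fun t ht => hu.avoid1 t (hI ▸ ht)) hu.real1 t (hI.symm ▸ ht)
  have hpi := Real.pi_pos
  exact ⟨_, by positivity, lineForm_eq_of_level h3 h1⟩

theorem IsAdmissible.level2 (h : C.IsAdmissible) : ∀ t ∈ Iio (0 : ℝ), ∃ r : ℝ, 0 ≤ r ∧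
    lineForm C.gE2 (fun t => C.QP (C.gE2 t)) t = r := by
  have hu := h.unbounded
  have hI : interior (Iic (0 : ℝ)) = Iio 0 := interior_Iic
  intro t ht
  obtain ⟨h1, h2, h3⟩ := h.sheets.unbounded_level (Or.inr rfl) hu.curve2 (Or.inr ⟨rfl, hu.end2⟩)
    (not_isBounded_of_tendsto hu.infty2 (by rw [hI]; exact eventually_lt_atBot 0)) hu.left2
    (fun t ht => hu.avoid2 t (hI ▸ ht)) hu.real2 t (hI.symm ▸ ht)
  have hpi := Real.pi_pos
  exact ⟨_, by positivity, lineForm_eq_of_level h3 h1⟩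

theorem lineForm_mirror (γ : ℝ → ℂ) :
    lineForm (fun t => -γ t) (fun t => C.mirror.QP (-γ t)) = lineForm γ fun t => C.QR (γ t) := by
  simp only [mirror_QP_neg]
  exact lineForm_neg _ _

theorem IsAdmissible.level3 (h : C.IsAdmissible) : ∀ t ∈ Ioi (0 : ℝ), ∃ r : ℝ, 0 ≤ r ∧
    lineForm C.gE3 (fun t => C.QR (C.gE3 t)) t = r := by
  rw [← lineForm_mirror]
  exact h.mirror.level1

theorem IsAdmissible.level4 (h : C.IsAdmissible) : ∀ t ∈ Iio (0 : ℝ), ∃ r : ℝ, 0 ≤ r ∧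
    lineForm C.gE4 (fun t => C.QR (C.gE4 t)) t = r := by
  rw [← lineForm_mirror]
  exact h.mirror.level2

end Config

/-! ### Measures from positive line elements -/

/-- The measure of a piece whose line elements are positive. -/
def Piece.measure (p : Piece) : Measure ℂ :=
  open Classical in
  -- The default value `0` off the domain only serves the measurability of the map; the restricted
  -- measure does not see it.
  ((volume.restrict p.dom).withDensity
    fun t => ENNReal.ofReal (lineForm p.curve p.density t).re).map (p.dom.piecewise p.curve 0)

/-- A piece with positive, locally integrable line elements. -/
structure Piece.IsPositive (p : Piece) : Prop where
  measurableSet : MeasurableSet p.dom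
  continuousOn : ContinuousOn p.curve p.dom
  nonneg : ∀ t ∈ p.dom, ∃ r : ℝ, 0 ≤ r ∧ lineForm p.curve p.density t = r
  integrableOn : ∀ B, Bornology.IsBounded B →
    IntegrableOn (lineForm p.curve p.density) (p.dom ∩ p.curve ⁻¹' B)

theorem Piece.IsPositive.measurableSet_inter {p : Piece} (h : p.IsPositive) {B : Set ℂ}
    (hB : MeasurableSet B) : MeasurableSet (p.dom ∩ p.curve ⁻¹' B) := by
  classical
  have hm : Measurable (p.dom.piecewise p.curve 0) :=
    h.continuousOn.measurable_piecewise continuousOn_const h.measurableSet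
  convert h.measurableSet.inter (hm hB) using 1
  ext t
  simp +contextual only [mem_inter_iff, mem_preimage, and_congr_right_iff, piecewise_eq_of_mem,
    implies_true]

theorem Piece.IsPositive.measure_apply {p : Piece} (h : p.IsPositive) {B : Set ℂ}
    (hB : MeasurableSet B) : p.measure B =
      ∫⁻ t in p.dom ∩ p.curve ⁻¹' B, ENNReal.ofReal (lineForm p.curve p.density t).re := by
  classical
  have hm : Measurable (p.dom.piecewise p.curve 0) :=
    h.continuousOn.measurable_piecewise continuousOn_const h.measurableSet
  have e : p.dom.piecewise p.curve 0 ⁻¹' B ∩ p.dom = p.dom ∩ p.curve ⁻¹' B := by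
    ext t
    rw [inter_comm]
    simp +contextual only [mem_inter_iff, mem_preimage, and_congr_right_iff, piecewise_eq_of_mem,
      implies_true]
  unfold Piece.measure
  rw [Measure.map_apply (by convert hm) hB, withDensity_apply _ (by convert hm hB),
    Measure.restrict_restrict (by convert hm hB)]
  rw [← e]

theorem Piece.IsPositive.measure_of_integrable {p : Piece} (h : p.IsPositive) {B : Set ℂ}
    (hB : MeasurableSet B)
    (hi : IntegrableOn (lineForm p.curve p.density) (p.dom ∩ p.curve ⁻¹' B)) :
    p.measure B ≠ ⊤ ∧ (((p.measure B).toReal : ℝ) : ℂ) =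
      ∫ t in p.dom ∩ p.curve ⁻¹' B, lineForm p.curve p.density t := by
  have hms := h.measurableSet_inter hB
  have hnn : 0 ≤ᵐ[volume.restrict (p.dom ∩ p.curve ⁻¹' B)]
      fun t => (lineForm p.curve p.density t).re := by
    refine (ae_restrict_iff' hms).2 (Eventually.of_forall fun t ht => ?_)
    obtain ⟨r, hr, he⟩ := h.nonneg t ht.1
    simpa [he] using hr
  have e := ofReal_integral_eq_lintegral_ofReal hi.re hnn
  rw [h.measure_apply hB]
  simp only [RCLike.re_to_complex] at e
  rw [← e]
  refine ⟨ENNReal.ofReal_ne_top, ?_⟩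
  rw [ENNReal.toReal_ofReal (integral_nonneg_of_ae hnn), ← integral_complex_ofReal]
  refine setIntegral_congr_fun hms fun t ht => ?_
  obtain ⟨r, hr, he⟩ := h.nonneg t ht.1
  simp [he]

theorem toReal_sum_measure {n : ℕ} {p : Fin n → Piece} {B : Set ℂ} (hp : ∀ k, (p k).IsPositive)
    (hB : MeasurableSet B)
    (hi : ∀ k, IntegrableOn (lineForm (p k).curve (p k).density) ((p k).dom ∩ (p k).curve ⁻¹' B)) :
    (∑ k, (p k).measure) B ≠ ⊤ ∧ ((((∑ k, (p k).measure) B).toReal : ℝ) : ℂ) =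
      ∑ k, ∫ t in (p k).dom ∩ (p k).curve ⁻¹' B, lineForm (p k).curve (p k).density t := by
  have hm := fun k => (hp k).measure_of_integrable hB (hi k)
  rw [Measure.finsetSum_apply]
  refine ⟨ENNReal.sum_ne_top.2 fun k _ => (hm k).1, ?_⟩
  rw [ENNReal.toReal_sum fun k _ => (hm k).1]
  push_cast
  exact Finset.sum_congr rfl fun k _ => (hm k).2

/-- Finitely many pieces with positive, locally integrable line elements give a positive measure. -/
theorem isGivenBy_sum {n : ℕ} {p : Fin n → Piece} (hp : ∀ k, (p k).IsPositive) :
    IsGivenBy (∑ k, (p k).measure) p := fun _ hB hb =>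
  ⟨fun k => (hp k).integrableOn _ hb,
    toReal_sum_measure hp hB fun k => (hp k).integrableOn _ hb⟩

theorem sum_measure_compl {n : ℕ} {p : Fin n → Piece} (hp : ∀ k, (p k).IsPositive) {S : Set ℂ}
    (hS : MeasurableSet S) (h : ∀ k, MapsTo (p k).curve (p k).dom S) :
    (∑ k, (p k).measure) Sᶜ = 0 := by
  rw [Measure.finsetSum_apply]
  refine Finset.sum_eq_zero fun k _ => ?_
  have e : (p k).dom ∩ (p k).curve ⁻¹' Sᶜ = ∅ := by
    ext t
    simp only [mem_inter_iff, mem_preimage, mem_compl_iff, mem_empty_iff_false, iff_false, not_and,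
      not_not]
    exact fun ht => h k ht
  rw [(hp k).measure_apply hS.compl, e, Measure.restrict_empty, lintegral_zero_measure]

theorem isProbabilityMeasure_sum {n : ℕ} {p : Fin n → Piece} (hp : ∀ k, (p k).IsPositive)
    (hi : ∀ k, IntegrableOn (lineForm (p k).curve (p k).density) (p k).dom)
    (h : ∑ k, ∫ t in (p k).dom, lineForm (p k).curve (p k).density t = 1) :
    IsProbabilityMeasure (∑ k, (p k).measure) := by
  obtain ⟨h1, h2⟩ := toReal_sum_measure hp MeasurableSet.univ (by simpa using hi)
  simp only [preimage_univ, inter_univ] at h2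
  rw [h, ← Complex.ofReal_one, Complex.ofReal_inj] at h2
  refine ⟨?_⟩
  rw [← ENNReal.ofReal_toReal h1, h2, ENNReal.ofReal_one]

/-! ### Primitives on half planes and their jumps on the real axis -/

/-- The primitive `3 ∫ w dz` for `z` in a closed half plane, the upper one for `ε > 0` and the
lower one for `ε < 0`. -/
def heightPrim (ε : ℝ) (w : ℂ) : ℂ :=
  prim (ε * Complex.I) (ε * Complex.I) (ε * Complex.I) w

/-- Preimages of points in one closed half plane lie in the opposite one. Multiplication by `εi`
turns `w`, `w-1` and `w+1` into the closed right half plane without the origin. -/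
theorem IsPreimage.slit_of_height {z w : ℂ} (h : IsPreimage z w) {ε : ℝ} (hε : ε ≠ 0)
    (hz : 0 ≤ ε * z.im) :
    ε * Complex.I * w ∈ Complex.slitPlane ∧ ε * Complex.I * (w - 1) ∈ Complex.slitPlane ∧
      ε * Complex.I * (w + 1) ∈ Complex.slitPlane := by
  obtain ⟨k, hk, he⟩ := h.exists_im
  have hw : ε * w.im ≤ 0 := by
    rw [he] at hz
    by_contra! hn
    nlinarith [mul_pos hk hn]
  have key : ∀ u : ℂ, u ≠ 0 → u.im = w.im → ε * Complex.I * u ∈ Complex.slitPlane := by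
    intro u hu hi
    have e1 : (ε * Complex.I * u).re = -(ε * w.im) := by simp [hi]
    have e2 : (ε * Complex.I * u).im = ε * u.re := by simp
    rw [Complex.mem_slitPlane_iff, e1, e2]
    rcases hw.lt_or_eq with h1 | h1
    · exact Or.inl (by linarith)
    · refine Or.inr (mul_ne_zero hε fun h0 => hu (Complex.ext h0 ?_))
      rw [hi]
      exact (mul_eq_zero.1 h1).resolve_left hε
  exact ⟨key w h.ne_zero rfl, key _ h.sub_one_ne (by simp), key _ h.add_one_ne (by simp)⟩

theorem IsPreimage.hasDerivAt_heightPrim {z w : ℂ} (h : IsPreimage z w) {ε : ℝ} (hε : ε ≠ 0)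
    (hz : 0 ≤ ε * z.im) : HasDerivAt (heightPrim ε) (3 * w * zMapDeriv w) w :=
  hasDerivAt_prim h (h.slit_of_height hε hz).1 (h.slit_of_height hε hz).2.1
    (h.slit_of_height hε hz).2.2

/-- The fundamental theorem, with differentiability inside and continuity up to the ends only.
Integrability is assumed separately, since the curve need not be regular at its ends. -/
theorem integral_lineForm {p q : ℂ → ℂ} {γ h : ℝ → ℂ} {c d ε : ℝ} (hε : ε ≠ 0) (hcd : c ≤ d)
    (hγ : ∀ t ∈ Ioo c d, DifferentiableAt ℝ γ t)
    (hq : ∀ t ∈ Ioo c d, IsBranchNear q (γ t)) (hp : ∀ t ∈ Ioo c d, IsBranchNear p (γ t))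
    (hqc : ContinuousOn (fun t => q (γ t)) (Icc c d))
    (hpc : ContinuousOn (fun t => p (γ t)) (Icc c d))
    (hr : ∀ t ∈ Icc c d, IsPreimage (γ t) (q (γ t)) ∧ IsPreimage (γ t) (p (γ t)))
    (him : ∀ t ∈ Icc c d, 0 ≤ ε * (γ t).im)
    (hh : ∀ t ∈ Ioo c d, h t = q (γ t) - p (γ t))
    (hint : IntervalIntegrable (lineForm γ h) volume c d) :
    ∫ t in c..d, lineForm γ h t = 1 / (2 * Real.pi * Complex.I) *
      (heightPrim ε (q (γ d)) - heightPrim ε (p (γ d)) -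
        (heightPrim ε (q (γ c)) - heightPrim ε (p (γ c)))) := by
  set W := heightPrim ε
  have hWc : ∀ r : ℂ → ℂ, ContinuousOn (fun t => r (γ t)) (Icc c d) →
      (∀ t ∈ Icc c d, IsPreimage (γ t) (r (γ t))) →
      ContinuousOn (fun t => W (r (γ t))) (Icc c d) := fun r hc h t ht =>
    ContinuousAt.comp_continuousWithinAt (f := fun t => r (γ t)) (g := W)
      ((h t ht).hasDerivAt_heightPrim hε (him t ht)).continuousAt (hc t ht)
  have hWd : ∀ r : ℂ → ℂ, (∀ t ∈ Ioo c d, IsBranchNear r (γ t)) →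
      ∀ t ∈ Ioo c d, HasDerivAt (fun t => W (r (γ t))) (3 * (r (γ t) * deriv γ t)) t := by
    intro r hb t ht
    have e1 := ((hb t ht).isPreimage.hasDerivAt_heightPrim hε
      (him t (Ioo_subset_Icc_self ht))).comp (γ t) (hb t ht).hasDerivAt
    have e2 := HasDerivAt.comp (h₂ := fun z => W (r z)) t e1 (hγ t ht).hasDerivAt
    refine e2.congr_deriv ?_
    have := (hb t ht).2
    field_simp
  have e := intervalIntegral.integral_eq_sub_of_hasDerivAt_of_le hcd
    (f := fun t => 1 / (2 * Real.pi * Complex.I) * (W (q (γ t)) - W (p (γ t))))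
    (f' := lineForm γ h)
    (continuousOn_const.mul ((hWc q hqc fun t ht => (hr t ht).1).sub
      (hWc p hpc fun t ht => (hr t ht).2))) (fun t ht => by
      refine (((hWd q hq t ht).sub (hWd p hp t ht)).const_mul _).congr_deriv ?_
      rw [lineForm, hh t ht]
      ring) hint
  rw [e]
  ring

theorem log_mul_I_sub {x : ℝ} (hx : 0 < x) :
    Complex.log ((1 : ℝ) * Complex.I * x) - Complex.log ((-1 : ℝ) * Complex.I * x) =
      Real.pi * Complex.I := by
  rw [mul_comm _ (x : ℂ), mul_comm _ (x : ℂ), Complex.log_ofReal_mul hx (by simp),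
    Complex.log_ofReal_mul hx (by simp)]
  push_cast
  rw [one_mul, neg_one_mul, Complex.log_I, Complex.log_neg_I]
  ring

theorem log_mul_I_sub_neg {x : ℝ} (hx : x < 0) :
    Complex.log ((1 : ℝ) * Complex.I * x) - Complex.log ((-1 : ℝ) * Complex.I * x) =
      -(Real.pi * Complex.I) := by
  have := log_mul_I_sub (neg_pos.2 hx)
  push_cast at this ⊢
  rw [show (1 : ℂ) * Complex.I * -x = -1 * Complex.I * x by ring,
    show (-1 : ℂ) * Complex.I * -x = 1 * Complex.I * x by ring] at this
  linear_combination -this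

/-- On the real axis each of the three logarithms contributes `-πi` or `πi` according to the sign of
its argument. The jump thus counts the poles `0, ±1` on either side of `x`. -/
theorem heightPrim_sub (x : ℝ) : heightPrim 1 x - heightPrim (-1) x =
    -(Complex.log ((1 : ℝ) * Complex.I * x) - Complex.log ((-1 : ℝ) * Complex.I * x)) -
    (Complex.log ((1 : ℝ) * Complex.I * (x - 1 : ℝ)) -
      Complex.log ((-1 : ℝ) * Complex.I * (x - 1 : ℝ))) -
    (Complex.log ((1 : ℝ) * Complex.I * (x + 1 : ℝ)) -
      Complex.log ((-1 : ℝ) * Complex.I * (x + 1 : ℝ))) := by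
  simp only [heightPrim, prim, Complex.ofReal_sub, Complex.ofReal_add, Complex.ofReal_one]
  ring

theorem heightPrim_sub_left {x : ℝ} (h : x < -1) :
    heightPrim 1 x - heightPrim (-1) x = 3 * (Real.pi * Complex.I) := by
  rw [heightPrim_sub, log_mul_I_sub_neg (by linarith), log_mul_I_sub_neg (by linarith),
    log_mul_I_sub_neg (by linarith)]
  ring

theorem heightPrim_sub_mid {x : ℝ} (h : -1 < x) (h0 : x < 0) :
    heightPrim 1 x - heightPrim (-1) x = Real.pi * Complex.I := by
  rw [heightPrim_sub, log_mul_I_sub_neg h0, log_mul_I_sub_neg (by linarith),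
    log_mul_I_sub (by linarith)]
  ring

theorem heightPrim_sub_right {x : ℝ} (h : 0 < x) (h1 : x < 1) :
    heightPrim 1 x - heightPrim (-1) x = -(Real.pi * Complex.I) := by
  rw [heightPrim_sub, log_mul_I_sub h, log_mul_I_sub_neg (by linarith), log_mul_I_sub (by linarith)]
  ring

/-- At a negative point the two smaller preimages are real and separated by `-1`. -/
theorem exists_real_roots {z : ℂ} (hz : z.re < 0) (hi : z.im = 0) : ∃ a b : ℝ,
    pairRoot z (-mainSqrt z) = a ∧ pairRoot z (mainSqrt z) = b ∧ a < -1 ∧ -1 < b ∧ b < 0 := by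
  have hz0 : z ≠ 0 := by rintro rfl; simp at hz
  obtain ⟨hm, hmi, hMi⟩ := pairM_of_real hz hi
  have hM := maxRoot_re_pos hz.le
  have hsp := mainSqrt_re_pos (Or.inl hm.ne')
  have hsi : (mainSqrt z).im = 0 := by
    have := mainSqrt_mul_im z
    rw [hmi, mul_zero, mul_eq_zero, mul_eq_zero] at this
    rcases this with h | h | h
    · norm_num at h
    · exact absurd h hsp.ne'
    · exact h
  have real : ∀ u : ℂ, u.im = 0 → u = (u.re : ℂ) := fun u h => Complex.ext rfl (by simp [h])
  set x := z.re
  set M := (maxRoot z).re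
  set m := (pairM z).re
  set s := (mainSqrt z).re
  have ex : z = x := real z hi
  have eM : maxRoot z = M := real _ hMi
  have em : pairM z = m := real _ hmi
  have es : mainSqrt z = s := real _ hsi
  have ea : pairRoot z (-mainSqrt z) = (((-(1 + m) * M - s) / 2 : ℝ) : ℂ) := by
    rw [pairRoot, em, eM, es]
    push_cast
    ring
  have eb : pairRoot z (mainSqrt z) = (((-(1 + m) * M + s) / 2 : ℝ) : ℂ) := by
    rw [pairRoot, em, eM, es]
    push_cast
    ring
  set a := (-(1 + m) * M - s) / 2
  set b := (-(1 + m) * M + s) / 2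
  have hab : a < b := by
    simp only [a, b]
    linarith
  have ht := isTriple_pairRoot hz0 (mainSqrt_sq z)
  rw [ea, eb, eM] at ht
  -- The cubic has the values `1/3` at `0` and `-2/3` at `-1`. Compared with the factored form these
  -- give the signs of `ab` and of `(-1-a)(1+b)`.
  have f0 := ht.factor 0
  have f1 := ht.factor (-1)
  rw [ex] at f0 f1
  have g0 : 1 / 3 = -(x * (M * b * a)) :=
    Complex.ofReal_injective (by push_cast; linear_combination f0)
  have g1 : -1 + 1 / 3 = x * ((-1 - M) * (-1 - b) * (-1 - a)) :=
    Complex.ofReal_injective (by push_cast; linear_combination f1)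
  have p0 : 0 < (-x * M) * (a * b) := by linarith
  have hxM : 0 < -x * M := by nlinarith
  have hab0 : 0 < a * b := (mul_pos_iff_of_pos_left hxM).1 p0
  have hx1 : 0 < -x * (1 + M) := by nlinarith
  have p1 : 0 < (-x * (1 + M)) * ((-1 - a) * (1 + b)) := by linarith
  have q1 : 0 < (-1 - a) * (1 + b) := (mul_pos_iff_of_pos_left hx1).1 p1
  have ha : a < -1 ∧ -1 < b := by
    rcases mul_pos_iff.1 q1 with h | h
    · exact ⟨by linarith, by linarith⟩
    · linarith
  exact ⟨a, b, ea, eb, ha.1, ha.2, by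
    rcases mul_pos_iff.1 hab0 with h | h
    · linarith
    · exact h.2⟩

theorem mainH_sq_eq_hDiff_canonS {z : ℂ} (hz : z ≠ 0) : mainH z ^ 2 = hDiff canonS z ^ 2 := by
  rcases sq_eq_sq_iff_eq_or_eq_neg.1 ((mainSqrt_sq z).trans (canonS_sq hz).symm) with h' | h'
  · rw [mainH, hDiff_congr h']
  · rw [mainH, hDiff_neg h', neg_sq]

/-! ### The curve `Γ_P^*` of an arbitrary configuration -/

namespace Config

variable {C : Config}

theorem IsAdmissible.star_facts (h : C.IsAdmissible) {t : ℝ} (ht : t ∈ Ioo (0 : ℝ) 1) :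
    C.gPstar t ≠ 0 ∧ C.gPstar t ∉ levelCut ∧ -C.gPstar t ∉ levelCut := by
  have ha := h.starred.avoidP t ht
  refine ⟨fun h0 => ha (Or.inr h0), fun hm => ha (Or.inl (Or.inl ?_)),
    fun hm => ha (Or.inl (Or.inr ?_))⟩
  · exact h.sheets.GammaP_eq.symm ▸ hm
  · exact h.sheets.mem_GammaR.2 hm

theorem IsAdmissible.star_branchQ (h : C.IsAdmissible) {t : ℝ} (ht : t ∈ Ioo (0 : ℝ) 1) :
    IsBranchNear canonQ (C.gPstar t) :=
  isBranchNear_canonQ (h.star_facts ht).1 (h.star_facts ht).2.1 (h.star_facts ht).2.2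

theorem IsAdmissible.star_branchP (h : C.IsAdmissible) {t : ℝ} (ht : t ∈ Ioo (0 : ℝ) 1) :
    IsBranchNear canonP (C.gPstar t) := isBranchNear_canonP (h.star_facts ht).2.1

theorem IsAdmissible.star_QP (h : C.IsAdmissible) {t : ℝ} (ht : t ∈ Ioo (0 : ℝ) 1) :
    C.QP (C.gPstar t) = canonQ (C.gPstar t) - canonP (C.gPstar t) := by
  obtain ⟨h1, h2, h3⟩ := h.star_facts ht
  rw [QP, h.sheets.psiQ_eq h1 h2 h3, h.sheets.psiP_eq h2]

theorem IsAdmissible.star_end (h : C.IsAdmissible) {t : ℝ} (ht : t ∈ Icc (0 : ℝ) 1) :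
    t ∈ Ioo (0 : ℝ) 1 ∨ C.gPstar t = z1 ∨ C.gPstar t = z2 := by
  rcases ht.1.eq_or_lt with h0 | h0
  · exact Or.inr (Or.inr (h0 ▸ h.starred.startP))
  · rcases ht.2.eq_or_lt with h1 | h1
    · exact Or.inr (Or.inl (h1 ▸ h.starred.endP))
    · exact Or.inl ⟨h0, h1⟩

theorem IsAdmissible.star_continuousAt (h : C.IsAdmissible) {t : ℝ} (ht : t ∈ Icc (0 : ℝ) 1) :
    ContinuousAt canonQ (C.gPstar t) ∧ ContinuousAt canonP (C.gPstar t) ∧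
      IsPreimage (C.gPstar t) (canonQ (C.gPstar t)) := by
  rcases h.star_end ht with h1 | h1
  · exact ⟨(h.star_branchQ h1).continuousAt, (h.star_branchP h1).continuousAt,
      (h.star_branchQ h1).isPreimage⟩
  · exact ⟨(canon_branch h1).1, (canon_branch h1).2.1, (canon_branch h1).2.2.2⟩

theorem IsAdmissible.star_continuousOn (h : C.IsAdmissible) :
    ContinuousOn (fun t => canonQ (C.gPstar t)) (Icc 0 1) ∧
      ContinuousOn (fun t => canonP (C.gPstar t)) (Icc 0 1) :=
  ⟨fun t ht => (h.star_continuousAt ht).1.comp_continuousWithinAt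
    (h.starred.curveP.continuousOn t ht), fun t ht =>
    (h.star_continuousAt ht).2.1.comp_continuousWithinAt (h.starred.curveP.continuousOn t ht)⟩

theorem IsAdmissible.star_differentiableAt (h : C.IsAdmissible) {t : ℝ} (ht : t ∈ Ioo (0 : ℝ) 1) :
    DifferentiableAt ℝ C.gPstar t :=
  (h.starred.curveP.analytic t (by rwa [interior_Icc])).differentiableAt

theorem IsAdmissible.star_re (h : C.IsAdmissible) {t : ℝ} (ht : t ∈ Ioo (0 : ℝ) 1) :
    ((canonQ (C.gPstar t) - canonP (C.gPstar t)) * deriv C.gPstar t).re = 0 := by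
  have hI : interior (Icc (0 : ℝ) 1) = Ioo 0 1 := interior_Icc
  have hc := h.star_continuousOn
  refine h.starred.realP.forall_mem (S := {w : ℂ | w.re = 0})
    (F := fun t => (canonQ (C.gPstar t) - canonP (C.gPstar t)) * deriv C.gPstar t)
    (isClosed_eq Complex.continuous_re continuous_const)
    (((hc.1.sub hc.2).mono interior_subset).mul h.starred.curveP.continuousOn_deriv)
    (fun u hu hre => ?_) t (hI.symm ▸ ht)
  rwa [h.star_QP (hI ▸ hu)] at hre

/-- The difference of `hFun` on the two sheets has derivative zero along the curve and vanishes at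
its end `z₁`, where the sheets meet. -/
theorem IsAdmissible.star_hFun (h : C.IsAdmissible) {t : ℝ} (ht : t ∈ Ioo (0 : ℝ) 1) :
    hFun (canonQ (C.gPstar t)) = hFun (canonP (C.gPstar t)) := by
  have hsub : Icc t 1 ⊆ Icc 0 1 := Icc_subset_Icc_left ht.1.le
  have hsub' : Ioo t 1 ⊆ Ioo 0 1 := Ioo_subset_Ioo_left ht.1.le
  have hc := h.star_continuousOn
  obtain ⟨c, hc1, hc2⟩ := exists_hasDerivAt_eq_slope
    (fun u => hFun (canonQ (C.gPstar u)) - hFun (canonP (C.gPstar u)))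
    (fun u => (3 * (canonQ (C.gPstar u) * deriv C.gPstar u)).re -
      (3 * (canonP (C.gPstar u) * deriv C.gPstar u)).re) ht.2
    ((fun u hu => ((continuousAt_hFun (h.star_continuousAt (hsub hu)).2.2).comp_continuousWithinAt
      (f := fun u => canonQ (C.gPstar u)) ((hc.1 u (hsub hu)).mono hsub)).sub
      ((continuousAt_hFun (isPreimage_canonP _)).comp_continuousWithinAt
        (f := fun u => canonP (C.gPstar u)) ((hc.2 u (hsub hu)).mono hsub))))
    (fun u hu => ((h.star_branchQ (hsub' hu)).hasDerivAt_hFun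
      (h.star_differentiableAt (hsub' hu)).hasDerivAt).sub
      ((h.star_branchP (hsub' hu)).hasDerivAt_hFun
      (h.star_differentiableAt (hsub' hu)).hasDerivAt))
  have hre := h.star_re (hsub' hc1)
  have e : (3 * (canonQ (C.gPstar c) * deriv C.gPstar c)).re -
      (3 * (canonP (C.gPstar c) * deriv C.gPstar c)).re =
      3 * ((canonQ (C.gPstar c) - canonP (C.gPstar c)) * deriv C.gPstar c).re := by
    simp
    ring
  rw [e, hre, mul_zero, eq_div_iff (sub_pos.2 ht.2).ne', zero_mul, h.starred.endP,
    (canon_branch (Or.inl rfl)).2.2.1, sub_self, zero_sub, eq_comm, neg_eq_zero] at hc2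
  linarith

theorem IsAdmissible.star_mainH (h : C.IsAdmissible) {t : ℝ} (ht : t ∈ Ioo (0 : ℝ) 1)
    (hre : (C.gPstar t).re ≤ 0) : mainH (C.gPstar t) = 0 := by
  have h0 := (h.star_facts ht).1
  have e := h.star_hFun ht
  rw [canonQ_left hre, canonP_left hre h0] at e
  have := mainH_sq_eq_hDiff_canonS h0
  rw [hDiff, e, sub_self] at this
  simpa using this

/-- On the imaginary axis `mainH` vanishes only at the two points of critical height. This limits
the crossings and determines `y^*`. -/
theorem IsAdmissible.star_imaginary (h : C.IsAdmissible) {t : ℝ} (ht : t ∈ Icc (0 : ℝ) 1)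
    (hre : (C.gPstar t).re = 0) : t ∈ Ioo (0 : ℝ) 1 ∧ |(C.gPstar t).im| = critHeight := by
  have ht' : t ∈ Ioo (0 : ℝ) 1 := by
    refine (h.star_end ht).resolve_right fun h1 => ?_
    exact (branch_facts h1).1.ne hre
  refine ⟨ht', ?_⟩
  have hH := h.star_mainH ht' hre.le
  have him := im_ne_zero_of_re hre (h.star_facts ht').1
  rw [eq_pt_of_re hre] at hH
  exact (mainH_imaginary_eq_iff him).1 hH

theorem IsAdmissible.ystar_eq (h : C.IsAdmissible) : C.ystar = critHeight := by
  obtain ⟨⟨t, ht, he⟩, -⟩ := h.starred.meet_upper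
  have := (h.star_imaginary ht (by rw [he]; simp)).2
  rw [he] at this
  simpa [abs_of_pos h.starred.ystar_pos] using this

/-- The parameters at which `Γ_P^*` meets the imaginary axis. -/
theorem IsAdmissible.exists_star_params (h : C.IsAdmissible) : ∃ a b : ℝ,
    a ∈ Ioo (0 : ℝ) 1 ∧ b ∈ Ioo (0 : ℝ) 1 ∧ C.gPstar a = pt 0 (-critHeight) ∧
    C.gPstar b = pt 0 critHeight ∧ ∀ t ∈ Icc (0 : ℝ) 1, (C.gPstar t).re = 0 → t = a ∨ t = b := by
  obtain ⟨⟨b, hb, hbe⟩, -⟩ := h.starred.meet_upper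
  obtain ⟨⟨a, ha, hae⟩, -⟩ := h.starred.meet_lower
  rw [h.ystar_eq] at hbe hae
  have hb' : C.gPstar b = pt 0 critHeight := by rw [hbe, segment_eq]
  have ha' : C.gPstar a = pt 0 (-critHeight) := by
    rw [hae, segment_eq]
    apply Complex.ext <;> simp [pt]
  refine ⟨a, b, (h.star_imaginary ha (by rw [ha']; rfl)).1,
    (h.star_imaginary hb (by rw [hb']; rfl)).1, ha', hb', fun t ht hre => ?_⟩
  have hp := eq_pt_of_re hre
  rcases (abs_eq critHeight_pos.le).1 (h.star_imaginary ht hre).2 with he | he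
  · exact Or.inr (h.starred.curveP.injOn ht hb (by rw [hb', hp, he]))
  · exact Or.inl (h.starred.curveP.injOn ht ha (by rw [ha', hp, he]))

/-- On a connected set of parameters without crossings the real part has constant sign. -/
theorem re_neg_of_preconnected {γ : ℝ → ℂ} {s : Set ℝ} (hs : IsPreconnected s)
    (hc : ContinuousOn γ s) (h0 : ∀ t ∈ s, (γ t).re ≠ 0) {u : ℝ} (hu : u ∈ s)
    (hneg : (γ u).re < 0) {t : ℝ} (ht : t ∈ s) : (γ t).re < 0 := by
  by_contra! hn
  obtain ⟨c, hc, hc'⟩ := hs.intermediate_value hu ht (Complex.continuous_re.comp_continuousOn hc)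
    ⟨hneg.le, hn⟩
  exact h0 c hc hc'

/-- The parts of `Γ_P^*` in the left half plane. -/
theorem IsAdmissible.exists_star (h : C.IsAdmissible) : ∃ a b : ℝ, 0 < a ∧ a < b ∧ b < 1 ∧
    C.gPstar a = pt 0 (-critHeight) ∧ C.gPstar b = pt 0 critHeight ∧
    (∀ t ∈ Ioo (0 : ℝ) 1, (C.gPstar t).re < 0 ↔ t ∈ Ioo 0 a ∪ Ioo b 1) ∧
    (∀ t ∈ Ioo 0 a, (C.gPstar t).im < 0 ∧ -z1.im < (C.gPstar t).im ∧ z1.re < (C.gPstar t).re) ∧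
    (∀ t ∈ Ioo b 1, 0 < (C.gPstar t).im ∧ (C.gPstar t).im < z1.im ∧ z1.re < (C.gPstar t).re) := by
  obtain ⟨a, b, ha, hb, hae, hbe, huniq⟩ := h.exists_star_params
  have hst := h.starred
  have hc := hst.curveP.continuousOn
  have c0 := critHeight_pos
  have c1 := critHeight_lt
  have hz2 : z2.im = -z1.im := by rw [z2_eq, Complex.conj_im]
  have hr2 : z2.re < 0 := (branch_facts (Or.inr rfl)).1
  have hne : a ≠ b := by
    rintro rfl
    rw [hae] at hbe
    have := congrArg Complex.im hbe
    simp only [pt] at this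
    linarith
  -- The order of the two crossings is not known yet; the heights of the outer arcs decide it below.
  set a' := min a b
  set b' := max a b
  have hab : a' < b' := min_lt_max.2 hne
  have ha' : a' ∈ Ioo (0 : ℝ) 1 := by rcases min_choice a b with e | e <;> simp only [a', e, ha, hb]
  have hb' : b' ∈ Ioo (0 : ℝ) 1 := by rcases max_choice a b with e | e <;> simp only [b', e, ha, hb]
  have hout : ∀ t ∈ Icc (0 : ℝ) 1, t < a' ∨ b' < t ∨ a' < t ∧ t < b' → (C.gPstar t).re ≠ 0 := by
    intro t ht hlt h0
    have h1 := min_le_left a b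
    have h2 := min_le_right a b
    have h3 := le_max_left a b
    have h4 := le_max_right a b
    rcases huniq t ht h0 with e | e
    · rcases hlt with hl | hl | hl
      · linarith
      · linarith
      · rcases min_choice a b with e1 | e1 <;> rcases max_choice a b with e2 | e2
        · exact hab.ne (e1.trans e2.symm)
        · exact hl.1.ne' (e.trans e1.symm)
        · exact hl.2.ne (e.trans e2.symm)
        · exact hab.ne (e1.trans e2.symm)
    · rcases hlt with hl | hl | hl
      · linarith
      · linarith
      · rcases min_choice a b with e1 | e1 <;> rcases max_choice a b with e2 | e2
        · exact hab.ne (e1.trans e2.symm)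
        · exact hl.2.ne (e.trans e2.symm)
        · exact hl.1.ne' (e.trans e1.symm)
        · exact hab.ne (e1.trans e2.symm)
  have hleft : ∀ t ∈ Ico 0 a', (C.gPstar t).re < 0 := fun t ht =>
    re_neg_of_preconnected isPreconnected_Ico
      (hc.mono fun u hu => ⟨hu.1, (hu.2.trans ha'.2).le⟩)
      (fun u hu => hout u ⟨hu.1, (hu.2.trans ha'.2).le⟩ (Or.inl hu.2))
      (u := 0) ⟨le_rfl, ha'.1⟩ (by rw [hst.startP]; exact hr2) ht
  have hright : ∀ t ∈ Ioc b' 1, (C.gPstar t).re < 0 := fun t ht =>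
    re_neg_of_preconnected isPreconnected_Ioc
      (hc.mono fun u hu => ⟨(hb'.1.trans hu.1).le, hu.2⟩)
      (fun u hu => hout u ⟨(hb'.1.trans hu.1).le, hu.2⟩ (Or.inr (Or.inl hu.1)))
      (u := 1) ⟨hb'.2, le_rfl⟩ (by rw [hst.endP]; exact z1_re_neg) ht
  -- The outer arcs lie on the left, so the point on the positive real axis belongs to the middle
  -- arc, which has no crossing inside and thus stays on the right.
  have hmid : ∀ t ∈ Icc a' b', 0 ≤ (C.gPstar t).re := by
    obtain ⟨x, hx, u, hu, hue⟩ := hst.crossP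
    have hux : 0 < (C.gPstar u).re := by rw [hue]; simpa using hx
    have hua : a' ≤ u := by
      by_contra! hn
      exact (hleft u ⟨hu.1, hn⟩).not_gt hux
    have hub : u ≤ b' := by
      by_contra! hn
      exact (hright u ⟨hn, hu.2⟩).not_gt hux
    have hre0 : ∀ t, t = a' ∨ t = b' → (C.gPstar t).re = 0 := by
      have e1 : (C.gPstar a).re = 0 := by rw [hae]; rfl
      have e2 : (C.gPstar b).re = 0 := by rw [hbe]; rfl
      rintro t (rfl | rfl)
      · rcases min_choice a b with e | e <;> simp only [a', e, e1, e2]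
      · rcases max_choice a b with e | e <;> simp only [b', e, e1, e2]
    intro t ht
    rcases ht.1.eq_or_lt with h1 | h1
    · exact (hre0 t (Or.inl h1.symm)).ge
    rcases ht.2.eq_or_lt with h2 | h2
    · exact (hre0 t (Or.inr h2)).ge
    by_contra! hn
    refine (re_neg_of_preconnected (γ := C.gPstar) isPreconnected_Ioo
      (hc.mono fun v hv => ⟨(ha'.1.trans hv.1).le, (hv.2.trans hb'.2).le⟩)
      (fun v hv => hout v ⟨(ha'.1.trans hv.1).le, (hv.2.trans hb'.2).le⟩ (Or.inr (Or.inr hv)))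
      (u := t) ⟨h1, h2⟩ hn (t := u) ⟨hua.lt_of_ne fun e => ?_, hub.lt_of_ne fun e => ?_⟩).not_gt hux
    · exact hux.ne' (hre0 u (Or.inl e.symm))
    · exact hux.ne' (hre0 u (Or.inr e))
  -- An outer arc has an end at critical height, below the branch height, which excludes the
  -- unbounded pieces of the level set. The piece in the strip is excluded since it belongs to
  -- `Γ_P`.
  have hcomp : ∀ c d, 0 ≤ c → c < d → d ≤ 1 → (∀ t ∈ Ioo c d, (C.gPstar t).re < 0) →
      (∀ u ∈ Icc c d, |(C.gPstar u).im| = critHeight →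
        (∀ t ∈ Ioo c d, 0 < (C.gPstar t).im ∧ (C.gPstar t).im < z1.im ∧ z1.re < (C.gPstar t).re) ∨
        (∀ t ∈ Ioo c d, (C.gPstar t).im < 0 ∧ -z1.im < (C.gPstar t).im ∧
          z1.re < (C.gPstar t).re)) := by
    intro c d hc0 hcd hd1 hneg u hu hue
    have hin : ∀ t ∈ Ioo c d, t ∈ Ioo (0 : ℝ) 1 := fun t ht => ⟨hc0.trans_lt ht.1, ht.2.trans_le hd1⟩
    have hcd' : ContinuousOn C.gPstar (Icc c d) := hc.mono (Icc_subset_Icc hc0 hd1)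
    have hcomp := level_component (s := C.gPstar '' Ioo c d)
      (isPreconnected_Ioo.image _ (hcd'.mono Ioo_subset_Icc_self)) (by
        rintro _ ⟨t, ht, rfl⟩
        refine ⟨hneg t ht, h.star_mainH (hin t ht) (hneg t ht).le, fun he => ?_, fun he => ?_⟩
        · exact (h.star_facts (hin t ht)).2.1 (he ▸ z1_mem_levelCut)
        · exact (h.star_facts (hin t ht)).2.1 (he ▸ z2_mem_levelCut))
    simp only [forall_mem_image] at hcomp
    rcases hcomp with hk | hk | hk | hk | hk
    · have : z1.im ≤ (C.gPstar u).im := mem_of_isClosed_Ioo hcd.ne hcd' (K := {z | z1.im ≤ z.im})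
        (isClosed_le continuous_const Complex.continuous_im) (fun t ht => (hk ht).le) hu
      linarith [le_abs_self (C.gPstar u).im]
    · have : (C.gPstar u).im ≤ -z1.im := mem_of_isClosed_Ioo hcd.ne hcd'
        (K := {z | z.im ≤ -z1.im})
        (isClosed_le Complex.continuous_im continuous_const) (fun t ht => (hk ht).le) hu
      linarith [neg_le_abs (C.gPstar u).im]
    · obtain ⟨t, ht⟩ := nonempty_Ioo.2 hcd
      exact ((h.star_facts (hin t ht)).2.1 (mem_levelCut_of_strip
        (h.star_mainH (hin t ht) (hneg t ht).le) (hk ht))).elim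
    · exact Or.inl fun t ht => hk ht
    · exact Or.inr fun t ht => hk ht
  have hcrit : ∀ t, t = a' ∨ t = b' → |(C.gPstar t).im| = critHeight := by
    have e1 : |(C.gPstar a).im| = critHeight := by rw [hae]; simp [pt, abs_of_pos c0]
    have e2 : |(C.gPstar b).im| = critHeight := by rw [hbe]; simp [pt, abs_of_pos c0]
    rintro t (rfl | rfl)
    · rcases min_choice a b with e | e <;> simp only [a', e, e1, e2]
    · rcases max_choice a b with e | e <;> simp only [b', e, e1, e2]
  have hlow := (hcomp 0 a' le_rfl ha'.1 ha'.2.le (fun t ht => hleft t ⟨ht.1.le, ht.2⟩) a'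
    ⟨ha'.1.le, le_rfl⟩ (hcrit a' (Or.inl rfl))).resolve_left fun hk => by
      have : 0 ≤ (C.gPstar 0).im := mem_of_isClosed_Ioo ha'.1.ne
        (hc.mono (Icc_subset_Icc_right ha'.2.le)) (K := {z | 0 ≤ z.im})
        (isClosed_le continuous_const Complex.continuous_im) (fun t ht => (hk t ht).1.le)
        (left_mem_Icc.2 ha'.1.le)
      rw [hst.startP] at this
      linarith
  have hupp := (hcomp b' 1 hb'.1.le hb'.2 le_rfl (fun t ht => hright t ⟨ht.1, ht.2.le⟩) b'
    ⟨le_rfl, hb'.2.le⟩ (hcrit b' (Or.inr rfl))).resolve_right fun hk => by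
      have : (C.gPstar 1).im ≤ 0 := mem_of_isClosed_Ioo hb'.2.ne
        (hc.mono (Icc_subset_Icc_left hb'.1.le)) (K := {z | z.im ≤ 0})
        (isClosed_le Complex.continuous_im continuous_const) (fun t ht => (hk t ht).1.le)
        (right_mem_Icc.2 hb'.2.le)
      rw [hst.endP] at this
      linarith [z1_im_pos]
  have hea : a' = a := by
    rcases min_choice a b with e | e
    · exact e
    · have : (C.gPstar a').im ≤ 0 := mem_of_isClosed_Ioo ha'.1.ne
        (hc.mono (Icc_subset_Icc_right ha'.2.le)) (K := {z | z.im ≤ 0})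
        (isClosed_le Complex.continuous_im continuous_const) (fun t ht => (hlow t ht).1.le)
        (right_mem_Icc.2 ha'.1.le)
      rw [show a' = b from e, hbe] at this
      exact absurd this c0.not_ge
  have heb : b' = b := by
    have h1 : a < b := by
      have := min_le_right a b
      rw [show min a b = a from hea] at this
      exact this.lt_of_ne hne
    exact max_eq_right h1.le
  rw [hea] at hlow hleft hmid hab ha'
  rw [heb] at hupp hright hmid hab hb'
  refine ⟨a, b, ha.1, hab, hb.2, hae, hbe, fun t ht => ⟨fun hneg => ?_, ?_⟩, hlow, hupp⟩
  · by_contra hn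
    rw [mem_union, not_or] at hn
    have h1 : a ≤ t := not_lt.1 fun hlt => hn.1 ⟨ht.1, hlt⟩
    have h2 : t ≤ b := not_lt.1 fun hlt => hn.2 ⟨hlt, ht.2⟩
    exact (hmid t ⟨h1, h2⟩).not_gt hneg
  · rintro (hk | hk)
    · exact hleft t ⟨hk.1.le, hk.2⟩
    · exact hright t ⟨hk.1, hk.2.le⟩

end Config

/-- A curve whose tangent vector is never real and that ends above its starting point moves
upwards. -/
theorem deriv_im_pos {γ : ℝ → ℂ} {c d : ℝ} (hcd : c < d) (hγ : ContinuousOn γ (Icc c d))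
    (hd : ∀ t ∈ Ioo c d, DifferentiableAt ℝ γ t) (hc : ContinuousOn (deriv γ) (Ioo c d))
    (h : ∀ t ∈ Ioo c d, (deriv γ t).im ≠ 0) (hlt : (γ c).im < (γ d).im) :
    ∀ t ∈ Ioo c d, 0 < (deriv γ t).im := by
  refine (deriv_im_sign isPreconnected_Ioo hc h).resolve_right fun hn => ?_
  obtain ⟨u, hu, hu'⟩ := exists_hasDerivAt_eq_slope (fun u => (γ u).im) _ hcd
    (Complex.continuous_im.comp_continuousOn hγ) (fun u hu => hasDerivAt_im (hd u hu))
  have := hn u hu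
  rw [hu', div_lt_iff₀ (sub_pos.2 hcd)] at this
  linarith

/-- On the part of the level set to the right of the branch points the two square roots agree. -/
theorem canonS_of_star {z : ℂ} (hz : z.re < 0) (hH : mainH z = 0) (hy : |z.im| < z1.im)
    (hx : z1.re < z.re) : canonS z = mainSqrt z ∧ 0 < (mainSqrt z).re := by
  have hz0 : z ≠ 0 := by rintro rfl; simp at hz
  have hb : boxH z = 0 := by
    have := mainH_sq_eq_boxH_sq hz0
    rw [hH, zero_pow two_ne_zero] at this
    exact pow_eq_zero_iff two_ne_zero |>.1 this.symm
  have hm : (pairM z).re < 0 := pairM_re_neg_of_boxH hy hx.le hz.le hz0 hb.ge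
  exact ⟨canonS_of_re_neg hz0 hm, mainSqrt_re_pos (Or.inl hm.ne)⟩

namespace Config

variable {C : Config}

theorem IsAdmissible.star_positive (h : C.IsAdmissible) {c d : ℝ} (hc0 : 0 ≤ c) (hcd : c < d)
    (hd1 : d ≤ 1) (hlt : (C.gPstar c).im < (C.gPstar d).im)
    (hs : ∀ t ∈ Ioo c d, (C.gPstar t).re < 0 ∧ |(C.gPstar t).im| < z1.im ∧
      z1.re < (C.gPstar t).re) :
    ∀ t ∈ Ioo c d, ∃ r : ℝ, 0 ≤ r ∧
      lineForm C.gPstar (fun t => C.QP (C.gPstar t)) t = r := by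
  have hI : interior (Icc (0 : ℝ) 1) = Ioo 0 1 := interior_Icc
  have hin : ∀ t ∈ Ioo c d, t ∈ Ioo (0 : ℝ) 1 := fun t ht => ⟨hc0.trans_lt ht.1, ht.2.trans_le hd1⟩
  have hS : ∀ t ∈ Ioo c d, C.QP (C.gPstar t) = mainSqrt (C.gPstar t) ∧
      0 < (mainSqrt (C.gPstar t)).re := by
    intro t ht
    obtain ⟨h1, h2, h3⟩ := hs t ht
    have h4 := canonS_of_star h1 (h.star_mainH (hin t ht) h1.le) h2 h3
    exact ⟨(h.sheets.QP_eq h1 (h.star_facts (hin t ht)).2.1).trans h4.1, h4.2⟩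
  have hre : ∀ t ∈ Ioo c d, (mainSqrt (C.gPstar t) * deriv C.gPstar t).re = 0 := by
    intro t ht
    rw [← (hS t ht).1, h.star_QP (hin t ht)]
    exact h.star_re (hin t ht)
  have hpos := deriv_im_pos hcd (h.starred.curveP.continuousOn.mono (Icc_subset_Icc hc0 hd1))
    (fun t ht => h.star_differentiableAt (hin t ht))
    (h.starred.curveP.continuousOn_deriv.mono fun t ht => hI.symm ▸ hin t ht)
    (fun t ht => im_ne_zero_of_mul_re (hre t ht) (hS t ht).2.ne'
      (h.starred.curveP.regular t (hI.symm ▸ hin t ht))) hlt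
  intro t ht
  have hpi := Real.pi_pos
  have := mul_im_pos (hre t ht) (hS t ht).2 (hpos t ht)
  exact ⟨_, by positivity, lineForm_eq_of_level (hS t ht).1 (hre t ht)⟩

theorem IsAdmissible.intervalIntegrable_star (h : C.IsAdmissible) {c d : ℝ}
    (hc : c ∈ Icc (0 : ℝ) 1) (hd : d ∈ Icc (0 : ℝ) 1) :
    IntervalIntegrable (lineForm C.gPstar fun t => C.QP (C.gPstar t)) volume c d :=
  (h.starred.realP c hc).1.symm.trans (h.starred.realP d hd).1

theorem IsAdmissible.integral_star (h : C.IsAdmissible) {c d ε : ℝ} (hε : ε ≠ 0) (hc0 : 0 ≤ c)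
    (hcd : c < d) (hd1 : d ≤ 1) (him : ∀ t ∈ Ioo c d, 0 ≤ ε * (C.gPstar t).im) :
    ∫ t in c..d, lineForm C.gPstar (fun t => C.QP (C.gPstar t)) t =
      1 / (2 * Real.pi * Complex.I) *
      (heightPrim ε (canonQ (C.gPstar d)) - heightPrim ε (canonP (C.gPstar d)) -
        (heightPrim ε (canonQ (C.gPstar c)) - heightPrim ε (canonP (C.gPstar c)))) := by
  have hin : ∀ t ∈ Ioo c d, t ∈ Ioo (0 : ℝ) 1 := fun t ht => ⟨hc0.trans_lt ht.1, ht.2.trans_le hd1⟩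
  have hin' : Icc c d ⊆ Icc 0 1 := Icc_subset_Icc hc0 hd1
  exact integral_lineForm hε hcd.le (fun t ht => h.star_differentiableAt (hin t ht))
    (fun t ht => h.star_branchQ (hin t ht)) (fun t ht => h.star_branchP (hin t ht))
    (h.star_continuousOn.1.mono hin') (h.star_continuousOn.2.mono hin')
    (fun t ht => ⟨(h.star_continuousAt (hin' ht)).2.2, isPreimage_canonP _⟩)
    (fun t ht => mem_of_isClosed_Ioo hcd.ne (h.starred.curveP.continuousOn.mono hin')
      (K := {z | 0 ≤ ε * z.im})
      (isClosed_le continuous_const (continuous_const.mul Complex.continuous_im)) him ht)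
    (fun t ht => h.star_QP (hin t ht))
    (h.intervalIntegrable_star (hin' (left_mem_Icc.2 hcd.le)) (hin' (right_mem_Icc.2 hcd.le)))

/-- The part of `Γ_P^*` in the left half plane: positivity and total mass. -/
theorem IsAdmissible.star_mass (h : C.IsAdmissible) :
    MeasurableSet (Ioo 0 1 ∩ {t | (C.gPstar t).re < 0}) ∧
    (∀ t ∈ Ioo 0 1 ∩ {t | (C.gPstar t).re < 0}, ∃ r : ℝ, 0 ≤ r ∧
      lineForm C.gPstar (fun t => C.QP (C.gPstar t)) t = r) ∧
    IntegrableOn (lineForm C.gPstar fun t => C.QP (C.gPstar t))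
      (Ioo 0 1 ∩ {t | (C.gPstar t).re < 0}) ∧
    ∫ t in Ioo 0 1 ∩ {t | (C.gPstar t).re < 0},
      lineForm C.gPstar (fun t => C.QP (C.gPstar t)) t = 1 / (2 * Real.pi * Complex.I) *
      (heightPrim (-1) (canonQ (pt 0 (-critHeight))) -
        heightPrim (-1) (canonP (pt 0 (-critHeight))) -
        (heightPrim 1 (canonQ (pt 0 critHeight)) - heightPrim 1 (canonP (pt 0 critHeight)))) := by
  obtain ⟨a, b, ha, hab, hb, hae, hbe, hiff, hlow, hupp⟩ := h.exists_star
  have c0 := critHeight_pos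
  have c1 := critHeight_lt
  have e : Ioo 0 1 ∩ {t | (C.gPstar t).re < 0} = Ioo 0 a ∪ Ioo b 1 := by
    ext t
    refine ⟨fun ht => (hiff t ht.1).1 ht.2, fun ht => ?_⟩
    have ht' : t ∈ Ioo (0 : ℝ) 1 := by
      rcases ht with ht | ht
      · exact ⟨ht.1, ht.2.trans (hab.trans hb)⟩
      · exact ⟨(ha.trans hab).trans ht.1, ht.2⟩
    exact ⟨ht', (hiff t ht').2 ht⟩
  have hneg : ∀ t ∈ Ioo 0 a ∪ Ioo b 1, (C.gPstar t).re < 0 := fun t ht => by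
    rw [← e] at ht
    exact ht.2
  have ima : (C.gPstar a).im = -critHeight := by rw [hae]; rfl
  have imb : (C.gPstar b).im = critHeight := by rw [hbe]; rfl
  have im0 : (C.gPstar 0).im = -z1.im := by rw [h.starred.startP, z2_eq, Complex.conj_im]
  have im1 : (C.gPstar 1).im = z1.im := by rw [h.starred.endP]
  have hposl := h.star_positive le_rfl ha (hab.trans hb).le (by rw [ima, im0]; linarith)
    fun t ht => ⟨hneg t (Or.inl ht), abs_lt.2 ⟨(hlow t ht).2.1, by linarith [(hlow t ht).1]⟩,
      (hlow t ht).2.2⟩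
  have hposu := h.star_positive (ha.trans hab).le hb le_rfl (by rw [imb, im1]; linarith)
    fun t ht => ⟨hneg t (Or.inr ht), abs_lt.2 ⟨by linarith [(hupp t ht).1], (hupp t ht).2.1⟩,
      (hupp t ht).2.2⟩
  have ma : a ∈ Icc (0 : ℝ) 1 := ⟨ha.le, (hab.trans hb).le⟩
  have mb : b ∈ Icc (0 : ℝ) 1 := ⟨(ha.trans hab).le, hb.le⟩
  have il := (intervalIntegrable_iff_integrableOn_Ioo_of_le ha.le).1
    (h.intervalIntegrable_star (by norm_num) ma)
  have iu := (intervalIntegrable_iff_integrableOn_Ioo_of_le hb.le).1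
    (h.intervalIntegrable_star mb (by norm_num))
  rw [e]
  refine ⟨measurableSet_Ioo.union measurableSet_Ioo, ?_, il.union iu, ?_⟩
  · rintro t (ht | ht)
    exacts [hposl t ht, hposu t ht]
  · rw [setIntegral_union (Set.disjoint_left.2 fun t h1 h2 => (h1.2.trans hab).not_gt h2.1)
      measurableSet_Ioo il iu, ← integral_Ioc_eq_integral_Ioo, ← integral_Ioc_eq_integral_Ioo,
      ← intervalIntegral.integral_of_le ha.le, ← intervalIntegral.integral_of_le hb.le,
      h.integral_star (ε := -1) (by norm_num) le_rfl ha ma.2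
        (fun t ht => by linarith [(hlow t ht).1]),
      h.integral_star (ε := 1) one_ne_zero mb.1 hb le_rfl
        (fun t ht => by linarith [(hupp t ht).1]), hae, hbe, h.starred.startP, h.starred.endP,
      (canon_branch (Or.inr rfl)).2.2.1, (canon_branch (Or.inl rfl)).2.2.1]
    ring

end Config

/-! ### The segment on the imaginary axis and the total masses -/

theorem IsBranchNear.neg {q : ℂ → ℂ} {z : ℂ} (h : IsBranchNear q (-z)) :
    IsBranchNear (fun w => -q (-w)) z := by
  refine ⟨?_, by rw [zMapDeriv_neg]; exact h.2⟩
  filter_upwards [continuous_neg.continuousAt.eventually h.1] with w hw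
  refine ⟨(ContinuousAt.comp (f := fun w : ℂ => -w) hw.1 continuous_neg.continuousAt).neg, ?_⟩
  simpa using hw.2.neg

/-- Since `ψ_Q` is odd, this identity cancels its contributions at `iy^*` and `-iy^*`. -/
theorem heightPrim_neg (w : ℂ) : heightPrim (-1) (-w) = heightPrim 1 w := by
  simp only [heightPrim, prim, neg_sq]
  push_cast
  rw [show -1 * Complex.I * -w = 1 * Complex.I * w by ring,
    show -1 * Complex.I * (-w - 1) = 1 * Complex.I * (w + 1) by ring,
    show -1 * Complex.I * (-w + 1) = 1 * Complex.I * (w - 1) by ring]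
  ring

theorem canonP_imaginary {z : ℂ} (h : z.re = 0) : canonP z = -maxRoot (-z) := by
  by_cases hz0 : z = 0
  · rw [hz0, canonP_zero, neg_zero]
  · rw [canonP_left h.le hz0, lower_imaginary h hz0]

/-- On the imaginary axis `-z` is the conjugate of `z`, so the sum is twice a positive real part. It
is the density on the segment, where `ψ_P` is minus the `maxRoot` of the opposite point. -/
theorem maxRoot_add_neg {z : ℂ} (h : z.re = 0) : ∃ r : ℝ, 0 ≤ r ∧ maxRoot z + maxRoot (-z) = r := by
  by_cases hz0 : z = 0
  · rw [hz0, neg_zero, maxRoot_zero]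
    exact ⟨(√3)⁻¹ + (√3)⁻¹, by positivity, by push_cast; rfl⟩
  · have e : -z = starRingEnd ℂ z := Complex.ext (by simp [h]) (by simp)
    rw [e, conj_maxRoot h.le hz0, Complex.add_conj]
    exact ⟨_, by linarith [maxRoot_re_pos h.le], rfl⟩

namespace Config

variable {C : Config}

theorem segment_re (t : ℝ) : (segment t).re = 0 := by simp [segment]

theorem segment_im (t : ℝ) : (segment t).im = t := by simp [segment]

theorem segment_neg (t : ℝ) : segment (-t) = -segment t := by simp [segment]

theorem hasDerivAt_segment (t : ℝ) : HasDerivAt segment Complex.I t := by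
  have e : segment = fun u => pt 0 u := funext segment_eq
  exact e ▸ hasDerivAt_pt_right 0 t

theorem continuous_segment : Continuous segment := by
  unfold segment
  fun_prop

theorem notMem_levelCut {z : ℂ} (h : z.re = 0) : z ∉ levelCut := fun hm =>
  (re_neg_of_mem_levelCut hm).ne h

theorem IsSheetStructure.RP_segment (h : C.IsSheetStructure) (t : ℝ) :
    C.RP (segment t) = -canonP (-segment t) - canonP (segment t) := by
  rw [RP, h.psiR_eq (notMem_levelCut (by simp [segment_re])),
    h.psiP_eq (notMem_levelCut (segment_re t))]

theorem segment_branches (t : ℝ) : IsBranchNear (fun w => -canonP (-w)) (segment t) ∧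
    IsBranchNear canonP (segment t) :=
  ⟨(isBranchNear_canonP (notMem_levelCut (by simp [segment_re]))).neg,
    isBranchNear_canonP (notMem_levelCut (segment_re t))⟩

theorem continuous_segment_branches : Continuous (fun t => -canonP (-segment t)) ∧
    Continuous fun t => canonP (segment t) :=
  ⟨continuous_iff_continuousAt.2 fun t => ContinuousAt.comp (f := segment)
    (g := fun w => -canonP (-w)) (segment_branches t).1.continuousAt continuous_segment.continuousAt,
    continuous_iff_continuousAt.2 fun t => ContinuousAt.comp (f := segment)
    (segment_branches t).2.continuousAt continuous_segment.continuousAt⟩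

theorem IsSheetStructure.lineForm_segment (h : C.IsSheetStructure) :
    lineForm segment (fun t => C.RP (segment t)) = fun t => 3 / (2 * Real.pi * Complex.I) *
      ((-canonP (-segment t) - canonP (segment t)) * Complex.I) := by
  funext t
  rw [lineForm, (hasDerivAt_segment t).deriv, h.RP_segment]

theorem IsSheetStructure.continuous_lineForm_segment (h : C.IsSheetStructure) :
    Continuous (lineForm segment fun t => C.RP (segment t)) := by
  rw [h.lineForm_segment]
  have := continuous_segment_branches
  exact continuous_const.mul ((this.1.sub this.2).mul continuous_const)

theorem IsSheetStructure.segment_positive (h : C.IsSheetStructure) (t : ℝ) : ∃ r : ℝ, 0 ≤ r ∧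
    lineForm segment (fun t => C.RP (segment t)) t = r := by
  obtain ⟨r, hr, he⟩ := maxRoot_add_neg (segment_re t)
  have hpi := Real.pi_pos
  refine ⟨3 / (2 * Real.pi) * r, by positivity, ?_⟩
  have hpi' : (Real.pi : ℂ) ≠ 0 := Complex.ofReal_ne_zero.2 Real.pi_ne_zero
  rw [h.lineForm_segment]
  simp only
  rw [canonP_imaginary (segment_re t), canonP_imaginary (by simp [segment_re]), neg_neg, neg_neg,
    sub_neg_eq_add, he]
  push_cast
  field_simp

/-- The segment is split at the origin, where the sheets are `1/√3` and `-1/√3`. The jumps `-πi` and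
`πi` of the primitive there give the summand `1`; the rest comes from the ends. -/
theorem IsSheetStructure.segment_mass (h : C.IsSheetStructure) {y : ℝ} (hy : 0 < y) :
    ∫ t in Icc (-y) y, lineForm segment (fun t => C.RP (segment t)) t =
      1 + 1 / (2 * Real.pi * Complex.I) *
      (2 * (heightPrim 1 (-canonP (-segment y)) - heightPrim 1 (canonP (segment y)))) := by
  have hii : ∀ a b, IntervalIntegrable (lineForm segment fun t => C.RP (segment t)) volume a b :=
    fun a b => h.continuous_lineForm_segment.intervalIntegrable a b
  have key : ∀ (c d ε : ℝ), ε ≠ 0 → c ≤ d → (∀ t ∈ Icc c d, 0 ≤ ε * t) →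
      ∫ t in c..d, lineForm segment (fun t => C.RP (segment t)) t =
      1 / (2 * Real.pi * Complex.I) *
      (heightPrim ε (-canonP (-segment d)) - heightPrim ε (canonP (segment d)) -
        (heightPrim ε (-canonP (-segment c)) - heightPrim ε (canonP (segment c)))) := by
    intro c d ε hε hcd him
    exact integral_lineForm (q := fun w => -canonP (-w)) (p := canonP) hε hcd
      (fun t _ => (hasDerivAt_segment t).differentiableAt)
      (fun t _ => (segment_branches t).1) (fun t _ => (segment_branches t).2)
      continuous_segment_branches.1.continuousOn continuous_segment_branches.2.continuousOn
      (fun t _ => ⟨(segment_branches t).1.isPreimage, (segment_branches t).2.isPreimage⟩)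
      (fun t ht => by rw [segment_im]; exact him t ht) (fun t _ => h.RP_segment t) (hii c d)
  rw [integral_Icc_eq_integral_Ioc, ← intervalIntegral.integral_of_le (by linarith),
    ← intervalIntegral.integral_add_adjacent_intervals (hii (-y) 0) (hii 0 y),
    key (-y) 0 (-1) (by norm_num) (by linarith) (fun t ht => by linarith [ht.2]),
    key 0 y 1 one_ne_zero hy.le (fun t ht => by linarith [ht.1])]
  have e0 : segment 0 = 0 := by simp [segment]
  have h3 : (1 : ℝ) < √3 := Real.lt_sqrt_of_sq_lt (by norm_num)
  have hr : (0 : ℝ) < (√3)⁻¹ := by positivity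
  have hr1 : (√3)⁻¹ < 1 := inv_lt_one_of_one_lt₀ h3
  have d1 := heightPrim_sub_right hr hr1
  have d2 := heightPrim_sub_mid (x := -(√3)⁻¹) (by linarith) (by linarith)
  rw [Complex.ofReal_neg] at d2
  have hP : heightPrim (-1) (canonP (-segment y)) = heightPrim 1 (-canonP (-segment y)) := by
    rw [← heightPrim_neg, neg_neg]
  rw [segment_neg, e0, neg_zero, canonP_zero, neg_neg, neg_neg, maxRoot_zero,
    heightPrim_neg, heightPrim_neg, hP]
  rw [heightPrim_neg] at d2
  generalize (√3)⁻¹ = r at d1 d2 ⊢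
  have hpi' : (Real.pi : ℂ) ≠ 0 := Complex.ofReal_ne_zero.2 Real.pi_ne_zero
  field_simp
  linear_combination -d1 + d2

/-- At `±iy^*` the contributions of `ψ_Q` cancel, and those of `ψ_P` and `ψ_R` on the two starred
arcs are opposite to those on the segment. Only the jump at the origin remains. -/
theorem IsAdmissible.mass_Q (h : C.IsAdmissible) :
    (∫ t in Ioo 0 1 ∩ {t | (C.gPstar t).re < 0},
      lineForm C.gPstar (fun t => C.QP (C.gPstar t)) t) +
    (∫ t in Ioo 0 1 ∩ {t | 0 < (C.gRstar t).re},
      lineForm C.gRstar (fun t => C.QR (C.gRstar t)) t) +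
    ∫ t in Icc (-C.ystar) C.ystar, lineForm segment (fun t => C.RP (segment t)) t = 1 := by
  have e1 := h.star_mass.2.2.2
  have e2 := h.mirror.star_mass.2.2.2
  have e3 := h.sheets.segment_mass critHeight_pos
  have e4 : (∫ t in Ioo 0 1 ∩ {t | 0 < (C.gRstar t).re},
      lineForm C.gRstar (fun t => C.QR (C.gRstar t)) t) =
      ∫ t in Ioo 0 1 ∩ {t | (C.mirror.gPstar t).re < 0},
        lineForm C.mirror.gPstar (fun t => C.mirror.QP (C.mirror.gPstar t)) t := by
    have : {t | (C.mirror.gPstar t).re < 0} = {t | 0 < (C.gRstar t).re} := by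
      ext t
      simp [Config.mirror]
    rw [this, ← lineForm_mirror]
    rfl
  have hpt : pt 0 critHeight = segment critHeight := by rw [← segment_eq]; rfl
  have hpt' : pt 0 (-critHeight) = -segment critHeight := by
    rw [← segment_neg, ← segment_eq]; rfl
  have hne : segment critHeight ≠ 0 := fun h0 => by
    have := segment_im critHeight
    rw [h0] at this
    exact critHeight_pos.ne this
  have hP : heightPrim (-1) (canonP (-segment critHeight)) =
      heightPrim 1 (-canonP (-segment critHeight)) := by
    rw [← heightPrim_neg, neg_neg]
  rw [e4, e1, e2, h.ystar_eq, e3, hpt, hpt', canonQ_neg hne, heightPrim_neg, hP]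
  ring

/-- At the ends the sheets coincide and contribute nothing. At the single crossing of the negative
axis they are separated by the pole `-1`, and the jumps `3πi` and `πi` differ by `2πi`. -/
theorem IsSheetStructure.mass_P (h : C.IsSheetStructure) :
    ∫ t in Ioo 0 1, lineForm C.gP (plusValue C.gP C.QP) t = 1 := by
  have hI : interior (Icc (0 : ℝ) 1) = Ioo 0 1 := interior_Icc
  have hc := h.curveP.continuousOn
  have hlt := z1_im_pos
  have im0 : (C.gP 0).im = z1.im := by rw [h.startP]
  have im1 : (C.gP 1).im = -z1.im := by rw [h.endP, z2_eq, Complex.conj_im]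
  have hcim : ContinuousOn (fun t => (C.gP t).im) (Icc 0 1) :=
    Complex.continuous_im.comp_continuousOn hc
  have hanti : StrictAntiOn (fun t => (C.gP t).im) (Icc 0 1) := by
    refine strictAntiOn_of_deriv_neg (convex_Icc 0 1) hcim fun t ht => ?_
    rw [hI] at ht
    rw [(hasDerivAt_im (h.differentiableAt ht)).deriv]
    exact h.deriv_im_neg ht
  obtain ⟨m, hm, hm0⟩ := intermediate_value_Icc' zero_le_one hcim
    (show (0 : ℝ) ∈ Icc ((C.gP 1).im) ((C.gP 0).im) by rw [im0, im1]; constructor <;> linarith)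
  have hm0 : (C.gP m).im = 0 := hm0
  have hreal : ∀ a ∈ Icc (0 : ℝ) 1, ∀ b ∈ Icc (0 : ℝ) 1,
      IntervalIntegrable (lineForm C.gP (plusValue C.gP C.QP)) volume a b := fun a ha b hb =>
    (h.realP a ha).1.symm.trans (h.realP b hb).1
  have hends : ∀ t ∈ Icc (0 : ℝ) 1, t ∈ Ioo (0 : ℝ) 1 ∨ C.gP t = z1 ∨ C.gP t = z2 := by
    intro t ht
    rcases ht.1.eq_or_lt with h0 | h0
    · exact Or.inr (Or.inl (h0 ▸ h.startP))
    · rcases ht.2.eq_or_lt with h1 | h1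
      · exact Or.inr (Or.inr (h1 ▸ h.endP))
      · exact Or.inl ⟨h0, h1⟩
  have hcont : ∀ t ∈ Icc (0 : ℝ) 1, ContinuousAt (fun w => pairRoot w (-mainSqrt w)) (C.gP t) ∧
      ContinuousAt (fun w => pairRoot w (mainSqrt w)) (C.gP t) := by
    intro t ht
    rcases hends t ht with h1 | h1
    · have := isBranchNear_main (h.cut.re_neg ht) (h.slit h1)
      exact ⟨this.2.continuousAt, this.1.continuousAt⟩
    · have := pairRoot_branch h1 (S := mainSqrt) fun w _ => mainSqrt_sq w
      exact ⟨this.2.1, this.1⟩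
  have hne : ∀ t ∈ Icc (0 : ℝ) 1, C.gP t ≠ 0 := fun t ht h0 => by
    have := h.cut.re_neg ht
    rw [h0] at this
    simp at this
  have key : ∀ c d ε : ℝ, ε ≠ 0 → 0 ≤ c → c ≤ d → d ≤ 1 →
      (∀ t ∈ Icc c d, 0 ≤ ε * (C.gP t).im) →
      ∫ t in c..d, lineForm C.gP (plusValue C.gP C.QP) t = 1 / (2 * Real.pi * Complex.I) *
      (heightPrim ε (pairRoot (C.gP d) (-mainSqrt (C.gP d))) -
        heightPrim ε (pairRoot (C.gP d) (mainSqrt (C.gP d))) -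
        (heightPrim ε (pairRoot (C.gP c) (-mainSqrt (C.gP c))) -
          heightPrim ε (pairRoot (C.gP c) (mainSqrt (C.gP c))))) := by
    intro c d ε hε hc0 hcd hd1 him
    have hsub : Icc c d ⊆ Icc 0 1 := Icc_subset_Icc hc0 hd1
    have hin : ∀ t ∈ Ioo c d, t ∈ Ioo (0 : ℝ) 1 := fun t ht =>
      ⟨hc0.trans_lt ht.1, ht.2.trans_le hd1⟩
    have hbr := fun t (ht : t ∈ Ioo c d) =>
      isBranchNear_main (h.cut.re_neg (hsub (Ioo_subset_Icc_self ht))) (h.slit (hin t ht))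
    exact integral_lineForm (q := fun w => pairRoot w (-mainSqrt w))
      (p := fun w => pairRoot w (mainSqrt w)) hε hcd (fun t ht => h.differentiableAt (hin t ht))
      (fun t ht => (hbr t ht).2) (fun t ht => (hbr t ht).1)
      (fun t ht => (hcont t (hsub ht)).1.comp_continuousWithinAt (f := C.gP)
        ((hc t (hsub ht)).mono hsub))
      (fun t ht => (hcont t (hsub ht)).2.comp_continuousWithinAt (f := C.gP)
        ((hc t (hsub ht)).mono hsub))
      (fun t ht => ⟨isPreimage_pairRoot (hne t (hsub ht)) (by rw [neg_sq, mainSqrt_sq]),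
        isPreimage_pairRoot (hne t (hsub ht)) (mainSqrt_sq _)⟩) him
      (fun t ht => by
        rw [h.plusValue_eq (hin t ht)]
        linear_combination pairRoot_sub (C.gP t) (mainSqrt (C.gP t)))
      (hreal c (hsub (left_mem_Icc.2 hcd)) d (hsub (right_mem_Icc.2 hcd)))
  rw [← integral_Ioc_eq_integral_Ioo, ← intervalIntegral.integral_of_le zero_le_one,
    ← intervalIntegral.integral_add_adjacent_intervals (hreal 0 (by norm_num) m hm)
      (hreal m hm 1 (by norm_num)),
    key 0 m 1 one_ne_zero le_rfl hm.1 hm.2 (fun t ht => by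
      rw [one_mul, ← hm0]
      exact hanti.antitoneOn ⟨ht.1, ht.2.trans hm.2⟩ hm ht.2),
    key m 1 (-1) (by norm_num) hm.1 hm.2 le_rfl (fun t ht => by
      have : (C.gP t).im ≤ (C.gP m).im := hanti.antitoneOn hm ⟨hm.1.trans ht.1, ht.2⟩ ht.1
      linarith), h.startP, h.endP,
    ← (pairRoot_branch (Or.inl rfl) (S := mainSqrt) fun w _ => mainSqrt_sq w).2.2.1,
    ← (pairRoot_branch (Or.inr rfl) (S := mainSqrt) fun w _ => mainSqrt_sq w).2.2.1]
  obtain ⟨a, b, ea, eb, ha, hb, hb0⟩ := exists_real_roots (h.cut.re_neg hm) hm0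
  have d1 := heightPrim_sub_left ha
  have d2 := heightPrim_sub_mid hb hb0
  rw [ea, eb]
  have hpi' : (Real.pi : ℂ) ≠ 0 := Complex.ofReal_ne_zero.2 Real.pi_ne_zero
  field_simp
  linear_combination d1 - d2

theorem IsSheetStructure.positive_P (h : C.IsSheetStructure) {t : ℝ} (ht : t ∈ Ioo (0 : ℝ) 1) :
    ∃ r : ℝ, 0 ≤ r ∧ lineForm C.gP (plusValue C.gP C.QP) t = r := by
  have hre := h.mainSqrt_mul_re ht
  have h1 := mul_im_pos (d := -deriv C.gP t) (by rw [mul_neg, Complex.neg_re, hre, neg_zero])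
    (mainSqrt_re_pos (h.slit ht)) (by simpa using h.deriv_im_neg ht)
  have hpi := Real.pi_pos
  refine ⟨_, ?_, lineForm_eq_of_level (h.plusValue_eq ht) (by rw [neg_mul, Complex.neg_re, hre,
    neg_zero])⟩
  rw [neg_mul, ← mul_neg]
  positivity

end Config

/-! ### Assembly of the measures -/

theorem measurableSet_image_Ici {γ : ℝ → ℂ} (h : ContinuousOn γ (Ici 0)) :
    MeasurableSet (γ '' Ici 0) := by
  have e : (Ici 0 : Set ℝ) = ⋃ n : ℕ, Icc 0 (n : ℝ) := by
    ext t
    simp only [mem_Ici, mem_iUnion, mem_Icc, exists_and_left, iff_self_and]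
    exact fun _ => exists_nat_ge t
  rw [e, image_iUnion]
  exact MeasurableSet.iUnion fun n =>
    (isCompact_Icc.image_of_continuousOn (h.mono Icc_subset_Ici_self)).measurableSet

theorem measurableSet_image_Iic {γ : ℝ → ℂ} (h : ContinuousOn γ (Iic 0)) :
    MeasurableSet (γ '' Iic 0) := by
  have e : (Iic 0 : Set ℝ) = ⋃ n : ℕ, Icc (-(n : ℝ)) 0 := by
    ext t
    simp only [mem_Iic, mem_iUnion, mem_Icc, exists_and_right, iff_and_self]
    exact fun _ => (exists_nat_ge (-t)).imp fun n hn => by linarith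
  rw [e, image_iUnion]
  exact MeasurableSet.iUnion fun n =>
    (isCompact_Icc.image_of_continuousOn (h.mono Icc_subset_Iic_self)).measurableSet

theorem isPositive_of_integrableOn {p : Piece} (hm : MeasurableSet p.dom)
    (hc : ContinuousOn p.curve p.dom)
    (hn : ∀ t ∈ p.dom, ∃ r : ℝ, 0 ≤ r ∧ lineForm p.curve p.density t = r)
    (hi : IntegrableOn (lineForm p.curve p.density) p.dom) : p.IsPositive :=
  ⟨hm, hc, hn, fun _ _ => hi.mono_set inter_subset_left⟩

/-- The curve escapes to infinity, so a bounded set meets it only in a bounded range of parameters,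
and there integrability is part of the condition that the integral is real. -/
theorem isPositive_Ioi {γ h : ℝ → ℂ} (hγ : IsAnalyticCurve γ (Ici 0))
    (hinf : Tendsto γ atTop (Bornology.cobounded ℂ)) (hr : RealAlong γ (Ici 0) 0 h)
    (hn : ∀ t ∈ Ioi (0 : ℝ), ∃ r : ℝ, 0 ≤ r ∧ lineForm γ h t = r) :
    (⟨γ, Ioi 0, h⟩ : Piece).IsPositive := by
  refine ⟨measurableSet_Ioi, hγ.continuousOn.mono Ioi_subset_Ici_self, hn, fun B hB => ?_⟩
  have hev : ∀ᶠ z in Bornology.cobounded ℂ, z ∉ B := hB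
  obtain ⟨N, hN⟩ := eventually_atTop.1 (hinf.eventually hev)
  have hi := (hr (max N 0) (mem_Ici.2 (le_max_right _ _))).1
  rw [intervalIntegrable_iff_integrableOn_Ioc_of_le (le_max_right _ _)] at hi
  refine hi.mono_set fun t ht => ⟨ht.1, ?_⟩
  by_contra! hlt
  exact hN t ((le_max_left _ _).trans hlt.le) ht.2

theorem isPositive_Iio {γ h : ℝ → ℂ} (hγ : IsAnalyticCurve γ (Iic 0))
    (hinf : Tendsto γ atBot (Bornology.cobounded ℂ)) (hr : RealAlong γ (Iic 0) 0 h)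
    (hn : ∀ t ∈ Iio (0 : ℝ), ∃ r : ℝ, 0 ≤ r ∧ lineForm γ h t = r) :
    (⟨γ, Iio 0, h⟩ : Piece).IsPositive := by
  refine ⟨measurableSet_Iio, hγ.continuousOn.mono Iio_subset_Iic_self, hn, fun B hB => ?_⟩
  have hev : ∀ᶠ z in Bornology.cobounded ℂ, z ∉ B := hB
  obtain ⟨N, hN⟩ := eventually_atBot.1 (hinf.eventually hev)
  have hi := (hr (min N 0) (mem_Iic.2 (min_le_right _ _))).1.symm
  rw [intervalIntegrable_iff_integrableOn_Ioo_of_le (min_le_right _ _)] at hi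
  refine hi.mono_set fun t ht => ⟨?_, ht.1⟩
  by_contra! hlt
  exact hN t (hlt.trans (min_le_left _ _)) ht.2

namespace Config

variable {C : Config}

theorem IsSheetStructure.integrableOn_P (h : C.IsSheetStructure) :
    IntegrableOn (lineForm C.gP (plusValue C.gP C.QP)) (Ioo 0 1) :=
  (intervalIntegrable_iff_integrableOn_Ioo_of_le zero_le_one).1 (h.realP 1 (by norm_num)).1

theorem IsSheetStructure.exists_measure_P (h : C.IsSheetStructure) :
    ∃ μ : Measure ℂ, IsProbabilityMeasure μ ∧ μ C.GammaPᶜ = 0 ∧ IsGivenBy μ C.piecesP := by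
  have hp : ∀ k, (C.piecesP k).IsPositive := fun k => by
    rw [Subsingleton.elim k 0]
    exact isPositive_of_integrableOn measurableSet_Ioo
      (h.curveP.continuousOn.mono Ioo_subset_Icc_self) (fun t ht => h.positive_P ht)
      h.integrableOn_P
  refine ⟨_, isProbabilityMeasure_sum hp (fun k => ?_) ?_,
    sum_measure_compl hp h.cut.isCompact_GammaP.measurableSet fun k => ?_, isGivenBy_sum hp⟩
  · rw [Subsingleton.elim k 0]
    exact h.integrableOn_P
  · rw [Fin.sum_univ_one]
    exact h.mass_P
  · rw [Subsingleton.elim k 0]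
    exact fun t ht => ⟨t, Ioo_subset_Icc_self ht, rfl⟩

theorem IsSheetStructure.lineForm_R (h : C.IsSheetStructure) {t : ℝ} (ht : t ∈ Ioo (0 : ℝ) 1) :
    lineForm C.gR (plusValue C.gR C.QR) t =
      lineForm C.mirror.gP (plusValue C.mirror.gP C.mirror.QP) t := by
  have e := plusValue_neg (h.hasPlusValueR ht)
  rw [← lineForm_neg, lineForm, lineForm, mirror_QP_eq, ← e]
  rfl

theorem IsSheetStructure.exists_measure_R (h : C.IsSheetStructure) :
    ∃ μ : Measure ℂ, IsProbabilityMeasure μ ∧ μ C.GammaRᶜ = 0 ∧ IsGivenBy μ C.piecesR := by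
  have hi : IntegrableOn (lineForm C.gR (plusValue C.gR C.QR)) (Ioo 0 1) :=
    (intervalIntegrable_iff_integrableOn_Ioo_of_le zero_le_one).1 (h.realR 1 (by norm_num)).1
  have hp : ∀ k, (C.piecesR k).IsPositive := fun k => by
    rw [Subsingleton.elim k 0]
    refine isPositive_of_integrableOn measurableSet_Ioo
      (h.curveR.continuousOn.mono Ioo_subset_Icc_self) (fun t ht => ?_) hi
    obtain ⟨r, hr, he⟩ := h.mirror.positive_P ht
    exact ⟨r, hr, (h.lineForm_R ht).trans he⟩
  refine ⟨_, isProbabilityMeasure_sum hp (fun k => ?_) ?_,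
    sum_measure_compl hp h.cut.isCompact_GammaR.measurableSet fun k => ?_, isGivenBy_sum hp⟩
  · rw [Subsingleton.elim k 0]
    exact hi
  · rw [Fin.sum_univ_one]
    exact (setIntegral_congr_fun measurableSet_Ioo fun t ht => h.lineForm_R ht).trans
      h.mirror.mass_P
  · rw [Subsingleton.elim k 0]
    exact fun t ht => ⟨t, Ioo_subset_Icc_self ht, rfl⟩

theorem IsAdmissible.measurableSet_GammaQ (h : C.IsAdmissible) : MeasurableSet C.GammaQ := by
  refine ((isCompact_Icc.image continuous_segment).measurableSet.union
    (MeasurableSet.inter ?_ ?_)).union (MeasurableSet.inter ?_ ?_)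
  · exact (isCompact_Icc.image_of_continuousOn h.starred.curveP.continuousOn).measurableSet
  · exact measurableSet_lt Complex.measurable_re measurable_const
  · exact (isCompact_Icc.image_of_continuousOn h.starred.curveR.continuousOn).measurableSet
  · exact measurableSet_lt measurable_const Complex.measurable_re

theorem IsAdmissible.exists_measure_Q (h : C.IsAdmissible) :
    ∃ μ : Measure ℂ, IsProbabilityMeasure μ ∧ μ C.GammaQᶜ = 0 ∧ IsGivenBy μ C.piecesQ := by
  obtain ⟨m1, p1, i1, -⟩ := h.star_mass
  have hR : Ioo 0 1 ∩ {t | (C.mirror.gPstar t).re < 0} = Ioo 0 1 ∩ {t | 0 < (C.gRstar t).re} := by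
    ext t
    simp [Config.mirror]
  obtain ⟨m2, p2, i2, -⟩ := h.mirror.star_mass
  rw [hR] at m2 p2 i2
  have e2 : lineForm C.mirror.gPstar (fun t => C.mirror.QP (C.mirror.gPstar t)) =
      lineForm C.gRstar fun t => C.QR (C.gRstar t) := lineForm_mirror _
  rw [e2] at p2 i2
  have i3 : IntegrableOn (lineForm segment fun t => C.RP (segment t)) (Icc (-C.ystar) C.ystar) :=
    h.sheets.continuous_lineForm_segment.continuousOn.integrableOn_Icc
  have hp : ∀ k, (C.piecesQ k).IsPositive := by
    rw [Fin.forall_fin_succ, Fin.forall_fin_succ, Fin.forall_fin_one]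
    refine ⟨?_, ?_, ?_⟩
    · exact isPositive_of_integrableOn m1
        (h.starred.curveP.continuousOn.mono fun t ht => Ioo_subset_Icc_self ht.1) p1 i1
    · exact isPositive_of_integrableOn m2
        (h.starred.curveR.continuousOn.mono fun t ht => Ioo_subset_Icc_self ht.1) p2 i2
    · exact isPositive_of_integrableOn measurableSet_Icc continuous_segment.continuousOn
        (fun t _ => h.sheets.segment_positive t) i3
  refine ⟨_, isProbabilityMeasure_sum hp ?_ ?_,
    sum_measure_compl hp h.measurableSet_GammaQ ?_, isGivenBy_sum hp⟩
  · rw [Fin.forall_fin_succ, Fin.forall_fin_succ, Fin.forall_fin_one]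
    exact ⟨i1, i2, i3⟩
  · rw [Fin.sum_univ_three]
    exact h.mass_Q
  · rw [Fin.forall_fin_succ, Fin.forall_fin_succ, Fin.forall_fin_one]
    exact ⟨fun t ht => Or.inl (Or.inr ⟨⟨t, Ioo_subset_Icc_self ht.1, rfl⟩, ht.2⟩),
      fun t ht => Or.inr ⟨⟨t, Ioo_subset_Icc_self ht.1, rfl⟩, ht.2⟩,
      fun t ht => Or.inl (Or.inl ⟨t, ht, rfl⟩)⟩

theorem IsAdmissible.exists_measure_E (h : C.IsAdmissible) :
    ∃ μ : Measure ℂ, μ C.GammaEᶜ = 0 ∧ IsGivenBy μ C.piecesE := by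
  have hu := h.unbounded
  have hp : ∀ k, (C.piecesE k).IsPositive := by
    rw [Fin.forall_fin_succ, Fin.forall_fin_succ, Fin.forall_fin_succ, Fin.forall_fin_one]
    exact ⟨isPositive_Ioi hu.curve1 hu.infty1 hu.real1 h.level1,
      isPositive_Iio hu.curve2 hu.infty2 hu.real2 h.level2,
      isPositive_Ioi hu.curve3 hu.infty3 hu.real3 h.level3,
      isPositive_Iio hu.curve4 hu.infty4 hu.real4 h.level4⟩
  refine ⟨_, sum_measure_compl hp ?_ ?_, isGivenBy_sum hp⟩
  · exact (((measurableSet_image_Ici hu.curve1.continuousOn).union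
      (measurableSet_image_Iic hu.curve2.continuousOn)).union
      (measurableSet_image_Ici hu.curve3.continuousOn)).union
      (measurableSet_image_Iic hu.curve4.continuousOn)
  · rw [Fin.forall_fin_succ, Fin.forall_fin_succ, Fin.forall_fin_succ, Fin.forall_fin_one]
    exact ⟨fun t ht => Or.inl (Or.inl (Or.inl ⟨t, Ioi_subset_Ici_self ht, rfl⟩)),
      fun t ht => Or.inl (Or.inl (Or.inr ⟨t, Iio_subset_Iic_self ht, rfl⟩)),
      fun t ht => Or.inl (Or.inr ⟨t, Ioi_subset_Ici_self ht, rfl⟩),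
      fun t ht => Or.inr ⟨t, Iio_subset_Iic_self ht, rfl⟩⟩

end Config

end

end HermitePade

theorem mainTheorem8 :
    (∃ C : HermitePade.Config, C.IsAdmissible) ∧
    ∀ C : HermitePade.Config, C.IsAdmissible →
      (∀ t ∈ Ioo (0 : ℝ) 1,
        HermitePade.HasPlusValue C.gP C.QP t (HermitePade.plusValue C.gP C.QP t) ∧
        HermitePade.HasPlusValue C.gR C.QR t (HermitePade.plusValue C.gR C.QR t)) ∧
      (∃ μP : Measure ℂ, IsProbabilityMeasure μP ∧ μP C.GammaPᶜ = 0 ∧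
        HermitePade.IsGivenBy μP C.piecesP) ∧
      (∃ μQ : Measure ℂ, IsProbabilityMeasure μQ ∧ μQ C.GammaQᶜ = 0 ∧
        HermitePade.IsGivenBy μQ C.piecesQ) ∧
      (∃ μR : Measure ℂ, IsProbabilityMeasure μR ∧ μR C.GammaRᶜ = 0 ∧
        HermitePade.IsGivenBy μR C.piecesR) ∧
      (∃ μE : Measure ℂ, μE C.GammaEᶜ = 0 ∧ HermitePade.IsGivenBy μE C.piecesE) := by
  refine ⟨⟨HermitePade.canonConfig, HermitePade.canonConfig_isAdmissible⟩, fun C h =>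
    ⟨fun t ht => ⟨(h.sheets.cut.hasPlusValue ht).1, h.sheets.hasPlusValueR ht⟩,
      h.sheets.exists_measure_P, h.exists_measure_Q, h.sheets.exists_measure_R,
      h.exists_measure_E⟩⟩
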